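/- \textbf{Setting.} Let $Y$ be a closed smooth $(2n+3)$-manifold, $n\ge 0$, with a concrete open book $(B,\theta)$: $B\subset Y$ is a closed $(2n+1)$-dimensional submanifold with a collar embedding $B\times\mathbb D\hookrightarrow Y$ ($\mathbb D$ the open unit disc with polar coordinates $(r,\theta)$, $B$ corresponding to $r=0$), and $\pi=e^{i\theta}:Y\setminus B\to S^1$ is a smooth fibre bundle which in the collar is the angular coordinate. The pages are the closures of the fibres of $\pi$. Let $\alpha$ be a Giroux form: a contact form on $Y$ that restricts to a contact form $\alpha_B$ on $B$ and for which $d\alpha$ is a positive symplectic form on the interior of each page (with $Y$ oriented by $\alpha$ and the pages cooriented by $d\theta$; equivalently $d\alpha$ is nondegenerate there and $d\theta(R_\alpha)>0$ for the Reeb field $R_\alpha$). Suppose that in the collar $\alpha=A(\alpha_B+r^2d\theta)$ for a smooth function $A$ on $B\times\mathbb D$. Let $P$ be a page, $\mathrm{int}(P)=P\setminus B$, and let $f:\mathrm{int}(P)\to\mathrm{int}(P)$ be the Poincar\'e (first) return map of the flow of $R_\alpha$; assume that $f$ extends to a smooth map on $P$, also denoted $f$. Write $\mathrm{Symp}(\mathrm{int}(P),d\alpha|_P)$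 for the group of diffeomorphisms of $\mathrm{int}(P)$ preserving $d\alpha|_P$. \textbf{Symplectic monodromy.} Consider $1$-forms $\beta$ on $Y\setminus B$ such that: $d\beta$ is symplectic on the interior of each page; $\beta|_P=\alpha|_P$ on $\mathrm{int}(P)$; $\beta=\alpha$ outside $B\times\{r\le\rho\}$ for some $\rho<1$; in the collar $\beta$ restricts to each page as $F\alpha_B$ with $F>0$ and $\partial_rF<0$; and near $B$ the kernel of $d\beta$ is spanned by $\partial_\theta$. The holonomy around $S^1$ of the connection $\ker d\beta$ on $Y\setminus B\to S^1$, based at $P$, is then a symplectomorphism of $(\mathrm{int}(P),d\alpha|_P)$ equal to the identity near $B$. An element $\phi$ of $\mathrm{Symp}(\mathrm{int}(P),d\alpha|_P)$ \emph{represents the symplectic monodromy} if it is joined to the holonomy of some such $\beta$ by a smooth path of symplectomorphisms of $(\mathrm{int}(P),d\alpha|_P)$ that are all the identity on a fixed neighbourhood of $B$. \textbf{Lemma.} Assume that the Hessian of $A$ in the normal direction of $B$ (that is, the second derivative of $A(b,\cdot):\mathbb D\to\mathbb R$ at $0$, for each $b\in B$) is negative definite. Then for every neighbourhood $U$ of $B$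 in $Y$ there are a representative $\phi$ of the symplectic monodromy and a smooth path $(\psi_t)_{t\in[0,1]}$ in $\mathrm{Symp}(\mathrm{int}(P),d\alpha|_P)$ with $\psi_0=f$ and $\psi_1=\phi$, such that $\psi_t=f$ on $P\setminus U$ for all $t$ (the isotopy is supported near $B$), and such that $(\psi_t)$ extends smoothly to $[0,1]\times P$, with each extended $\psi_t$ a diffeomorphism of $P$ mapping $B$ onto $B$. -/

import Mathlib

open Set
open scoped Manifold ContDiff ComplexConjugate

noncomputable section

section OneForms

variable {E : Type*} [NormedAddCommGroup E] [NormedSpace ℝ E]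
  {M : Type*} [TopologicalSpace M] [ChartedSpace E M]

/-- A (not necessarily smooth) `1`-form on a manifold `M` modelled on `E`, without boundary. -/
abbrev OneForm (E : Type*) [NormedAddCommGroup E] [NormedSpace ℝ E]
    (M : Type*) [TopologicalSpace M] [ChartedSpace E M] : Type _ :=
  (x : M) → TangentSpace 𝓘(ℝ, E) x →L[ℝ] ℝ

namespace OneForm

/-- The `1`-form is smooth on `s`, as a section of the cotangent bundle. -/
def SmoothOn [IsManifold 𝓘(ℝ, E) ∞ M] (α : OneForm E M) (s : Set M) : Prop :=
  haveI : IsManifold 𝓘(ℝ, E) 1 M := IsManifold.of_le (n := ∞) (by simp)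
  ContMDiffOn 𝓘(ℝ, E) (𝓘(ℝ, E).prod 𝓘(ℝ, E →L[ℝ] ℝ)) ∞
    (fun x => Bundle.TotalSpace.mk' (E →L[ℝ] ℝ)
      (E := fun x : M => TangentSpace 𝓘(ℝ, E) x →L[ℝ] ℝ) x (α x)) s

/-- The expression of a `1`-form in the preferred chart at `x`, as a map `E → E*`. -/
def inChart (α : OneForm E M) (x : M) : E → E →L[ℝ] ℝ := fun y =>
  (α ((extChartAt 𝓘(ℝ, E) x).symm y)).comp
    (mfderiv 𝓘(ℝ, E) 𝓘(ℝ, E) (extChartAt 𝓘(ℝ, E) x).symm y)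

/-- The exterior derivative `dα` at `x`, evaluated on `v, w ∈ T_x M`, computed in the preferred chart
at `x`: `dα(v, w) = (D_v a)(w) - (D_w a)(v)`. -/
def d (α : OneForm E M) (x : M) (v w : TangentSpace 𝓘(ℝ, E) x) : ℝ :=
  let v' : E := mfderiv 𝓘(ℝ, E) 𝓘(ℝ, E) (extChartAt 𝓘(ℝ, E) x) x v
  let w' : E := mfderiv 𝓘(ℝ, E) 𝓘(ℝ, E) (extChartAt 𝓘(ℝ, E) x) x w
  fderiv ℝ (α.inChart x) (extChartAt 𝓘(ℝ, E) x x) v' w' -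
    fderiv ℝ (α.inChart x) (extChartAt 𝓘(ℝ, E) x x) w' v'

/-- The `2`-form `dα` is nondegenerate on the subspace `{v | p v}` of `T_x M`. -/
def NondegenerateOn (α : OneForm E M) (x : M) (p : TangentSpace 𝓘(ℝ, E) x → Prop) : Prop :=
  ∀ v, p v → (∀ w, p w → α.d x v w = 0) → v = 0

/-- The contact condition (for `M` odd-dimensional, this is `α ∧ (dα)ⁿ ≠ 0` everywhere). -/
def IsContact (α : OneForm E M) : Prop :=
  ∀ x, α x ≠ 0 ∧ α.NondegenerateOn x (fun v => α x v = 0)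

/-- `v` is the value of the Reeb vector field of `α` at `x`. -/
def IsReebVector (α : OneForm E M) (x : M) (v : TangentSpace 𝓘(ℝ, E) x) : Prop :=
  α x v = 1 ∧ ∀ w, α.d x v w = 0

end OneForm

end OneForms

/-- `g` restricts to a diffeomorphism of the subset `S` onto itself (smoothness on `S` being understood
as for maps on subsets of a manifold; for a submanifold, with or without boundary, this is the usual
smoothness). -/
def IsDiffeoOn {E : Type*} [NormedAddCommGroup E] [NormedSpace ℝ E]
    {M : Type*} [TopologicalSpace M] [ChartedSpace E M] (g : M → M) (S : Set M) : Prop :=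
  BijOn g S S ∧ ContMDiffOn 𝓘(ℝ, E) 𝓘(ℝ, E) ∞ g S ∧
    ∃ g' : M → M, ContMDiffOn 𝓘(ℝ, E) 𝓘(ℝ, E) ∞ g' S ∧ LeftInvOn g' g S

/-- `π` restricts on the open set `W` to a smooth (locally trivial) fibre bundle over the circle. Over
a neighbourhood `U` of `ζ`, the map `y ↦ (π y, p y)` is a diffeomorphism from `W ∩ π⁻¹(U)` to the
product of `U` with the fibre over `ζ`, with inverse `s`. -/
def IsCircleBundleOn {E : Type*} [NormedAddCommGroup E] [NormedSpace ℝ E]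
    {M : Type*} [TopologicalSpace M] [ChartedSpace E M] (π : M → Circle) (W : Set M) : Prop :=
  ContMDiffOn 𝓘(ℝ, E) (𝓡 1) ∞ π W ∧
  ∀ ζ : Circle, ∃ (U : Set Circle) (p : M → M) (s : Circle × M → M),
    IsOpen U ∧ ζ ∈ U ∧
    ContMDiffOn 𝓘(ℝ, E) 𝓘(ℝ, E) ∞ p (W ∩ π ⁻¹' U) ∧
    ContMDiffOn ((𝓡 1).prod 𝓘(ℝ, E)) 𝓘(ℝ, E) ∞ s (U ×ˢ (W ∩ π ⁻¹' {ζ})) ∧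
    MapsTo p (W ∩ π ⁻¹' U) (W ∩ π ⁻¹' {ζ}) ∧
    (∀ z ∈ U, ∀ x ∈ W ∩ π ⁻¹' {ζ}, s (z, x) ∈ W ∧ π (s (z, x)) = z ∧ p (s (z, x)) = x) ∧
    (∀ y ∈ W ∩ π ⁻¹' U, s (π y, p y) = y)

/-- A concrete open book on a `(2n+3)`-manifold `Y`, with binding the `(2n+1)`-manifold `B`.
The map `collar` is an embedding of `B × 𝔻` (`𝔻` the open unit disc in `ℂ`) as an open subset of `Y`;
the binding, as a subset of `Y`, is the image of `B × {0}`. Away from the binding, `proj` is a fibre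
bundle over the circle, which in the collar is the angular coordinate `(b, r e^{iθ}) ↦ e^{iθ}`.
The values of `collar` for `|z| ≥ 1` and of `proj` on the binding are irrelevant. -/
structure ConcreteOpenBook (n : ℕ)
    (Y : Type*) [TopologicalSpace Y] [ChartedSpace (EuclideanSpace ℝ (Fin (2 * n + 3))) Y]
    (B : Type*) [TopologicalSpace B] [ChartedSpace (EuclideanSpace ℝ (Fin (2 * n + 1))) B] where
  collar : B × ℂ → Y
  proj : Y → Circle
  collar_isLocalDiffeomorphOn :
    IsLocalDiffeomorphOn ((𝓡 (2 * n + 1)).prod 𝓘(ℝ, ℂ)) (𝓡 (2 * n + 3)) ∞ collar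
      (univ ×ˢ Metric.ball 0 1)
  collar_injOn : InjOn collar (univ ×ˢ Metric.ball 0 1)
  proj_collar : ∀ (b : B) (z : ℂ), z ≠ 0 → ‖z‖ < 1 → (‖z‖ : ℂ) * (proj (collar (b, z)) : ℂ) = z
  isCircleBundleOn : IsCircleBundleOn (E := EuclideanSpace ℝ (Fin (2 * n + 3))) proj
    (range fun b : B => collar (b, 0))ᶜ

namespace ConcreteOpenBook

variable {n : ℕ}
  {Y : Type*} [TopologicalSpace Y] [ChartedSpace (EuclideanSpace ℝ (Fin (2 * n + 3))) Y]
  {B : Type*} [TopologicalSpace B] [ChartedSpace (EuclideanSpace ℝ (Fin (2 * n + 1))) B]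

/-- The binding, as a subset of `Y`. -/
def binding (O : ConcreteOpenBook n Y B) : Set Y := range fun b : B => O.collar (b, 0)

/-- The interior of the page over `ζ`, that is, the fibre of `proj` over `ζ`. -/
def openPage (O : ConcreteOpenBook n Y B) (ζ : Circle) : Set Y := O.bindingᶜ ∩ O.proj ⁻¹' {ζ}

/-- The page over `ζ`: the closure of the fibre (it is the union of the fibre and the binding). -/
def page (O : ConcreteOpenBook n Y B) (ζ : Circle) : Set Y := closure (O.openPage ζ)

/-- The differential `dθ` of the circle-valued projection, `θ` being the angle. -/
def dtheta (O : ConcreteOpenBook n Y B) (x : Y) (v : TangentSpace (𝓡 (2 * n + 3)) x) : ℝ :=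
  let w : ℂ := mfderiv (𝓡 (2 * n + 3)) 𝓘(ℝ, ℂ) (fun y => (O.proj y : ℂ)) x v
  (conj (O.proj x : ℂ) * w).im

/-- The differential of the collar embedding at `(b, z)`, applied to `(v, w) ∈ T_b B × ℂ`. -/
def dcollar (O : ConcreteOpenBook n Y B) (b : B) (z : ℂ)
    (v : TangentSpace (𝓡 (2 * n + 1)) b) (w : ℂ) :
    TangentSpace (𝓡 (2 * n + 3)) (O.collar (b, z)) :=
  mfderiv ((𝓡 (2 * n + 1)).prod 𝓘(ℝ, ℂ)) (𝓡 (2 * n + 3)) O.collar (b, z) (v, w)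

/-- The restriction `α_B` of a `1`-form on `Y` to the binding. -/
def bindingForm (O : ConcreteOpenBook n Y B)
    (α : OneForm (EuclideanSpace ℝ (Fin (2 * n + 3))) Y) :
    OneForm (EuclideanSpace ℝ (Fin (2 * n + 1))) B := fun b =>
  (α (O.collar (b, 0))).comp
    (mfderiv (𝓡 (2 * n + 1)) (𝓡 (2 * n + 3)) (fun b : B => O.collar (b, 0)) b)

/-- `α` is a Giroux form for the open book: a smooth contact form on `Y` that restricts to a contact
form on the binding and such that `dα` restricts to a positive symplectic form on the interior of each
page. Here `Y` is oriented by `α ∧ (dα)^(n+1)` and the pages are cooriented by `dθ`, so that `dα` is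
positive on the page through `x` exactly when `dθ` is positive on the Reeb vector at `x`. -/
structure IsGirouxForm [IsManifold (𝓡 (2 * n + 3)) ∞ Y] (O : ConcreteOpenBook n Y B)
    (α : OneForm (EuclideanSpace ℝ (Fin (2 * n + 3))) Y) : Prop where
  smooth : α.SmoothOn univ
  contact : α.IsContact
  contact_binding : (O.bindingForm α).IsContact
  symplectic_pages : ∀ x ∉ O.binding, α.NondegenerateOn x (fun v => O.dtheta x v = 0)
  positive : ∀ x ∉ O.binding, ∀ v, α.IsReebVector x v → 0 < O.dtheta x v

/-- In the collar, `α = A (α_B + r² dθ)` for the smooth function `A`. On `ℂ`, the form `r² dθ` at `z`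
is `w ↦ Im (z̄ w)`. -/
def HasNormalForm (O : ConcreteOpenBook n Y B)
    (α : OneForm (EuclideanSpace ℝ (Fin (2 * n + 3))) Y) (A : B × ℂ → ℝ) : Prop :=
  ContMDiffOn ((𝓡 (2 * n + 1)).prod 𝓘(ℝ, ℂ)) 𝓘(ℝ, ℝ) ∞ A (univ ×ˢ Metric.ball 0 1) ∧
  ∀ (b : B) (z : ℂ), ‖z‖ < 1 → ∀ (v : TangentSpace (𝓡 (2 * n + 1)) b) (w : ℂ),
    α (O.collar (b, z)) (O.dcollar b z v w) =
      A (b, z) * (O.bindingForm α b v + (conj z * w).im)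

/-- `f` is the Poincaré return map to the interior of the page over `ζ` of the flow of the vector
field `R`: it sends `p` to the first point of the forward orbit of `p` at positive time that lies in
the interior of the page. -/
def IsReturnMap (O : ConcreteOpenBook n Y B) (R : (x : Y) → TangentSpace (𝓡 (2 * n + 3)) x)
    (ζ : Circle) (f : Y → Y) : Prop :=
  ∀ p ∈ O.openPage ζ, f p ∈ O.openPage ζ ∧
    ∃ (γ : ℝ → Y) (τ : ℝ), IsMIntegralCurve (I := 𝓡 (2 * n + 3)) γ R ∧ γ 0 = p ∧
      0 < τ ∧ γ τ = f p ∧ ∀ t ∈ Ioo 0 τ, γ t ∉ O.openPage ζ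

/-- `g` restricts to an element of `Symp(int P, dα|_P)`, `P` the page over `ζ`. The tangent space of
the page at `x` is the kernel of `dθ`. On it `mfderivWithin` is the differential of `g` as a map of
the submanifold `int P`. -/
def IsSymplectomorphism (O : ConcreteOpenBook n Y B)
    (α : OneForm (EuclideanSpace ℝ (Fin (2 * n + 3))) Y) (ζ : Circle) (g : Y → Y) : Prop :=
  IsDiffeoOn (E := EuclideanSpace ℝ (Fin (2 * n + 3))) g (O.openPage ζ) ∧
  ∀ x ∈ O.openPage ζ, ∀ v w, O.dtheta x v = 0 → O.dtheta x w = 0 →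
    α.d (g x) (mfderivWithin (𝓡 (2 * n + 3)) (𝓡 (2 * n + 3)) g (O.openPage ζ) x v)
      (mfderivWithin (𝓡 (2 * n + 3)) (𝓡 (2 * n + 3)) g (O.openPage ζ) x w) = α.d x v w

/-- A symplectic isotopy: a smooth path `t ↦ Ψ t`, `t ∈ [0, 1]`, in `Symp(int P, dα|_P)`. -/
def IsSymplecticIsotopy (O : ConcreteOpenBook n Y B)
    (α : OneForm (EuclideanSpace ℝ (Fin (2 * n + 3))) Y) (ζ : Circle) (Ψ : ℝ → Y → Y) : Prop :=
  ContMDiffOn (𝓘(ℝ, ℝ).prod (𝓡 (2 * n + 3))) (𝓡 (2 * n + 3)) ∞ (fun q : ℝ × Y => Ψ q.1 q.2)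
    (Icc 0 1 ×ˢ O.openPage ζ) ∧
  ∀ t ∈ Icc (0 : ℝ) 1, O.IsSymplectomorphism α ζ (Ψ t)

/-- A symplectic connection `dβ` on the mapping torus `Y \ B`, modelled on `α` and flat near the
binding. The `1`-form `β` is smooth on `Y \ B` and `dβ` is symplectic on the pages; `β` agrees with
`α` on the page over `ζ`, and everywhere away from the binding; in the collar, `β` restricts to each
page as `F α_B` with `F > 0` and `∂F/∂r < 0`, as `α` itself does; and near the binding `∂/∂θ` spans
the kernel of `dβ`, that is, the connection is the product connection there. These `β` form a convex
set. -/
structure IsMonodromyForm [IsManifold (𝓡 (2 * n + 3)) ∞ Y] (O : ConcreteOpenBook n Y B)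
    (α : OneForm (EuclideanSpace ℝ (Fin (2 * n + 3))) Y) (ζ : Circle)
    (β : OneForm (EuclideanSpace ℝ (Fin (2 * n + 3))) Y) : Prop where
  smooth : β.SmoothOn O.bindingᶜ
  symplectic_pages : ∀ x ∉ O.binding, β.NondegenerateOn x (fun v => O.dtheta x v = 0)
  eq_on_page : ∀ x ∈ O.openPage ζ, ∀ v, O.dtheta x v = 0 → β x v = α x v
  eq_away : ∃ ρ : ℝ, 0 < ρ ∧ ρ < 1 ∧
    ∀ x ∉ O.collar '' (univ ×ˢ Metric.closedBall 0 ρ), β x = α x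
  /-- `(v, s z)`, for `s` real, is the general vector tangent to the page at `(b, z)`. -/
  collar_pages : ∃ F : B × ℂ → ℝ, ∀ (b : B) (z : ℂ), z ≠ 0 → ‖z‖ < 1 →
    0 < F (b, z) ∧ deriv (fun s : ℝ => F (b, s * z)) 1 < 0 ∧
    ∀ (v : TangentSpace (𝓡 (2 * n + 1)) b) (s : ℝ),
      β (O.collar (b, z)) (O.dcollar b z v (s * z)) = F (b, z) * O.bindingForm α b v
  /-- `∂/∂θ` at `(b, z)` is the vector `(0, i z)`. -/
  flat_near_binding : ∃ ρ : ℝ, 0 < ρ ∧ ρ < 1 ∧ ∀ (b : B) (z : ℂ), z ≠ 0 → ‖z‖ < ρ →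
    ∀ u, β.d (O.collar (b, z)) (O.dcollar b z 0 (Complex.I * z)) u = 0

/-- `h` is the holonomy of the connection `ker dβ` around the circle, based at the page over `ζ`: it
sends `p` to the end point of the horizontal lift, starting at `p`, of the loop `t ↦ ζ e^{it}`,
`0 ≤ t ≤ 2π`. -/
def IsHolonomy (O : ConcreteOpenBook n Y B)
    (β : OneForm (EuclideanSpace ℝ (Fin (2 * n + 3))) Y) (ζ : Circle) (h : Y → Y) : Prop :=
  ∀ p ∈ O.openPage ζ, ∃ γ : ℝ → Y, γ 0 = p ∧ γ (2 * Real.pi) = h p ∧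
    ∀ t ∈ Icc 0 (2 * Real.pi), γ t ∉ O.binding ∧ O.proj (γ t) = ζ * Circle.exp t ∧
      ∃ v : TangentSpace (𝓡 (2 * n + 3)) (γ t),
        HasMFDerivWithinAt 𝓘(ℝ, ℝ) (𝓡 (2 * n + 3)) γ (Icc 0 (2 * Real.pi)) t
          ((1 : ℝ →L[ℝ] ℝ).smulRight v) ∧
        ∀ u, β.d (γ t) v u = 0

/-- `φ` represents the symplectic monodromy of the open book with Giroux form `α`. The symplectic
monodromy is the class, in the group of symplectomorphisms of `(int P, dα|_P)` that are the identity
near the binding modulo isotopy in that group, of the holonomy of a symplectic connection as in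
`IsMonodromyForm` (the class is independent of the choice, these forming a convex set). -/
def RepresentsSymplecticMonodromy [IsManifold (𝓡 (2 * n + 3)) ∞ Y] (O : ConcreteOpenBook n Y B)
    (α : OneForm (EuclideanSpace ℝ (Fin (2 * n + 3))) Y) (ζ : Circle) (φ : Y → Y) : Prop :=
  ∃ (β : OneForm (EuclideanSpace ℝ (Fin (2 * n + 3))) Y) (h : Y → Y) (Φ : ℝ → Y → Y) (V : Set Y),
    O.IsMonodromyForm α ζ β ∧ O.IsHolonomy β ζ h ∧
    IsOpen V ∧ O.binding ⊆ V ∧ O.IsSymplecticIsotopy α ζ Φ ∧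
    EqOn (Φ 0) h (O.openPage ζ) ∧ EqOn (Φ 1) φ (O.openPage ζ) ∧
    ∀ t ∈ Icc (0 : ℝ) 1, ∀ x ∈ O.openPage ζ ∩ V, Φ t x = x

end ConcreteOpenBook

end

/-! The Reeb field spans `ker dα`, so the return map `f` is the holonomy around the circle of the
connection `ker dα` on `Y \ B`. The symplectic monodromy is the holonomy of another connection `ker
dβ`, flat near `B`. The two are joined by the forms `β_l = α + l · correction`, `0 ≤ l ≤ 1`. In the
collar `β_l = F α_B + G dθ` with `F = (1 - lχ) A + lχ A(b, rζ)` and `G = (1 - lχ) r² A`, where `χ`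
is a cutoff equal to `1` near `B` and to `0` for `r ≥ ρ`. On the page over `ζ` the two values of `A`
agree, so every `β_l` restricts to `α` there. If `dβ_l` is symplectic on the pages, then `ker dβ_l`
is a connection, closedness of `dβ_l` makes its transport symplectic, and its holonomy lies in
`Symp(int P, dα)`. For `l = 0` the holonomy is `f`. For `l = 1` the form is `A(b, rζ) α_B` near `B`,
so `∂_θ` spans the kernel of its differential and the holonomy is the identity near `B`.

The Hessian enters twice. First, `dβ_l` is symplectic on the pages in the collar as soon as `F > 0`
and `∂_r F < 0`. The page condition on `α` forces `∂_r A ≠ 0` off `B`, hence the normal derivative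
of `A` vanishes on `B`, and the negative Hessian gives `∂_r A ≤ -c r` near `B`. Since `χ` is a
function of `δ log (ρ / r)`, its derivative is `O(δ / r)`, while `A(b, rζ) - A = O(r²)`. The error
is `O(δ r)`, and a small `δ`, independent of `ρ`, makes it harmless (`exists_cutoff_parameter`,
`nondegenerateOn_interpForm`).

Second, the holonomies must extend smoothly over `B`. Near `B` one has `F = 1 + r² q` and `G = r²
g`. The equations for the horizontal lift of `∂_θ` can be divided by powers of `r` until the only
remaining denominators are `F` and `r⁻¹ ∂_r F`, which is negative even at `r = 0`. The lift is
therefore `W + r k ∂_r + ∂_θ` with `W` and `k` smooth up to `r = 0` (`PolarData.horizontal`). Its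
flow in polar coordinates preserves `r = 0`; this gives completeness off `B`
(`exists_suspendedFlow`) and the extension to the page, on which `r = Re (conj ζ · z)` is a smooth
coordinate (`contMDiffWithinAt_monodromyMap`).

For the support, orbits starting in the compact set `P \ U` stay away from `B` during one turn, so
they miss the correction once `ρ` is small (`exists_cutoffParameters_flow_eq`). The identification
with `f` is `returnMap_eq_flow`, the symplectic property is `symplectic_flow`. Smooth dependence of
flows on time, point and parameter is obtained from the implicit function theorem in `C([0, 1], E)`.
-/

open scoped Topology

noncomputable section

set_option linter.unusedSectionVars false

/-! ### Smoothness of composition operators on `C(K, E)`. -/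

section Nemytskii

variable {K : Type*} [TopologicalSpace K] [CompactSpace K]
  {E : Type*} [NormedAddCommGroup E] [NormedSpace ℝ E]

/-- Pointwise application of a continuous family of operators to a continuous function. -/
def ContinuousMap.pointwiseApply (K : Type*) [TopologicalSpace K] [CompactSpace K]
    (E F : Type*) [NormedAddCommGroup E] [NormedSpace ℝ E] [NormedAddCommGroup F] [NormedSpace ℝ F] :
    C(K, E →L[ℝ] F) →L[ℝ] C(K, E) →L[ℝ] C(K, F) :=
  LinearMap.mkContinuous₂
    (LinearMap.mk₂ ℝ (fun (T : C(K, E →L[ℝ] F)) (g : C(K, E)) =>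
        (⟨fun t => T t (g t), by fun_prop⟩ : C(K, F)))
      (by intros; ext; simp) (by intros; ext; simp) (by intros; ext; simp) (by intros; ext; simp)) 1
    (by
      intro T g
      rw [one_mul, ContinuousMap.norm_le _ (by positivity)]
      intro t
      exact ((T t).le_opNorm _).trans
        (mul_le_mul (T.norm_coe_le_norm t) (g.norm_coe_le_norm t) (norm_nonneg _) (norm_nonneg T)))

@[simp] lemma ContinuousMap.pointwiseApply_apply {F : Type*} [NormedAddCommGroup F]
    [NormedSpace ℝ F] (T : C(K, E →L[ℝ] F)) (g : C(K, E)) (t : K) :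
    ContinuousMap.pointwiseApply K E F T g t = T t (g t) := rfl

/-- The mean value inequality on the segment from `g t` to `g t + k t` bounds the remainder by `‖k‖`
times the oscillation of `f'` there. That oscillation is small uniformly in `t`, because `g ↦ f' ∘
g` is continuous for the sup norm. -/
lemma hasFDerivAt_continuousMap_comp {F : Type*} [NormedAddCommGroup F] [NormedSpace ℝ F]
    (f : C(E, F)) (f' : C(E, E →L[ℝ] F)) (h : ∀ x, HasFDerivAt f (f' x) x) (g : C(K, E)) :
    HasFDerivAt (fun g : C(K, E) => f.comp g) (ContinuousMap.pointwiseApply K E F (f'.comp g)) g := by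
  rw [hasFDerivAt_iff_isLittleO_nhds_zero, Asymptotics.isLittleO_iff]
  intro c hc
  have hcont : Continuous fun g : C(K, E) => f'.comp g := ContinuousMap.continuous_postcomp f'
  obtain ⟨δ, hδ, hd⟩ := (Metric.continuousAt_iff (α := C(K, E)) (β := C(K, E →L[ℝ] F))).1
    (hcont.continuousAt (x := g)) c hc
  filter_upwards [Metric.ball_mem_nhds (0 : C(K, E)) hδ] with k hk
  rw [mem_ball_zero_iff] at hk
  rw [ContinuousMap.norm_le _ (by positivity)]
  intro t
  have key : ∀ x ∈ segment ℝ (g t) (g t + k t), ‖f' x - f' (g t)‖ ≤ c := by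
    rintro x hx
    rw [segment_eq_image'] at hx
    obtain ⟨τ, hτ, rfl⟩ := hx
    have : dist (g + τ • k) g < δ := by
      rw [dist_eq_norm, add_sub_cancel_left, norm_smul, Real.norm_eq_abs, abs_of_nonneg hτ.1]
      exact (mul_le_of_le_one_left (norm_nonneg _) hτ.2).trans_lt hk
    have h2 := (ContinuousMap.norm_coe_le_norm _ t).trans (dist_eq_norm (E := C(K, E →L[ℝ] F)) _ _ ▸ hd this).le
    simpa using h2
  have := (convex_segment (𝕜 := ℝ) (g t) (g t + k t)).norm_image_sub_le_of_norm_hasFDerivWithin_le'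
    (f := f) (f' := f') (φ := f' (g t)) (C := c) (fun x _ => (h x).hasFDerivWithinAt) key
    (left_mem_segment ℝ _ _) (right_mem_segment ℝ _ _)
  rw [add_sub_cancel_left] at this
  refine LE.le.trans (by simpa using this) ?_
  exact mul_le_mul_of_nonneg_left (k.norm_coe_le_norm t) hc.le

universe u

/-- Induction on `n`: the derivative is again a composition operator, that of `f'`, followed by a
bounded linear map. The target changes from `F` to `E →L[ℝ] F`, so `F` is quantified inside the
induction and shares the universe of `E`. -/
lemma contDiff_continuousMap_comp {E : Type u} [NormedAddCommGroup E] [NormedSpace ℝ E] (n : ℕ) :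
    ∀ {F : Type u} [NormedAddCommGroup F] [NormedSpace ℝ F] (f : C(E, F)), ContDiff ℝ n f →
      ContDiff ℝ n (fun g : C(K, E) => f.comp g) := by
  induction n with
  | zero =>
    intro F _ _ f _
    exact contDiff_zero.2 (ContinuousMap.continuous_postcomp f)
  | succ n ih =>
    intro F _ _ f hf
    have hf1 : ContDiff ℝ (n + 1) f := by exact_mod_cast hf
    have hd := (contDiff_succ_iff_fderiv (𝕜 := ℝ)).1 hf1
    have e : ((n + 1 : ℕ) : WithTop ℕ∞) = n + 1 := by push_cast; rfl
    rw [e]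
    refine contDiff_succ_iff_hasFDerivAt.2 ⟨_, ?_, fun g =>
      hasFDerivAt_continuousMap_comp f ⟨fderiv ℝ f, hd.2.2.continuous⟩
        (fun x => (hd.1 x).hasFDerivAt) g⟩
    exact (ContinuousMap.pointwiseApply K E F).contDiff.comp (ih ⟨fderiv ℝ f, hd.2.2.continuous⟩ hd.2.2)

end Nemytskii

/-! ### Integration as a bounded operator on `C([0, 1], E)`. -/

section Primitive

variable {E : Type*} [NormedAddCommGroup E] [NormedSpace ℝ E] [CompleteSpace E]

/-- The primitive vanishing at `0` of a continuous function on `[0, 1]`. -/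
def ContinuousMap.primitive (E : Type*) [NormedAddCommGroup E] [NormedSpace ℝ E] :
    C(unitInterval, E) →L[ℝ] C(unitInterval, E) :=
  LinearMap.mkContinuous
    { toFun := fun g => ⟨fun t => ∫ u in (0 : ℝ)..t, g (projIcc 0 1 zero_le_one u), by
        refine (intervalIntegral.continuous_primitive (fun a b => ?_) 0).comp continuous_subtype_val
        exact (g.continuous.comp continuous_projIcc).intervalIntegrable _ _⟩
      map_add' := by
        intro g h
        ext t
        simp only [ContinuousMap.coe_mk, ContinuousMap.add_apply]
        exact intervalIntegral.integral_add
          ((g.continuous.comp continuous_projIcc).intervalIntegrable _ _)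
          ((h.continuous.comp continuous_projIcc).intervalIntegrable _ _)
      map_smul' := by intro c g; ext t; simp } 1
    (by
      intro g
      rw [one_mul, ContinuousMap.norm_le _ (norm_nonneg _)]
      intro t
      refine (intervalIntegral.norm_integral_le_of_norm_le_const
        (fun u _ => g.norm_coe_le_norm _)).trans ?_
      rw [sub_zero, abs_of_nonneg t.2.1]
      exact mul_le_of_le_one_right (norm_nonneg _) t.2.2)

lemma ContinuousMap.primitive_apply {E : Type*} [NormedAddCommGroup E] [NormedSpace ℝ E]
    (g : C(unitInterval, E)) (t : unitInterval) :
    ContinuousMap.primitive E g t = ∫ u in (0 : ℝ)..t, g (projIcc 0 1 zero_le_one u) := rfl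

end Primitive

/-! ### Hadamard's lemma with parameters. -/

section Hadamard

/-- Multiplication by a bump function. Composition operators need functions defined on the whole
space, while the data at hand are smooth only on open sets. -/
lemma exists_contDiff_eventuallyEq {E F : Type*} [NormedAddCommGroup E] [NormedSpace ℝ E]
    [FiniteDimensional ℝ E] [NormedAddCommGroup F] [NormedSpace ℝ F] {U : Set E} (hU : IsOpen U)
    {x : E} (hx : x ∈ U) {f : E → F} (hf : ContDiffOn ℝ ∞ f U) :
    ∃ g : E → F, ContDiff ℝ ∞ g ∧ g =ᶠ[𝓝 x] f := by
  obtain ⟨r, hr, hrU⟩ := Metric.isOpen_iff.1 hU x hx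
  let χ : ContDiffBump x := ⟨r / 4, r / 2, by positivity, by linarith⟩
  refine ⟨fun y => χ y • f y, contDiff_iff_contDiffAt.2 fun y => ?_, ?_⟩
  · by_cases hy : y ∈ U
    · exact χ.contDiff.contDiffAt.smul (hf.contDiffAt (hU.mem_nhds hy))
    · have hy' : y ∉ Metric.closedBall x (r / 2) := fun h =>
        hy (hrU (Metric.closedBall_subset_ball (by linarith) h))
      refine (contDiffAt_const (c := (0 : F))).congr_of_eventuallyEq ?_
      filter_upwards [Metric.isClosed_closedBall.isOpen_compl.mem_nhds hy'] with z hz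
      have : χ z = 0 := χ.zero_of_le_dist (le_of_lt (by simpa using hz))
      simp [this]
  · filter_upwards [χ.eventuallyEq_one] with y hy
    simp [hy]

/-- The integral is the composite of the linear map `L`, the composition operator of `G`, the
primitive and evaluation at `1`, so no differentiation under the integral sign is needed. -/
lemma contDiff_integral_unitInterval {E F : Type} [NormedAddCommGroup E] [NormedSpace ℝ E]
    [NormedAddCommGroup F] [NormedSpace ℝ F] [CompleteSpace F] {G : E → F} (hG : ContDiff ℝ ∞ G)
    {V : Type*} [NormedAddCommGroup V] [NormedSpace ℝ V] (L : V →L[ℝ] C(unitInterval, E)) :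
    ContDiff ℝ ∞ fun v => ∫ t in (0 : ℝ)..1, G (L v (projIcc 0 1 zero_le_one t)) := by
  refine contDiff_infty.2 fun n => ?_
  have h := contDiff_continuousMap_comp (K := unitInterval) n ⟨G, hG.continuous⟩
    (hG.of_le (by exact_mod_cast le_top))
  have h2 : ContDiff ℝ n fun v => ContinuousMap.primitive F
      ((⟨G, hG.continuous⟩ : C(E, F)).comp (L v)) :=
    (ContinuousMap.primitive F).contDiff.comp (h.comp L.contDiff)
  have h3 : ContDiff ℝ n fun v => ContinuousMap.evalCLM ℝ (1 : unitInterval)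
      (ContinuousMap.primitive F ((⟨G, hG.continuous⟩ : C(E, F)).comp (L v))) :=
    ContDiff.comp (g := ContinuousMap.evalCLM (M := F) ℝ (1 : unitInterval))
      (ContinuousLinearMap.contDiff _) h2
  exact h3

/-- The linear map sending `(v, r)` to the path `t ↦ (v, t r)`. -/
def rayPath (V : Type*) [NormedAddCommGroup V] [NormedSpace ℝ V] :
    V × ℝ →L[ℝ] C(unitInterval, V × ℝ) :=
  LinearMap.mkContinuous
    { toFun := fun p => ⟨fun t => (p.1, t * p.2), by fun_prop⟩
      map_add' := by intro p q; ext t <;> simp [mul_add]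
      map_smul' := by intro c p; ext t <;> simp [mul_left_comm] } 1
    (by
      intro p
      rw [one_mul, ContinuousMap.norm_le _ (norm_nonneg _)]
      intro t
      refine norm_prod_le_iff.2 ⟨norm_fst_le p, ?_⟩
      refine le_trans ?_ (norm_snd_le p)
      simp only [LinearMap.coe_mk, AddHom.coe_mk, ContinuousMap.coe_mk, norm_mul]
      refine mul_le_of_le_one_left (norm_nonneg _) ?_
      rw [Real.norm_eq_abs, abs_of_nonneg t.2.1]
      exact t.2.2)

/-- Hadamard's formula: the divided difference equals `∫₀¹ ∂_r f(v, t r) dt`, including at `r = 0`.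
-/
lemma contDiff_dslope_zero {V F : Type} [NormedAddCommGroup V] [NormedSpace ℝ V]
    [NormedAddCommGroup F] [NormedSpace ℝ F] [CompleteSpace F] {f : V × ℝ → F}
    (hf : ContDiff ℝ ∞ f) :
    ContDiff ℝ ∞ fun p : V × ℝ => dslope (fun r => f (p.1, r)) 0 p.2 := by
  have hG : ContDiff ℝ ∞ fun p : V × ℝ => fderiv ℝ f p (0, 1) :=
    (hf.fderiv_right (m := ∞) le_rfl).clm_apply contDiff_const
  convert contDiff_integral_unitInterval hG (rayPath V) using 2 with p
  obtain ⟨v, r⟩ := p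
  have hd : ∀ s : ℝ, HasDerivAt (fun r => f (v, r)) (fderiv ℝ f (v, s) (0, 1)) s := fun s =>
    (hf.differentiable (by simp) (v, s)).hasFDerivAt.comp_hasDerivAt s
      ((hasDerivAt_const s v).prodMk (hasDerivAt_id s))
  have e : ∫ t in (0 : ℝ)..1, fderiv ℝ f (rayPath V (v, r) (projIcc 0 1 zero_le_one t)) (0, 1) =
      ∫ t in (0 : ℝ)..1, fderiv ℝ f (v, t * r) (0, 1) := by
    refine intervalIntegral.integral_congr fun t ht => ?_
    rw [uIcc_of_le zero_le_one] at ht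
    simp only [rayPath, LinearMap.mkContinuous_apply, LinearMap.coe_mk, AddHom.coe_mk,
      ContinuousMap.coe_mk, projIcc_of_mem _ ht]
  rw [e]
  have hc : Continuous fun s : ℝ => fderiv ℝ f (v, s) (0, 1) :=
    hG.continuous.comp (by fun_prop)
  by_cases hr : r = 0
  · subst hr
    simp [dslope_same, (hd 0).deriv]
  · rw [dslope_of_ne _ hr, slope_def_module]
    have := intervalIntegral.integral_comp_mul_right (a := 0) (b := 1)
      (fun s => fderiv ℝ f (v, s) (0, 1)) hr
    rw [this, zero_mul, one_mul, intervalIntegral.integral_eq_sub_of_hasDerivAt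
      (fun s _ => hd s) (hc.intervalIntegrable _ _), sub_zero]

/-- Near `r = 0` the function is replaced by a global one with the same germ; elsewhere the quotient
formula applies directly. -/
lemma contDiffAt_dslope_zero {V F : Type} [NormedAddCommGroup V] [NormedSpace ℝ V]
    [FiniteDimensional ℝ V] [NormedAddCommGroup F] [NormedSpace ℝ F] [CompleteSpace F]
    {f : V × ℝ → F} {U : Set (V × ℝ)} (hU : IsOpen U) (hf : ContDiffOn ℝ ∞ f U)
    {v : V} {r : ℝ} (h0 : (v, 0) ∈ U) (hr : (v, r) ∈ U) :
    ContDiffAt ℝ ∞ (fun p : V × ℝ => dslope (fun r => f (p.1, r)) 0 p.2) (v, r) := by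
  by_cases hr0 : r = 0
  · subst hr0
    obtain ⟨g, hg, hgf⟩ := exists_contDiff_eventuallyEq hU h0 hf
    refine (contDiff_dslope_zero hg).contDiffAt.congr_of_eventuallyEq ?_
    obtain ⟨ε, hε, hb⟩ := Metric.eventually_nhds_iff.1 hgf
    filter_upwards [Metric.ball_mem_nhds _ hε] with p hp
    have hpe : ∀ s : ℝ, |s| < ε → g (p.1, s) = f (p.1, s) := by
      intro s hs
      refine hb ?_
      rw [Metric.mem_ball, Prod.dist_eq] at hp
      rw [Prod.dist_eq]
      exact max_lt ((le_max_left _ _).trans_lt hp) (by simpa using hs)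
    have hp2 : |p.2| < ε := by
      rw [Metric.mem_ball, Prod.dist_eq] at hp
      simpa using (le_max_right _ _).trans_lt hp
    by_cases h : p.2 = 0
    · rw [h, dslope_same, dslope_same]
      refine (Filter.EventuallyEq.deriv_eq ?_).symm
      filter_upwards [Metric.ball_mem_nhds (0 : ℝ) hε] with s hs
      exact hpe s (by simpa using hs)
    · rw [dslope_of_ne _ h, dslope_of_ne _ h, slope_def_module, slope_def_module, hpe _ hp2,
        hpe 0 (by simpa using hε)]
  · have h1 : ContDiffAt ℝ ∞ (fun p : V × ℝ => (p.2)⁻¹ • (f p - f (p.1, 0))) (v, r) := by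
      refine (contDiffAt_snd.inv hr0).smul ((hf.contDiffAt (hU.mem_nhds hr)).sub ?_)
      exact (hf.contDiffAt (hU.mem_nhds h0)).comp (v, r)
        (contDiffAt_fst.prodMk contDiffAt_const)
    refine h1.congr_of_eventuallyEq ?_
    have : ∀ᶠ p : V × ℝ in 𝓝 (v, r), p.2 ≠ 0 := continuous_snd.continuousAt.eventually_ne hr0
    filter_upwards [this] with p hp
    rw [dslope_of_ne _ hp, slope_def_module, sub_zero]

end Hadamard

/-! ### Local flows in a Banach space via the implicit function theorem. -/

section LocalFlow

variable {E : Type} [NormedAddCommGroup E] [NormedSpace ℝ E]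

/-- The equation for a rescaled integral curve, a function on `[0, 1]`. -/
def flowEquation (X : C(E, E)) (p : (ℝ × E) × C(unitInterval, E)) : C(unitInterval, E) :=
  p.2 - ContinuousMap.const unitInterval p.1.2 - p.1.1 • ContinuousMap.primitive E (X.comp p.2)

lemma contDiff_flowEquation {X : E → E} (hX : ContDiff ℝ ∞ X) (n : ℕ) :
    ContDiff ℝ n (flowEquation ⟨X, hX.continuous⟩) := by
  have h := contDiff_continuousMap_comp (K := unitInterval) n ⟨X, hX.continuous⟩
    (hX.of_le (by exact_mod_cast le_top))
  have hc : ContDiff ℝ n fun x : E => ContinuousMap.const unitInterval x :=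
    (ContinuousLinearMap.const ℝ unitInterval : E →L[ℝ] C(unitInterval, E)).contDiff
  exact (contDiff_snd.sub (hc.comp (contDiff_snd.comp contDiff_fst))).sub
    ((contDiff_fst.comp contDiff_fst).smul
      ((ContinuousMap.primitive E).contDiff.comp (h.comp contDiff_snd)))

/-- A smooth vector field on a Banach space has a local flow, of class `C^n` at time `0` for all
`n`. -/
theorem exists_contDiffAt_localFlow [CompleteSpace E] {X : E → E} (hX : ContDiff ℝ ∞ X) (x₀ : E) :
    ∃ ε > 0, ∃ Φ : ℝ × E → E, (∀ n : ℕ, ContDiffAt ℝ n Φ (0, x₀)) ∧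
      ∀ x ∈ Metric.ball x₀ ε, Φ (0, x) = x ∧
        ∀ t ∈ Ioo (-ε) ε, HasDerivAt (fun t => Φ (t, x)) (X (Φ (t, x))) t := by
  obtain ⟨ε, hε, a, r, _, _, hr, hpl⟩ := IsPicardLindelof.of_contDiffAt_one
    (hX.contDiffAt.of_le (by simp) : ContDiffAt ℝ 1 X x₀)
  obtain ⟨α, hα, hαc⟩ := (hpl 0).exists_forall_mem_closedBall_eq_hasDerivWithinAt_continuousOn
  simp only [zero_sub, zero_add] at hα hαc
  have hsub : Metric.closedBall x₀ r ×ˢ Icc (-ε) ε ∈ 𝓝 (x₀, (0 : ℝ)) :=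
    prod_mem_nhds (Metric.closedBall_mem_nhds _ hr) (Icc_mem_nhds (by linarith) hε)
  have hder : ∀ x ∈ Metric.closedBall x₀ r, ∀ t ∈ Ioo (-ε) ε,
      HasDerivAt (fun t => α (x, t)) (X (α (x, t))) t := fun x hx t ht =>
    ((hα x hx).2 t (Ioo_subset_Icc_self ht)).hasDerivAt (Icc_mem_nhds ht.1 ht.2)
  refine ⟨min ε r, lt_min hε hr, fun p => α (p.2, p.1), fun n => ?_, fun x hx => ⟨?_, fun t ht => ?_⟩⟩
  rotate_left
  · exact (hα x (Metric.ball_subset_closedBall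
      (Metric.ball_subset_ball (min_le_right _ _) hx))).1
  · exact hder x (Metric.ball_subset_closedBall
      (Metric.ball_subset_ball (min_le_right _ _) hx)) t
      ⟨lt_of_le_of_lt (neg_le_neg (min_le_left _ _)) ht.1, ht.2.trans_le (min_le_left _ _)⟩
  -- The implicit function theorem needs at least `C^1`; the case `n = 0` follows from `n = 1`.
  suffices H : ∀ n : ℕ, n ≠ 0 → ContDiffAt ℝ n (fun p : ℝ × E => α (p.2, p.1)) (0, x₀) from
    (H (n + 1) n.succ_ne_zero).of_le (by exact_mod_cast n.le_succ)
  clear n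
  intro n hn
  -- A curve `g` on `[0, 1]` is a zero of `f ((t, x), ·)` exactly when `g s = x + t ∫₀ˢ X (g)`, that
  -- is, when it is the orbit of `x` run at speed `t`. The flow at time `t` is then the value of `g`
  -- at `1`.
  set f := flowEquation ⟨X, hX.continuous⟩ with hf
  let c₀ := ContinuousMap.const unitInterval x₀
  let u : (ℝ × E) × C(unitInterval, E) := ((0, x₀), c₀)
  have cdf : ContDiffAt ℝ n f u := (contDiff_flowEquation hX n).contDiffAt
  have hn' : (n : WithTop ℕ∞) ≠ 0 := by exact_mod_cast hn
  have hfu : f u = 0 := by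
    simp [f, flowEquation, u, c₀]
  -- At `t = 0` the integral term disappears, so the partial derivative in `g` is the identity.
  have hinr : fderiv ℝ f u ∘L .inr ℝ (ℝ × E) C(unitInterval, E) = .id ℝ _ := by
    have h1 : HasFDerivAt f (fderiv ℝ f u) u := (cdf.differentiableAt hn').hasFDerivAt
    have h2 : HasFDerivAt (fun g => f ((0, x₀), g))
        (fderiv ℝ f u ∘L .inr ℝ (ℝ × E) C(unitInterval, E)) c₀ :=
      h1.comp c₀ (hasFDerivAt_prodMk_right _ _)
    have h3 : HasFDerivAt (fun g => f ((0, x₀), g)) (.id ℝ _) c₀ := by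
      have : (fun g => f ((0, x₀), g)) = fun g => g - c₀ := by
        ext g; simp [f, flowEquation, c₀]
      rw [this]
      exact (hasFDerivAt_id c₀).sub_const c₀
    exact h2.unique h3
  have hinv : (fderiv ℝ f u ∘L .inr ℝ (ℝ × E) C(unitInterval, E)).IsInvertible := by
    rw [hinr]; exact ⟨ContinuousLinearEquiv.refl ℝ _, rfl⟩
  have hψ := cdf.contDiffAt_implicitFunction hn' hinv
  set ψ := cdf.implicitFunction hn' hinv
  have huniq := cdf.eventually_apply_eq_iff_implicitFunction hn' hinv
  rw [hfu] at huniq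
  obtain ⟨δ, hδ, hδu⟩ := Metric.eventually_nhds_iff.1 huniq
  have hα0 : α (x₀, 0) = x₀ := (hα x₀ (Metric.mem_closedBall_self hr.le)).1
  have hcont0 : ContinuousAt α (x₀, 0) := hαc.continuousAt hsub
  obtain ⟨η, hη, hηα⟩ := Metric.continuousAt_iff.1 hcont0 (δ / 2) (by positivity)
  have hev : ContDiffAt ℝ n (fun p => ContinuousMap.evalCLM (M := E) ℝ (1 : unitInterval) (ψ p))
      (0, x₀) := ContDiffAt.comp _ (g := ContinuousMap.evalCLM (M := E) ℝ (1 : unitInterval))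
      (ContinuousLinearMap.contDiff _).contDiffAt hψ
  refine hev.congr_of_eventuallyEq ?_
  have hsmall : ∀ᶠ p : ℝ × E in 𝓝 (0, x₀), |p.1| < min (min ε δ) η ∧ p.2 ∈ Metric.ball x₀ (min (min r δ) η) :=
    Filter.Eventually.prod_nhds (p := fun t : ℝ => |t| < min (min ε δ) η)
      (by
        filter_upwards [Metric.ball_mem_nhds (0 : ℝ) (lt_min (lt_min hε hδ) hη)] with t ht
        simpa using ht)
      (Metric.ball_mem_nhds _ (lt_min (lt_min (by exact_mod_cast hr) hδ) hη))
  filter_upwards [hsmall] with p hp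
  obtain ⟨⟨hp1, hp2⟩, hp3⟩ := hp.imp_left (fun h => lt_min_iff.1 h)
  rw [lt_min_iff] at hp1
  obtain ⟨⟨hp4, hp5⟩, hp6⟩ : (p.2 ∈ Metric.ball x₀ r ∧ p.2 ∈ Metric.ball x₀ δ) ∧ p.2 ∈ Metric.ball x₀ η := by
    simpa [Metric.mem_ball, lt_min_iff] using hp3
  have hpr : p.2 ∈ Metric.closedBall x₀ r := Metric.ball_subset_closedBall hp4
  have habs : ∀ s ∈ Icc (0 : ℝ) 1, |p.1 * s| ≤ |p.1| := fun s hs => by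
    rw [abs_mul, abs_of_nonneg hs.1]; exact mul_le_of_le_one_right (abs_nonneg _) hs.2
  have hIoo : ∀ s ∈ Icc (0 : ℝ) 1, p.1 * s ∈ Ioo (-ε) ε := fun s hs =>
    abs_lt.1 ((habs s hs).trans_lt hp1.1)
  have hcα : ContinuousOn (fun s : ℝ => α (p.2, p.1 * s)) (Icc 0 1) := fun s hs =>
    (((hder p.2 hpr _ (hIoo s hs)).continuousAt).comp (f := fun s : ℝ => p.1 * s)
      (by fun_prop)).continuousWithinAt
  -- The flow given by Picard–Lindelöf, rescaled to `[0, 1]`. It solves the equation and is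
  -- uniformly close to the constant `x₀`, so the uniqueness in the implicit function theorem
  -- identifies it with the smooth solution.
  let g : C(unitInterval, E) := ⟨fun s => α (p.2, p.1 * s), hcα.domRestrict⟩
  have hgv : ∀ s : unitInterval, g s = α (p.2, p.1 * s) := fun s => rfl
  have hfg : f (p, g) = 0 := by
    ext s
    have hs0 : ∀ y ∈ uIcc (0 : ℝ) s, y ∈ Icc (0 : ℝ) 1 := by
      intro y hy
      rw [uIcc_of_le s.2.1] at hy
      exact ⟨hy.1, hy.2.trans s.2.2⟩
    have hint : ∫ y in (0 : ℝ)..s, p.1 • X (α (p.2, p.1 * y)) =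
        α (p.2, p.1 * s) - α (p.2, p.1 * 0) := by
      refine intervalIntegral.integral_eq_sub_of_hasDerivAt
        (f := fun y => α (p.2, p.1 * y)) (fun y hy => ?_) ?_
      · have := (hder p.2 hpr _ (hIoo y (hs0 y hy))).scomp y
          ((hasDerivAt_id y).const_mul p.1)
        rw [mul_one] at this
        exact this
      · refine ContinuousOn.intervalIntegrable ?_
        exact continuousOn_const.smul (hX.continuous.comp_continuousOn (hcα.mono hs0))
    have hint2 : ∫ y in (0 : ℝ)..s, X (g (projIcc 0 1 zero_le_one y)) =
        ∫ y in (0 : ℝ)..s, X (α (p.2, p.1 * y)) := by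
      refine intervalIntegral.integral_congr fun y hy => ?_
      simp [hgv, projIcc_of_mem _ (hs0 y hy)]
    have h0 : α (p.2, p.1 * 0) = p.2 := by rw [mul_zero]; exact (hα p.2 hpr).1
    rw [h0, intervalIntegral.integral_smul] at hint
    simp only [f, flowEquation, ContinuousMap.sub_apply, ContinuousMap.smul_apply,
      ContinuousMap.primitive_apply, ContinuousMap.comp_apply, ContinuousMap.coe_mk,
      ContinuousMap.const_apply, ContinuousMap.zero_apply]
    rw [hint2, hint]
    simp [hgv]
  have hclose : dist (p, g) u < δ := by
    rw [Prod.dist_eq]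
    refine max_lt ?_ ?_
    · rw [Prod.dist_eq]
      exact max_lt (by simpa [u] using hp1.2) hp5
    · refine lt_of_le_of_lt ((ContinuousMap.dist_le (by positivity)).2 fun s => ?_) (half_lt_self hδ)
      have := hηα (x := (p.2, p.1 * s)) (by
        rw [Prod.dist_eq]
        exact max_lt hp6 (by simpa using (habs s s.2).trans_lt hp2))
      rw [hα0] at this
      exact this.le
  have := (hδu hclose).1 hfg
  have h2 : ContinuousMap.evalCLM (M := E) ℝ (1 : unitInterval) (ψ p) = ψ p 1 := rfl
  have h3 : ψ p = g := this
  rw [h2, h3, hgv]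
  simp

end LocalFlow

/-! ### Integral curves and complete flows of vector fields on manifolds. -/

section Flow

variable {E : Type} [NormedAddCommGroup E] [NormedSpace ℝ E]
  {H : Type*} [TopologicalSpace H] {I : ModelWithCorners ℝ E H}
  {M : Type*} [TopologicalSpace M] [ChartedSpace H M]

lemma hasMFDerivAt_smulRight_iff {c : ℝ → E} {x : E} {t : ℝ} :
    HasMFDerivAt 𝓘(ℝ, ℝ) 𝓘(ℝ, E) c t ((1 : ℝ →L[ℝ] ℝ).smulRight x) ↔ HasDerivAt c x t := by
  have e : ContinuousLinearMap.toSpanSingleton ℝ x = (1 : ℝ →L[ℝ] ℝ).smulRight x :=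
    ContinuousLinearMap.ext_ring (by simp)
  refine hasMFDerivAt_iff_hasFDerivAt.trans ?_
  exact ⟨fun h => (e ▸ h : HasFDerivAt c (ContinuousLinearMap.toSpanSingleton ℝ x) t),
    fun h => e ▸ h.hasFDerivAt⟩

lemma clm_comp_smulRight_one {F : Type*} [NormedAddCommGroup F] [NormedSpace ℝ F]
    (T : E →L[ℝ] F) (x : E) :
    T.comp ((1 : ℝ →L[ℝ] ℝ).smulRight x) = (1 : ℝ →L[ℝ] ℝ).smulRight (T x) := by
  ext; simp

/-- A local parametrization `φ : U → V`, with inverse `ψ`, in which the vector field `v` is given by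
the smooth map `X`. -/
structure VectorFieldChart (v : (x : M) → TangentSpace I x) (x₀ : M) where
  φ : E → M
  ψ : M → E
  X : E → E
  U : Set E
  V : Set M
  isOpen_U : IsOpen U
  isOpen_V : IsOpen V
  mem_V : x₀ ∈ V
  mapsTo_φ : MapsTo φ U V
  mapsTo_ψ : MapsTo ψ V U
  left_inv : ∀ x ∈ V, φ (ψ x) = x
  right_inv : ∀ u ∈ U, ψ (φ u) = u
  contMDiffOn_φ : ContMDiffOn 𝓘(ℝ, E) I ∞ φ U
  contMDiffOn_ψ : ContMDiffOn I 𝓘(ℝ, E) ∞ ψ V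
  contDiffOn_X : ContDiffOn ℝ ∞ X U
  eq_mfderiv : ∀ u ∈ U, v (φ u) = mfderiv 𝓘(ℝ, E) I φ u (X u)

/-- `γ` has the velocity prescribed by `v` at time `t`. -/
def HasVelocityAt (v : (x : M) → TangentSpace I x) (γ : ℝ → M) (t : ℝ) : Prop :=
  HasMFDerivAt 𝓘(ℝ, ℝ) I γ t ((1 : ℝ →L[ℝ] ℝ).smulRight (v (γ t)))

variable {v : (x : M) → TangentSpace I x}

lemma HasVelocityAt.continuousAt {γ : ℝ → M} {t : ℝ} (h : HasVelocityAt v γ t) :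
    ContinuousAt γ t := HasMFDerivAt.continuousAt h

lemma HasVelocityAt.congr_of_eventuallyEq {γ γ' : ℝ → M} {t : ℝ} (h : HasVelocityAt v γ t)
    (e : γ' =ᶠ[𝓝 t] γ) : HasVelocityAt v γ' t := by
  unfold HasVelocityAt
  rw [e.eq_of_nhds]
  exact HasMFDerivAt.congr_of_eventuallyEq h e

lemma HasVelocityAt.comp_add {γ : ℝ → M} {t a : ℝ} (h : HasVelocityAt v γ (t + a)) :
    HasVelocityAt v (fun s => γ (s + a)) t := by
  have h1 : HasMFDerivAt 𝓘(ℝ, ℝ) 𝓘(ℝ, ℝ) (fun s : ℝ => s + a) t (.id ℝ ℝ) :=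
    ((hasFDerivAt_id t).add_const a).hasMFDerivAt
  have := HasMFDerivAt.comp t (f := fun s : ℝ => s + a) h h1
  exact this

namespace VectorFieldChart

variable {x₀ : M} (C : VectorFieldChart v x₀)
include C

lemma hasVelocityAt {c : ℝ → E} {t : ℝ} (hc : HasDerivAt c (C.X (c t)) t) (ht : c t ∈ C.U) :
    HasVelocityAt v (C.φ ∘ c) t := by
  have h1 : HasMFDerivAt 𝓘(ℝ, E) I C.φ (c t) (mfderiv 𝓘(ℝ, E) I C.φ (c t)) :=
    ((C.contMDiffOn_φ.contMDiffAt (C.isOpen_U.mem_nhds ht)).mdifferentiableAt (by simp)).hasMFDerivAt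
  have h2 := h1.comp t (hasMFDerivAt_smulRight_iff.2 hc)
  have e := clm_comp_smulRight_one (E := E) (F := E) (mfderiv 𝓘(ℝ, E) I C.φ (c t)) (C.X (c t))
  unfold HasVelocityAt
  rw [Function.comp_apply, C.eq_mfderiv _ ht]
  exact Eq.mp (congrArg (fun T => HasMFDerivAt 𝓘(ℝ, ℝ) I (C.φ ∘ c) t T) e) h2

lemma mfderiv_ψ_apply {x : M} (hx : x ∈ C.V) : mfderiv I 𝓘(ℝ, E) C.ψ x (v x) = C.X (C.ψ x) := by
  have hu := C.mapsTo_ψ hx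
  have h1 : HasMFDerivAt 𝓘(ℝ, E) I C.φ (C.ψ x) (mfderiv 𝓘(ℝ, E) I C.φ (C.ψ x)) :=
    ((C.contMDiffOn_φ.contMDiffAt (C.isOpen_U.mem_nhds hu)).mdifferentiableAt (by simp)).hasMFDerivAt
  have h2 : HasMFDerivAt I 𝓘(ℝ, E) C.ψ (C.φ (C.ψ x)) (mfderiv I 𝓘(ℝ, E) C.ψ (C.φ (C.ψ x))) := by
    rw [C.left_inv x hx]
    exact ((C.contMDiffOn_ψ.contMDiffAt (C.isOpen_V.mem_nhds hx)).mdifferentiableAt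
      (by simp)).hasMFDerivAt
  have h3 := h2.comp _ h1
  have h4 : HasMFDerivAt 𝓘(ℝ, E) 𝓘(ℝ, E) (C.ψ ∘ C.φ) (C.ψ x) (.id ℝ E) := by
    refine (hasMFDerivAt_id (C.ψ x)).congr_of_eventuallyEq ?_
    filter_upwards [C.isOpen_U.mem_nhds hu] with u hu using C.right_inv u hu
  have h5 := hasMFDerivAt_unique h3 h4
  have h6 := congrArg (fun T : E →L[ℝ] E => T (C.X (C.ψ x))) h5
  have h7 := C.eq_mfderiv _ hu
  have h8 : mfderiv I 𝓘(ℝ, E) C.ψ (C.φ (C.ψ x)) (v (C.φ (C.ψ x))) = C.X (C.ψ x) := by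
    rw [h7]; exact h6
  rw [C.left_inv x hx] at h8
  exact h8

lemma hasDerivAt_ψ_comp {γ : ℝ → M} {t : ℝ} (h : HasVelocityAt v γ t) (ht : γ t ∈ C.V) :
    HasDerivAt (C.ψ ∘ γ) (C.X (C.ψ (γ t))) t := by
  have h2 : HasMFDerivAt I 𝓘(ℝ, E) C.ψ (γ t) (mfderiv I 𝓘(ℝ, E) C.ψ (γ t)) :=
    ((C.contMDiffOn_ψ.contMDiffAt (C.isOpen_V.mem_nhds ht)).mdifferentiableAt
      (by simp)).hasMFDerivAt
  have e := clm_comp_smulRight_one (E := E) (F := E) (mfderiv I 𝓘(ℝ, E) C.ψ (γ t)) (v (γ t))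
  rw [← C.mfderiv_ψ_apply ht]
  exact hasMFDerivAt_smulRight_iff.1
    (Eq.mp (congrArg (fun T => HasMFDerivAt 𝓘(ℝ, ℝ) 𝓘(ℝ, E) (C.ψ ∘ γ) t T) e) (h2.comp t h))

lemma eventuallyEq_of_hasVelocityAt {γ γ' : ℝ → M} {t₀ : ℝ} (h0 : γ t₀ = x₀)
    (h : γ t₀ = γ' t₀) (hγ : ∀ᶠ t in 𝓝 t₀, HasVelocityAt v γ t)
    (hγ' : ∀ᶠ t in 𝓝 t₀, HasVelocityAt v γ' t) : γ =ᶠ[𝓝 t₀] γ' := by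
  have hu : C.ψ (γ t₀) ∈ C.U := C.mapsTo_ψ (h0 ▸ C.mem_V)
  obtain ⟨K, s, hs, hlip⟩ := ((C.contDiffOn_X.contDiffAt (C.isOpen_U.mem_nhds hu)).of_le
    (by simp : (1 : WithTop ℕ∞) ≤ ∞)).exists_lipschitzOnWith
  have hV : ∀ {g : ℝ → M}, g t₀ = x₀ → (∀ᶠ t in 𝓝 t₀, HasVelocityAt v g t) →
      ∀ᶠ t in 𝓝 t₀, g t ∈ C.V := fun {g} hg0 hg =>
    hg.self_of_nhds.continuousAt.eventually_mem (C.isOpen_V.mem_nhds (hg0 ▸ C.mem_V))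
  have hψ : ContinuousAt C.ψ x₀ :=
    (C.contMDiffOn_ψ.contMDiffAt (C.isOpen_V.mem_nhds C.mem_V)).continuousAt
  have key : ∀ {g : ℝ → M}, g t₀ = x₀ → (∀ᶠ t in 𝓝 t₀, HasVelocityAt v g t) →
      ∀ᶠ t in 𝓝 t₀, HasDerivAt (C.ψ ∘ g) (C.X ((C.ψ ∘ g) t)) t ∧ (C.ψ ∘ g) t ∈ s := by
    intro g hg0 hg
    have hc : ContinuousAt (C.ψ ∘ g) t₀ :=
      ContinuousAt.comp (by rw [hg0]; exact hψ) hg.self_of_nhds.continuousAt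
    have hs' : s ∈ 𝓝 ((C.ψ ∘ g) t₀) := by
      have : (C.ψ ∘ g) t₀ = C.ψ (γ t₀) := congrArg C.ψ (hg0.trans h0.symm)
      rw [this]; exact hs
    filter_upwards [hg, hV hg0 hg, hc.eventually_mem hs'] with t h1 h2 h3
    exact ⟨C.hasDerivAt_ψ_comp h1 h2, h3⟩
  have e := ODE_solution_unique_of_eventually (v := fun _ => C.X) (s := fun _ => s) (K := K)
    (Filter.Eventually.of_forall fun _ => hlip)
    (key h0 hγ) (key (h ▸ h0) hγ') (by simp [h])
  filter_upwards [e, hV h0 hγ, hV (h ▸ h0) hγ'] with t h1 h2 h3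
  rw [← C.left_inv _ h2, ← C.left_inv _ h3]
  exact congrArg C.φ h1

/-- `C.X` is smooth only on `C.U`, so the flow is taken for a global field with the same germ at
`C.ψ x₀`. Times and points are shrunk until orbits stay where both fields agree. Smoothness is
recorded for each finite `n`, at the single point `(0, x₀)`, where the implicit function theorem
provides it. -/
lemma exists_localFlow [FiniteDimensional ℝ E] :
    ∃ ε > 0, ∃ N ∈ 𝓝 x₀, ∃ Θ : ℝ × M → M,
      (∀ n : ℕ, ContMDiffAt (𝓘(ℝ, ℝ).prod I) I n Θ (0, x₀)) ∧
      ∀ x ∈ N, Θ (0, x) = x ∧ ∀ t ∈ Ioo (-ε) ε, HasVelocityAt v (fun t => Θ (t, x)) t ∧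
        Θ (t, x) ∈ C.V := by
  have : CompleteSpace E := FiniteDimensional.complete ℝ E
  have hu : C.ψ x₀ ∈ C.U := C.mapsTo_ψ C.mem_V
  obtain ⟨X, hX, hXe⟩ := exists_contDiff_eventuallyEq C.isOpen_U hu C.contDiffOn_X
  obtain ⟨ε, hε, Φ, hΦ, hΦf⟩ := exists_contDiffAt_localFlow hX (C.ψ x₀)
  have hΦ0 : Φ (0, C.ψ x₀) = C.ψ x₀ := (hΦf _ (Metric.mem_ball_self hε)).1
  have hev : ∀ᶠ p in 𝓝 ((0 : ℝ), C.ψ x₀), X (Φ p) = C.X (Φ p) ∧ Φ p ∈ C.U := by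
    have hc : ContinuousAt Φ (0, C.ψ x₀) := (hΦ 0).continuousAt
    have := hXe.and (C.isOpen_U.mem_nhds hu)
    rw [← hΦ0] at this
    exact hc.eventually this
  rw [nhds_prod_eq] at hev
  obtain ⟨pt, hpt, pu, hpu, hp⟩ := Filter.eventually_prod_iff.1 hev
  obtain ⟨δ, hδ, hδt⟩ := Metric.eventually_nhds_iff.1 hpt
  have hψ : ContinuousAt C.ψ x₀ :=
    (C.contMDiffOn_ψ.contMDiffAt (C.isOpen_V.mem_nhds C.mem_V)).continuousAt
  refine ⟨min ε δ, lt_min hε hδ, _, Filter.inter_mem (hψ.eventually_mem (Metric.ball_mem_nhds _ hε))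
    (Filter.inter_mem (hψ.eventually hpu) (C.isOpen_V.mem_nhds C.mem_V)),
    fun p => C.φ (Φ (p.1, C.ψ p.2)), fun n => ?_, fun x hx => ⟨?_, fun t ht => ?_⟩⟩
  · have h1 : ContMDiffAt 𝓘(ℝ, E) I n C.φ (Φ (0, C.ψ x₀)) := by
      rw [hΦ0]
      exact (C.contMDiffOn_φ.contMDiffAt (C.isOpen_U.mem_nhds hu)).of_le (by exact_mod_cast le_top)
    have h2 : ContMDiffAt I 𝓘(ℝ, E) n C.ψ x₀ :=
      (C.contMDiffOn_ψ.contMDiffAt (C.isOpen_V.mem_nhds C.mem_V)).of_le (by exact_mod_cast le_top)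
    have h3 : ContMDiffAt (𝓘(ℝ, ℝ).prod I) (𝓘(ℝ, ℝ × E)) n
        (fun p : ℝ × M => (p.1, C.ψ p.2)) (0, x₀) := by
      refine ContMDiffAt.prodMk_space contMDiffAt_fst ?_
      exact ContMDiffAt.comp (0, x₀) (g := C.ψ) (f := Prod.snd) h2 contMDiffAt_snd
    have h4 : ContMDiffAt (𝓘(ℝ, ℝ × E)) 𝓘(ℝ, E) n Φ (0, C.ψ x₀) := (hΦ n).contMDiffAt
    have h5 := ContMDiffAt.comp (0, x₀) (g := Φ) (f := fun p : ℝ × M => (p.1, C.ψ p.2)) h4 h3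
    exact ContMDiffAt.comp (0, x₀) (g := C.φ) (f := fun p : ℝ × M => Φ (p.1, C.ψ p.2)) h1 h5
  · simp only
    rw [(hΦf _ hx.1).1, C.left_inv _ hx.2.2]
  · have ht1 : t ∈ Ioo (-ε) ε :=
      ⟨lt_of_le_of_lt (neg_le_neg (min_le_left _ _)) ht.1, ht.2.trans_le (min_le_left _ _)⟩
    have ht2 : dist t 0 < δ := by
      rw [dist_zero_right, Real.norm_eq_abs, abs_lt]
      exact ⟨lt_of_le_of_lt (neg_le_neg (min_le_right _ _)) ht.1, ht.2.trans_le (min_le_right _ _)⟩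
    obtain ⟨h1, h2⟩ := hp (hδt ht2) hx.2.1
    refine ⟨C.hasVelocityAt (c := fun t => Φ (t, C.ψ x)) ?_ h2, C.mapsTo_φ h2⟩
    rw [← h1]
    exact (hΦf _ hx.1).2 t ht1

end VectorFieldChart

section Open

variable [T2Space M] {W : Set M} (hv : ∀ x ∈ W, Nonempty (VectorFieldChart v x))
include hv

/-- The coincidence set is open in `J` by local uniqueness and closed in `J` by the Hausdorff
property, and `J` is connected. -/
lemma eqOn_of_hasVelocityAt {J : Set ℝ} (hJ : IsOpen J) (hJc : IsPreconnected J) {γ γ' : ℝ → M}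
    (hγ : ∀ t ∈ J, HasVelocityAt v γ t) (hγ' : ∀ t ∈ J, HasVelocityAt v γ' t)
    (hW : ∀ t ∈ J, γ t ∈ W) {t₀ : ℝ} (ht₀ : t₀ ∈ J) (h : γ t₀ = γ' t₀) : EqOn γ γ' J := by
  set s := {t | γ t = γ' t} ∩ J with hs
  suffices hsub : J ⊆ s from fun t ht => (hsub ht).1
  refine hJc.subset_of_closure_inter_subset (u := s) ?_ ⟨t₀, ht₀, h, ht₀⟩ ?_
  · rw [isOpen_iff_mem_nhds]
    rintro t ⟨ht, htJ⟩
    obtain ⟨C⟩ := hv _ (hW t htJ)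
    have hn := hJ.mem_nhds htJ
    filter_upwards [C.eventuallyEq_of_hasVelocityAt rfl ht
      (Filter.eventually_of_mem hn hγ) (Filter.eventually_of_mem hn hγ'), hn] with u h1 h2
    exact ⟨h1, h2⟩
  · rintro t ⟨ht, htJ⟩
    refine ⟨?_, htJ⟩
    have hc : ContinuousAt (fun t => (γ t, γ' t)) t :=
      (hγ t htJ).continuousAt.prodMk (hγ' t htJ).continuousAt
    by_contra hne
    have : ∀ᶠ u in 𝓝 t, γ u ≠ γ' u :=
      hc.eventually_mem (isClosed_diagonal.isOpen_compl.mem_nhds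
        (show (γ t, γ' t) ∈ (diagonal M)ᶜ from hne))
    obtain ⟨u, hu1, hu2⟩ := mem_closure_iff_nhds.1 ht _ this
    exact hu1 hu2.1

omit [T2Space M] in
-- Having a common lifetime is inherited by subsets and by finite unions, so by compactness the
-- local flow around each point suffices.
lemma exists_uniform_time [FiniteDimensional ℝ E] (hW : IsOpen W) {K : Set M} (hK : IsCompact K)
    (hKW : K ⊆ W) : ∃ ε > 0, ∀ x ∈ K, ∃ γ : ℝ → M, γ 0 = x ∧
      ∀ t ∈ Ioo (-ε) ε, HasVelocityAt v γ t ∧ γ t ∈ W := by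
  refine hK.induction_on (p := fun S => ∃ ε > 0, ∀ x ∈ S, ∃ γ : ℝ → M, γ 0 = x ∧
      ∀ t ∈ Ioo (-ε) ε, HasVelocityAt v γ t ∧ γ t ∈ W) ⟨1, one_pos, by simp⟩ ?_ ?_ ?_
  · rintro S T hST ⟨ε, hε, h⟩
    exact ⟨ε, hε, fun x hx => h x (hST hx)⟩
  · rintro S T ⟨ε, hε, h⟩ ⟨δ, hδ, h'⟩
    have hl : ∀ a b : ℝ, Ioo (-(min a b)) (min a b) ⊆ Ioo (-a) a := fun a b t ht =>
      ⟨lt_of_le_of_lt (neg_le_neg (min_le_left _ _)) ht.1, ht.2.trans_le (min_le_left _ _)⟩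
    have hr : ∀ a b : ℝ, Ioo (-(min a b)) (min a b) ⊆ Ioo (-b) b := fun a b t ht =>
      ⟨lt_of_le_of_lt (neg_le_neg (min_le_right _ _)) ht.1, ht.2.trans_le (min_le_right _ _)⟩
    refine ⟨min ε δ, lt_min hε hδ, fun x hx => ?_⟩
    rcases hx with hx | hx
    · obtain ⟨γ, h0, hγ⟩ := h x hx
      exact ⟨γ, h0, fun t ht => hγ t (hl _ _ ht)⟩
    · obtain ⟨γ, h0, hγ⟩ := h' x hx
      exact ⟨γ, h0, fun t ht => hγ t (hr _ _ ht)⟩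
  · intro x hx
    obtain ⟨C⟩ := hv x (hKW hx)
    obtain ⟨ε, hε, N, hN, Θ, hΘ, hΘf⟩ := C.exists_localFlow
    have hx0 := (hΘf x (mem_of_mem_nhds hN)).1
    have hcW : ∀ᶠ p in 𝓝 ((0 : ℝ), x), Θ p ∈ W :=
      (hΘ 0).continuousAt.eventually_mem (by rw [hx0]; exact hW.mem_nhds (hKW hx))
    rw [nhds_prod_eq] at hcW
    obtain ⟨pt, hpt, px, hpx, hp⟩ := Filter.eventually_prod_iff.1 hcW
    obtain ⟨δ, hδ, hδt⟩ := Metric.eventually_nhds_iff.1 hpt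
    refine ⟨N ∩ {y | px y}, mem_nhdsWithin_of_mem_nhds (Filter.inter_mem hN hpx),
      min ε δ, lt_min hε hδ, fun y hy => ⟨fun t => Θ (t, y), (hΘf y hy.1).1, fun t ht => ?_⟩⟩
    refine ⟨((hΘf y hy.1).2 t ⟨lt_of_le_of_lt (neg_le_neg (min_le_left _ _)) ht.1,
      ht.2.trans_le (min_le_left _ _)⟩).1, hp (hδt ?_) hy.2⟩
    rw [dist_zero_right, Real.norm_eq_abs, abs_lt]
    exact ⟨lt_of_le_of_lt (neg_le_neg (min_le_right _ _)) ht.1, ht.2.trans_le (min_le_right _ _)⟩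

/-- The curve through `x` is continued by the curves of lifetime `a` issued from its positions at
times `a / 2` and `-a / 2`; uniqueness makes the three agree on the overlaps. -/
lemma exists_time_extension {a : ℝ} (ha : 0 < a)
    (h : ∀ x ∈ W, ∃ γ : ℝ → M, γ 0 = x ∧ ∀ t ∈ Ioo (-a) a, HasVelocityAt v γ t ∧ γ t ∈ W) :
    ∀ x ∈ W, ∃ γ : ℝ → M, γ 0 = x ∧
      ∀ t ∈ Ioo (-(3 / 2 * a)) (3 / 2 * a), HasVelocityAt v γ t ∧ γ t ∈ W := by
  intro x hx
  obtain ⟨γ₁, h10, h1⟩ := h x hx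
  obtain ⟨γ₂, h20, h2⟩ := h (γ₁ (a / 2)) (h1 _ ⟨by linarith, by linarith⟩).2
  obtain ⟨γ₃, h30, h3⟩ := h (γ₁ (-(a / 2))) (h1 _ ⟨by linarith, by linarith⟩).2
  have e2 : EqOn γ₁ (fun t => γ₂ (t + -(a / 2))) (Ioo (-(a / 2)) a) := by
    refine eqOn_of_hasVelocityAt hv isOpen_Ioo isPreconnected_Ioo (t₀ := a / 2)
      (fun t ht => (h1 t ⟨by linarith [ht.1], ht.2⟩).1)
      (fun t ht => (h2 _ ⟨by linarith [ht.1], by linarith [ht.2]⟩).1.comp_add)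
      (fun t ht => (h1 t ⟨by linarith [ht.1], ht.2⟩).2)
      ⟨by linarith, by linarith⟩ (by simp [h20])
  have e3 : EqOn γ₁ (fun t => γ₃ (t + a / 2)) (Ioo (-a) (a / 2)) := by
    refine eqOn_of_hasVelocityAt hv isOpen_Ioo isPreconnected_Ioo (t₀ := -(a / 2))
      (fun t ht => (h1 t ⟨ht.1, by linarith [ht.2]⟩).1)
      (fun t ht => (h3 _ ⟨by linarith [ht.1], by linarith [ht.2]⟩).1.comp_add)
      (fun t ht => (h1 t ⟨ht.1, by linarith [ht.2]⟩).2)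
      ⟨by linarith, by linarith⟩ (by simp [h30])
  let γ : ℝ → M := fun t => if t ≤ 0 then γ₃ (t + a / 2) else γ₂ (t + -(a / 2))
  have hγ3 : EqOn γ (fun t => γ₃ (t + a / 2)) (Ioo (-(3 / 2 * a)) (a / 2)) := by
    intro t ht
    by_cases ht0 : t ≤ 0
    · simp [γ, ht0]
    · simp only [γ, ht0, if_false]
      exact (e2 ⟨by linarith, by linarith [ht.2]⟩).symm.trans (e3 ⟨by linarith, ht.2⟩)
  have hγ2 : EqOn γ (fun t => γ₂ (t + -(a / 2))) (Ioo (-(a / 2)) (3 / 2 * a)) := by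
    intro t ht
    by_cases ht0 : t ≤ 0
    · simp only [γ, ht0, if_true]
      exact (e3 ⟨by linarith [ht.1], by linarith⟩).symm.trans (e2 ⟨ht.1, by linarith⟩)
    · simp [γ, ht0]
  refine ⟨γ, ?_, fun t ht => ?_⟩
  · rw [hγ3 ⟨by linarith, by linarith⟩]
    exact (e3 ⟨by linarith, by linarith⟩).symm.trans h10
  · rcases lt_or_ge t (a / 2) with hlt | hge
    · have hm : t ∈ Ioo (-(3 / 2 * a)) (a / 2) := ⟨ht.1, hlt⟩
      have hb := h3 (t + a / 2) ⟨by linarith [ht.1], by linarith⟩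
      refine ⟨hb.1.comp_add.congr_of_eventuallyEq (hγ3.eventuallyEq_of_mem
        (isOpen_Ioo.mem_nhds hm)), ?_⟩
      rw [hγ3 hm]; exact hb.2
    · have hm : t ∈ Ioo (-(a / 2)) (3 / 2 * a) := ⟨by linarith, ht.2⟩
      have hb := h2 (t + -(a / 2)) ⟨by linarith, by linarith [ht.2]⟩
      refine ⟨hb.1.comp_add.congr_of_eventuallyEq (hγ2.eventuallyEq_of_mem
        (isOpen_Ioo.mem_nhds hm)), ?_⟩
      rw [hγ2 hm]; exact hb.2

/-- Iterating the extension multiplies the lifetime by `3 / 2` each time. The curves obtained at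
different stages agree by uniqueness and patch to one defined for all times. -/
lemma exists_global_of_uniform_time {ε : ℝ} (hε : 0 < ε)
    (h : ∀ x ∈ W, ∃ γ : ℝ → M, γ 0 = x ∧ ∀ t ∈ Ioo (-ε) ε, HasVelocityAt v γ t ∧ γ t ∈ W) :
    ∀ x ∈ W, ∃ γ : ℝ → M, γ 0 = x ∧ ∀ t, HasVelocityAt v γ t ∧ γ t ∈ W := by
  have hk : ∀ k : ℕ, ∀ x ∈ W, ∃ γ : ℝ → M, γ 0 = x ∧
      ∀ t ∈ Ioo (-((3 / 2) ^ k * ε)) ((3 / 2) ^ k * ε), HasVelocityAt v γ t ∧ γ t ∈ W := by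
    intro k
    induction k with
    | zero => simpa using h
    | succ k ih =>
      have := exists_time_extension hv (a := (3 / 2) ^ k * ε) (by positivity) ih
      simpa only [pow_succ', mul_assoc] using this
  intro x hx
  choose γ h0 hγ using fun k => hk k x hx
  have hmono : ∀ {k l : ℕ}, k ≤ l → (3 / 2 : ℝ) ^ k * ε ≤ (3 / 2) ^ l * ε := fun hkl =>
    mul_le_mul_of_nonneg_right (pow_le_pow_right₀ (by norm_num) hkl) hε.le
  have heq : ∀ k l : ℕ, k ≤ l →
      EqOn (γ k) (γ l) (Ioo (-((3 / 2) ^ k * ε)) ((3 / 2) ^ k * ε)) := by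
    intro k l hkl
    have hp : (0 : ℝ) < (3 / 2) ^ k * ε := by positivity
    refine eqOn_of_hasVelocityAt hv isOpen_Ioo isPreconnected_Ioo (t₀ := 0)
      (fun t ht => (hγ k t ht).1) (fun t ht => (hγ l t ?_).1) (fun t ht => (hγ k t ht).2)
      ⟨by linarith, hp⟩ (by rw [h0, h0])
    have := hmono hkl
    exact ⟨by linarith [ht.1], by linarith [ht.2]⟩
  have hex : ∀ t : ℝ, ∃ k : ℕ, |t| < (3 / 2) ^ k * ε := by
    intro t
    obtain ⟨k, hk⟩ := pow_unbounded_of_one_lt (|t| / ε) (by norm_num : (1 : ℝ) < 3 / 2)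
    exact ⟨k, by rwa [div_lt_iff₀ hε] at hk⟩
  choose κ hκ using hex
  have key : ∀ k, EqOn (fun t => γ (κ t) t) (γ k) (Ioo (-((3 / 2) ^ k * ε)) ((3 / 2) ^ k * ε)) := by
    intro k t ht
    rcases le_total k (κ t) with hle | hle
    · exact (heq _ _ hle ht).symm
    · exact heq _ _ hle (abs_lt.1 (hκ t))
  refine ⟨fun t => γ (κ t) t, h0 _, fun t => ?_⟩
  have hm := abs_lt.1 (hκ t)
  have hb := hγ (κ t) t hm
  exact ⟨hb.1.congr_of_eventuallyEq ((key (κ t)).eventuallyEq_of_mem (isOpen_Ioo.mem_nhds hm)), hb.2⟩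

end Open

/-- `Θ` is a complete flow of the vector field `v` on the set `W`. -/
structure IsCompleteFlow (v : (x : M) → TangentSpace I x) (W : Set M) (Θ : ℝ → M → M) : Prop where
  zero : ∀ x ∈ W, Θ 0 x = x
  hasVelocityAt : ∀ x ∈ W, ∀ t, HasVelocityAt v (fun t => Θ t x) t
  mem : ∀ x ∈ W, ∀ t, Θ t x ∈ W

lemma exists_isCompleteFlow [T2Space M] {W : Set M}
    (hv : ∀ x ∈ W, Nonempty (VectorFieldChart v x)) {ε : ℝ} (hε : 0 < ε)
    (h : ∀ x ∈ W, ∃ γ : ℝ → M, γ 0 = x ∧ ∀ t ∈ Ioo (-ε) ε, HasVelocityAt v γ t ∧ γ t ∈ W) :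
    ∃ Θ : ℝ → M → M, IsCompleteFlow v W Θ := by
  classical
  choose! γ h0 hγ using exists_global_of_uniform_time hv hε h
  exact ⟨fun t x => γ x t, h0, fun x hx t => (hγ x hx t).1, fun x hx t => (hγ x hx t).2⟩

namespace IsCompleteFlow

variable [T2Space M] {W : Set M} (hv : ∀ x ∈ W, Nonempty (VectorFieldChart v x)) {Θ : ℝ → M → M}
  (hΘ : IsCompleteFlow v W Θ)
include hv hΘ

lemma eq_of_hasVelocityAt {γ : ℝ → M} {J : Set ℝ} (hJ : IsOpen J) (hJc : IsPreconnected J)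
    (h0 : (0 : ℝ) ∈ J) (hγ : ∀ t ∈ J, HasVelocityAt v γ t) (hW : γ 0 ∈ W) {t : ℝ} (ht : t ∈ J) :
    γ t = Θ t (γ 0) :=
  (eqOn_of_hasVelocityAt hv hJ hJc (γ := fun t => Θ t (γ 0))
    (fun t _ => hΘ.hasVelocityAt _ hW t) hγ (fun t _ => hΘ.mem _ hW t) h0
    (hΘ.zero _ hW) ht).symm

lemma add {x : M} (hx : x ∈ W) (s t : ℝ) : Θ (s + t) x = Θ s (Θ t x) := by
  have := hΘ.eq_of_hasVelocityAt hv (γ := fun s => Θ (s + t) x) isOpen_univ isPreconnected_univ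
    (mem_univ _) (fun s _ => (hΘ.hasVelocityAt x hx (s + t)).comp_add)
    (by simpa using hΘ.mem x hx t) (mem_univ s)
  simpa using this

lemma contMDiffAt_zero [FiniteDimensional ℝ E] (hW : IsOpen W) {x : M} (hx : x ∈ W) (n : ℕ) :
    ContMDiffAt (𝓘(ℝ, ℝ).prod I) I n (fun q : ℝ × M => Θ q.1 q.2) (0, x) := by
  obtain ⟨C⟩ := hv x hx
  obtain ⟨ε, hε, N, hN, Φ, hΦ, hΦf⟩ := C.exists_localFlow
  refine (hΦ n).congr_of_eventuallyEq ?_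
  filter_upwards [prod_mem_nhds (Ioo_mem_nhds (neg_lt_zero.2 hε) hε)
    (Filter.inter_mem hN (hW.mem_nhds hx))] with q hq
  have h0 := (hΦf q.2 hq.2.1).1
  have := hΘ.eq_of_hasVelocityAt hv (γ := fun t => Φ (t, q.2)) isOpen_Ioo isPreconnected_Ioo
    ⟨neg_lt_zero.2 hε, hε⟩ (fun t ht => ((hΦf q.2 hq.2.1).2 t ht).1)
    (by rw [h0]; exact hq.2.2) hq.1
  rw [h0] at this
  exact this.symm

/-- For finite `n`, being `C^n` at a point is an open condition, which makes the set `S` of good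
times open. It contains `0` and the real line is connected, so it is enough that `S` be closed; the
finite orders together give smoothness. -/
theorem contMDiffAt [FiniteDimensional ℝ E] [IsManifold I ∞ M] (hW : IsOpen W) {x : M}
    (hx : x ∈ W) (t : ℝ) :
    ContMDiffAt (𝓘(ℝ, ℝ).prod I) I ∞ (fun q : ℝ × M => Θ q.1 q.2) (t, x) := by
  refine contMDiffAt_infty.2 fun n => ?_
  have : IsManifold I n M := IsManifold.of_le (n := ∞) (by exact_mod_cast le_top)
  let Q : ℝ × M → Prop := fun q =>
    ContMDiffAt (𝓘(ℝ, ℝ).prod I) I n (fun q : ℝ × M => Θ q.1 q.2) q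
  have hQ : ∀ q, Q q → ∀ᶠ q' in 𝓝 q, Q q' := fun q hq =>
    (contMDiffAt_iff_contMDiffAt_nhds (by simp)).1 hq
  let S : Set ℝ := {t | Q (t, x)}
  have hopen : IsOpen S := by
    rw [isOpen_iff_mem_nhds]
    intro t ht
    exact (Continuous.prodMk_left x).continuousAt.eventually (hQ _ ht)
  -- For `s` in `S` close to `t`, `Θ_t = Θ_(t - s) ∘ Θ_s`. The point `(t - s, Θ_s x)` is close to
  -- `(0, Θ_t x)`, where the flow is `C^n` by the short time result.
  have hclosed : IsClosed S := by
    refine isClosed_of_closure_subset fun t ht => ?_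
    have hz := hΘ.mem x hx t
    have h0 := hQ _ (hΘ.contMDiffAt_zero hv hW hz n)
    have hcont : ContinuousAt (fun s => (t - s, Θ s x)) t :=
      ContinuousAt.prodMk (by fun_prop) (hΘ.hasVelocityAt x hx t).continuousAt
    have h1 : ∀ᶠ s in 𝓝 t, Q (t - s, Θ s x) :=
      hcont.eventually (by simpa using h0)
    obtain ⟨s, hs1, hs2⟩ := mem_closure_iff_nhds.1 ht _ h1
    have h2 : ContMDiffAt (𝓘(ℝ, ℝ).prod I) (𝓘(ℝ, ℝ).prod I) n
        (fun q : ℝ × M => (q.1 - s, Θ s q.2)) (t, x) := by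
      refine ContMDiffAt.prodMk ?_ ?_
      · have : ContMDiffAt 𝓘(ℝ, ℝ) 𝓘(ℝ, ℝ) n (fun r : ℝ => r - s) t :=
          (contDiffAt_id.sub contDiffAt_const).contMDiffAt
        exact ContMDiffAt.comp (t, x) (g := fun r : ℝ => r - s) (f := Prod.fst) this contMDiffAt_fst
      · exact ContMDiffAt.comp (t, x) (g := fun q : ℝ × M => Θ q.1 q.2)
          (f := fun q : ℝ × M => (s, q.2)) hs2 (contMDiffAt_const.prodMk contMDiffAt_snd)
    have h3 := ContMDiffAt.comp (t, x) (g := fun q : ℝ × M => Θ q.1 q.2)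
      (f := fun q : ℝ × M => (q.1 - s, Θ s q.2)) hs1 h2
    refine h3.congr_of_eventuallyEq ?_
    have : ∀ᶠ q : ℝ × M in 𝓝 (t, x), q.2 ∈ W := continuousAt_snd.eventually_mem (hW.mem_nhds hx)
    filter_upwards [this] with q hq
    simp only [Function.comp_apply]
    rw [← hΘ.add hv hq, sub_add_cancel]
  have huniv : S = univ := IsClopen.eq_univ ⟨hclosed, hopen⟩ ⟨0, hΘ.contMDiffAt_zero hv hW hx n⟩
  exact (huniv ▸ mem_univ t : t ∈ S)

end IsCompleteFlow

end Flow

/-! ### Exterior derivatives and pullbacks of one-forms. -/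

section ExteriorDerivative

variable {V : Type*} [NormedAddCommGroup V] [NormedSpace ℝ V]
  {E : Type*} [NormedAddCommGroup E] [NormedSpace ℝ E]

/-- The exterior derivative of a `1`-form on a normed space. -/
def formD (b : V → V →L[ℝ] ℝ) (x u w : V) : ℝ := fderiv ℝ b x u w - fderiv ℝ b x w u

lemma formD_congr {b b' : V → V →L[ℝ] ℝ} {x : V} (h : b =ᶠ[𝓝 x] b') (u w : V) :
    formD b x u w = formD b' x u w := by
  simp only [formD, h.fderiv_eq]

lemma contDiffAt_pull {a : E → E →L[ℝ] ℝ} {ψ : V → E} {x : V} (hψ : ContDiffAt ℝ ∞ ψ x)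
    (ha : ContDiffAt ℝ ∞ a (ψ x)) :
    ContDiffAt ℝ ∞ (fun v => (a (ψ v)).comp (fderiv ℝ ψ v)) x :=
  (ha.comp x hψ).clm_comp (hψ.fderiv_right (m := ∞) le_rfl)

/-- The terms containing the second derivative of `ψ` cancel by its symmetry. -/
lemma formD_pull {a : E → E →L[ℝ] ℝ} {ψ : V → E} {x : V} (hψ : ContDiffAt ℝ ∞ ψ x)
    (ha : ContDiffAt ℝ ∞ a (ψ x)) (u w : V) :
    formD (fun v => (a (ψ v)).comp (fderiv ℝ ψ v)) x u w =
      formD a (ψ x) (fderiv ℝ ψ x u) (fderiv ℝ ψ x w) := by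
  have h1 : HasFDerivAt (fun v => a (ψ v)) ((fderiv ℝ a (ψ x)).comp (fderiv ℝ ψ x)) x :=
    (ha.differentiableAt (by simp)).hasFDerivAt.comp x (hψ.differentiableAt (by simp)).hasFDerivAt
  have h2 : HasFDerivAt (fun v => fderiv ℝ ψ v) (fderiv ℝ (fderiv ℝ ψ) x) x :=
    ((hψ.fderiv_right (m := ∞) le_rfl).differentiableAt (by simp)).hasFDerivAt
  have h3 := (h1.clm_comp h2).fderiv
  have hsymm : fderiv ℝ (fderiv ℝ ψ) x u w = fderiv ℝ (fderiv ℝ ψ) x w u :=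
    (hψ.isSymmSndFDerivAt (by rw [minSmoothness_of_isRCLikeNormedField]; exact WithTop.coe_le_coe.2 le_top)).eq u w
  simp only [formD, h3]
  simp [hsymm]

end ExteriorDerivative

namespace OneForm

variable {E : Type*} [NormedAddCommGroup E] [NormedSpace ℝ E]
  {M : Type*} [TopologicalSpace M] [ChartedSpace E M]
  {V : Type*} [NormedAddCommGroup V] [NormedSpace ℝ V]

/-- The pullback of a `1`-form on a manifold to a normed space. -/
def pull (β : OneForm E M) (φ : V → M) : V → V →L[ℝ] ℝ := fun x =>
  (β (φ x)).comp (mfderiv 𝓘(ℝ, V) 𝓘(ℝ, E) φ x)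

/-- A `1`-form is smooth at `x`, in the preferred chart. -/
def SmoothAt (β : OneForm E M) (x : M) : Prop :=
  ContDiffAt ℝ ∞ (β.inChart x) (extChartAt 𝓘(ℝ, E) x x)

variable [IsManifold 𝓘(ℝ, E) ∞ M]

lemma isManifold_one : IsManifold 𝓘(ℝ, E) 1 M := IsManifold.of_le (n := ∞) (by simp)

lemma contDiffAt_extChartAt_comp {φ : V → M} {x : V} {y : M}
    (hφ : ContMDiffAt 𝓘(ℝ, V) 𝓘(ℝ, E) ∞ φ x) (hy : φ x ∈ (chartAt E y).source) :
    ContDiffAt ℝ ∞ (fun v => extChartAt 𝓘(ℝ, E) y (φ v)) x :=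
  ((contMDiffAt_extChartAt' hy).comp x hφ).contDiffAt

/-- Chain rule through the chart at `y`. It reduces pullbacks from a manifold to pullbacks between
normed spaces, and the chart may be centred at a fixed point while `v` varies. -/
lemma pull_eventuallyEq {β : OneForm E M} {φ : V → M} {x : V} {y : M}
    (hφ : ContMDiffAt 𝓘(ℝ, V) 𝓘(ℝ, E) ∞ φ x) (hy : φ x ∈ (chartAt E y).source) :
    β.pull φ =ᶠ[𝓝 x] fun v => (β.inChart y (extChartAt 𝓘(ℝ, E) y (φ v))).comp
      (fderiv ℝ (fun v => extChartAt 𝓘(ℝ, E) y (φ v)) v) := by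
  have := isManifold_one (E := E) (M := M)
  have h1 : ∀ᶠ v in 𝓝 x, ContMDiffAt 𝓘(ℝ, V) 𝓘(ℝ, E) 1 φ v :=
    (contMDiffAt_iff_contMDiffAt_nhds (by simp)).1 (hφ.of_le (by simp))
  have h2 : ∀ᶠ v in 𝓝 x, φ v ∈ (chartAt E y).source :=
    hφ.continuousAt.eventually_mem ((chartAt E y).open_source.mem_nhds hy)
  filter_upwards [h1, h2.eventually_nhds] with v hv hsn
  have hs := hsn.self_of_nhds
  set e := extChartAt 𝓘(ℝ, E) y with he
  have hse : φ v ∈ e.source := by rw [he, extChartAt_source]; exact hs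
  have ht : e (φ v) ∈ e.target := e.map_source hse
  have hφv : MDifferentiableAt 𝓘(ℝ, V) 𝓘(ℝ, E) φ v := hv.mdifferentiableAt (by simp)
  have d1 : HasMFDerivAt 𝓘(ℝ, V) 𝓘(ℝ, E) (fun v => e (φ v)) v
      (fderiv ℝ (fun v => e (φ v)) v) := by
    have h : MDifferentiableAt 𝓘(ℝ, V) 𝓘(ℝ, E) (fun v => e (φ v)) v :=
      MDifferentiableAt.comp v (g := e) (mdifferentiableAt_extChartAt hs) hφv
    exact h.differentiableAt.hasFDerivAt.hasMFDerivAt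
  have d2 : HasMFDerivAt 𝓘(ℝ, E) 𝓘(ℝ, E) e.symm (e (φ v))
      (mfderiv 𝓘(ℝ, E) 𝓘(ℝ, E) e.symm (e (φ v))) := by
    have := mdifferentiableWithinAt_extChartAt_symm (I := 𝓘(ℝ, E)) ht
    rw [ModelWithCorners.range_eq_univ, mdifferentiableWithinAt_univ] at this
    exact this.hasMFDerivAt
  have d3 := HasMFDerivAt.comp v (g := e.symm) d2 d1
  have d4 : HasMFDerivAt 𝓘(ℝ, V) 𝓘(ℝ, E) (e.symm ∘ fun v => e (φ v)) v
      (mfderiv 𝓘(ℝ, V) 𝓘(ℝ, E) φ v) := by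
    refine hφv.hasMFDerivAt.congr_of_eventuallyEq ?_
    filter_upwards [hsn] with v' hv'
    exact e.left_inv (by rw [he, extChartAt_source]; exact hv')
  have d5 := hasMFDerivAt_unique d4 d3
  have hleft : e.symm (e (φ v)) = φ v := e.left_inv hse
  ext u
  have d6 : mfderiv 𝓘(ℝ, V) 𝓘(ℝ, E) φ v u =
      mfderiv 𝓘(ℝ, E) 𝓘(ℝ, E) e.symm (e (φ v)) (fderiv ℝ (fun v => e (φ v)) v u) :=
    congrArg (fun T : V →L[ℝ] E => T u) d5
  change β (φ v) (mfderiv 𝓘(ℝ, V) 𝓘(ℝ, E) φ v u) = β (e.symm (e (φ v)))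
    (mfderiv 𝓘(ℝ, E) 𝓘(ℝ, E) e.symm (e (φ v)) (fderiv ℝ (fun v => e (φ v)) v u))
  have hβ : ∀ (z : M) (hz : z = φ v) (w : E), β z w = β (φ v) w := by
    rintro z rfl w; rfl
  exact (congrArg (β (φ v)) d6).trans (hβ _ hleft _).symm

lemma SmoothAt.contDiffAt_pull {β : OneForm E M} {φ : V → M} {x : V} (hβ : β.SmoothAt (φ x))
    (hφ : ContMDiffAt 𝓘(ℝ, V) 𝓘(ℝ, E) ∞ φ x) : ContDiffAt ℝ ∞ (β.pull φ) x :=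
  (_root_.contDiffAt_pull (contDiffAt_extChartAt_comp hφ (mem_chart_source E (φ x)))
    hβ).congr_of_eventuallyEq (pull_eventuallyEq hφ (mem_chart_source E (φ x)))

/-- Naturality of the exterior derivative. As `φ` may be any parametrization, `d` can be computed in
whichever coordinates are convenient, although it is defined through the preferred chart. -/
lemma SmoothAt.formD_pull {β : OneForm E M} {φ : V → M} {x : V} (hβ : β.SmoothAt (φ x))
    (hφ : ContMDiffAt 𝓘(ℝ, V) 𝓘(ℝ, E) ∞ φ x) (u w : V) :
    formD (β.pull φ) x u w =
      β.d (φ x) (mfderiv 𝓘(ℝ, V) 𝓘(ℝ, E) φ x u) (mfderiv 𝓘(ℝ, V) 𝓘(ℝ, E) φ x w) := by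
  have := isManifold_one (E := E) (M := M)
  rw [formD_congr (pull_eventuallyEq hφ (mem_chart_source E (φ x))),
    _root_.formD_pull (contDiffAt_extChartAt_comp hφ (mem_chart_source E (φ x))) hβ]
  have d1 : HasMFDerivAt 𝓘(ℝ, V) 𝓘(ℝ, E) (fun v => extChartAt 𝓘(ℝ, E) (φ x) (φ v)) x
      (fderiv ℝ (fun v => extChartAt 𝓘(ℝ, E) (φ x) (φ v)) x) :=
    ((contDiffAt_extChartAt_comp hφ (mem_chart_source E (φ x))).differentiableAt
      (by simp)).hasFDerivAt.hasMFDerivAt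
  have d2 := HasMFDerivAt.comp x (g := extChartAt 𝓘(ℝ, E) (φ x))
    (mdifferentiableAt_extChartAt (mem_chart_source E (φ x))).hasMFDerivAt
    (hφ.mdifferentiableAt (by simp)).hasMFDerivAt
  have d3 := hasMFDerivAt_unique d1 d2
  have d4 : ∀ u : V, fderiv ℝ (fun v => extChartAt 𝓘(ℝ, E) (φ x) (φ v)) x u =
      mfderiv 𝓘(ℝ, E) 𝓘(ℝ, E) (extChartAt 𝓘(ℝ, E) (φ x)) (φ x)
        (mfderiv 𝓘(ℝ, V) 𝓘(ℝ, E) φ x u) := fun u => congrArg (fun T : V →L[ℝ] E => T u) d3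
  rw [d4, d4]
  rfl

/-- In the trivialization of the cotangent bundle induced by the chart at `x₀`, the coordinates of
the section are `β.inChart x₀` composed with the chart. Smoothness of forms thus becomes smoothness
of maps `E → E*`. -/
lemma contMDiffAt_section_iff (β : OneForm E M) (x₀ : M) :
    haveI : IsManifold 𝓘(ℝ, E) 1 M := isManifold_one
    ContMDiffAt 𝓘(ℝ, E) (𝓘(ℝ, E).prod 𝓘(ℝ, E →L[ℝ] ℝ)) ∞
      (fun x => Bundle.TotalSpace.mk' (E →L[ℝ] ℝ)
        (E := fun x : M => TangentSpace 𝓘(ℝ, E) x →L[ℝ] ℝ) x (β x)) x₀ ↔ β.SmoothAt x₀ := by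
  have := isManifold_one (E := E) (M := M)
  have h1 := contMDiffAt_hom_bundle (𝕜 := ℝ) (n := ∞) (B := M) (M := M) (F₁ := E)
    (E₁ := fun x : M => TangentSpace 𝓘(ℝ, E) x) (F₂ := ℝ) (E₂ := Bundle.Trivial M ℝ)
    (IB := 𝓘(ℝ, E)) (IM := 𝓘(ℝ, E))
    (fun x : M => Bundle.TotalSpace.mk' (E →L[ℝ] ℝ)
        (E := fun x : M => TangentSpace 𝓘(ℝ, E) x →L[ℝ] ℝ) x (β x)) (x₀ := x₀)
  refine h1.trans ?_
  have hid : ContMDiffAt 𝓘(ℝ, E) 𝓘(ℝ, E) ∞ (fun x : M => x) x₀ := contMDiffAt_id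
  have e : (fun x : M => ContinuousLinearMap.inCoordinates E (fun x : M => TangentSpace 𝓘(ℝ, E) x) ℝ
      (Bundle.Trivial M ℝ) x₀ x x₀ x (β x)) =ᶠ[𝓝 x₀]
      fun x => β.inChart x₀ (extChartAt 𝓘(ℝ, E) x₀ x) := by
    filter_upwards [(chartAt E x₀).open_source.mem_nhds (mem_chart_source E x₀)] with x hx
    have hleft : (extChartAt 𝓘(ℝ, E) x₀).symm (extChartAt 𝓘(ℝ, E) x₀ x) = x :=
      (extChartAt 𝓘(ℝ, E) x₀).left_inv (by rw [extChartAt_source]; exact hx)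
    have h2 := TangentBundle.symmL_trivializationAt (𝕜 := ℝ) (I := 𝓘(ℝ, E)) hx
    rw [ModelWithCorners.range_eq_univ, mfderivWithin_univ] at h2
    have hβ : ∀ (z : M) (hz : z = x) (w : E), β z w = β x w := by
      rintro z rfl w; rfl
    refine ContinuousLinearMap.ext fun w => ?_
    refine Eq.trans ?_ (hβ _ hleft _).symm
    have h3 : (trivializationAt ℝ (Bundle.Trivial M ℝ) x₀).continuousLinearMapAt ℝ x =
        ContinuousLinearMap.id ℝ ℝ := Bundle.Trivial.continuousLinearMapAt_trivialization ℝ M ℝ x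
    have h4 := congrArg (fun T : ℝ →L[ℝ] ℝ => T (β x
      ((trivializationAt E (TangentSpace 𝓘(ℝ, E)) x₀).symmL ℝ x w))) h3
    refine Eq.trans h4 ?_
    exact congrArg (fun T : E →L[ℝ] E => β x (T w)) h2
  constructor
  · rintro ⟨-, h⟩
    have h' : ContMDiffAt 𝓘(ℝ, E) 𝓘(ℝ, E →L[ℝ] ℝ) ∞
        (fun x => β.inChart x₀ (extChartAt 𝓘(ℝ, E) x₀ x)) x₀ := h.congr_of_eventuallyEq e.symm
    set c := extChartAt 𝓘(ℝ, E) x₀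
    have hs : ContMDiffAt 𝓘(ℝ, E) 𝓘(ℝ, E) ∞ c.symm (c x₀) := by
      have := contMDiffOn_extChartAt_symm (I := 𝓘(ℝ, E)) (n := ∞) x₀
      exact this.contMDiffAt (extChartAt_target_mem_nhds x₀)
    have hx : c.symm (c x₀) = x₀ := c.left_inv (mem_extChartAt_source x₀)
    have h2 : ContMDiffAt 𝓘(ℝ, E) 𝓘(ℝ, E →L[ℝ] ℝ) ∞ (fun y => β.inChart x₀ (c (c.symm y))) (c x₀) := by
      refine ContMDiffAt.comp (c x₀) (g := fun x => β.inChart x₀ (c x)) (f := c.symm) ?_ hs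
      rw [hx]; exact h'
    refine h2.contDiffAt.congr_of_eventuallyEq ?_
    filter_upwards [extChartAt_target_mem_nhds (I := 𝓘(ℝ, E)) x₀] with y hy
    exact congrArg (β.inChart x₀) (c.right_inv hy).symm
  · intro h
    refine ⟨hid, ?_⟩
    have h' : ContMDiffAt 𝓘(ℝ, E) 𝓘(ℝ, E →L[ℝ] ℝ) ∞
        (fun x => β.inChart x₀ (extChartAt 𝓘(ℝ, E) x₀ x)) x₀ :=
      ContMDiffAt.comp x₀ (g := β.inChart x₀) (ContDiffAt.contMDiffAt h)
        (contMDiffAt_extChartAt (x := x₀))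
    exact h'.congr_of_eventuallyEq e

lemma SmoothOn.smoothAt {β : OneForm E M} {s : Set M} (h : β.SmoothOn s) (hs : IsOpen s) {x : M}
    (hx : x ∈ s) : β.SmoothAt x :=
  (contMDiffAt_section_iff β x).1 (ContMDiffWithinAt.contMDiffAt (h x hx) (hs.mem_nhds hx))

lemma smoothOn_of_smoothAt {β : OneForm E M} {s : Set M} (h : ∀ x ∈ s, β.SmoothAt x) :
    β.SmoothOn s := fun x hx =>
  ContMDiffAt.contMDiffWithinAt ((contMDiffAt_section_iff β x).2 (h x hx))

end OneForm

/-! ### Linear algebra of two-forms nondegenerate on a hyperplane. -/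

section HyperplaneNondegenerate

variable {E : Type*} [NormedAddCommGroup E] [NormedSpace ℝ E]

/-- A bilinear form that is alternating, and nondegenerate on the kernel of the nonzero linear
form `τ`. -/
structure NondegenerateOnKer (σ : E →L[ℝ] E →L[ℝ] ℝ) (τ : E →L[ℝ] ℝ) : Prop where
  self_eq_zero : ∀ v, σ v v = 0
  ne_zero : τ ≠ 0
  eq_zero : ∀ v, τ v = 0 → (∀ w, τ w = 0 → σ v w = 0) → v = 0

/-- The linear map `v ↦ σ(v, ·) + τ(v) τ`. -/
def augmentedForm (σ : E →L[ℝ] E →L[ℝ] ℝ) (τ : E →L[ℝ] ℝ) : E →L[ℝ] E →L[ℝ] ℝ :=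
  σ + τ.smulRight τ

lemma augmentedForm_apply (σ : E →L[ℝ] E →L[ℝ] ℝ) (τ : E →L[ℝ] ℝ) (v w : E) :
    augmentedForm σ τ v w = σ v w + τ v * τ w := by simp [augmentedForm]

/-- The vector `v` with `τ(v) = u` and `σ(v, ·) = μ` on the kernel of `τ`. -/
def solveOnKer (σ : E →L[ℝ] E →L[ℝ] ℝ) (τ : E →L[ℝ] ℝ) (u : ℝ) (μ : E →L[ℝ] ℝ) : E :=
  (augmentedForm σ τ).inverse μ +
    (u - μ ((augmentedForm σ τ).inverse τ)) • (augmentedForm σ τ).inverse τ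

namespace NondegenerateOnKer

variable {σ : E →L[ℝ] E →L[ℝ] ℝ} {τ : E →L[ℝ] ℝ} (h : NondegenerateOnKer σ τ)
include h

lemma skew (v w : E) : σ v w = -σ w v := by
  have h1 := h.self_eq_zero (v + w)
  simp only [map_add, add_apply, h.self_eq_zero] at h1
  linarith

/-- If `σ(v, ·) + τ(v) τ = 0`, evaluation at `v` gives `τ(v)² = 0`. Hence `v` lies in the hyperplane
and in the kernel of `σ` there, so `v = 0`; dimensions agree. -/
lemma isInvertible [FiniteDimensional ℝ E] : (augmentedForm σ τ).IsInvertible := by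
  have hinj : Function.Injective (augmentedForm σ τ) := by
    refine (injective_iff_map_eq_zero _).2 fun v hv => ?_
    have hvw : ∀ w, σ v w + τ v * τ w = 0 := fun w => by
      rw [← augmentedForm_apply, hv]; rfl
    have h0 : τ v = 0 := by
      have := hvw v
      rw [h.self_eq_zero, zero_add] at this
      exact mul_self_eq_zero.1 this
    refine h.eq_zero v h0 fun w _ => ?_
    simpa [h0] using hvw w
  have hfin : Module.finrank ℝ E = Module.finrank ℝ (E →L[ℝ] ℝ) := by
    rw [← LinearEquiv.finrank_eq (LinearMap.toContinuousLinearMap (𝕜 := ℝ) (E := E) (F' := ℝ))]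
    exact (Subspace.dual_finrank_eq (K := ℝ) (V := E)).symm
  exact ⟨(LinearEquiv.ofInjectiveOfFinrankEq (augmentedForm σ τ).toLinearMap hinj
    hfin).toContinuousLinearEquiv, by ext; rfl⟩

lemma unique {v v' : E} (hτ : τ v = τ v') (hσ : ∀ w, τ w = 0 → σ v w = σ v' w) : v = v' := by
  refine sub_eq_zero.1 (h.eq_zero _ (by simp [hτ]) fun w hw => ?_)
  simp [hσ w hw]

lemma augmentedForm_inverse [FiniteDimensional ℝ E] (μ : E →L[ℝ] ℝ) (w : E) :
    σ ((augmentedForm σ τ).inverse μ) w + τ ((augmentedForm σ τ).inverse μ) * τ w = μ w := by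
  rw [← augmentedForm_apply]
  have := h.isInvertible.self_comp_inverse
  exact congrArg (fun T : (E →L[ℝ] ℝ) →L[ℝ] (E →L[ℝ] ℝ) => T μ w) this

/-- Evaluating `σ(R, ·) + τ(R) τ = τ` at `R` gives `τ(R)² = τ(R)`. The value `0` would force `R = 0`
and then `τ = 0`. With `τ(R) = 1` the equation leaves `σ(R, ·) = 0`: `R` is the Reeb vector of the
pair. -/
lemma inverse_self [FiniteDimensional ℝ E] : τ ((augmentedForm σ τ).inverse τ) = 1 ∧
    ∀ w, σ ((augmentedForm σ τ).inverse τ) w = 0 := by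
  set R := (augmentedForm σ τ).inverse τ with hR
  have h1 : ∀ w, σ R w + τ R * τ w = τ w := h.augmentedForm_inverse τ
  have h2 : τ R = 1 := by
    have h3 := h1 R
    rw [h.self_eq_zero, zero_add] at h3
    rcases eq_or_ne (τ R) 0 with h0 | h0
    · exfalso
      have hR0 : R = 0 := h.eq_zero R h0 fun w hw => by simpa [h0, hw] using h1 w
      refine h.ne_zero (ContinuousLinearMap.ext fun w => ?_)
      rw [← h1 w, hR0]; simp
    · exact mul_right_cancel₀ h0 (by rw [h3, one_mul])
  exact ⟨h2, fun w => by have := h1 w; rw [h2, one_mul] at this; linarith⟩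

/-- The multiple of the Reeb vector in `solveOnKer` corrects the value of `τ` without affecting `σ`.
-/
lemma solveOnKer_spec [FiniteDimensional ℝ E] (u : ℝ) (μ : E →L[ℝ] ℝ) :
    τ (solveOnKer σ τ u μ) = u ∧ ∀ w, τ w = 0 → σ (solveOnKer σ τ u μ) w = μ w := by
  obtain ⟨h1, h2⟩ := h.inverse_self
  have h3 := h.augmentedForm_inverse μ ((augmentedForm σ τ).inverse τ)
  rw [h1, mul_one, h.skew, h2, neg_zero, zero_add] at h3
  refine ⟨by simp [solveOnKer, h1, h3], fun w hw => ?_⟩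
  have h4 := h.augmentedForm_inverse μ w
  rw [hw, mul_zero, add_zero] at h4
  simp [solveOnKer, h2, h4]

lemma solveOnKer_one_zero [FiniteDimensional ℝ E] :
    τ (solveOnKer σ τ 1 0) = 1 ∧ ∀ w, σ (solveOnKer σ τ 1 0) w = 0 := by
  simpa [solveOnKer] using h.inverse_self

lemma unique_kernel [FiniteDimensional ℝ E] {v : E} (hτ : τ v = 1) (hσ : ∀ w, σ v w = 0) :
    v = solveOnKer σ τ 1 0 :=
  h.unique (by rw [hτ, h.solveOnKer_one_zero.1]) fun w _ => by
    rw [hσ, h.solveOnKer_one_zero.2]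

end NondegenerateOnKer

/-- Inversion of operators is smooth at invertible ones, and all vector fields of the proof (Reeb
field, horizontal lifts, their polar components) are instances of `solveOnKer`. -/
lemma contDiffAt_solveOnKer [FiniteDimensional ℝ E] {P : Type*} [NormedAddCommGroup P]
    [NormedSpace ℝ P] {σ : P → E →L[ℝ] E →L[ℝ] ℝ} {τ μ : P → E →L[ℝ] ℝ} {u : P → ℝ} {p : P}
    (h : NondegenerateOnKer (σ p) (τ p)) (hσ : ContDiffAt ℝ ∞ σ p) (hτ : ContDiffAt ℝ ∞ τ p)
    (hu : ContDiffAt ℝ ∞ u p) (hμ : ContDiffAt ℝ ∞ μ p) :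
    ContDiffAt ℝ ∞ (fun p => solveOnKer (σ p) (τ p) (u p) (μ p)) p := by
  have : CompleteSpace E := FiniteDimensional.complete ℝ E
  have hT : ContDiffAt ℝ ∞ (fun p => augmentedForm (σ p) (τ p)) p :=
    hσ.add (hτ.smulRight hτ)
  have hI : ContDiffAt ℝ ∞ (fun p => (augmentedForm (σ p) (τ p)).inverse) p := by
    obtain ⟨e, he⟩ := h.isInvertible
    have h1 : ContDiffAt ℝ ∞ ContinuousLinearMap.inverse (augmentedForm (σ p) (τ p)) := by
      rw [← he]; exact contDiffAt_map_inverse e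
    exact h1.comp p hT
  have h1 := hI.clm_apply hμ
  have h2 := hI.clm_apply hτ
  exact h1.add ((hu.sub (hμ.clm_apply h2)).smul h2)

end HyperplaneNondegenerate

/-! ### Closedness of the exterior derivative along its kernel. -/

section ExteriorDerivative

variable {V : Type*} [NormedAddCommGroup V] [NormedSpace ℝ V]

/-- The exterior derivative of a `1`-form on a normed space, as a continuous bilinear map. -/
def formDCLM (b : V → V →L[ℝ] ℝ) (x : V) : V →L[ℝ] V →L[ℝ] ℝ :=
  fderiv ℝ b x - (fderiv ℝ b x).flip

lemma formDCLM_apply (b : V → V →L[ℝ] ℝ) (x u w : V) : formDCLM b x u w = formD b x u w := rfl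

lemma formD_self (b : V → V →L[ℝ] ℝ) (x u : V) : formD b x u u = 0 := sub_self _

lemma contDiffAt_formDCLM {b : V → V →L[ℝ] ℝ} {x : V} (hb : ContDiffAt ℝ ∞ b x) :
    ContDiffAt ℝ ∞ (formDCLM b) x := by
  have h1 : ContDiffAt ℝ ∞ (fderiv ℝ b) x := hb.fderiv_right (m := ∞) le_rfl
  obtain ⟨L, hLf⟩ : ∃ L : (V →L[ℝ] V →L[ℝ] ℝ) →L[ℝ] (V →L[ℝ] V →L[ℝ] ℝ), ∀ T, L T = T.flip :=
    ⟨(ContinuousLinearMap.flipₗᵢ ℝ V V ℝ).toContinuousLinearEquiv, fun _ => rfl⟩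
  have hL : ContDiff ℝ ∞ L := by fun_prop
  have h2 : ContDiffAt ℝ ∞ (fun y => L (fderiv ℝ b y)) x := hL.contDiffAt.comp x h1
  simp only [hLf] at h2
  exact h1.sub h2

/-- If `τ` spans the kernel of the exterior derivative of `b`, then the latter is constant in the
direction of `τ`. -/
lemma formD_eq_of_kernel {b : V → V →L[ℝ] ℝ} {U : Set V} (hU : IsOpen U)
    (hb : ∀ x ∈ U, ContDiffAt ℝ ∞ b x) {τ : V} (hτ : ∀ x ∈ U, ∀ w, formD b x τ w = 0) {x : V}
    (hx : ∀ t : ℝ, x + t • τ ∈ U) (v w : V) (t : ℝ) :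
    formD b (x + t • τ) v w = formD b x v w := by
  have hder : ∀ t : ℝ, HasDerivAt (fun t : ℝ => formD b (x + t • τ) v w) 0 t := by
    intro t
    set y := x + t • τ
    have hy : y ∈ U := hx t
    have hbd : ContDiffAt ℝ ∞ (fderiv ℝ b) y := (hb y hy).fderiv_right (m := ∞) le_rfl
    have h2 : HasFDerivAt (fderiv ℝ b) (fderiv ℝ (fderiv ℝ b) y) y :=
      (hbd.differentiableAt (by simp)).hasFDerivAt
    set D := fderiv ℝ (fderiv ℝ b) y
    have hsymm : ∀ u w, D u w = D w u := fun u w =>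
      ((hb y hy).isSymmSndFDerivAt (by
        rw [minSmoothness_of_isRCLikeNormedField]; exact WithTop.coe_le_coe.2 le_top)).eq u w
    have happ : ∀ p q : V, ∃ T : V →L[ℝ] ℝ, (∀ z, T z = D z p q) ∧
        HasFDerivAt (fun z => fderiv ℝ b z p q) T y := fun p q =>
      ⟨_, by simp, (h2.clm_apply (hasFDerivAt_const p y)).clm_apply (hasFDerivAt_const q y)⟩
    have hform : ∀ p q : V, ∃ T : V →L[ℝ] ℝ, (∀ z, T z = D z p q - D z q p) ∧
        HasFDerivAt (fun z => formD b z p q) T y := fun p q => by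
      obtain ⟨T, hT, hT'⟩ := happ p q
      obtain ⟨S, hS, hS'⟩ := happ q p
      exact ⟨T - S, fun z => by simp [hT, hS], hT'.sub hS'⟩
    -- Differentiating `formD b z τ q = 0` in `z`. Together with the symmetry of `D` in its first
    -- two arguments, this is `d(db) = 0` contracted with `τ`.
    have hzero : ∀ q z : V, D z τ q - D z q τ = 0 := by
      intro q z
      have h3 : HasFDerivAt (fun z => formD b z τ q) (0 : V →L[ℝ] ℝ) y := by
        refine (hasFDerivAt_const (0 : ℝ) y).congr_of_eventuallyEq ?_
        filter_upwards [hU.mem_nhds hy] with z hz using hτ z hz q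
      obtain ⟨T, hT, hT'⟩ := hform τ q
      rw [← hT, hT'.unique h3]; rfl
    have hline : HasDerivAt (fun t : ℝ => x + t • τ) τ t := by
      simpa using ((hasDerivAt_id t).smul_const τ).const_add x
    obtain ⟨T, hT, hT'⟩ := hform v w
    have h5 := hT'.comp_hasDerivAt t hline
    have e1 := hzero w v
    have e2 := hzero v w
    rw [hsymm v w] at e1
    have h6 : T τ = 0 := by
      rw [hT, hsymm τ v, hsymm τ w]
      linarith
    rw [h6] at h5
    exact h5
  have := is_const_of_deriv_eq_zero (fun t => (hder t).differentiableAt)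
    (fun t => (hder t).deriv) t 0
  simpa using this

end ExteriorDerivative

/-! ### Polar coordinates in the plane. -/

section PolarPoint

/-- The point of the complex plane with polar coordinates `(r, θ)`, angles being measured from
`ζ`. -/
def polarPt (ζ : Circle) (r θ : ℝ) : ℂ := r * (ζ * Circle.exp θ : Circle)

variable (ζ : Circle)

lemma norm_polarPt (r θ : ℝ) : ‖polarPt ζ r θ‖ = |r| := by
  rw [polarPt, norm_mul, Circle.norm_coe, mul_one, Complex.norm_real, Real.norm_eq_abs]

lemma polarPt_zero (θ : ℝ) : polarPt ζ 0 θ = 0 := by simp [polarPt]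

lemma polarPt_angle_zero (r : ℝ) : polarPt ζ r 0 = r * ζ := by simp [polarPt]

lemma exists_polarPt (z : ℂ) : ∃ θ ∈ Icc (-Real.pi) Real.pi, polarPt ζ ‖z‖ θ = z := by
  refine ⟨Complex.arg (z / ζ), ⟨(Complex.neg_pi_lt_arg _).le, Complex.arg_le_pi _⟩, ?_⟩
  have h := Complex.norm_mul_exp_arg_mul_I (z / ζ)
  have h0 : (ζ : ℂ) ≠ 0 := Circle.coe_ne_zero ζ
  rw [norm_div, Circle.norm_coe, div_one] at h
  rw [polarPt, Circle.coe_mul, Circle.coe_exp, mul_left_comm, h, mul_div_cancel₀ _ h0]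

lemma hasFDerivAt_polarPt (p : ℝ × ℝ) : ∃ T : ℝ × ℝ →L[ℝ] ℂ,
    (∀ ρ t : ℝ, T (ρ, t) = ρ * (ζ * Circle.exp p.2 : Circle) +
      t * (Complex.I * polarPt ζ p.1 p.2)) ∧
    HasFDerivAt (fun p : ℝ × ℝ => polarPt ζ p.1 p.2) T p := by
  have h1 : HasFDerivAt (fun p : ℝ × ℝ => (p.1 : ℂ)) (Complex.ofRealCLM.comp (.fst ℝ ℝ ℝ)) p :=
    (Complex.ofRealCLM.comp (.fst ℝ ℝ ℝ)).hasFDerivAt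
  have h2 : HasFDerivAt (fun p : ℝ × ℝ => (p.2 : ℂ) * Complex.I)
      (((.snd ℝ ℝ ℝ : ℝ × ℝ →L[ℝ] ℝ)).smulRight Complex.I) p := by
    have := (((.snd ℝ ℝ ℝ : ℝ × ℝ →L[ℝ] ℝ)).smulRight Complex.I).hasFDerivAt (x := p)
    refine this.congr_of_eventuallyEq (Filter.Eventually.of_forall fun p => ?_)
    simp
  have h3 := h1.mul (h2.cexp.const_mul (ζ : ℂ))
  refine ⟨_, fun ρ t => ?_, h3.congr_of_eventuallyEq (Filter.Eventually.of_forall fun q => ?_)⟩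
  · simp [polarPt, Circle.coe_exp]
    ring
  · simp [polarPt, Circle.coe_exp]

lemma contDiff_polarPt : ContDiff ℝ ∞ (fun p : ℝ × ℝ => polarPt ζ p.1 p.2) := by
  have e : (fun p : ℝ × ℝ => polarPt ζ p.1 p.2) =
      fun p => Complex.ofRealCLM p.1 * (ζ * Complex.exp (Complex.ofRealCLM p.2 * Complex.I)) := by
    ext p; simp [polarPt, Circle.coe_exp]
  rw [e]
  have h1 : ContDiff ℝ ∞ fun p : ℝ × ℝ => Complex.ofRealCLM p.1 :=
    Complex.ofRealCLM.contDiff.comp contDiff_fst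
  have h2 : ContDiff ℝ ∞ fun p : ℝ × ℝ => Complex.ofRealCLM p.2 :=
    Complex.ofRealCLM.contDiff.comp contDiff_snd
  exact h1.mul (contDiff_const.mul (h2.mul contDiff_const).cexp)

/-- The value of `r² dθ` on `ρ ∂_r + t ∂_θ`. -/
lemma conj_polarPt_mul (r θ ρ t : ℝ) : (conj (polarPt ζ r θ) *
    (ρ * (ζ * Circle.exp θ : Circle) + t * (Complex.I * polarPt ζ r θ))).im = r ^ 2 * t := by
  have h : conj ((ζ * Circle.exp θ : Circle) : ℂ) * ((ζ * Circle.exp θ : Circle) : ℂ) = 1 := by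
    rw [← Complex.normSq_eq_conj_mul_self, Circle.normSq_coe]; simp
  have e : conj (polarPt ζ r θ) *
      (ρ * (ζ * Circle.exp θ : Circle) + t * (Complex.I * polarPt ζ r θ)) =
      (r * ρ + r ^ 2 * t * Complex.I) *
        (conj ((ζ * Circle.exp θ : Circle) : ℂ) * (ζ * Circle.exp θ : Circle)) := by
    simp only [polarPt, map_mul, Complex.conj_ofReal]; ring
  rw [e, h, mul_one]
  have e2 : (r * ρ + r ^ 2 * t * Complex.I : ℂ) = ((r * ρ : ℝ) : ℂ) + ((r ^ 2 * t : ℝ) : ℂ) * Complex.I := by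
    push_cast; ring
  rw [e2, Complex.add_im, Complex.ofReal_im, Complex.im_ofReal_mul, Complex.I_im]
  ring

lemma polar_vector_eq_zero (ζ : Circle) {r θ ρ t : ℝ} (hr : r ≠ 0)
    (h : ρ * ((ζ * Circle.exp θ : Circle) : ℂ) + t * (Complex.I * polarPt ζ r θ) = 0) :
    ρ = 0 ∧ t = 0 := by
  have h0 : ((ζ * Circle.exp θ : Circle) : ℂ) ≠ 0 := Circle.coe_ne_zero _
  have h1 : (ρ + t * r * Complex.I) * ((ζ * Circle.exp θ : Circle) : ℂ) = 0 := by
    rw [← h, polarPt]; ring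
  have h2 := (mul_eq_zero.1 h1).resolve_right h0
  have h3 := congrArg Complex.re h2
  have h4 := congrArg Complex.im h2
  simp at h3 h4
  exact ⟨h3, h4.resolve_right hr⟩

end PolarPoint

/-! ### Nondegeneracy under pullback. -/

section Pull

variable {E : Type*} [NormedAddCommGroup E] [NormedSpace ℝ E]
  {M : Type*} [TopologicalSpace M] [ChartedSpace E M]
  {V : Type*} [NormedAddCommGroup V] [NormedSpace ℝ V]

namespace OneForm

/-- The exterior derivative of a `1`-form at a point, as a continuous bilinear map. -/
def dCLM (β : OneForm E M) (x : M) : E →L[ℝ] E →L[ℝ] ℝ :=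
  (formDCLM (β.inChart x) (extChartAt 𝓘(ℝ, E) x x)).bilinearComp
    (mfderiv 𝓘(ℝ, E) 𝓘(ℝ, E) (extChartAt 𝓘(ℝ, E) x) x : E →L[ℝ] E)
    (mfderiv 𝓘(ℝ, E) 𝓘(ℝ, E) (extChartAt 𝓘(ℝ, E) x) x : E →L[ℝ] E)

lemma d_self (β : OneForm E M) (x : M) (v : TangentSpace 𝓘(ℝ, E) x) : β.d x v v = 0 := sub_self _

lemma nondegenerateOnKer {β τ : OneForm E M} {x : M}
    (h : β.NondegenerateOn x (fun v => τ x v = 0)) (h0 : τ x ≠ 0) :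
    NondegenerateOnKer (E := E) (β.dCLM x) (τ x) :=
  ⟨fun v => β.d_self x v, h0, fun v hv hw => h v hv hw⟩

lemma inChart_add (β γ : OneForm E M) (x : M) (y : E) :
    inChart (fun z => β z + γ z) x y = β.inChart x y + γ.inChart x y :=
  ContinuousLinearMap.add_comp _ _ _

lemma inChart_smul (a : M → ℝ) (γ : OneForm E M) (x : M) (y : E) :
    inChart (fun z => a z • γ z) x y =
      a ((extChartAt 𝓘(ℝ, E) x).symm y) • γ.inChart x y :=
  ContinuousLinearMap.ext fun _ => rfl

lemma SmoothAt.add {β γ : OneForm E M} {x : M} (hβ : β.SmoothAt x) (hγ : γ.SmoothAt x) :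
    SmoothAt (fun z => β z + γ z) x := by
  unfold SmoothAt
  rw [show inChart (fun z => β z + γ z) x = fun y => β.inChart x y + γ.inChart x y from
    funext (inChart_add β γ x)]
  exact ContDiffAt.add hβ hγ

lemma inChart_eventuallyEq {β γ : OneForm E M} {x : M} (h : ∀ᶠ y in 𝓝 x, β y = γ y) :
    β.inChart x =ᶠ[𝓝 (extChartAt 𝓘(ℝ, E) x x)] γ.inChart x := by
  have h1 : ContinuousAt (extChartAt 𝓘(ℝ, E) x).symm (extChartAt 𝓘(ℝ, E) x x) :=
    continuousAt_extChartAt_symm x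
  have h2 : (extChartAt 𝓘(ℝ, E) x).symm (extChartAt 𝓘(ℝ, E) x x) = x := extChartAt_to_inv x
  unfold ContinuousAt at h1
  rw [h2] at h1
  filter_upwards [h1.eventually h] with y hy
  unfold inChart
  rw [hy]

lemma d_congr {β γ : OneForm E M} {x : M} (h : ∀ᶠ y in 𝓝 x, β y = γ y) : β.d x = γ.d x := by
  ext v w
  unfold d
  rw [(inChart_eventuallyEq h).fderiv_eq]

variable [IsManifold 𝓘(ℝ, E) ∞ M]

lemma SmoothAt.smul {a : M → ℝ} {γ : OneForm E M} {x : M}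
    (ha : ContMDiffAt 𝓘(ℝ, E) 𝓘(ℝ, ℝ) ∞ a x) (hγ : γ.SmoothAt x) :
    SmoothAt (fun z => a z • γ z) x := by
  unfold SmoothAt
  rw [show inChart (fun z => a z • γ z) x = fun y =>
    a ((extChartAt 𝓘(ℝ, E) x).symm y) • γ.inChart x y from funext (inChart_smul a γ x)]
  suffices hs : ContDiffAt ℝ ∞ (fun y => a ((extChartAt 𝓘(ℝ, E) x).symm y))
    (extChartAt 𝓘(ℝ, E) x x) from hs.smul (show ContDiffAt ℝ ∞ (γ.inChart x) _ from hγ)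
  have h1 : ContMDiffAt 𝓘(ℝ, E) 𝓘(ℝ, E) ∞ (extChartAt 𝓘(ℝ, E) x).symm (extChartAt 𝓘(ℝ, E) x x) :=
    (contMDiffOn_extChartAt_symm (I := 𝓘(ℝ, E)) (n := ∞) x).contMDiffAt
      (extChartAt_target_mem_nhds x)
  refine (ContMDiffAt.comp (g := a) (extChartAt 𝓘(ℝ, E) x x) ?_ h1).contDiffAt
  rw [extChartAt_to_inv]; exact ha

lemma nondegenerateOnKer_pull {β τ : OneForm E M} {φ : V → M} {x : V} (hβ : β.SmoothAt (φ x))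
    (hφ : ContMDiffAt 𝓘(ℝ, V) 𝓘(ℝ, E) ∞ φ x)
    (hb : Function.Bijective (mfderiv 𝓘(ℝ, V) 𝓘(ℝ, E) φ x))
    (h : β.NondegenerateOn (φ x) (fun v => τ (φ x) v = 0)) (h0 : τ (φ x) ≠ 0) :
    NondegenerateOnKer (formDCLM (β.pull φ) x) (τ.pull φ x) := by
  refine ⟨fun v => formD_self _ _ _, fun he => h0 ?_, fun v hv hw => ?_⟩
  · refine ContinuousLinearMap.ext fun w => ?_
    obtain ⟨w', rfl⟩ := hb.2 w
    exact congrArg (fun T : V →L[ℝ] ℝ => T w') he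
  · have h1 : mfderiv 𝓘(ℝ, V) 𝓘(ℝ, E) φ x v = 0 := by
      refine h _ hv fun w hw' => ?_
      obtain ⟨w', rfl⟩ := hb.2 w
      exact (hβ.formD_pull hφ v w').symm.trans (hw w' hw')
    exact hb.1 (h1.trans (map_zero _).symm)

lemma nondegenerateOn_of_pull {β τ : OneForm E M} {φ : V → M} {x : V} (hβ : β.SmoothAt (φ x))
    (hφ : ContMDiffAt 𝓘(ℝ, V) 𝓘(ℝ, E) ∞ φ x)
    (hb : Function.Surjective (mfderiv 𝓘(ℝ, V) 𝓘(ℝ, E) φ x))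
    (h : ∀ v, τ.pull φ x v = 0 → (∀ w, τ.pull φ x w = 0 → formD (β.pull φ) x v w = 0) → v = 0) :
    β.NondegenerateOn (φ x) (fun v => τ (φ x) v = 0) := by
  intro v hv hw
  obtain ⟨v', rfl⟩ := hb v
  have : v' = 0 := by
    refine h v' hv fun w hw' => ?_
    exact (hβ.formD_pull hφ v' w).trans (hw _ hw')
  rw [this]; exact map_zero _

end OneForm

/-- Uniqueness of the solution makes `solveOnKer` natural. This is how chart expressions of the Reeb
and horizontal fields are matched with their intrinsic definitions. -/
lemma NondegenerateOnKer.map_solveOnKer [FiniteDimensional ℝ E] [FiniteDimensional ℝ V]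
    {σ : E →L[ℝ] E →L[ℝ] ℝ} {τ : E →L[ℝ] ℝ} {σ' : V →L[ℝ] V →L[ℝ] ℝ} {τ' : V →L[ℝ] ℝ}
    (h : NondegenerateOnKer σ τ) (h' : NondegenerateOnKer σ' τ') {T : V →L[ℝ] E}
    (hT : Function.Surjective T) (hσ : ∀ v w, σ' v w = σ (T v) (T w)) (hτ : ∀ v, τ' v = τ (T v))
    {u : ℝ} {μ : E →L[ℝ] ℝ} {μ' : V →L[ℝ] ℝ} (hμ : ∀ v, μ' v = μ (T v)) :
    T (solveOnKer σ' τ' u μ') = solveOnKer σ τ u μ := by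
  refine h.unique ?_ fun w hw => ?_
  · rw [← hτ, (h'.solveOnKer_spec u μ').1, (h.solveOnKer_spec u μ).1]
  · obtain ⟨w, rfl⟩ := hT w
    rw [← hσ, (h'.solveOnKer_spec u μ').2 w (by rw [hτ, hw]), (h.solveOnKer_spec u μ).2 _ hw, hμ]

lemma bijective_mfderiv_extChartAt_symm [IsManifold 𝓘(ℝ, E) ∞ M] (x : M) {y : E}
    (hy : y ∈ (extChartAt 𝓘(ℝ, E) x).target) :
    Function.Bijective (mfderiv 𝓘(ℝ, E) 𝓘(ℝ, E) (extChartAt 𝓘(ℝ, E) x).symm y) := by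
  have := OneForm.isManifold_one (E := E) (M := M)
  have h := isInvertible_mfderivWithin_extChartAt_symm (I := 𝓘(ℝ, E)) hy
  rw [ModelWithCorners.range_eq_univ, mfderivWithin_univ] at h
  obtain ⟨e, he⟩ := h
  rw [← he]; exact e.bijective

lemma contMDiffAt_extChartAt_symm' [IsManifold 𝓘(ℝ, E) ∞ M] (x : M) {y : E}
    (hy : y ∈ (extChartAt 𝓘(ℝ, E) x).target) :
    ContMDiffAt 𝓘(ℝ, E) 𝓘(ℝ, E) ∞ (extChartAt 𝓘(ℝ, E) x).symm y :=
  (contMDiffOn_extChartAt_symm (I := 𝓘(ℝ, E)) (n := ∞) x).contMDiffAt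
    ((isOpen_extChartAt_target x).mem_nhds hy)

end Pull

/-! ### The collar, the angular form and polar charts. -/

namespace ConcreteOpenBook

variable {n : ℕ}
  {Y : Type*} [TopologicalSpace Y] [ChartedSpace (EuclideanSpace ℝ (Fin (2 * n + 3))) Y]
  {B : Type*} [TopologicalSpace B] [ChartedSpace (EuclideanSpace ℝ (Fin (2 * n + 1))) B]
  (O : ConcreteOpenBook n Y B)

section Collar

lemma isLocalDiffeomorphAt_collar (b : B) {z : ℂ} (hz : ‖z‖ < 1) :
    IsLocalDiffeomorphAt ((𝓡 (2 * n + 1)).prod 𝓘(ℝ, ℂ)) (𝓡 (2 * n + 3)) ∞ O.collar (b, z) :=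
  O.collar_isLocalDiffeomorphOn ⟨(b, z), mem_univ _, mem_ball_zero_iff.2 hz⟩

lemma contMDiffAt_collar (b : B) {z : ℂ} (hz : ‖z‖ < 1) :
    ContMDiffAt ((𝓡 (2 * n + 1)).prod 𝓘(ℝ, ℂ)) (𝓡 (2 * n + 3)) ∞ O.collar (b, z) :=
  (O.isLocalDiffeomorphAt_collar b hz).contMDiffAt

lemma dcollar_surjective (b : B) {z : ℂ} (hz : ‖z‖ < 1)
    (u : TangentSpace (𝓡 (2 * n + 3)) (O.collar (b, z))) : ∃ v w, O.dcollar b z v w = u := by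
  obtain ⟨p, hp⟩ := ((O.isLocalDiffeomorphAt_collar b hz).mfderivToContinuousLinearEquiv
    (by simp)).surjective u
  exact ⟨p.1, p.2, hp⟩

lemma dcollar_eq_zero (b : B) {z : ℂ} (hz : ‖z‖ < 1) {v : TangentSpace (𝓡 (2 * n + 1)) b} {w : ℂ}
    (h : O.dcollar b z v w = 0) : v = 0 ∧ w = 0 := by
  have h1 := ((O.isLocalDiffeomorphAt_collar b hz).mfderivToContinuousLinearEquiv
    (by simp)).injective (a₁ := (v, w)) (a₂ := 0) (h.trans (map_zero _).symm)
  exact ⟨congrArg Prod.fst h1, congrArg Prod.snd h1⟩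

lemma collar_injective {b b' : B} {z z' : ℂ} (hz : ‖z‖ < 1) (hz' : ‖z'‖ < 1)
    (h : O.collar (b, z) = O.collar (b', z')) : b = b' ∧ z = z' := by
  have := O.collar_injOn ⟨mem_univ _, mem_ball_zero_iff.2 hz⟩ ⟨mem_univ _, mem_ball_zero_iff.2 hz'⟩ h
  exact ⟨congrArg Prod.fst this, congrArg Prod.snd this⟩

lemma collar_mem_binding_iff (b : B) {z : ℂ} (hz : ‖z‖ < 1) :
    O.collar (b, z) ∈ O.binding ↔ z = 0 := by
  constructor
  · rintro ⟨b', hb'⟩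
    exact (O.collar_injective (by simp) hz hb').2.symm
  · rintro rfl
    exact ⟨b, rfl⟩

lemma continuousOn_collar : ContinuousOn O.collar (univ ×ˢ Metric.ball 0 1) := fun p hp =>
  (O.contMDiffAt_collar p.1 (mem_ball_zero_iff.1 hp.2)).continuousAt.continuousWithinAt

lemma isCompact_collar_image [CompactSpace B] {K : Set ℂ} (hK : IsCompact K)
    (h : K ⊆ Metric.ball 0 1) : IsCompact (O.collar '' (univ ×ˢ K)) :=
  (isCompact_univ.prod hK).image_of_continuousOn
    (O.continuousOn_collar.mono (prod_mono subset_rfl h))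

lemma collar_image_mem_nhds (b : B) {z : ℂ} (hz : ‖z‖ < 1) {S : Set (B × ℂ)} (hS : S ∈ 𝓝 (b, z)) :
    O.collar '' S ∈ 𝓝 (O.collar (b, z)) := by
  have h := O.collar_isLocalDiffeomorphOn.isLocalHomeomorphOn.map_nhds_eq
    (x := (b, z)) ⟨mem_univ _, mem_ball_zero_iff.2 hz⟩
  rw [← h]
  exact Filter.image_mem_map hS

lemma isOpen_collar_image {r : ℝ} (hr : r ≤ 1) :
    IsOpen (O.collar '' (univ ×ˢ Metric.ball 0 r)) := by
  rw [isOpen_iff_mem_nhds]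
  rintro _ ⟨⟨b, z⟩, ⟨-, hz⟩, rfl⟩
  exact O.collar_image_mem_nhds b ((mem_ball_zero_iff.1 hz).trans_le hr)
    ((isOpen_univ.prod Metric.isOpen_ball).mem_nhds ⟨mem_univ _, hz⟩)

lemma binding_eq_image : O.binding = O.collar '' (univ ×ˢ {0}) := by
  ext y
  constructor
  · rintro ⟨b, rfl⟩
    exact ⟨(b, 0), ⟨mem_univ _, rfl⟩, rfl⟩
  · rintro ⟨⟨b, z⟩, ⟨-, hz⟩, rfl⟩
    rw [mem_singleton_iff] at hz
    exact ⟨b, by rw [← hz]⟩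

lemma isClosed_binding [CompactSpace B] [T2Space Y] : IsClosed O.binding := by
  rw [binding_eq_image]
  exact (O.isCompact_collar_image isCompact_singleton (by simp)).isClosed

lemma binding_subset {r : ℝ} (hr : 0 < r) : O.binding ⊆ O.collar '' (univ ×ˢ Metric.ball 0 r) := by
  rintro _ ⟨b, rfl⟩
  exact ⟨(b, 0), ⟨mem_univ _, Metric.mem_ball_self hr⟩, rfl⟩

lemma proj_polarPt (ζ : Circle) (b : B) {r : ℝ} (θ : ℝ) (hr : 0 < r) (hr1 : r < 1) :
    O.proj (O.collar (b, polarPt ζ r θ)) = ζ * Circle.exp θ := by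
  have hn : ‖polarPt ζ r θ‖ = r := by rw [norm_polarPt, abs_of_pos hr]
  have h := O.proj_collar b (polarPt ζ r θ) (by rw [← norm_pos_iff, hn]; exact hr)
    (by rw [hn]; exact hr1)
  rw [hn, polarPt] at h
  exact Circle.ext (mul_left_cancel₀ (by exact_mod_cast hr.ne') h)

lemma collar_mem_openPage_iff (ζ : Circle) (b : B) {z : ℂ} (hz : ‖z‖ < 1) :
    O.collar (b, z) ∈ O.openPage ζ ↔ z ≠ 0 ∧ z = ‖z‖ * ζ := by
  rw [openPage, mem_inter_iff, mem_compl_iff, O.collar_mem_binding_iff b hz]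
  refine and_congr_right fun h0 => ?_
  have h := O.proj_collar b z h0 hz
  have hn : (‖z‖ : ℂ) ≠ 0 := by exact_mod_cast (norm_pos_iff.2 h0).ne'
  constructor
  · rintro hζ
    rw [mem_preimage, mem_singleton_iff] at hζ
    rw [← hζ, h]
  · intro hζ
    rw [mem_preimage, mem_singleton_iff]
    exact Circle.ext (mul_left_cancel₀ hn (h.trans hζ))

end Collar

section Angle

lemma contMDiffAt_proj [CompactSpace B] [T2Space Y] {x : Y} (hx : x ∉ O.binding) :
    ContMDiffAt (𝓡 (2 * n + 3)) 𝓘(ℝ, ℂ) ∞ (fun y => (O.proj y : ℂ)) x := by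
  have h1 : ContMDiffAt (𝓡 (2 * n + 3)) (𝓡 1) ∞ O.proj x :=
    O.isCircleBundleOn.1.contMDiffAt (O.isClosed_binding.isOpen_compl.mem_nhds hx)
  have : Fact (Module.finrank ℝ ℂ = 1 + 1) := ⟨Complex.finrank_real_complex⟩
  have h2 : ContMDiff (𝓡 1) 𝓘(ℝ, ℂ) ∞ (fun z : Circle => (z : ℂ)) := contMDiff_coe_sphere
  exact ContMDiffAt.comp x (h2 (O.proj x)) h1

/-- The closed `1`-form `dθ`. -/
def dthetaForm : OneForm (EuclideanSpace ℝ (Fin (2 * n + 3))) Y := fun x =>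
  (Complex.imCLM.comp (ContinuousLinearMap.mul ℝ ℂ (conj (O.proj x : ℂ)))).comp
    (mfderiv (𝓡 (2 * n + 3)) 𝓘(ℝ, ℂ) (fun y => (O.proj y : ℂ)) x)

variable {V : Type*} [NormedAddCommGroup V] [NormedSpace ℝ V]

lemma dthetaForm_pull [CompactSpace B] [T2Space Y] {φ : V → Y} {x : V}
    (hφ : MDifferentiableAt 𝓘(ℝ, V) (𝓡 (2 * n + 3)) φ x) (hx : φ x ∉ O.binding) :
    O.dthetaForm.pull φ x = (Complex.imCLM.comp (ContinuousLinearMap.mul ℝ ℂ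
      (conj (O.proj (φ x) : ℂ)))).comp (fderiv ℝ (fun v => (O.proj (φ v) : ℂ)) x) := by
  have h1 := HasMFDerivAt.comp x
    (((O.contMDiffAt_proj hx).mdifferentiableAt (by simp)).hasMFDerivAt) hφ.hasMFDerivAt
  have h2 : fderiv ℝ (fun v => (O.proj (φ v) : ℂ)) x = _ :=
    mfderiv_eq_fderiv.symm.trans h1.mfderiv
  ext u
  exact (congrArg (fun T : V →L[ℝ] ℂ => (conj (O.proj (φ x) : ℂ) * T u).im) h2).symm

lemma smoothAt_dthetaForm [CompactSpace B] [T2Space Y] [IsManifold (𝓡 (2 * n + 3)) ∞ Y] {x : Y}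
    (hx : x ∉ O.binding) : O.dthetaForm.SmoothAt x := by
  set e := extChartAt (𝓡 (2 * n + 3)) x
  have hex : e.symm (e x) = x := extChartAt_to_inv x
  have h0 : e x ∈ e.target := mem_extChartAt_target x
  have hc : ContinuousAt e.symm (e x) := continuousAt_extChartAt_symm x
  have hP : ContDiffAt ℝ ∞ (fun y => (O.proj (e.symm y) : ℂ)) (e x) := by
    have h1 : ContMDiffAt (𝓡 (2 * n + 3)) 𝓘(ℝ, ℂ) ∞ (fun y => (O.proj y : ℂ)) (e.symm (e x)) := by
      rw [hex]; exact O.contMDiffAt_proj hx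
    exact (ContMDiffAt.comp (e x) h1 (contMDiffAt_extChartAt_symm' x h0)).contDiffAt
  have hcon : ContDiffAt ℝ ∞ (fun y => ContinuousLinearMap.mul ℝ ℂ (conj (O.proj (e.symm y) : ℂ)))
      (e x) := by
    have h2 : ContDiff ℝ ∞ fun z : ℂ => ContinuousLinearMap.mul ℝ ℂ (conj z) :=
      (ContinuousLinearMap.mul ℝ ℂ).contDiff.comp Complex.conjCLE.contDiff
    exact h2.contDiffAt.comp (e x) hP
  have h3 : ContDiffAt ℝ ∞ (fun y => (Complex.imCLM.comp (ContinuousLinearMap.mul ℝ ℂ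
      (conj (O.proj (e.symm y) : ℂ)))).comp (fderiv ℝ (fun v => (O.proj (e.symm v) : ℂ)) y)) (e x) :=
    (contDiffAt_const.clm_comp hcon).clm_comp (hP.fderiv_right (m := ∞) le_rfl)
  refine h3.congr_of_eventuallyEq ?_
  have h4 : ∀ᶠ y in 𝓝 (e x), e.symm y ∉ O.binding := hc.eventually_mem
    (by rw [hex]; exact O.isClosed_binding.isOpen_compl.mem_nhds hx)
  filter_upwards [h4, extChartAt_target_mem_nhds (I := 𝓡 (2 * n + 3)) x] with y hy hy'
  exact O.dthetaForm_pull ((contMDiffAt_extChartAt_symm' x hy').mdifferentiableAt (by simp)) hy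

end Angle

section PolarChart

/-- Polar coordinates near the binding, over a chart of the binding. -/
def polarChart (ζ : Circle) (b₀ : B) (x : EuclideanSpace ℝ (Fin (2 * n + 1)) × ℝ × ℝ) : Y :=
  O.collar ((extChartAt (𝓡 (2 * n + 1)) b₀).symm x.1, polarPt ζ x.2.1 x.2.2)

variable [IsManifold (𝓡 (2 * n + 1)) ∞ B] (ζ : Circle) (b₀ : B)
  {x : EuclideanSpace ℝ (Fin (2 * n + 1)) × ℝ × ℝ}

lemma contMDiffAt_polarChart (hx : x.1 ∈ (extChartAt (𝓡 (2 * n + 1)) b₀).target)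
    (hr : |x.2.1| < 1) :
    ContMDiffAt 𝓘(ℝ, EuclideanSpace ℝ (Fin (2 * n + 1)) × ℝ × ℝ) (𝓡 (2 * n + 3)) ∞
      (O.polarChart ζ b₀) x := by
  have h1 := O.contMDiffAt_collar ((extChartAt (𝓡 (2 * n + 1)) b₀).symm x.1)
    (z := polarPt ζ x.2.1 x.2.2) (by rwa [norm_polarPt])
  refine ContMDiffAt.comp x (g := O.collar)
    (f := fun x : EuclideanSpace ℝ (Fin (2 * n + 1)) × ℝ × ℝ =>
      ((extChartAt (𝓡 (2 * n + 1)) b₀).symm x.1, polarPt ζ x.2.1 x.2.2)) h1 ?_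
  refine ContMDiffAt.prodMk ?_ ?_
  · exact ContMDiffAt.comp x (g := (extChartAt (𝓡 (2 * n + 1)) b₀).symm) (f := Prod.fst)
      (contMDiffAt_extChartAt_symm' b₀ hx) contDiffAt_fst.contMDiffAt
  · exact ((contDiff_polarPt ζ).contDiffAt.comp x contDiffAt_snd).contMDiffAt

lemma mfderiv_polarChart (hx : x.1 ∈ (extChartAt (𝓡 (2 * n + 1)) b₀).target)
    (hr : |x.2.1| < 1) (v : EuclideanSpace ℝ (Fin (2 * n + 1))) (ρ t : ℝ) :
    mfderiv 𝓘(ℝ, EuclideanSpace ℝ (Fin (2 * n + 1)) × ℝ × ℝ) (𝓡 (2 * n + 3))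
      (O.polarChart ζ b₀) x (v, ρ, t) =
    O.dcollar ((extChartAt (𝓡 (2 * n + 1)) b₀).symm x.1) (polarPt ζ x.2.1 x.2.2)
      (mfderiv (𝓡 (2 * n + 1)) (𝓡 (2 * n + 1)) (extChartAt (𝓡 (2 * n + 1)) b₀).symm x.1 v)
      (ρ * (ζ * Circle.exp x.2.2 : Circle) + t * (Complex.I * polarPt ζ x.2.1 x.2.2)) := by
  have h1 := ((O.contMDiffAt_collar ((extChartAt (𝓡 (2 * n + 1)) b₀).symm x.1)
    (z := polarPt ζ x.2.1 x.2.2) (by rwa [norm_polarPt])).mdifferentiableAt (by simp)).hasMFDerivAt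
  have h2 : HasMFDerivAt 𝓘(ℝ, EuclideanSpace ℝ (Fin (2 * n + 1)) × ℝ × ℝ) (𝓡 (2 * n + 1))
      (fun x : EuclideanSpace ℝ (Fin (2 * n + 1)) × ℝ × ℝ =>
        (extChartAt (𝓡 (2 * n + 1)) b₀).symm x.1) x _ :=
    HasMFDerivAt.comp x (g := (extChartAt (𝓡 (2 * n + 1)) b₀).symm) (f := Prod.fst)
      ((contMDiffAt_extChartAt_symm' b₀ hx).mdifferentiableAt (by simp)).hasMFDerivAt
      (hasFDerivAt_fst (𝕜 := ℝ) (p := x)).hasMFDerivAt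
  obtain ⟨T, hT, hT'⟩ := hasFDerivAt_polarPt ζ x.2
  have h3 : HasMFDerivAt 𝓘(ℝ, EuclideanSpace ℝ (Fin (2 * n + 1)) × ℝ × ℝ) 𝓘(ℝ, ℂ)
      (fun x : EuclideanSpace ℝ (Fin (2 * n + 1)) × ℝ × ℝ => polarPt ζ x.2.1 x.2.2) x
      (T.comp (.snd ℝ _ _)) :=
    (hT'.comp x (hasFDerivAt_snd (𝕜 := ℝ) (p := x))).hasMFDerivAt
  have h4 := HasMFDerivAt.comp x (g := O.collar) h1 (h2.prodMk h3)
  refine (congrArg (fun S : EuclideanSpace ℝ (Fin (2 * n + 1)) × ℝ × ℝ →L[ℝ]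
    EuclideanSpace ℝ (Fin (2 * n + 3)) => S (v, ρ, t)) h4.mfderiv).trans ?_
  exact congrArg (O.dcollar _ _ _) (hT ρ t)

/-- Injectivity holds because polar coordinates are regular for `r ≠ 0`; the dimensions `(2n + 1) +
2` and `2n + 3` agree. -/
lemma bijective_mfderiv_polarChart (hx : x.1 ∈ (extChartAt (𝓡 (2 * n + 1)) b₀).target)
    (hr : |x.2.1| < 1) (h0 : x.2.1 ≠ 0) :
    Function.Bijective (mfderiv 𝓘(ℝ, EuclideanSpace ℝ (Fin (2 * n + 1)) × ℝ × ℝ) (𝓡 (2 * n + 3))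
      (O.polarChart ζ b₀) x) := by
  have hinj : Function.Injective (mfderiv 𝓘(ℝ, EuclideanSpace ℝ (Fin (2 * n + 1)) × ℝ × ℝ)
      (𝓡 (2 * n + 3)) (O.polarChart ζ b₀) x) := by
    refine (injective_iff_map_eq_zero _).2 ?_
    rintro ⟨v, ρ, t⟩ h
    obtain ⟨h1, h2⟩ := O.dcollar_eq_zero _ (by rwa [norm_polarPt])
      ((O.mfderiv_polarChart ζ b₀ hx hr v ρ t).symm.trans h)
    obtain ⟨rfl, rfl⟩ := polar_vector_eq_zero ζ h0 h2
    have h3 : v = 0 := (bijective_mfderiv_extChartAt_symm b₀ hx).1 (h1.trans (map_zero _).symm)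
    rw [h3]; rfl
  refine ⟨hinj, ?_⟩
  have hd : Module.finrank ℝ (EuclideanSpace ℝ (Fin (2 * n + 1)) × ℝ × ℝ) =
      Module.finrank ℝ (EuclideanSpace ℝ (Fin (2 * n + 3))) := by simp
  exact (LinearMap.injective_iff_surjective_of_finrank_eq_finrank
    (f := (mfderiv 𝓘(ℝ, EuclideanSpace ℝ (Fin (2 * n + 1)) × ℝ × ℝ)
      (𝓡 (2 * n + 3)) (O.polarChart ζ b₀) x : EuclideanSpace ℝ (Fin (2 * n + 1)) × ℝ × ℝ →L[ℝ]
        EuclideanSpace ℝ (Fin (2 * n + 3))).toLinearMap) hd).1 hinj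

/-- In polar coordinates the projection is `ζ e^{iθ}`, so the angular form is the differential of
the last coordinate. -/
lemma dthetaForm_polarChart [CompactSpace B] [T2Space Y]
    (hx : x.1 ∈ (extChartAt (𝓡 (2 * n + 1)) b₀).target)
    (h0 : 0 < x.2.1) (hr : x.2.1 < 1) (v : EuclideanSpace ℝ (Fin (2 * n + 1))) (ρ t : ℝ) :
    O.dthetaForm.pull (O.polarChart ζ b₀) x (v, ρ, t) = t := by
  have hr' : |x.2.1| < 1 := by rwa [abs_of_pos h0]
  have hb : O.polarChart ζ b₀ x ∉ O.binding := by
    rw [polarChart, O.collar_mem_binding_iff _ (by rwa [norm_polarPt]), ← norm_eq_zero,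
      norm_polarPt, abs_of_pos h0]
    exact h0.ne'
  rw [O.dthetaForm_pull ((O.contMDiffAt_polarChart ζ b₀ hx hr').mdifferentiableAt (by simp)) hb]
  have e : (fun y => (O.proj (O.polarChart ζ b₀ y) : ℂ)) =ᶠ[𝓝 x] fun y => polarPt ζ 1 y.2.2 := by
    have hc : ContinuousAt (fun y : EuclideanSpace ℝ (Fin (2 * n + 1)) × ℝ × ℝ => y.2.1) x := by
      fun_prop
    filter_upwards [hc.eventually_mem (Ioo_mem_nhds h0 hr)] with y hy
    rw [polarChart, O.proj_polarPt ζ _ _ hy.1 hy.2, polarPt, Complex.ofReal_one, one_mul]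
  obtain ⟨T, hT, hT'⟩ := hasFDerivAt_polarPt ζ (1, x.2.2)
  have h1 : HasFDerivAt (fun y : EuclideanSpace ℝ (Fin (2 * n + 1)) × ℝ × ℝ => ((1 : ℝ), y.2.2))
      ((0 : EuclideanSpace ℝ (Fin (2 * n + 1)) × ℝ × ℝ →L[ℝ] ℝ).prod
        ((ContinuousLinearMap.snd ℝ ℝ ℝ).comp (.snd ℝ _ _))) x :=
    (hasFDerivAt_const _ _).prodMk
      (((ContinuousLinearMap.snd ℝ ℝ ℝ).hasFDerivAt (x := x.2)).comp x (hasFDerivAt_snd (𝕜 := ℝ)))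
  have h2 := (hT'.comp x h1).congr_of_eventuallyEq e
  rw [h2.fderiv, e.eq_of_nhds]
  have h3 : (T.comp ((0 : EuclideanSpace ℝ (Fin (2 * n + 1)) × ℝ × ℝ →L[ℝ] ℝ).prod
        ((ContinuousLinearMap.snd ℝ ℝ ℝ).comp (.snd ℝ _ _)))) (v, ρ, t) = T (0, t) := rfl
  change (conj (polarPt ζ 1 x.2.2) * (T.comp _) (v, ρ, t)).im = t
  rw [h3, hT]
  have := conj_polarPt_mul ζ 1 x.2.2 0 t
  simpa using this

end PolarChart

section BindingForm

variable [IsManifold (𝓡 (2 * n + 1)) ∞ B]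
  {α : OneForm (EuclideanSpace ℝ (Fin (2 * n + 3))) Y}

lemma bindingForm_inChart (b₀ : B) {y : EuclideanSpace ℝ (Fin (2 * n + 1))}
    (hy : y ∈ (extChartAt (𝓡 (2 * n + 1)) b₀).target) :
    (O.bindingForm α).inChart b₀ y =
      α.pull (fun y => O.collar ((extChartAt (𝓡 (2 * n + 1)) b₀).symm y, 0)) y := by
  have h0 : MDifferentiableAt (𝓡 (2 * n + 1)) (𝓡 (2 * n + 3)) (fun b : B => O.collar (b, 0))
      ((extChartAt (𝓡 (2 * n + 1)) b₀).symm y) := by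
    refine ContMDiffAt.mdifferentiableAt (n := ∞) ?_ (by simp)
    exact ContMDiffAt.comp _ (g := O.collar) (f := fun b : B => (b, (0 : ℂ)))
      (O.contMDiffAt_collar _ (by simp)) (contMDiffAt_id.prodMk contMDiffAt_const)
  have h1 := HasMFDerivAt.comp y (g := fun b : B => O.collar (b, 0)) h0.hasMFDerivAt
    ((contMDiffAt_extChartAt_symm' b₀ hy).mdifferentiableAt (by simp)).hasMFDerivAt
  have h2 : mfderiv (𝓡 (2 * n + 1)) (𝓡 (2 * n + 3))
    (fun y => O.collar ((extChartAt (𝓡 (2 * n + 1)) b₀).symm y, 0)) y = _ := h1.mfderiv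
  refine ContinuousLinearMap.ext fun u => ?_
  exact (congrArg (fun T : EuclideanSpace ℝ (Fin (2 * n + 1)) →L[ℝ]
    EuclideanSpace ℝ (Fin (2 * n + 3)) => α (O.collar ((extChartAt (𝓡 (2 * n + 1)) b₀).symm y, 0))
      (T u)) h2).symm

lemma smoothAt_bindingForm [IsManifold (𝓡 (2 * n + 3)) ∞ Y] (hα : ∀ x, α.SmoothAt x) (b : B) : (O.bindingForm α).SmoothAt b := by
  have h1 : ContMDiffAt (𝓡 (2 * n + 1)) (𝓡 (2 * n + 3)) ∞
      (fun y => O.collar ((extChartAt (𝓡 (2 * n + 1)) b).symm y, 0))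
      (extChartAt (𝓡 (2 * n + 1)) b b) :=
    ContMDiffAt.comp _ (g := O.collar)
      (f := fun y => ((extChartAt (𝓡 (2 * n + 1)) b).symm y, (0 : ℂ)))
      (O.contMDiffAt_collar _ (by simp))
      ((contMDiffAt_extChartAt_symm' b (mem_extChartAt_target b)).prodMk contMDiffAt_const)
  refine ContDiffAt.congr_of_eventuallyEq ((hα _).contDiffAt_pull h1) ?_
  filter_upwards [extChartAt_target_mem_nhds (I := 𝓡 (2 * n + 1)) b] with y hy
  exact O.bindingForm_inChart b hy

variable {A : B × ℂ → ℝ}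

lemma HasNormalForm.pull_polarChart (hA : O.HasNormalForm α A) (ζ : Circle) (b₀ : B)
    {x : EuclideanSpace ℝ (Fin (2 * n + 1)) × ℝ × ℝ}
    (hx : x.1 ∈ (extChartAt (𝓡 (2 * n + 1)) b₀).target)
    (hr : |x.2.1| < 1) (v : EuclideanSpace ℝ (Fin (2 * n + 1))) (ρ t : ℝ) :
    α.pull (O.polarChart ζ b₀) x (v, ρ, t) =
      A ((extChartAt (𝓡 (2 * n + 1)) b₀).symm x.1, polarPt ζ x.2.1 x.2.2) *
        ((O.bindingForm α).inChart b₀ x.1 v + x.2.1 ^ 2 * t) := by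
  have h1 := O.mfderiv_polarChart ζ b₀ hx hr v ρ t
  refine (congrArg (α _) h1).trans ((hA.2 _ _ (by rwa [norm_polarPt]) _ _).trans ?_)
  rw [conj_polarPt_mul]
  rfl

end BindingForm

end ConcreteOpenBook

lemma hasDerivAt_polarPt (ζ : Circle) (r θ : ℝ) :
    HasDerivAt (fun s : ℝ => polarPt ζ s θ) (ζ * Circle.exp θ : Circle) r := by
  have h1 : HasDerivAt (fun s : ℝ => (s : ℂ)) 1 r := Complex.ofRealCLM.hasDerivAt
  have h2 := h1.mul_const ((ζ * Circle.exp θ : Circle) : ℂ)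
  rw [one_mul] at h2
  exact h2

/-! ### The exterior derivative of `F a + G dθ`. -/

section FormDPolar

variable {E : Type*} [NormedAddCommGroup E] [NormedSpace ℝ E]

/-- The `1`-form `F a + G dθ` on `E × ℝ × ℝ`, with coordinates `(w, r, θ)`, where `a` is a `1`-form
on `E`. -/
def polarForm (F G : E × ℝ × ℝ → ℝ) (a : E → E →L[ℝ] ℝ) (x : E × ℝ × ℝ) : E × ℝ × ℝ →L[ℝ] ℝ :=
  F x • (a x.1).comp (.fst ℝ E (ℝ × ℝ)) +
    G x • (ContinuousLinearMap.snd ℝ ℝ ℝ).comp (.snd ℝ E (ℝ × ℝ))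

lemma polarForm_apply (F G : E × ℝ × ℝ → ℝ) (a : E → E →L[ℝ] ℝ) (x : E × ℝ × ℝ) (v : E) (ρ t : ℝ) :
    polarForm F G a x (v, ρ, t) = F x * a x.1 v + G x * t := by
  simp [polarForm]

lemma formD_polarForm {F G : E × ℝ × ℝ → ℝ} {a : E → E →L[ℝ] ℝ} {x : E × ℝ × ℝ}
    {F' G' : E × ℝ × ℝ →L[ℝ] ℝ} (hF : HasFDerivAt F F' x) (hG : HasFDerivAt G G' x)
    (ha : DifferentiableAt ℝ a x.1) (v v' : E) (ρ ρ' t t' : ℝ) :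
    formD (polarForm F G a) x (v, ρ, t) (v', ρ', t') =
      F' (v, ρ, t) * a x.1 v' - F' (v', ρ', t') * a x.1 v + F x * formD a x.1 v v' +
        (G' (v, ρ, t) * t' - G' (v', ρ', t') * t) := by
  have h1 : HasFDerivAt (fun y : E × ℝ × ℝ => a y.1) ((fderiv ℝ a x.1).comp (.fst ℝ E (ℝ × ℝ))) x :=
    ha.hasFDerivAt.comp x hasFDerivAt_fst
  have h2 := hF.smul (h1.clm_comp (hasFDerivAt_const (.fst ℝ E (ℝ × ℝ)) x))
  have h3 := hG.smul (hasFDerivAt_const ((ContinuousLinearMap.snd ℝ ℝ ℝ).comp (.snd ℝ E (ℝ × ℝ))) x)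
  have h4 : fderiv ℝ (polarForm F G a) x = _ := (h2.add h3).fderiv
  rw [formD, h4]
  simp [formD]
  ring

end FormDPolar

/-! ### Expansion of a function at a nondegenerate maximum. -/

section RadialFunction

lemma contDiffAt_dslope_zero' {h : ℝ → ℝ} (hh : ContDiffOn ℝ ∞ h (Ioo (-1) 1)) {r : ℝ}
    (hr : r ∈ Ioo (-1 : ℝ) 1) : ContDiffAt ℝ ∞ (dslope h 0) r := by
  have h1 : ContDiffOn ℝ ∞ (fun p : ℝ × ℝ => h p.2) (univ ×ˢ Ioo (-1) 1) :=
    hh.comp contDiffOn_snd fun p hp => hp.2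
  have h2 := contDiffAt_dslope_zero (V := ℝ) (v := 0) (r := r) (isOpen_univ.prod isOpen_Ioo) h1
    ⟨mem_univ _, by norm_num, by norm_num⟩ ⟨mem_univ _, hr⟩
  exact h2.comp r (contDiffAt_const.prodMk contDiffAt_id)

/-- A function of one variable with nondegenerate maximum at `0` and no other critical point. -/
lemma exists_radial_expansion {h : ℝ → ℝ} (hh : ContDiffOn ℝ ∞ h (Ioo (-1) 1)) (h1 : h 0 = 1)
    (hd0 : deriv h 0 = 0) (hd : ∀ r ∈ Ioo (-1 : ℝ) 1, r ≠ 0 → deriv h r ≠ 0)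
    (hdd : deriv (deriv h) 0 < 0) {q : ℝ → ℝ} (hq : q = dslope (dslope h 0) 0) {r : ℝ}
    (hr : r ∈ Ioo (-1 : ℝ) 1) :
    h r = 1 + r ^ 2 * q r ∧ DifferentiableAt ℝ q r ∧
      HasDerivAt h (r * (2 * q r + r * deriv q r)) r ∧ 2 * q r + r * deriv q r < 0 := by
  have hs1 : ∀ r ∈ Ioo (-1 : ℝ) 1, ContDiffAt ℝ ∞ (dslope h 0) r := fun r hr =>
    contDiffAt_dslope_zero' hh hr
  have hsq : ∀ r ∈ Ioo (-1 : ℝ) 1, ContDiffAt ℝ ∞ q r := fun r hr => by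
    rw [hq]
    exact contDiffAt_dslope_zero' (fun r hr => (hs1 r hr).contDiffWithinAt) hr
  have he : ∀ r, h r = 1 + r ^ 2 * q r := by
    intro r
    have e1 := sub_smul_dslope h 0 r
    have e2 := sub_smul_dslope (dslope h 0) 0 r
    rw [← hq, dslope_same, hd0] at e2
    simp only [smul_eq_mul, sub_zero] at e1 e2
    rw [← e2, h1] at e1
    linarith
  have hdq : ∀ r ∈ Ioo (-1 : ℝ) 1, HasDerivAt h (r * (2 * q r + r * deriv q r)) r := by
    intro r hr
    have e1 : HasDerivAt (fun r => 1 + r ^ 2 * q r) (2 * r * q r + r ^ 2 * deriv q r) r := by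
      have e0 : HasDerivAt (fun r : ℝ => r ^ 2) (2 * r) r := by simpa using hasDerivAt_pow 2 r
      exact (e0.mul ((hsq r hr).differentiableAt (by simp)).hasDerivAt).const_add 1
    rw [show h = fun r => 1 + r ^ 2 * q r from funext he]
    convert e1 using 1; ring
  have hcont : ContinuousOn (fun r => 2 * q r + r * deriv q r) (Ioo (-1) 1) := fun r hr => by
    have e1 : ContinuousAt (deriv q) r := ((hsq r hr).fderiv_right (m := ∞) le_rfl).continuousAt.clm_apply
      continuousAt_const
    exact (((hsq r hr).continuousAt.const_mul 2).add (continuousAt_id.mul e1)).continuousWithinAt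
  have h0 : (0 : ℝ) ∈ Ioo (-1 : ℝ) 1 := by norm_num
  -- `2 q + r q'` is continuous and is the difference quotient of `h'` at `0`, so its value at `0`
  -- is `h''(0)`.
  have hden0 : 2 * q 0 + 0 * deriv q 0 < 0 := by
    have e1 : deriv h =ᶠ[𝓝 0] fun r => r * (2 * q r + r * deriv q r) := by
      filter_upwards [Ioo_mem_nhds h0.1 h0.2] with r hr using (hdq r hr).deriv
    have e2 : HasDerivAt (fun r => r * (2 * q r + r * deriv q r)) (2 * q 0 + 0 * deriv q 0) 0 := by
      have e3 : ContinuousAt (fun r => 2 * q r + r * deriv q r) 0 :=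
        hcont.continuousAt (Ioo_mem_nhds h0.1 h0.2)
      rw [hasDerivAt_iff_tendsto_slope]
      refine (e3.tendsto.mono_left nhdsWithin_le_nhds).congr' ?_
      filter_upwards [self_mem_nhdsWithin] with r hr
      have hr0 : r ≠ 0 := hr
      rw [slope_def_field]
      field_simp
      ring
    rw [← e2.deriv, ← e1.deriv_eq]
    exact hdd
  refine ⟨he r, (hsq r hr).differentiableAt (by simp), hdq r hr, ?_⟩
  -- A change of sign would produce a zero by the intermediate value theorem. It cannot be at `0`,
  -- and elsewhere it would be a critical point of `h`.
  by_contra hcon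
  have hpre : IsPreconnected (Ioo (-1 : ℝ) 1) := isPreconnected_Ioo
  obtain ⟨c, hc, hc0⟩ := hpre.intermediate_value h0 hr hcont ⟨hden0.le, not_lt.1 hcon⟩
  have hc0' : 2 * q c + c * deriv q c = 0 := hc0
  rcases eq_or_ne c 0 with rfl | hne
  · exact hden0.ne hc0'
  · exact hd c hc hne (by rw [(hdq c hc).deriv, hc0', mul_zero])

end RadialFunction

/-! ### The conformal factor `A` near the binding. -/

section NormalForm

variable {n : ℕ}
  {Y : Type*} [TopologicalSpace Y] [ChartedSpace (EuclideanSpace ℝ (Fin (2 * n + 3))) Y]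
  [IsManifold (𝓡 (2 * n + 3)) ∞ Y] [CompactSpace Y] [T2Space Y]
  {B : Type*} [TopologicalSpace B] [ChartedSpace (EuclideanSpace ℝ (Fin (2 * n + 1))) B]
  [IsManifold (𝓡 (2 * n + 1)) ∞ B] [CompactSpace B] [T2Space B]

/-- The standing assumptions: a Giroux form in normal form near the binding, with negative definite
normal Hessian. -/
structure ConcaveGirouxForm (O : ConcreteOpenBook n Y B)
    (α : OneForm (EuclideanSpace ℝ (Fin (2 * n + 3))) Y) (A : B × ℂ → ℝ) : Prop where
  giroux : O.IsGirouxForm α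
  normalForm : O.HasNormalForm α A
  hessian : ∀ (b : B) (w : ℂ), w ≠ 0 → fderiv ℝ (fderiv ℝ (fun z : ℂ => A (b, z))) 0 w w < 0

namespace ConcaveGirouxForm

variable {O : ConcreteOpenBook n Y B} {α : OneForm (EuclideanSpace ℝ (Fin (2 * n + 3))) Y}
  {A : B × ℂ → ℝ} (h : ConcaveGirouxForm O α A)
include h

lemma smoothAt (x : Y) : α.SmoothAt x := h.giroux.smooth.smoothAt isOpen_univ (mem_univ x)

lemma nondegenerateOnKer (x : Y) :
    NondegenerateOnKer (E := EuclideanSpace ℝ (Fin (2 * n + 3))) (α.dCLM x) (α x) :=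
  OneForm.nondegenerateOnKer (h.giroux.contact x).2 (h.giroux.contact x).1

lemma dthetaForm_ne_zero {x : Y} (hx : x ∉ O.binding) : O.dthetaForm x ≠ 0 := by
  intro h0
  have h1 := (h.nondegenerateOnKer x).solveOnKer_one_zero
  have h2 := h.giroux.positive x hx _ ⟨h1.1, h1.2⟩
  exact lt_irrefl _ (h2.trans_eq
    (congrArg (fun T : EuclideanSpace ℝ (Fin (2 * n + 3)) →L[ℝ] ℝ => T _) h0))

lemma contMDiffAt_A (b : B) {z : ℂ} (hz : ‖z‖ < 1) :
    ContMDiffAt ((𝓡 (2 * n + 1)).prod 𝓘(ℝ, ℂ)) 𝓘(ℝ, ℝ) ∞ A (b, z) :=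
  h.normalForm.1.contMDiffAt ((isOpen_univ.prod Metric.isOpen_ball).mem_nhds
    ⟨mem_univ _, mem_ball_zero_iff.2 hz⟩)

lemma contDiffAt_chart (b₀ : B) {p : EuclideanSpace ℝ (Fin (2 * n + 1)) × ℂ}
    (hp : p.1 ∈ (extChartAt (𝓡 (2 * n + 1)) b₀).target) (hz : ‖p.2‖ < 1) :
    ContDiffAt ℝ ∞ (fun p : EuclideanSpace ℝ (Fin (2 * n + 1)) × ℂ =>
      A ((extChartAt (𝓡 (2 * n + 1)) b₀).symm p.1, p.2)) p := by
  refine ContMDiffAt.contDiffAt (ContMDiffAt.comp p (g := A)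
    (f := fun p : EuclideanSpace ℝ (Fin (2 * n + 1)) × ℂ =>
      ((extChartAt (𝓡 (2 * n + 1)) b₀).symm p.1, p.2)) (h.contMDiffAt_A _ hz) ?_)
  refine ContMDiffAt.prodMk ?_ contDiffAt_snd.contMDiffAt
  exact ContMDiffAt.comp p (g := (extChartAt (𝓡 (2 * n + 1)) b₀).symm) (f := Prod.fst)
      (contMDiffAt_extChartAt_symm' b₀ hp) contDiffAt_fst.contMDiffAt

lemma contDiffAt_fibre (b : B) {z : ℂ} (hz : ‖z‖ < 1) :
    ContDiffAt ℝ ∞ (fun z : ℂ => A (b, z)) z := by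
  refine ContMDiffAt.contDiffAt (ContMDiffAt.comp z (g := A) (f := fun z : ℂ => (b, z))
    (h.contMDiffAt_A _ hz) ?_)
  exact contMDiffAt_const.prodMk contMDiffAt_id

/-- At a zero of `A` the normal form would make the contact form vanish. -/
lemma A_ne_zero (b : B) {z : ℂ} (hz : ‖z‖ < 1) : A (b, z) ≠ 0 := by
  intro h0
  refine (h.giroux.contact (O.collar (b, z))).1 (ContinuousLinearMap.ext fun u => ?_)
  obtain ⟨v, w, rfl⟩ := O.dcollar_surjective b hz u
  rw [h.normalForm.2 b z hz, h0, zero_mul]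
  rfl

/-- On vectors tangent to the binding at `z = 0` the normal form reads `α_B = A α_B`, and `α_B` is
nonzero. -/
lemma A_zero (b : B) : A (b, 0) = 1 := by
  have h1 := (h.giroux.contact_binding b).1
  obtain ⟨v, hv⟩ : ∃ v, O.bindingForm α b v ≠ 0 := by
    by_contra! hcon
    exact h1 (ContinuousLinearMap.ext hcon)
  have h2 := h.normalForm.2 b 0 (by simp) v 0
  have h3 : α (O.collar (b, 0)) (O.dcollar b 0 v 0) = O.bindingForm α b v := by
    have d1 := ((O.contMDiffAt_collar b (z := 0) (by simp)).mdifferentiableAt (by simp)).hasMFDerivAt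
    have d2 : HasMFDerivAt (𝓡 (2 * n + 1)) ((𝓡 (2 * n + 1)).prod 𝓘(ℝ, ℂ)) (fun b : B => (b, (0 : ℂ)))
        b _ := (hasMFDerivAt_id b).prodMk (hasMFDerivAt_const (0 : ℂ) b)
    have d3 := (HasMFDerivAt.comp b (g := O.collar) d1 d2).mfderiv
    exact (congrArg (fun T : EuclideanSpace ℝ (Fin (2 * n + 1)) →L[ℝ]
      EuclideanSpace ℝ (Fin (2 * n + 3)) => α (O.collar (b, 0)) (T v)) d3).symm
  rw [h3] at h2
  simp only [map_zero, zero_mul, Complex.zero_im, add_zero] at h2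
  exact mul_right_cancel₀ hv (by rw [one_mul]; exact h2.symm)

/-- `A` equals `1` at the centre of each disc and has no zero along the ray to `z`. -/
lemma A_pos (b : B) {z : ℂ} (hz : ‖z‖ < 1) : 0 < A (b, z) := by
  have hn : ∀ t ∈ Icc (0 : ℝ) 1, ‖(t : ℂ) * z‖ < 1 := fun t ht => by
    rw [norm_mul, Complex.norm_real, Real.norm_of_nonneg ht.1]
    exact (mul_le_of_le_one_left (norm_nonneg z) ht.2).trans_lt hz
  have hc : ContinuousOn (fun t : ℝ => A (b, t * z)) (Icc 0 1) := fun t ht => by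
    have h1 : ContinuousAt (fun t : ℝ => (t : ℂ) * z) t := by fun_prop
    exact (ContinuousAt.comp (g := fun z : ℂ => A (b, z)) (f := fun t : ℝ => (t : ℂ) * z)
      (h.contDiffAt_fibre b (hn t ht)).continuousAt h1).continuousWithinAt
  by_contra hcon
  have h2 := intermediate_value_Icc' zero_le_one hc
  simp only [Complex.ofReal_zero, zero_mul, Complex.ofReal_one, one_mul, h.A_zero b] at h2
  obtain ⟨t, ht, ht0⟩ := h2 ⟨not_lt.1 hcon, zero_le_one⟩
  exact h.A_ne_zero b (hn t ht) ht0

lemma pull_eventuallyEq (ζ : Circle) (b₀ : B) {x : EuclideanSpace ℝ (Fin (2 * n + 1)) × ℝ × ℝ}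
    (hx : x.1 ∈ (extChartAt (𝓡 (2 * n + 1)) b₀).target) (hr : |x.2.1| < 1) :
    α.pull (O.polarChart ζ b₀) =ᶠ[𝓝 x] polarForm
      (fun x => A ((extChartAt (𝓡 (2 * n + 1)) b₀).symm x.1, polarPt ζ x.2.1 x.2.2))
      (fun x => x.2.1 ^ 2 * A ((extChartAt (𝓡 (2 * n + 1)) b₀).symm x.1, polarPt ζ x.2.1 x.2.2))
      ((O.bindingForm α).inChart b₀) := by
  have h1 : ∀ᶠ y : EuclideanSpace ℝ (Fin (2 * n + 1)) × ℝ × ℝ in 𝓝 x,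
      y.1 ∈ (extChartAt (𝓡 (2 * n + 1)) b₀).target :=
    continuousAt_fst.eventually_mem ((isOpen_extChartAt_target b₀).mem_nhds hx)
  have h2 : ∀ᶠ y : EuclideanSpace ℝ (Fin (2 * n + 1)) × ℝ × ℝ in 𝓝 x, |y.2.1| < 1 := by
    have hc : ContinuousAt (fun y : EuclideanSpace ℝ (Fin (2 * n + 1)) × ℝ × ℝ => |y.2.1|) x := by
      fun_prop
    exact hc.eventually_mem (Iio_mem_nhds hr)
  filter_upwards [h1, h2] with y hy1 hy2
  refine ContinuousLinearMap.ext ?_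
  rintro ⟨v, ρ, t⟩
  rw [h.normalForm.pull_polarChart O ζ b₀ hy1 hy2, polarForm_apply]
  ring

lemma contDiffAt_A_polar (ζ : Circle) (b₀ : B) {x : EuclideanSpace ℝ (Fin (2 * n + 1)) × ℝ × ℝ}
    (hx : x.1 ∈ (extChartAt (𝓡 (2 * n + 1)) b₀).target) (hr : |x.2.1| < 1) :
    ContDiffAt ℝ ∞ (fun x : EuclideanSpace ℝ (Fin (2 * n + 1)) × ℝ × ℝ =>
      A ((extChartAt (𝓡 (2 * n + 1)) b₀).symm x.1, polarPt ζ x.2.1 x.2.2)) x :=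
  ContDiffAt.comp x (g := fun p : EuclideanSpace ℝ (Fin (2 * n + 1)) × ℂ =>
      A ((extChartAt (𝓡 (2 * n + 1)) b₀).symm p.1, p.2))
    (f := fun x : EuclideanSpace ℝ (Fin (2 * n + 1)) × ℝ × ℝ => (x.1, polarPt ζ x.2.1 x.2.2))
    (h.contDiffAt_chart b₀ (p := (x.1, polarPt ζ x.2.1 x.2.2)) hx (by rwa [norm_polarPt]))
    (contDiffAt_fst.prodMk ((contDiff_polarPt ζ).contDiffAt.comp x contDiffAt_snd))

lemma differentiableAt_bindingForm (b₀ : B) {y : EuclideanSpace ℝ (Fin (2 * n + 1))}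
    (hy : y ∈ (extChartAt (𝓡 (2 * n + 1)) b₀).target) :
    ContDiffAt ℝ ∞ ((O.bindingForm α).inChart b₀) y :=
  ((O.smoothAt_bindingForm h.smoothAt _).contDiffAt_pull (contMDiffAt_extChartAt_symm' b₀ hy) :)

/-- On a page `α` is `A α_B`, so contracting `dα` with `∂_r` gives `(∂_r A) α_B`. If `∂_r A`
vanished, the nonzero vector `∂_r` would lie in the kernel of `dα` on the page. -/
lemma fderiv_A_ne_zero (b : B) {z : ℂ} (h0 : z ≠ 0) (hz : ‖z‖ < 1) :
    fderiv ℝ (fun z : ℂ => A (b, z)) z z ≠ 0 := by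
  intro hcon
  obtain ⟨θ, -, hθ⟩ := exists_polarPt 1 z
  set r := ‖z‖ with hr
  have hr0 : 0 < r := norm_pos_iff.2 h0
  set e := extChartAt (𝓡 (2 * n + 1)) b
  set x : EuclideanSpace ℝ (Fin (2 * n + 1)) × ℝ × ℝ := (e b, r, θ) with hxdef
  have hx : x.1 ∈ e.target := mem_extChartAt_target b
  have heb : e.symm (e b) = b := extChartAt_to_inv b
  have hr1 : |x.2.1| < 1 := by rwa [hxdef, abs_of_pos hr0]
  have hφ := O.contMDiffAt_polarChart 1 b hx hr1
  have hbind : O.polarChart 1 b x ∉ O.binding := by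
    rw [ConcreteOpenBook.polarChart, O.collar_mem_binding_iff _ (by rwa [norm_polarPt]),
      ← norm_eq_zero, norm_polarPt, abs_eq_zero]
    exact hr0.ne'
  have hF := ((h.contDiffAt_A_polar 1 b hx hr1).differentiableAt (by simp)).hasFDerivAt
  set F := fun x : EuclideanSpace ℝ (Fin (2 * n + 1)) × ℝ × ℝ =>
      A ((extChartAt (𝓡 (2 * n + 1)) b).symm x.1, polarPt 1 x.2.1 x.2.2) with hFdef
  have hG : HasFDerivAt (fun x : EuclideanSpace ℝ (Fin (2 * n + 1)) × ℝ × ℝ => x.2.1 ^ 2 * F x)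
      _ x := ((hasFDerivAt_id (𝕜 := ℝ) x).snd.fst.pow 2).mul hF
  have hrad : fderiv ℝ F x (0, 1, 0) = 0 := by
    have d1 : HasDerivAt (fun s : ℝ => F (e b, s, θ)) (fderiv ℝ F x (0, 1, 0)) r :=
      HasFDerivAt.comp_hasDerivAt r (l := F) (f := fun s : ℝ => (e b, s, θ)) hF
        ((hasDerivAt_const r (e b)).prodMk ((hasDerivAt_id r).prodMk (hasDerivAt_const r θ)))
    have d2 : HasDerivAt (fun s : ℝ => A (b, polarPt 1 s θ))
        (fderiv ℝ (fun z : ℂ => A (b, z)) z ((1 : Circle) * Circle.exp θ : Circle)) r := by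
      have d3 := ((h.contDiffAt_fibre b hz).differentiableAt (by simp)).hasFDerivAt
      have d4 : HasDerivAt (fun s : ℝ => polarPt 1 s θ) ((1 : Circle) * Circle.exp θ : Circle) r :=
        hasDerivAt_polarPt 1 r θ
      rw [← hθ] at d3
      rw [← hθ]
      exact HasFDerivAt.comp_hasDerivAt r (f := fun s : ℝ => polarPt 1 s θ) d3 d4
    have e1 : (fun s : ℝ => F (e b, s, θ)) = fun s : ℝ => A (b, polarPt 1 s θ) := by
      ext s
      change A (e.symm (e b), _) = _
      rw [heb]
    rw [e1] at d1
    rw [d1.unique d2]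
    have e2 : z = r • (((1 : Circle) * Circle.exp θ : Circle) : ℂ) := by
      conv_lhs => rw [← hθ, polarPt]
      simp
    have e3 : r • fderiv ℝ (fun z : ℂ => A (b, z)) z (((1 : Circle) * Circle.exp θ : Circle) : ℂ) = 0 := by
      rw [← map_smul, ← e2]; exact hcon
    exact (smul_eq_zero.1 e3).resolve_left hr0.ne'
  have hnd := OneForm.nondegenerateOnKer_pull (τ := O.dthetaForm) (h.smoothAt _) hφ
    (O.bijective_mfderiv_polarChart 1 b hx hr1 hr0.ne')
    (h.giroux.symplectic_pages _ hbind) (h.dthetaForm_ne_zero hbind)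
  have hzero := hnd.eq_zero (0, 1, 0)
    (O.dthetaForm_polarChart 1 b hx hr0 (by simpa [hxdef] using hz) 0 1 0) (by
    rintro ⟨w, ρ, t⟩ hw
    have ht : t = 0 :=
      (O.dthetaForm_polarChart 1 b hx hr0 (by simpa [hxdef] using hz) w ρ t).symm.trans hw
    rw [formDCLM_apply, formD_congr (h.pull_eventuallyEq 1 b hx hr1),
      formD_polarForm hF hG ((h.differentiableAt_bindingForm b hx).differentiableAt (by simp)), hrad, ht]
    simp [formD])
  have := congrArg (fun p : EuclideanSpace ℝ (Fin (2 * n + 1)) × ℝ × ℝ => p.2.1) hzero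
  exact one_ne_zero this

/-- If the derivative at `0` were positive on some `u`, the radial derivative of `A` would have
opposite signs at `t u` and `-t u` for small `t > 0`. It would then vanish somewhere on the half
circle joining them, against `fderiv_A_ne_zero`. -/
lemma fderiv_A_zero (b : B) : fderiv ℝ (fun z : ℂ => A (b, z)) 0 = 0 := by
  set G := fun z : ℂ => A (b, z)
  have hG : ∀ {z : ℂ}, ‖z‖ < 1 → ContinuousAt (fderiv ℝ G) z := fun hz =>
    ((h.contDiffAt_fibre b hz).fderiv_right (m := ∞) le_rfl).continuousAt
  by_contra hcon
  obtain ⟨u, hu⟩ : ∃ u, 0 < fderiv ℝ G 0 u := by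
    obtain ⟨u, hu⟩ := DFunLike.ne_iff.1 hcon
    rcases lt_or_gt_of_ne hu with h1 | h1
    · exact ⟨-u, by rw [map_neg]; simpa using h1⟩
    · exact ⟨u, h1⟩
  have hu0 : u ≠ 0 := by rintro rfl; simp at hu
  have h1 : ∀ᶠ t : ℝ in 𝓝 0, ‖(t : ℂ) * u‖ < 1 ∧ 0 < fderiv ℝ G (t * u) u ∧
      0 < fderiv ℝ G (-(t * u)) u := by
    have c1 : ContinuousAt (fun t : ℝ => (t : ℂ) * u) 0 := by fun_prop
    have c2 : ContinuousAt (fun t : ℝ => -((t : ℂ) * u)) 0 := by fun_prop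
    have c3 : ContinuousAt (fun t : ℝ => fderiv ℝ G (t * u) u) 0 :=
      (ContinuousAt.comp (g := fderiv ℝ G) (hG (by simp)) c1).clm_apply continuousAt_const
    have c4 : ContinuousAt (fun t : ℝ => fderiv ℝ G (-(t * u)) u) 0 :=
      (ContinuousAt.comp (g := fderiv ℝ G) (hG (by simp)) c2).clm_apply continuousAt_const
    refine (c1.norm.eventually_mem (Iio_mem_nhds (by simp))).and
      ((c3.eventually_mem (Ioi_mem_nhds (by simpa using hu))).and
        (c4.eventually_mem (Ioi_mem_nhds (by simpa using hu))))
  obtain ⟨t, ht0, h2, h3, h4⟩ : ∃ t : ℝ, 0 < t ∧ ‖(t : ℂ) * u‖ < 1 ∧ 0 < fderiv ℝ G (t * u) u ∧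
      0 < fderiv ℝ G (-(t * u)) u := by
    obtain ⟨ε, hε, hb⟩ := Metric.eventually_nhds_iff.1 h1
    exact ⟨ε / 2, by positivity, hb (by simp [abs_of_pos hε, hε])⟩
  set c : ℝ → ℂ := fun φ => t * u * Complex.exp (φ * Complex.I) with hc
  have hcn : ∀ φ, ‖c φ‖ = ‖(t : ℂ) * u‖ := fun φ => by
    rw [hc]; simp [Complex.norm_exp_ofReal_mul_I]
  have hcc : Continuous c := by rw [hc]; fun_prop
  have hcont : ContinuousOn (fun φ => fderiv ℝ G (c φ) (c φ)) (Icc 0 Real.pi) := fun φ _ =>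
    ((ContinuousAt.comp (g := fderiv ℝ G) (hG (by rw [hcn]; exact h2))
      hcc.continuousAt).clm_apply hcc.continuousAt).continuousWithinAt
  have h5 := intermediate_value_Icc' Real.pi_pos.le hcont
  have e0 : c 0 = t • u := by simp [hc]
  have e1 : c Real.pi = -(t • u) := by simp [hc, Complex.exp_pi_mul_I]
  have h6 : (0 : ℝ) ∈ Icc (fderiv ℝ G (c Real.pi) (c Real.pi)) (fderiv ℝ G (c 0) (c 0)) := by
    have e2 : (t : ℂ) * u = t • u := by simp
    rw [e2] at h3 h4
    rw [e0, e1, map_neg, map_smul, map_smul, smul_eq_mul, smul_eq_mul]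
    exact ⟨by nlinarith, by positivity⟩
  obtain ⟨φ, -, hφ⟩ := h5 h6
  refine h.fderiv_A_ne_zero b (z := c φ) ?_ (by rw [hcn]; exact h2) hφ
  rw [← norm_pos_iff, hcn, norm_pos_iff]
  exact mul_ne_zero (by exact_mod_cast ht0.ne') hu0

end ConcaveGirouxForm

end NormalForm

/-! ### The logarithmic cutoff. -/

section Cutoff

lemma exists_bound_deriv_smoothTransition : ∃ K > 0, ∀ x, |deriv Real.smoothTransition x| ≤ K := by
  have hc : Continuous (deriv Real.smoothTransition) :=
    (Real.smoothTransition.contDiff (n := 1)).continuous_deriv le_rfl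
  obtain ⟨K, hK⟩ := isCompact_Icc.exists_bound_of_continuousOn (s := Icc (0 : ℝ) 1) hc.continuousOn
  refine ⟨max K 1, lt_max_of_lt_right one_pos, fun x => ?_⟩
  rcases lt_or_ge x 0 with h0 | h0
  · have : Real.smoothTransition =ᶠ[𝓝 x] fun _ => 0 := by
      filter_upwards [Iio_mem_nhds h0] with y hy using
        Real.smoothTransition.zero_of_nonpos (le_of_lt hy)
    rw [this.deriv_eq]; simp
  rcases lt_or_ge 1 x with h1 | h1
  · have : Real.smoothTransition =ᶠ[𝓝 x] fun _ => 1 := by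
      filter_upwards [Ioi_mem_nhds h1] with y hy using
        Real.smoothTransition.one_of_one_le (le_of_lt hy)
    rw [this.deriv_eq]; simp
  · exact (hK x ⟨h0, h1⟩).trans (le_max_left _ _)

/-- A cutoff function, equal to `1` near `0` and to `0` for `ρ ≤ r`, whose derivative is bounded by a
multiple of `δ / r`. -/
def logCutoff (δ ρ r : ℝ) : ℝ := Real.smoothTransition (δ * Real.log (ρ / r))

variable {δ ρ r : ℝ}

lemma logCutoff_mem (δ ρ r : ℝ) : logCutoff δ ρ r ∈ Icc (0 : ℝ) 1 :=
  ⟨Real.smoothTransition.nonneg _, Real.smoothTransition.le_one _⟩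

lemma logCutoff_eq_zero (hδ : 0 < δ) (hρ : 0 < ρ) (hr : ρ ≤ r) : logCutoff δ ρ r = 0 :=
  Real.smoothTransition.zero_of_nonpos (mul_nonpos_of_nonneg_of_nonpos hδ.le
    (Real.log_nonpos (div_nonneg hρ.le (hρ.le.trans hr)) ((div_le_one (hρ.trans_le hr)).2 hr)))

lemma logCutoff_eq_one (hδ : 0 < δ) (h0 : 0 < r) (hr : r ≤ ρ * Real.exp (-δ⁻¹)) :
    logCutoff δ ρ r = 1 := by
  refine Real.smoothTransition.one_of_one_le ?_
  have hρ : 0 < ρ := pos_of_mul_pos_left (h0.trans_le hr) (Real.exp_pos _).le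
  have h1 : Real.exp δ⁻¹ ≤ ρ / r := by
    rw [le_div_iff₀ h0]
    calc Real.exp δ⁻¹ * r ≤ Real.exp δ⁻¹ * (ρ * Real.exp (-δ⁻¹)) := by gcongr
      _ = ρ := by rw [mul_left_comm, ← Real.exp_add]; simp
  have h2 := (Real.le_log_iff_exp_le (div_pos hρ h0)).2 h1
  calc (1 : ℝ) = δ * δ⁻¹ := (mul_inv_cancel₀ hδ.ne').symm
    _ ≤ _ := by gcongr

lemma contDiffAt_logCutoff (hρ : 0 < ρ) (h0 : r ≠ 0) : ContDiffAt ℝ ∞ (logCutoff δ ρ) r := by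
  have h1 : ContDiffAt ℝ ∞ (fun r => δ * Real.log (ρ / r)) r :=
    contDiffAt_const.mul ((contDiffAt_const.div contDiffAt_id h0).log (div_ne_zero hρ.ne' h0))
  exact (Real.smoothTransition.contDiff (n := (⊤ : ℕ∞))).contDiffAt.comp r h1

/-- The logarithm contributes `δ / r` to the derivative. The resulting bound on `r |χ'|` does not
involve `ρ`, so `ρ` may be shrunk later with `δ` fixed. -/
lemma hasDerivAt_logCutoff (hδ : 0 < δ) (hρ : 0 < ρ) (h0 : 0 < r) {K : ℝ}
    (hK : ∀ x, |deriv Real.smoothTransition x| ≤ K) :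
    ∃ c, HasDerivAt (logCutoff δ ρ) c r ∧ |c| * r ≤ δ * K := by
  have h1 : HasDerivAt (fun r => δ * Real.log (ρ / r)) (-(δ / r)) r := by
    have h2 : HasDerivAt (fun r => δ * (Real.log ρ - Real.log r)) (δ * (0 - r⁻¹)) r :=
      ((hasDerivAt_const r _).sub (Real.hasDerivAt_log h0.ne')).const_mul δ
    have h3 : HasDerivAt (fun r => δ * Real.log (ρ / r)) (δ * (0 - r⁻¹)) r := by
      refine h2.congr_of_eventuallyEq ?_
      filter_upwards [Ioi_mem_nhds h0] with s hs
      rw [Real.log_div hρ.ne' (ne_of_gt hs)]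
    convert h3 using 1
    rw [zero_sub, mul_neg, div_eq_mul_inv]
  have h2 := ((Real.smoothTransition.contDiff (n := 1)).differentiable one_ne_zero
    (δ * Real.log (ρ / r))).hasDerivAt.comp r h1
  refine ⟨_, h2, ?_⟩
  rw [abs_mul, abs_neg, abs_of_pos (div_pos hδ h0), mul_assoc, div_mul_cancel₀ _ h0.ne', mul_comm]
  exact mul_le_mul_of_nonneg_left (hK _) hδ.le

end Cutoff

/-! ### Radial quotients of `A` and uniform estimates. -/

section RadialQuotient

variable {B : Type*}

/-- The function `q` for which `A(b, r e^{iθ}) = 1 + r² q(b, r, θ)`. -/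
def radialQuot (A : B × ℂ → ℝ) (ζ : Circle) (b : B) (r θ : ℝ) : ℝ :=
  dslope (dslope (fun r => A (b, polarPt ζ r θ)) 0) 0 r

/-- The function `r⁻¹ ∂A/∂r`, smooth up to the binding. -/
def radialDeriv (A : B × ℂ → ℝ) (ζ : Circle) (b : B) (r θ : ℝ) : ℝ :=
  2 * radialQuot A ζ b r θ + r * deriv (fun r => radialQuot A ζ b r θ) r

lemma exists_angle_mem (θ : ℝ) : ∃ θ' ∈ Icc (-Real.pi) Real.pi, ∀ (ζ : Circle) (r : ℝ),
    polarPt ζ r θ' = polarPt ζ r θ := by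
  obtain ⟨θ', h1, h2⟩ := exists_polarPt 1 (Circle.exp θ : ℂ)
  refine ⟨θ', h1, fun ζ r => ?_⟩
  simp only [polarPt, Circle.norm_coe, Complex.ofReal_one, one_mul] at h2
  simp [polarPt, h2]

end RadialQuotient

namespace ConcaveGirouxForm

variable {n : ℕ}
  {Y : Type*} [TopologicalSpace Y] [ChartedSpace (EuclideanSpace ℝ (Fin (2 * n + 3))) Y]
  [IsManifold (𝓡 (2 * n + 3)) ∞ Y] [CompactSpace Y] [T2Space Y]
  {B : Type*} [TopologicalSpace B] [ChartedSpace (EuclideanSpace ℝ (Fin (2 * n + 1))) B]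
  [IsManifold (𝓡 (2 * n + 1)) ∞ B] [CompactSpace B] [T2Space B]
  {O : ConcreteOpenBook n Y B} {α : OneForm (EuclideanSpace ℝ (Fin (2 * n + 3))) Y}
  {A : B × ℂ → ℝ} (h : ConcaveGirouxForm O α A)
include h

lemma deriv_radial (ζ : Circle) (b : B) (θ : ℝ) {r : ℝ} (hr : |r| < 1) :
    HasDerivAt (fun r => A (b, polarPt ζ r θ))
      (fderiv ℝ (fun z : ℂ => A (b, z)) (polarPt ζ r θ) (ζ * Circle.exp θ : Circle)) r :=
  HasFDerivAt.comp_hasDerivAt r (f := fun s : ℝ => polarPt ζ s θ)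
    ((h.contDiffAt_fibre b (by rwa [norm_polarPt])).differentiableAt (by simp)).hasFDerivAt
    (hasDerivAt_polarPt ζ r θ)

/-- `exists_radial_expansion` applied along each diameter, negative `r` included. The critical point
at `0` comes from `fderiv_A_zero`, the absence of others from `fderiv_A_ne_zero`, and the sign from
the Hessian. -/
lemma radial (ζ : Circle) (b : B) (θ : ℝ) {r : ℝ} (hr : |r| < 1) :
    A (b, polarPt ζ r θ) = 1 + r ^ 2 * radialQuot A ζ b r θ ∧
      DifferentiableAt ℝ (fun r => radialQuot A ζ b r θ) r ∧
      HasDerivAt (fun r => A (b, polarPt ζ r θ)) (r * radialDeriv A ζ b r θ) r ∧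
      radialDeriv A ζ b r θ < 0 := by
  have hmem : ∀ {s : ℝ}, s ∈ Ioo (-1 : ℝ) 1 → |s| < 1 := fun hs => abs_lt.2 hs
  refine exists_radial_expansion (h := fun r => A (b, polarPt ζ r θ))
    (q := fun r => radialQuot A ζ b r θ) ?_ ?_ ?_ ?_ ?_ rfl (abs_lt.1 hr)
  · intro s hs
    refine ContDiffAt.contDiffWithinAt (ContDiffAt.comp s (g := fun z : ℂ => A (b, z))
      (f := fun s => polarPt ζ s θ) (h.contDiffAt_fibre b (by rw [norm_polarPt]; exact hmem hs)) ?_)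
    exact (contDiff_polarPt ζ).contDiffAt.comp s (contDiffAt_id.prodMk contDiffAt_const)
  · rw [polarPt_zero, h.A_zero]
  · rw [(h.deriv_radial ζ b θ (r := 0) (by simp)).deriv, polarPt_zero, h.fderiv_A_zero]
    rfl
  · intro s hs hs0
    rw [(h.deriv_radial ζ b θ (hmem hs)).deriv]
    intro hcon
    refine h.fderiv_A_ne_zero b (z := polarPt ζ s θ) ?_ (by rw [norm_polarPt]; exact hmem hs) ?_
    · rw [← norm_pos_iff, norm_polarPt]; exact abs_pos.2 hs0
    · have e : polarPt ζ s θ = s • ((ζ * Circle.exp θ : Circle) : ℂ) := by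
        rw [polarPt, Complex.real_smul]
      conv_lhs => rw [show fderiv ℝ (fun z : ℂ => A (b, z)) (polarPt ζ s θ) (polarPt ζ s θ) =
        fderiv ℝ (fun z : ℂ => A (b, z)) (polarPt ζ s θ) (s • ((ζ * Circle.exp θ : Circle) : ℂ)) from
        congrArg _ e, map_smul, hcon, smul_zero]
  · have e1 : deriv (fun r => A (b, polarPt ζ r θ)) =ᶠ[𝓝 0] fun r =>
        fderiv ℝ (fun z : ℂ => A (b, z)) (polarPt ζ r θ) (ζ * Circle.exp θ : Circle) := by
      filter_upwards [Ioo_mem_nhds (show (-1 : ℝ) < 0 by norm_num) one_pos] with s hs using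
        (h.deriv_radial ζ b θ (hmem hs)).deriv
    have e2 : HasFDerivAt (fderiv ℝ (fun z : ℂ => A (b, z)))
        (fderiv ℝ (fderiv ℝ (fun z : ℂ => A (b, z))) 0) (polarPt ζ 0 θ) := by
      rw [polarPt_zero]
      exact (((h.contDiffAt_fibre b (z := 0) (by simp)).fderiv_right (m := ∞)
        le_rfl).differentiableAt (by simp)).hasFDerivAt
    have e3 := HasFDerivAt.comp_hasDerivAt (0 : ℝ) (f := fun s : ℝ => polarPt ζ s θ) e2
      (hasDerivAt_polarPt ζ 0 θ)
    have e4 := e3.clm_apply (hasDerivAt_const (0 : ℝ) ((ζ * Circle.exp θ : Circle) : ℂ))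
    rw [map_zero, add_zero] at e4
    rw [e1.deriv_eq]
    have e5 := e4.deriv
    refine lt_of_eq_of_lt e5 (h.hessian b _ (Circle.coe_ne_zero _))

/-- Hadamard's lemma twice, after moving the radius to the last variable. -/
lemma contDiffAt_radialQuot (ζ : Circle) (b₀ : B)
    {x : EuclideanSpace ℝ (Fin (2 * n + 1)) × ℝ × ℝ}
    (hx : x.1 ∈ (extChartAt (𝓡 (2 * n + 1)) b₀).target) (hr : |x.2.1| < 1) :
    ContDiffAt ℝ ∞ (fun x : EuclideanSpace ℝ (Fin (2 * n + 1)) × ℝ × ℝ =>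
      radialQuot A ζ ((extChartAt (𝓡 (2 * n + 1)) b₀).symm x.1) x.2.1 x.2.2) x := by
  set e := extChartAt (𝓡 (2 * n + 1)) b₀
  let f : (EuclideanSpace ℝ (Fin (2 * n + 1)) × ℝ) × ℝ → ℝ := fun p =>
    A (e.symm p.1.1, polarPt ζ p.2 p.1.2)
  let U : Set ((EuclideanSpace ℝ (Fin (2 * n + 1)) × ℝ) × ℝ) := {p | p.1.1 ∈ e.target ∧ |p.2| < 1}
  have hU : IsOpen U := ((isOpen_extChartAt_target b₀).preimage (continuous_fst.comp continuous_fst)).inter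
    (isOpen_lt (continuous_abs.comp continuous_snd) continuous_const)
  have hf : ContDiffOn ℝ ∞ f U := fun p hp => by
    refine ContDiffAt.contDiffWithinAt (ContDiffAt.comp p
      (g := fun x : EuclideanSpace ℝ (Fin (2 * n + 1)) × ℝ × ℝ =>
        A (e.symm x.1, polarPt ζ x.2.1 x.2.2)) (f := fun p : (EuclideanSpace ℝ (Fin (2 * n + 1)) × ℝ) × ℝ => (p.1.1, p.2, p.1.2))
      (h.contDiffAt_A_polar ζ b₀ hp.1 hp.2) ?_)
    exact (by fun_prop : ContDiff ℝ ∞ fun p : (EuclideanSpace ℝ (Fin (2 * n + 1)) × ℝ) × ℝ =>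
      (p.1.1, p.2, p.1.2)).contDiffAt
  have h0 : ∀ {p : (EuclideanSpace ℝ (Fin (2 * n + 1)) × ℝ) × ℝ}, p ∈ U → (p.1, (0 : ℝ)) ∈ U :=
    fun hp => ⟨hp.1, by simp⟩
  have hf1 : ContDiffOn ℝ ∞ (fun p : (EuclideanSpace ℝ (Fin (2 * n + 1)) × ℝ) × ℝ =>
      dslope (fun r => f (p.1, r)) 0 p.2) U := fun p hp =>
    (contDiffAt_dslope_zero hU hf (h0 hp) hp).contDiffWithinAt
  have hx' : ((x.1, x.2.2), x.2.1) ∈ U := ⟨hx, hr⟩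
  have hf2 := contDiffAt_dslope_zero hU hf1 (h0 hx') hx'
  refine ContDiffAt.comp x (f := fun x : EuclideanSpace ℝ (Fin (2 * n + 1)) × ℝ × ℝ =>
    ((x.1, x.2.2), x.2.1)) hf2 ?_
  exact (by fun_prop : ContDiff ℝ ∞ fun x : EuclideanSpace ℝ (Fin (2 * n + 1)) × ℝ × ℝ =>
    ((x.1, x.2.2), x.2.1)).contDiffAt

lemma radialDeriv_chart (ζ : Circle) (b₀ : B) {x : EuclideanSpace ℝ (Fin (2 * n + 1)) × ℝ × ℝ}
    (hx : x.1 ∈ (extChartAt (𝓡 (2 * n + 1)) b₀).target) (hr : |x.2.1| < 1) :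
    radialDeriv A ζ ((extChartAt (𝓡 (2 * n + 1)) b₀).symm x.1) x.2.1 x.2.2 =
      2 * radialQuot A ζ ((extChartAt (𝓡 (2 * n + 1)) b₀).symm x.1) x.2.1 x.2.2 +
      x.2.1 * fderiv ℝ (fun x : EuclideanSpace ℝ (Fin (2 * n + 1)) × ℝ × ℝ =>
        radialQuot A ζ ((extChartAt (𝓡 (2 * n + 1)) b₀).symm x.1) x.2.1 x.2.2) x (0, 1, 0) := by
  have h1 := ((h.contDiffAt_radialQuot ζ b₀ hx hr).differentiableAt (by simp)).hasFDerivAt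
  have h2 := HasFDerivAt.comp_hasDerivAt x.2.1 (f := fun s : ℝ => (x.1, s, x.2.2)) h1
    ((hasDerivAt_const _ x.1).prodMk ((hasDerivAt_id _).prodMk (hasDerivAt_const _ x.2.2)))
  rw [radialDeriv, ← h2.deriv]
  rfl

lemma contDiffAt_radialDeriv (ζ : Circle) (b₀ : B)
    {x : EuclideanSpace ℝ (Fin (2 * n + 1)) × ℝ × ℝ}
    (hx : x.1 ∈ (extChartAt (𝓡 (2 * n + 1)) b₀).target) (hr : |x.2.1| < 1) :
    ContDiffAt ℝ ∞ (fun x : EuclideanSpace ℝ (Fin (2 * n + 1)) × ℝ × ℝ =>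
      radialDeriv A ζ ((extChartAt (𝓡 (2 * n + 1)) b₀).symm x.1) x.2.1 x.2.2) x := by
  have h1 := h.contDiffAt_radialQuot ζ b₀ hx hr
  have h2 := (h1.fderiv_right (m := ∞) le_rfl).clm_apply
    (contDiffAt_const (c := ((0, 1, 0) : EuclideanSpace ℝ (Fin (2 * n + 1)) × ℝ × ℝ)))
  have h3 : ContDiffAt ℝ ∞ (fun x : EuclideanSpace ℝ (Fin (2 * n + 1)) × ℝ × ℝ => x.2.1) x := by
    fun_prop
  refine ((contDiffAt_const (c := (2 : ℝ)).mul h1).add (h3.mul h2)).congr_of_eventuallyEq ?_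
  have e1 : ∀ᶠ y : EuclideanSpace ℝ (Fin (2 * n + 1)) × ℝ × ℝ in 𝓝 x,
      y.1 ∈ (extChartAt (𝓡 (2 * n + 1)) b₀).target :=
    continuousAt_fst.eventually_mem ((isOpen_extChartAt_target b₀).mem_nhds hx)
  have e2 : ∀ᶠ y : EuclideanSpace ℝ (Fin (2 * n + 1)) × ℝ × ℝ in 𝓝 x, |y.2.1| < 1 := by
    have hc : ContinuousAt (fun y : EuclideanSpace ℝ (Fin (2 * n + 1)) × ℝ × ℝ => |y.2.1|) x := by
      fun_prop
    exact hc.eventually_mem (Iio_mem_nhds hr)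
  filter_upwards [e1, e2] with y hy1 hy2 using h.radialDeriv_chart ζ b₀ hy1 hy2

omit h in
lemma continuousAt_of_chart {g : B → ℝ → ℝ → ℝ} {b : B} {r θ : ℝ}
    (hg : ContinuousAt (fun x : EuclideanSpace ℝ (Fin (2 * n + 1)) × ℝ × ℝ =>
      g ((extChartAt (𝓡 (2 * n + 1)) b).symm x.1) x.2.1 x.2.2) (extChartAt (𝓡 (2 * n + 1)) b b, r, θ)) :
    ContinuousAt (fun p : B × ℝ × ℝ => g p.1 p.2.1 p.2.2) (b, r, θ) := by
  have h1 : ContinuousAt (fun p : B × ℝ × ℝ => (extChartAt (𝓡 (2 * n + 1)) b p.1, p.2)) (b, r, θ) :=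
    (ContinuousAt.comp (g := extChartAt (𝓡 (2 * n + 1)) b) (f := Prod.fst)
      (continuousAt_extChartAt b) continuousAt_fst).prodMk continuousAt_snd
  refine (ContinuousAt.comp (x := ((b, r, θ) : B × ℝ × ℝ)) hg h1).congr ?_
  have h2 : ∀ᶠ p : B × ℝ × ℝ in 𝓝 (b, r, θ), p.1 ∈ (extChartAt (𝓡 (2 * n + 1)) b).source :=
    continuousAt_fst.eventually_mem (extChartAt_source_mem_nhds b)
  filter_upwards [h2] with p hp
  simp only [Function.comp_apply]
  rw [(extChartAt (𝓡 (2 * n + 1)) b).left_inv hp]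

/-- Continuity on a compact set, the angle being reduced to `[-π, π]` by periodicity. -/
lemma exists_uniform_bounds (ζ : Circle) : ∃ c > 0, ∃ C > 0, ∀ (b : B) (θ : ℝ), ∀ r ∈ Icc (0 : ℝ) (1 / 2),
    radialDeriv A ζ b r θ ≤ -c ∧ |radialQuot A ζ b r θ| ≤ C := by
  set K : Set (B × ℝ × ℝ) := univ ×ˢ Icc 0 (1 / 2) ×ˢ Icc (-Real.pi) Real.pi with hKdef
  have hK : IsCompact K := isCompact_univ.prod (isCompact_Icc.prod isCompact_Icc)
  have hr : ∀ p ∈ K, |p.2.1| < 1 := fun p hp => by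
    rw [abs_of_nonneg hp.2.1.1]; linarith [hp.2.1.2]
  have hd : ContinuousOn (fun p : B × ℝ × ℝ => radialDeriv A ζ p.1 p.2.1 p.2.2) K := fun p hp =>
    (continuousAt_of_chart (h.contDiffAt_radialDeriv ζ p.1 (x := (extChartAt (𝓡 (2 * n + 1)) p.1 p.1,
      p.2.1, p.2.2)) (mem_extChartAt_target p.1) (hr p hp)).continuousAt).continuousWithinAt
  have hq : ContinuousOn (fun p : B × ℝ × ℝ => radialQuot A ζ p.1 p.2.1 p.2.2) K := fun p hp =>
    (continuousAt_of_chart (h.contDiffAt_radialQuot ζ p.1 (x := (extChartAt (𝓡 (2 * n + 1)) p.1 p.1,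
      p.2.1, p.2.2)) (mem_extChartAt_target p.1) (hr p hp)).continuousAt).continuousWithinAt
  have hdr : ∃ c > 0, ∀ p ∈ K, radialDeriv A ζ p.1 p.2.1 p.2.2 ≤ -c := by
    rcases K.eq_empty_or_nonempty with hE | hne
    · exact ⟨1, one_pos, by simp [hE]⟩
    · obtain ⟨p, hp, hmax⟩ := hK.exists_isMaxOn hne hd
      refine ⟨-radialDeriv A ζ p.1 p.2.1 p.2.2, neg_pos.2 (h.radial ζ p.1 p.2.2 (hr p hp)).2.2.2,
        fun p' hp' => ?_⟩
      rw [neg_neg]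
      exact hmax hp'
  obtain ⟨c, hc, hc'⟩ := hdr
  obtain ⟨C, hC⟩ := hK.exists_bound_of_continuousOn hq
  refine ⟨c, hc, max C 1, lt_max_of_lt_right one_pos, fun b θ r hr => ?_⟩
  obtain ⟨θ', hθ', he⟩ := exists_angle_mem θ
  have hp : (b, r, θ') ∈ K := ⟨mem_univ _, hr, hθ'⟩
  have e1 : ∀ r, radialQuot A ζ b r θ = radialQuot A ζ b r θ' := fun r => by
    simp only [radialQuot, he]
  have e2 : radialDeriv A ζ b r θ = radialDeriv A ζ b r θ' := by
    simp only [radialDeriv, e1]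
  rw [e1, e2]
  exact ⟨hc' _ hp, (hC _ hp).trans (le_max_left _ _)⟩

/-- The interpolation between `A` and its value on the base page is decreasing along the radii. -/
lemma exists_cutoff_parameter (ζ : Circle) : ∃ δ > 0, ∀ ρ ∈ Ioc (0 : ℝ) (1 / 2),
    ∀ l ∈ Icc (0 : ℝ) 1, ∀ (b : B) (θ : ℝ), ∀ r ∈ Ioo (0 : ℝ) 1,
    ∃ F' < 0, HasDerivAt (fun r => (1 - l * logCutoff δ ρ r) * A (b, polarPt ζ r θ) +
      l * logCutoff δ ρ r * A (b, polarPt ζ r 0)) F' r := by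
  obtain ⟨c, hc, C, hC, hb⟩ := h.exists_uniform_bounds ζ
  obtain ⟨K, hK, hKb⟩ := exists_bound_deriv_smoothTransition
  -- The derivative of the cutoff contributes at most `r · (δ K) · (2 C) = r c / 2`, half of the
  -- decrease `r c` coming from the radial derivatives of `A`.
  refine ⟨c / (4 * C * K), by positivity, fun ρ hρ l hl b θ r hr => ?_⟩
  set δ := c / (4 * C * K) with hδdef
  have hδ : 0 < δ := by positivity
  have hr1 : |r| < 1 := by rw [abs_of_pos hr.1]; exact hr.2
  obtain ⟨e1, -, d1, n1⟩ := h.radial ζ b θ hr1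
  obtain ⟨e2, -, d2, n2⟩ := h.radial ζ b 0 hr1
  obtain ⟨χ', dχ, hχ'⟩ := hasDerivAt_logCutoff hδ hρ.1 hr.1 hKb
  have hχ := logCutoff_mem δ ρ r
  set χ := logCutoff δ ρ r
  refine ⟨_, ?_, (((dχ.const_mul l).const_sub 1).mul d1).add ((dχ.const_mul l).mul d2)⟩
  have hlχ : l * χ ∈ Icc (0 : ℝ) 1 := ⟨mul_nonneg hl.1 hχ.1, mul_le_one₀ hl.2 hχ.1 hχ.2⟩
  rcases le_or_gt r (1 / 2) with hr2 | hr2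
  · obtain ⟨b1, b2⟩ := hb b θ r ⟨hr.1.le, hr2⟩
    obtain ⟨b3, b4⟩ := hb b 0 r ⟨hr.1.le, hr2⟩
    rw [e1, e2]
    have k1 : -(l * χ') * (1 + r ^ 2 * radialQuot A ζ b r θ) + l * χ' * (1 + r ^ 2 * radialQuot A ζ b r 0) ≤
        r * (c / 2) := by
      have : -(l * χ') * (1 + r ^ 2 * radialQuot A ζ b r θ) + l * χ' * (1 + r ^ 2 * radialQuot A ζ b r 0)
          = r * (χ' * r * (l * (radialQuot A ζ b r 0 - radialQuot A ζ b r θ))) := by ring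
      rw [this]
      refine mul_le_mul_of_nonneg_left ?_ hr.1.le
      refine (le_abs_self _).trans ?_
      rw [abs_mul, abs_mul, abs_of_pos hr.1, abs_mul, abs_of_nonneg hl.1]
      have k2 : |radialQuot A ζ b r 0 - radialQuot A ζ b r θ| ≤ 2 * C := by
        refine (abs_sub _ _).trans (by linarith)
      have k3 : l * |radialQuot A ζ b r 0 - radialQuot A ζ b r θ| ≤ 2 * C := by
        calc _ ≤ 1 * |radialQuot A ζ b r 0 - radialQuot A ζ b r θ| := by gcongr; exact hl.2
          _ ≤ 2 * C := by rw [one_mul]; exact k2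
      calc |χ'| * r * (l * |radialQuot A ζ b r 0 - radialQuot A ζ b r θ|)
          ≤ (δ * K) * (2 * C) := mul_le_mul hχ' k3 (mul_nonneg hl.1 (abs_nonneg _)) (by positivity)
        _ = c / 2 := by rw [hδdef]; field_simp; ring
    have k4 : (1 - l * χ) * (r * radialDeriv A ζ b r θ) + l * χ * (r * radialDeriv A ζ b r 0) ≤
        r * (-c) := by
      have m1 : (1 - l * χ) * radialDeriv A ζ b r θ ≤ (1 - l * χ) * (-c) :=
        mul_le_mul_of_nonneg_left b1 (by linarith [hlχ.2])
      have m2 : (l * χ) * radialDeriv A ζ b r 0 ≤ (l * χ) * (-c) :=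
        mul_le_mul_of_nonneg_left b3 hlχ.1
      have m3 := mul_le_mul_of_nonneg_left (add_le_add m1 m2) hr.1.le
      calc _ = r * ((1 - l * χ) * radialDeriv A ζ b r θ + l * χ * radialDeriv A ζ b r 0) := by ring
        _ ≤ _ := m3
        _ = r * (-c) := by ring
    have : 0 < r * (c / 2) := mul_pos hr.1 (by positivity)
    linarith
  -- Beyond radius `1 / 2` the uniform bounds are unavailable, but `ρ ≤ 1 / 2` makes the cutoff
  -- vanish there.
  · have z1 : χ = 0 := logCutoff_eq_zero hδ hρ.1 (hρ.2.trans hr2.le)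
    have z2 : χ' = 0 := by
      refine dχ.unique ((hasDerivAt_const r (0 : ℝ)).congr_of_eventuallyEq ?_)
      filter_upwards [Ioi_mem_nhds hr2] with s hs using
        logCutoff_eq_zero hδ hρ.1 (hρ.2.trans (le_of_lt hs))
    simp only [show logCutoff δ ρ r = 0 from z1, z2, mul_zero, neg_zero, zero_mul, sub_zero, one_mul, zero_add, add_zero]
    exact mul_neg_of_pos_of_neg hr.1 n1

end ConcaveGirouxForm

/-! ### Extension by zero from the collar to the manifold. -/

namespace ConcreteOpenBook

variable {n : ℕ}
  {Y : Type*} [TopologicalSpace Y] [ChartedSpace (EuclideanSpace ℝ (Fin (2 * n + 3))) Y]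
  {B : Type*} [TopologicalSpace B] [ChartedSpace (EuclideanSpace ℝ (Fin (2 * n + 1))) B]
  (O : ConcreteOpenBook n Y B)

/-- Extension by zero of a function on the collar. -/
def collarExt (f : B × ℂ → ℝ) : Y → ℝ :=
  Function.extend (fun p : (univ ×ˢ Metric.ball 0 1 : Set (B × ℂ)) => O.collar p) (fun p => f p) 0

lemma collarExt_collar (f : B × ℂ → ℝ) (b : B) {z : ℂ} (hz : ‖z‖ < 1) :
    O.collarExt f (O.collar (b, z)) = f (b, z) :=
  Function.Injective.extend_apply (f := fun p : (univ ×ˢ Metric.ball 0 1 : Set (B × ℂ)) => O.collar p)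
    (fun p q hpq => Subtype.ext (O.collar_injOn p.2 q.2 hpq)) (fun p => f p) 0
    ⟨(b, z), mem_univ _, mem_ball_zero_iff.2 hz⟩

lemma collarExt_of_notMem {f : B × ℂ → ℝ} {ρ : ℝ} (hf : ∀ b z, ρ ≤ ‖z‖ → f (b, z) = 0) {y : Y}
    (hy : y ∉ O.collar '' (univ ×ˢ Metric.closedBall 0 ρ)) : O.collarExt f y = 0 := by
  by_cases h : ∃ p : (univ ×ˢ Metric.ball 0 1 : Set (B × ℂ)), O.collar p = y
  · obtain ⟨⟨⟨b, z⟩, hbz'⟩, hbz⟩ := h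
    have hz := hbz'.2
    rw [← hbz, O.collarExt_collar f b (mem_ball_zero_iff.1 hz)]
    refine hf b z (not_lt.1 fun hlt => hy ⟨(b, z), ⟨mem_univ _, ?_⟩, hbz⟩)
    exact mem_closedBall_zero_iff.2 hlt.le
  · exact Function.extend_apply' _ _ _ h

/-- Inside the collar a local inverse of the collar map is used. Outside it the extension vanishes
nearby, since the closed collar of radius `ρ` is compact, hence closed. -/
lemma contMDiffAt_collarExt [CompactSpace B] [T2Space Y] {f : B × ℂ → ℝ} {ρ : ℝ} (hρ1 : ρ < 1)
    (hf : ∀ b z, ρ ≤ ‖z‖ → f (b, z) = 0)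
    (hfs : ∀ b z, z ≠ 0 → ‖z‖ < 1 →
      ContMDiffAt ((𝓡 (2 * n + 1)).prod 𝓘(ℝ, ℂ)) 𝓘(ℝ, ℝ) ∞ f (b, z)) {y : Y}
    (hy : y ∉ O.binding) : ContMDiffAt (𝓡 (2 * n + 3)) 𝓘(ℝ, ℝ) ∞ (O.collarExt f) y := by
  by_cases hc : y ∈ O.collar '' (univ ×ˢ Metric.ball 0 1)
  · obtain ⟨⟨b, z⟩, ⟨-, hz⟩, rfl⟩ := hc
    rw [mem_ball_zero_iff] at hz
    rw [O.collar_mem_binding_iff b hz] at hy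
    have hl := O.isLocalDiffeomorphAt_collar b hz
    have h1 := hl.localInverse_contMDiffAt
    have h0 : hl.localInverse (O.collar (b, z)) = (b, z) :=
      hl.localInverse_left_inv hl.localInverse_mem_target
    have h2 : ContMDiffAt (𝓡 (2 * n + 3)) 𝓘(ℝ, ℝ) ∞ (fun y => f (hl.localInverse y))
        (O.collar (b, z)) := by
      refine ContMDiffAt.comp _ (g := f) ?_ h1
      rw [h0]; exact hfs b z hy hz
    refine h2.congr_of_eventuallyEq ?_
    have h3 : ∀ᶠ y in 𝓝 (O.collar (b, z)), hl.localInverse y ∈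
        (univ ×ˢ Metric.ball 0 1 : Set (B × ℂ)) := by
      refine h1.continuousAt.eventually_mem ?_
      rw [h0]
      exact (isOpen_univ.prod Metric.isOpen_ball).mem_nhds ⟨mem_univ _, mem_ball_zero_iff.2 hz⟩
    filter_upwards [h3, hl.localInverse_eventuallyEq_right] with y hy1 hy2
    conv_lhs => rw [show y = O.collar (hl.localInverse y) from hy2.symm]
    exact O.collarExt_collar f (hl.localInverse y).1 (mem_ball_zero_iff.1 hy1.2)
  · have hK := O.isCompact_collar_image (isCompact_closedBall (0 : ℂ) ρ)
      (Metric.closedBall_subset_ball hρ1)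
    have hyK : y ∉ O.collar '' (univ ×ˢ Metric.closedBall 0 ρ) := fun hcon =>
      hc (image_mono (prod_mono subset_rfl (Metric.closedBall_subset_ball hρ1)) hcon)
    refine (contMDiffAt_const (c := (0 : ℝ))).congr_of_eventuallyEq ?_
    filter_upwards [hK.isClosed.isOpen_compl.mem_nhds hyK] with y' hy' using
      O.collarExt_of_notMem hf hy'

lemma dthetaForm_dcollar [CompactSpace B] [T2Space Y] (b : B) {z : ℂ} (h0 : z ≠ 0) (hz : ‖z‖ < 1)
    (v : TangentSpace (𝓡 (2 * n + 1)) b) (w : ℂ) :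
    O.dthetaForm (O.collar (b, z)) (O.dcollar b z v w) = (conj z * w).im / ‖z‖ ^ 2 := by
  have hb : O.collar (b, z) ∉ O.binding := by rwa [O.collar_mem_binding_iff b hz]
  have h1 := HasMFDerivAt.comp (b, z) (g := fun y => (O.proj y : ℂ)) (f := O.collar)
    ((O.contMDiffAt_proj hb).mdifferentiableAt (by simp)).hasMFDerivAt
    ((O.contMDiffAt_collar b hz).mdifferentiableAt (by simp)).hasMFDerivAt
  have d0 : DifferentiableAt ℝ (fun z : ℂ => ‖z‖⁻¹) z :=
    ((contDiffAt_norm ℝ h0 (n := 1)).differentiableAt one_ne_zero).inv (norm_ne_zero_iff.2 h0)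
  have d1 : HasFDerivAt (fun z : ℂ => ‖z‖⁻¹ • z) _ z := d0.hasFDerivAt.smul (hasFDerivAt_id z)
  have d2 : HasMFDerivAt ((𝓡 (2 * n + 1)).prod 𝓘(ℝ, ℂ)) 𝓘(ℝ, ℂ)
      (fun p : B × ℂ => ‖p.2‖⁻¹ • p.2) (b, z) _ :=
    HasMFDerivAt.comp (b, z) (g := fun z : ℂ => ‖z‖⁻¹ • z) (f := Prod.snd) d1.hasMFDerivAt
      (hasMFDerivAt_snd (b, z))
  have e : (fun p : B × ℂ => (O.proj (O.collar p) : ℂ)) =ᶠ[𝓝 (b, z)] fun p => ‖p.2‖⁻¹ • p.2 := by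
    have h3 : ∀ᶠ p : B × ℂ in 𝓝 (b, z), p.2 ∈ Metric.ball (0 : ℂ) 1 ∩ {0}ᶜ :=
      continuousAt_snd.eventually_mem ((Metric.isOpen_ball.inter isOpen_compl_singleton).mem_nhds
        ⟨mem_ball_zero_iff.2 hz, h0⟩)
    filter_upwards [h3] with p hp
    have hp0 : p.2 ≠ 0 := hp.2
    have h4 := O.proj_collar p.1 p.2 hp0 (mem_ball_zero_iff.1 hp.1)
    rw [Complex.real_smul]
    nth_rewrite 2 [← h4]
    rw [← mul_assoc, ← Complex.ofReal_mul, inv_mul_cancel₀ (norm_ne_zero_iff.2 hp0),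
      Complex.ofReal_one, one_mul]
  have h4 := hasMFDerivAt_unique h1 (d2.congr_of_eventuallyEq e)
  have h5 : (mfderiv (𝓡 (2 * n + 3)) 𝓘(ℝ, ℂ) (fun y => (O.proj y : ℂ)) (O.collar (b, z))
      (O.dcollar b z v w) : ℂ) = ‖z‖⁻¹ • w + (fderiv ℝ (fun z : ℂ => ‖z‖⁻¹) z w) • z :=
    congrArg (fun T : EuclideanSpace ℝ (Fin (2 * n + 1)) × ℂ →L[ℝ] ℂ => T (v, w)) h4
  refine (congrArg (fun u : ℂ => (conj (O.proj (O.collar (b, z)) : ℂ) * u).im) h5).trans ?_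
  rw [show (O.proj (O.collar (b, z)) : ℂ) = ‖z‖⁻¹ • z from e.eq_of_nhds]
  simp only [Complex.real_smul, map_mul, Complex.conj_ofReal]
  have e3 : (‖z‖⁻¹ : ℂ) * conj z * ((‖z‖⁻¹ : ℂ) * w + ((fderiv ℝ (fun z : ℂ => ‖z‖⁻¹) z w : ℝ) : ℂ) * z) =
      ((‖z‖⁻¹ ^ 2 : ℝ) : ℂ) * (conj z * w) +
        ((‖z‖⁻¹ * fderiv ℝ (fun z : ℂ => ‖z‖⁻¹) z w * Complex.normSq z : ℝ) : ℂ) := by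
    push_cast [Complex.normSq_eq_conj_mul_self]; ring
  push_cast
  rw [e3, Complex.add_im, Complex.im_ofReal_mul, Complex.ofReal_im]
  rw [inv_pow, add_zero, div_eq_inv_mul]

variable [IsManifold (𝓡 (2 * n + 1)) ∞ B]

/-- To prove a property of the points of the collar, one may work in polar coordinates. -/
lemma forall_collar_of_polar (ζ : Circle) {P : B → ℂ → Prop}
    (hP : ∀ (b₀ : B) (x : EuclideanSpace ℝ (Fin (2 * n + 1)) × ℝ × ℝ),
      x.1 ∈ (extChartAt (𝓡 (2 * n + 1)) b₀).target → 0 < x.2.1 → x.2.1 < 1 →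
      P ((extChartAt (𝓡 (2 * n + 1)) b₀).symm x.1) (polarPt ζ x.2.1 x.2.2)) (b : B) {z : ℂ}
    (h0 : z ≠ 0) (hz : ‖z‖ < 1) : P b z := by
  obtain ⟨θ, -, hθ⟩ := exists_polarPt ζ z
  have h1 := hP b (extChartAt (𝓡 (2 * n + 1)) b b, ‖z‖, θ) (mem_extChartAt_target b)
    (norm_pos_iff.2 h0) hz
  rwa [extChartAt_to_inv, hθ] at h1

end ConcreteOpenBook

/-! ### The interpolating forms and their nondegeneracy on pages. -/

section Interpolation

variable {n : ℕ}
  {Y : Type*} [TopologicalSpace Y] [ChartedSpace (EuclideanSpace ℝ (Fin (2 * n + 3))) Y]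
  [IsManifold (𝓡 (2 * n + 3)) ∞ Y] [CompactSpace Y] [T2Space Y]
  {B : Type*} [TopologicalSpace B] [ChartedSpace (EuclideanSpace ℝ (Fin (2 * n + 1))) B]
  [IsManifold (𝓡 (2 * n + 1)) ∞ B] [CompactSpace B] [T2Space B]

/-- The interpolating function `F` in `β = F α_B + G dθ`. -/
def interpF (A : B × ℂ → ℝ) (ζ : Circle) (δ ρ l : ℝ) (b : B) (z : ℂ) : ℝ :=
  (1 - l * logCutoff δ ρ ‖z‖) * A (b, z) + l * logCutoff δ ρ ‖z‖ * A (b, polarPt ζ ‖z‖ 0)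

/-- The interpolating function `G` in `β = F α_B + G dθ`. -/
def interpG (A : B × ℂ → ℝ) (δ ρ l : ℝ) (b : B) (z : ℂ) : ℝ :=
  ‖z‖ ^ 2 * ((1 - l * logCutoff δ ρ ‖z‖) * A (b, z))

/-- The factor of `α` in the correction term. -/
def corrA (A : B × ℂ → ℝ) (ζ : Circle) (δ ρ : ℝ) (p : B × ℂ) : ℝ :=
  logCutoff δ ρ ‖p.2‖ * ((A (p.1, polarPt ζ ‖p.2‖ 0) - A p) / A p)

/-- The factor of `dθ` in the correction term. -/
def corrC (A : B × ℂ → ℝ) (ζ : Circle) (δ ρ : ℝ) (p : B × ℂ) : ℝ :=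
  -(logCutoff δ ρ ‖p.2‖ * (‖p.2‖ ^ 2 * A (p.1, polarPt ζ ‖p.2‖ 0)))

/-- The difference between the flat connection form and the Giroux form. -/
def correction (O : ConcreteOpenBook n Y B) (α : OneForm (EuclideanSpace ℝ (Fin (2 * n + 3))) Y)
    (A : B × ℂ → ℝ) (ζ : Circle) (δ ρ : ℝ) : OneForm (EuclideanSpace ℝ (Fin (2 * n + 3))) Y :=
  fun y => O.collarExt (corrA A ζ δ ρ) y • α y + O.collarExt (corrC A ζ δ ρ) y • O.dthetaForm y

/-- The interpolation between the Giroux form (`l = 0`) and a form which is flat near the binding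
(`l = 1`). -/
def interpForm (O : ConcreteOpenBook n Y B) (α : OneForm (EuclideanSpace ℝ (Fin (2 * n + 3))) Y)
    (A : B × ℂ → ℝ) (ζ : Circle) (δ ρ l : ℝ) : OneForm (EuclideanSpace ℝ (Fin (2 * n + 3))) Y :=
  fun y => α y + l • correction O α A ζ δ ρ y

/-- The conditions on the cutoff parameters. -/
structure CutoffParameters (A : B × ℂ → ℝ) (ζ : Circle) (δ ρ : ℝ) : Prop where
  δ_pos : 0 < δ
  ρ_pos : 0 < ρ
  ρ_le : ρ ≤ 1 / 2
  decreasing : ∀ l ∈ Icc (0 : ℝ) 1, ∀ (b : B) (θ : ℝ), ∀ r ∈ Ioo (0 : ℝ) 1,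
    ∃ F' < 0, HasDerivAt (fun r => (1 - l * logCutoff δ ρ r) * A (b, polarPt ζ r θ) +
      l * logCutoff δ ρ r * A (b, polarPt ζ r 0)) F' r

namespace ConcaveGirouxForm

variable {O : ConcreteOpenBook n Y B} {α : OneForm (EuclideanSpace ℝ (Fin (2 * n + 3))) Y}
  {A : B × ℂ → ℝ} (h : ConcaveGirouxForm O α A) {ζ : Circle} {δ ρ : ℝ}
  (hc : CutoffParameters A ζ δ ρ)
include h hc

lemma contMDiffAt_cutoff (b : B) {z : ℂ} (h0 : z ≠ 0) :
    ContMDiffAt ((𝓡 (2 * n + 1)).prod 𝓘(ℝ, ℂ)) 𝓘(ℝ, ℝ) ∞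
      (fun p : B × ℂ => logCutoff δ ρ ‖p.2‖) (b, z) := by
  have h1 : ContDiffAt ℝ ∞ (fun z : ℂ => logCutoff δ ρ ‖z‖) z :=
    ContDiffAt.comp z (g := logCutoff δ ρ)
      (contDiffAt_logCutoff hc.ρ_pos (norm_ne_zero_iff.2 h0)) (contDiffAt_norm ℝ h0)
  exact ContMDiffAt.comp (b, z) (g := fun z : ℂ => logCutoff δ ρ ‖z‖) (f := Prod.snd)
    h1.contMDiffAt contMDiffAt_snd

lemma contMDiffAt_A_page (b : B) {z : ℂ} (h0 : z ≠ 0) (hz : ‖z‖ < 1) :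
    ContMDiffAt ((𝓡 (2 * n + 1)).prod 𝓘(ℝ, ℂ)) 𝓘(ℝ, ℝ) ∞
      (fun p : B × ℂ => A (p.1, polarPt ζ ‖p.2‖ 0)) (b, z) := by
  have h1 : ContDiffAt ℝ ∞ (fun z : ℂ => polarPt ζ ‖z‖ 0) z :=
    ContDiffAt.comp z (g := fun p : ℝ × ℝ => polarPt ζ p.1 p.2) (f := fun z : ℂ => (‖z‖, (0 : ℝ)))
      (contDiff_polarPt ζ).contDiffAt ((contDiffAt_norm ℝ h0).prodMk contDiffAt_const)
  refine ContMDiffAt.comp (b, z) (g := A) (f := fun p : B × ℂ => (p.1, polarPt ζ ‖p.2‖ 0))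
    (h.contMDiffAt_A b (by rw [norm_polarPt, abs_norm]; exact hz)) ?_
  exact contMDiffAt_fst.prodMk (ContMDiffAt.comp (b, z) (g := fun z : ℂ => polarPt ζ ‖z‖ 0)
    (f := Prod.snd) h1.contMDiffAt contMDiffAt_snd)

lemma smoothAt_correction {y : Y} (hy : y ∉ O.binding) : (correction O α A ζ δ ρ).SmoothAt y := by
  have h1 : ContMDiffAt (𝓡 (2 * n + 3)) 𝓘(ℝ, ℝ) ∞ (O.collarExt (corrA A ζ δ ρ)) y := by
    refine O.contMDiffAt_collarExt (ρ := ρ) (by linarith [hc.ρ_le]) ?_ ?_ hy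
    · intro b z hz
      rw [corrA, logCutoff_eq_zero hc.δ_pos hc.ρ_pos hz, zero_mul]
    · intro b z h0 hz
      exact (h.contMDiffAt_cutoff hc b h0).mul
        (((h.contMDiffAt_A_page hc b h0 hz).sub (h.contMDiffAt_A b hz)).div₀
          (h.contMDiffAt_A b hz) (h.A_ne_zero b hz))
  have h2 : ContMDiffAt (𝓡 (2 * n + 3)) 𝓘(ℝ, ℝ) ∞ (O.collarExt (corrC A ζ δ ρ)) y := by
    refine O.contMDiffAt_collarExt (ρ := ρ) (by linarith [hc.ρ_le]) ?_ ?_ hy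
    · intro b z hz
      rw [corrC, logCutoff_eq_zero hc.δ_pos hc.ρ_pos hz, zero_mul, neg_zero]
    · intro b z h0 hz
      have h3 : ContMDiffAt ((𝓡 (2 * n + 1)).prod 𝓘(ℝ, ℂ)) 𝓘(ℝ, ℝ) ∞
          (fun p : B × ℂ => ‖p.2‖ ^ 2) (b, z) :=
        ContMDiffAt.comp (b, z) (g := fun z : ℂ => ‖z‖ ^ 2) (f := Prod.snd)
          ((contDiff_norm_sq ℝ).contDiffAt.contMDiffAt) contMDiffAt_snd
      exact ((h.contMDiffAt_cutoff hc b h0).mul (h3.mul (h.contMDiffAt_A_page hc b h0 hz))).neg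
  exact (OneForm.SmoothAt.smul h1 (h.smoothAt y)).add
    (OneForm.SmoothAt.smul h2 (O.smoothAt_dthetaForm hy))

lemma smoothAt_interpForm (l : ℝ) {y : Y} (hy : y ∉ O.binding) :
    (interpForm O α A ζ δ ρ l).SmoothAt y :=
  (h.smoothAt y).add (OneForm.SmoothAt.smul (a := fun _ => l) contMDiffAt_const
    (h.smoothAt_correction hc hy))

lemma interpForm_eq (l : ℝ) {y : Y} (hy : y ∉ O.collar '' (univ ×ˢ Metric.closedBall 0 ρ)) :
    interpForm O α A ζ δ ρ l y = α y := by
  have h1 : O.collarExt (corrA A ζ δ ρ) y = 0 := O.collarExt_of_notMem (fun b z hz => by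
    rw [corrA, logCutoff_eq_zero hc.δ_pos hc.ρ_pos hz, zero_mul]) hy
  have h2 : O.collarExt (corrC A ζ δ ρ) y = 0 := O.collarExt_of_notMem (fun b z hz => by
    rw [corrC, logCutoff_eq_zero hc.δ_pos hc.ρ_pos hz, zero_mul, neg_zero]) hy
  rw [interpForm, correction, h1, h2, zero_smul, zero_smul, add_zero, smul_zero, add_zero]

lemma interpForm_eventuallyEq (l : ℝ) {y : Y}
    (hy : y ∉ O.collar '' (univ ×ˢ Metric.closedBall 0 ρ)) :
    ∀ᶠ y' in 𝓝 y, interpForm O α A ζ δ ρ l y' = α y' := by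
  have hK := O.isCompact_collar_image (isCompact_closedBall (0 : ℂ) ρ)
    (Metric.closedBall_subset_ball (by linarith [hc.ρ_le]))
  filter_upwards [hK.isClosed.isOpen_compl.mem_nhds hy] with y' hy' using h.interpForm_eq hc l hy'

/-- The factor `corrA` turns `A α_B` into `F α_B`. This also multiplies the `dθ` term of `α`, and
`corrC` removes the excess `lχ r² A(b, rζ)`. -/
lemma interpForm_dcollar (l : ℝ) (b : B) {z : ℂ} (h0 : z ≠ 0) (hz : ‖z‖ < 1)
    (v : TangentSpace (𝓡 (2 * n + 1)) b) (w : ℂ) :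
    interpForm O α A ζ δ ρ l (O.collar (b, z)) (O.dcollar b z v w) =
      interpF A ζ δ ρ l b z * O.bindingForm α b v +
        interpG A δ ρ l b z * ((conj z * w).im / ‖z‖ ^ 2) := by
  have e : interpForm O α A ζ δ ρ l (O.collar (b, z)) (O.dcollar b z v w) =
    α (O.collar (b, z)) (O.dcollar b z v w) +
      l * (O.collarExt (corrA A ζ δ ρ) (O.collar (b, z)) * α (O.collar (b, z)) (O.dcollar b z v w) +
        O.collarExt (corrC A ζ δ ρ) (O.collar (b, z)) *
          O.dthetaForm (O.collar (b, z)) (O.dcollar b z v w)) := rfl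
  rw [e, O.collarExt_collar _ b hz, O.collarExt_collar _ b hz, h.normalForm.2 b z hz,
    O.dthetaForm_dcollar b h0 hz, corrA, corrC, interpF, interpG]
  have hA := h.A_ne_zero b hz
  have hn : ‖z‖ ≠ 0 := norm_ne_zero_iff.2 h0
  field_simp
  ring

lemma pull_interpForm_eventuallyEq (l : ℝ) (b₀ : B)
    {x : EuclideanSpace ℝ (Fin (2 * n + 1)) × ℝ × ℝ}
    (hx : x.1 ∈ (extChartAt (𝓡 (2 * n + 1)) b₀).target) (h0 : 0 < x.2.1) (hr : x.2.1 < 1) :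
    (interpForm O α A ζ δ ρ l).pull (O.polarChart ζ b₀) =ᶠ[𝓝 x] polarForm
      (fun x => (1 - l * logCutoff δ ρ x.2.1) *
          A ((extChartAt (𝓡 (2 * n + 1)) b₀).symm x.1, polarPt ζ x.2.1 x.2.2) +
        l * logCutoff δ ρ x.2.1 * A ((extChartAt (𝓡 (2 * n + 1)) b₀).symm x.1, polarPt ζ x.2.1 0))
      (fun x => x.2.1 ^ 2 * ((1 - l * logCutoff δ ρ x.2.1) *
          A ((extChartAt (𝓡 (2 * n + 1)) b₀).symm x.1, polarPt ζ x.2.1 x.2.2)))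
      ((O.bindingForm α).inChart b₀) := by
  have h1 : ∀ᶠ y : EuclideanSpace ℝ (Fin (2 * n + 1)) × ℝ × ℝ in 𝓝 x,
      y.1 ∈ (extChartAt (𝓡 (2 * n + 1)) b₀).target :=
    continuousAt_fst.eventually_mem ((isOpen_extChartAt_target b₀).mem_nhds hx)
  have h2 : ∀ᶠ y : EuclideanSpace ℝ (Fin (2 * n + 1)) × ℝ × ℝ in 𝓝 x, y.2.1 ∈ Ioo (0 : ℝ) 1 := by
    have hc : ContinuousAt (fun y : EuclideanSpace ℝ (Fin (2 * n + 1)) × ℝ × ℝ => y.2.1) x := by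
      fun_prop
    exact hc.eventually_mem (Ioo_mem_nhds h0 hr)
  filter_upwards [h1, h2] with y hy1 hy2
  have hn : ‖polarPt ζ y.2.1 y.2.2‖ = y.2.1 := by rw [norm_polarPt, abs_of_pos hy2.1]
  refine ContinuousLinearMap.ext ?_
  rintro ⟨v, s, t⟩
  have e1 := O.mfderiv_polarChart ζ b₀ hy1 (by rw [abs_of_pos hy2.1]; exact hy2.2) v s t
  refine (congrArg (interpForm O α A ζ δ ρ l _) e1).trans ((h.interpForm_dcollar hc l _
    (norm_ne_zero_iff.1 (by rw [hn]; exact hy2.1.ne')) (by rw [hn]; exact hy2.2) _ _).trans ?_)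
  rw [conj_polarPt_mul, interpF, interpG, hn, polarForm_apply]
  have hy0 : y.2.1 ≠ 0 := hy2.1.ne'
  congr 1
  field_simp

/-- Off the support of the correction this is the hypothesis on `α`. In the collar the restriction
to a page has differential `dF ∧ α_B + F dα_B`; since `∂_r F < 0` and `F > 0`, nondegeneracy reduces
to the contact condition on `α_B`. -/
lemma nondegenerateOn_interpForm {l : ℝ} (hl : l ∈ Icc (0 : ℝ) 1) {y : Y} (hy : y ∉ O.binding) :
    (interpForm O α A ζ δ ρ l).NondegenerateOn y (fun v => O.dthetaForm y v = 0) := by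
  by_cases hyK : y ∈ O.collar '' (univ ×ˢ Metric.closedBall 0 ρ)
  swap
  · intro v hv hw
    rw [OneForm.d_congr (h.interpForm_eventuallyEq hc l hyK)] at hw
    exact h.giroux.symplectic_pages y hy v hv hw
  obtain ⟨⟨b, z⟩, ⟨-, hz⟩, rfl⟩ := hyK
  have hz1 : ‖z‖ < 1 := lt_of_le_of_lt (mem_closedBall_zero_iff.1 hz) (by linarith [hc.ρ_le])
  rw [O.collar_mem_binding_iff b hz1] at hy
  refine ConcreteOpenBook.forall_collar_of_polar (n := n) ζ (P := fun b z => (interpForm O α A ζ δ ρ l).NondegenerateOn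
    (O.collar (b, z)) (fun v => O.dthetaForm (O.collar (b, z)) v = 0)) ?_ b hy hz1
  intro b₀ x hx h0 hr
  have hr1 : |x.2.1| < 1 := by rwa [abs_of_pos h0]
  have hbind : O.polarChart ζ b₀ x ∉ O.binding := by
    rw [ConcreteOpenBook.polarChart, O.collar_mem_binding_iff _ (by rwa [norm_polarPt]),
      ← norm_eq_zero, norm_polarPt, abs_eq_zero]
    exact h0.ne'
  have hφ := O.contMDiffAt_polarChart ζ b₀ hx hr1
  refine OneForm.nondegenerateOn_of_pull (φ := O.polarChart ζ b₀) (x := x)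
    (h.smoothAt_interpForm hc l hbind) hφ (O.bijective_mfderiv_polarChart ζ b₀ hx hr1 h0.ne').2 ?_
  have hA1 := (h.contDiffAt_A_polar ζ b₀ hx hr1)
  have hA2 : ContDiffAt ℝ ∞ (fun x : EuclideanSpace ℝ (Fin (2 * n + 1)) × ℝ × ℝ =>
      A ((extChartAt (𝓡 (2 * n + 1)) b₀).symm x.1, polarPt ζ x.2.1 0)) x := by
    refine ContDiffAt.comp x (g := fun x : EuclideanSpace ℝ (Fin (2 * n + 1)) × ℝ × ℝ =>
      A ((extChartAt (𝓡 (2 * n + 1)) b₀).symm x.1, polarPt ζ x.2.1 x.2.2))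
      (f := fun x : EuclideanSpace ℝ (Fin (2 * n + 1)) × ℝ × ℝ => (x.1, x.2.1, (0 : ℝ)))
      (h.contDiffAt_A_polar ζ b₀ hx hr1) ?_
    exact (by fun_prop : ContDiff ℝ ∞ fun x : EuclideanSpace ℝ (Fin (2 * n + 1)) × ℝ × ℝ =>
      (x.1, x.2.1, (0 : ℝ))).contDiffAt
  have hrr : ContDiffAt ℝ ∞ (fun x : EuclideanSpace ℝ (Fin (2 * n + 1)) × ℝ × ℝ => x.2.1) x := by
    fun_prop
  have hχ : ContDiffAt ℝ ∞ (fun x : EuclideanSpace ℝ (Fin (2 * n + 1)) × ℝ × ℝ =>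
      logCutoff δ ρ x.2.1) x := ContDiffAt.comp x (g := logCutoff δ ρ) (contDiffAt_logCutoff hc.ρ_pos h0.ne') hrr
  have hF := (((contDiffAt_const (c := (1 : ℝ)).sub
    (contDiffAt_const (c := l).mul hχ)).mul hA1).add ((contDiffAt_const (c := l).mul
    hχ).mul hA2)).differentiableAt (by simp) |>.hasFDerivAt
  have hG := ((hrr.pow 2).mul ((contDiffAt_const (c := (1 : ℝ)).sub
    (contDiffAt_const (c := l).mul hχ)).mul hA1)).differentiableAt (by simp) |>.hasFDerivAt
  obtain ⟨F', hF', dF'⟩ := hc.decreasing l hl ((extChartAt (𝓡 (2 * n + 1)) b₀).symm x.1) x.2.2 x.2.1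
    ⟨h0, hr⟩
  have hd := HasFDerivAt.comp_hasDerivAt x.2.1 (f := fun s : ℝ => (x.1, s, x.2.2)) hF
    ((hasDerivAt_const _ x.1).prodMk ((hasDerivAt_id _).prodMk (hasDerivAt_const _ x.2.2)))
  have hFr := hd.unique dF'
  have hFpos : 0 < (1 - l * logCutoff δ ρ x.2.1) *
          A ((extChartAt (𝓡 (2 * n + 1)) b₀).symm x.1, polarPt ζ x.2.1 x.2.2) +
        l * logCutoff δ ρ x.2.1 * A ((extChartAt (𝓡 (2 * n + 1)) b₀).symm x.1, polarPt ζ x.2.1 0) := by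
    have hχ := logCutoff_mem δ ρ x.2.1
    have p1 := h.A_pos ((extChartAt (𝓡 (2 * n + 1)) b₀).symm x.1) (z := polarPt ζ x.2.1 x.2.2)
      (by rwa [norm_polarPt])
    have p2 := h.A_pos ((extChartAt (𝓡 (2 * n + 1)) b₀).symm x.1) (z := polarPt ζ x.2.1 0)
      (by rwa [norm_polarPt])
    have hlχ : l * logCutoff δ ρ x.2.1 ≤ 1 := mul_le_one₀ hl.2 hχ.1 hχ.2
    rcases eq_or_lt_of_le (mul_nonneg hl.1 hχ.1) with h1 | h1
    · rw [← h1]; simpa using p1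
    · exact add_pos_of_nonneg_of_pos (mul_nonneg (by linarith) p1.le) (mul_pos h1 p2)
  have hβ := h.pull_interpForm_eventuallyEq hc l b₀ hx h0 hr
  have hda : DifferentiableAt ℝ ((O.bindingForm α).inChart b₀) x.1 :=
    (h.differentiableAt_bindingForm b₀ hx).differentiableAt (by simp)
  have hcontact : NondegenerateOnKer (formDCLM ((O.bindingForm α).inChart b₀) x.1)
      ((O.bindingForm α).inChart b₀ x.1) :=
    OneForm.nondegenerateOnKer_pull (τ := O.bindingForm α) (O.smoothAt_bindingForm h.smoothAt _)
      (contMDiffAt_extChartAt_symm' b₀ hx) (bijective_mfderiv_extChartAt_symm b₀ hx)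
      (h.giroux.contact_binding _).2 (h.giroux.contact_binding _).1
  rintro ⟨v, s, t⟩ hv hw
  rw [O.dthetaForm_polarChart ζ b₀ hx h0 hr] at hv
  subst hv
  have hw' : ∀ (w : EuclideanSpace ℝ (Fin (2 * n + 1))) (s' : ℝ), _ := fun w s' =>
    hw (w, s', 0) (O.dthetaForm_polarChart ζ b₀ hx h0 hr w s' 0)
  simp only [formD_congr hβ, formD_polarForm hF hG hda, mul_zero, sub_zero, add_zero] at hw'
  -- Pairing with `∂_r` leaves `-(∂_r F) α_B(v)`. Once `α_B(v) = 0`, vectors in `ker α_B` force `v =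
  -- 0`, and any vector with `α_B ≠ 0` then forces the radial component `s` to vanish.
  have hav : (O.bindingForm α).inChart b₀ x.1 v = 0 := by
    have := hw' 0 1
    rw [hFr] at this
    simp only [map_zero, mul_zero, zero_sub, formD, zero_apply, add_zero,
      neg_eq_zero, sub_self] at this
    exact (mul_eq_zero.1 this).resolve_left hF'.ne
  have hv0 : v = 0 := by
    refine hcontact.eq_zero v hav fun w hw0 => ?_
    have := hw' w 0
    rw [hav, hw0, mul_zero, mul_zero, sub_zero, zero_add] at this
    exact (mul_eq_zero.1 this).resolve_left hFpos.ne'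
  subst hv0
  obtain ⟨w, hw0⟩ := DFunLike.ne_iff.1 hcontact.ne_zero
  have h3 := hw' w 0
  have e3 : ((0 : EuclideanSpace ℝ (Fin (2 * n + 1))), s, (0 : ℝ)) = s • (0, 1, 0) := by simp
  rw [hav, mul_zero, sub_zero, e3, map_smul, hFr] at h3
  simp only [formD, map_zero, zero_apply, mul_zero, add_zero, smul_eq_mul, sub_self] at h3
  have hs : s = 0 := by
    rcases mul_eq_zero.1 h3 with h4 | h4
    · exact (mul_eq_zero.1 h4).resolve_right hF'.ne
    · exact absurd h4 hw0
  rw [hs]; rfl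

end ConcaveGirouxForm

end Interpolation

lemma contDiffAt_real_smul {P F : Type*} [NormedAddCommGroup P] [NormedSpace ℝ P]
    [NormedAddCommGroup F] [NormedSpace ℝ F] {a : P → ℝ} {f : P → F} {p : P}
    (ha : ContDiffAt ℝ ∞ a p) (hf : ContDiffAt ℝ ∞ f p) :
    ContDiffAt ℝ ∞ (fun p => a p • f p) p := ha.smul hf

/-! ### The monodromy form and the horizontal lifts. -/

section MonodromyForm

variable {n : ℕ}
  {Y : Type*} [TopologicalSpace Y] [ChartedSpace (EuclideanSpace ℝ (Fin (2 * n + 3))) Y]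
  [IsManifold (𝓡 (2 * n + 3)) ∞ Y] [CompactSpace Y] [T2Space Y]
  {B : Type*} [TopologicalSpace B] [ChartedSpace (EuclideanSpace ℝ (Fin (2 * n + 1))) B]
  [IsManifold (𝓡 (2 * n + 1)) ∞ B] [CompactSpace B] [T2Space B]

namespace ConcaveGirouxForm

variable {O : ConcreteOpenBook n Y B} {α : OneForm (EuclideanSpace ℝ (Fin (2 * n + 3))) Y}
  {A : B × ℂ → ℝ} (h : ConcaveGirouxForm O α A) {ζ : Circle} {δ ρ : ℝ}
  (hc : CutoffParameters A ζ δ ρ)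
include h hc

lemma interpF_pos {l : ℝ} (hl : l ∈ Icc (0 : ℝ) 1) (b : B) {z : ℂ} (hz : ‖z‖ < 1) :
    0 < interpF A ζ δ ρ l b z := by
  have hχ := logCutoff_mem δ ρ ‖z‖
  have p1 := h.A_pos b hz
  have p2 := h.A_pos b (z := polarPt ζ ‖z‖ 0) (by rwa [norm_polarPt, abs_norm])
  have hlχ : l * logCutoff δ ρ ‖z‖ ≤ 1 := mul_le_one₀ hl.2 hχ.1 hχ.2
  rw [interpF]
  rcases eq_or_lt_of_le (mul_nonneg hl.1 hχ.1) with h1 | h1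
  · rw [← h1]; simpa using p1
  · exact add_pos_of_nonneg_of_pos (mul_nonneg (by linarith) p1.le) (mul_pos h1 p2)

/-- On the page over `ζ` one has `z = ‖z‖ ζ`, so both values of `A` in `corrA` coincide. -/
lemma collarExt_corrA_openPage {y : Y} (hy : y ∈ O.openPage ζ) :
    O.collarExt (corrA A ζ δ ρ) y = 0 := by
  by_cases hK : y ∈ O.collar '' (univ ×ˢ Metric.closedBall 0 ρ)
  · obtain ⟨⟨b, z⟩, ⟨-, hz⟩, rfl⟩ := hK
    have hz1 : ‖z‖ < 1 := lt_of_le_of_lt (mem_closedBall_zero_iff.1 hz) (by linarith [hc.ρ_le])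
    have hzp := ((O.collar_mem_openPage_iff ζ b hz1).1 hy).2
    rw [O.collarExt_collar _ b hz1, corrA, polarPt_angle_zero, ← hzp, sub_self, zero_div, mul_zero]
  · exact O.collarExt_of_notMem (fun b z hz => by
      rw [corrA, logCutoff_eq_zero hc.δ_pos hc.ρ_pos hz, zero_mul]) hK

lemma interpForm_openPage (l : ℝ) {y : Y} (hy : y ∈ O.openPage ζ)
    (v : TangentSpace (𝓡 (2 * n + 3)) y) (hv : O.dthetaForm y v = 0) :
    interpForm O α A ζ δ ρ l y v = α y v := by
  have e : interpForm O α A ζ δ ρ l y v = α y v +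
      l * (O.collarExt (corrA A ζ δ ρ) y * α y v +
        O.collarExt (corrC A ζ δ ρ) y * O.dthetaForm y v) := rfl
  rw [e, h.collarExt_corrA_openPage hc hy, hv]
  ring

/-- Near the binding, the form `β` for `l = 1` is flat. -/
lemma d_interpForm_one (b : B) {z : ℂ} (h0 : z ≠ 0) (hz : ‖z‖ < ρ * Real.exp (-δ⁻¹)) :
    ∀ u, (interpForm O α A ζ δ ρ 1).d (O.collar (b, z)) (O.dcollar b z 0 (Complex.I * z)) u = 0 := by
  have hρ1 : ρ * Real.exp (-δ⁻¹) ≤ 1 := by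
    refine mul_le_one₀ (by linarith [hc.ρ_le]) (Real.exp_pos _).le (Real.exp_le_one_iff.2 ?_)
    exact neg_nonpos.2 (inv_nonneg.2 hc.δ_pos.le)
  refine ConcreteOpenBook.forall_collar_of_polar (n := n) ζ (P := fun b z =>
    ‖z‖ < ρ * Real.exp (-δ⁻¹) → ∀ u, (interpForm O α A ζ δ ρ 1).d (O.collar (b, z))
      (O.dcollar b z 0 (Complex.I * z)) u = 0) ?_ b h0 (hz.trans_le hρ1) hz
  intro b₀ x hx h0 hr hz u
  rw [norm_polarPt, abs_of_pos h0] at hz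
  have hr1 : |x.2.1| < 1 := by rwa [abs_of_pos h0]
  have hbind : O.polarChart ζ b₀ x ∉ O.binding := by
    rw [ConcreteOpenBook.polarChart, O.collar_mem_binding_iff _ (by rwa [norm_polarPt]),
      ← norm_eq_zero, norm_polarPt, abs_eq_zero]
    exact h0.ne'
  have hφ := O.contMDiffAt_polarChart ζ b₀ hx hr1
  obtain ⟨⟨w, s, t⟩, rfl⟩ := (O.bijective_mfderiv_polarChart ζ b₀ hx hr1 h0.ne').2 u
  have e1 := O.mfderiv_polarChart ζ b₀ hx hr1 0 0 1
  have e2 : mfderiv (𝓡 (2 * n + 1)) (𝓡 (2 * n + 1)) (extChartAt (𝓡 (2 * n + 1)) b₀).symm x.1 0 = 0 :=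
    map_zero _
  replace e1 := e1.trans (congrArg₂ (O.dcollar _ _) e2
    (show _ = Complex.I * polarPt ζ x.2.1 x.2.2 by simp))
  have e3 := (h.smoothAt_interpForm hc 1 hbind).formD_pull hφ (0, 0, 1) (w, s, t)
  refine (congrArg (fun v : EuclideanSpace ℝ (Fin (2 * n + 3)) =>
    (interpForm O α A ζ δ ρ 1).d (O.polarChart ζ b₀ x) v _) e1).symm.trans (e3.symm.trans ?_)
  set F := fun x : EuclideanSpace ℝ (Fin (2 * n + 1)) × ℝ × ℝ =>
    A ((extChartAt (𝓡 (2 * n + 1)) b₀).symm x.1, polarPt ζ x.2.1 0) with hFdef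
  -- With `l = 1` and cutoff equal to `1`, the `dθ` term is gone and the coefficient `A(b, rζ)` of
  -- `α_B` does not depend on the angle.
  have e4 : (interpForm O α A ζ δ ρ 1).pull (O.polarChart ζ b₀) =ᶠ[𝓝 x] polarForm F (fun _ => 0)
      ((O.bindingForm α).inChart b₀) := by
    have hr2 : ∀ᶠ y : EuclideanSpace ℝ (Fin (2 * n + 1)) × ℝ × ℝ in 𝓝 x,
        y.2.1 ∈ Ioo 0 (ρ * Real.exp (-δ⁻¹)) := by
      have hc : ContinuousAt (fun y : EuclideanSpace ℝ (Fin (2 * n + 1)) × ℝ × ℝ => y.2.1) x := by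
        fun_prop
      exact hc.eventually_mem (Ioo_mem_nhds h0 hz)
    filter_upwards [h.pull_interpForm_eventuallyEq hc 1 b₀ hx h0 hr, hr2] with y hy hy2
    rw [hy, polarForm, polarForm, logCutoff_eq_one hc.δ_pos hy2.1 hy2.2.le]
    simp [hFdef]
  have hF : HasFDerivAt F (fderiv ℝ F x) x := by
    refine (ContDiffAt.differentiableAt (n := ∞) ?_ (by simp)).hasFDerivAt
    refine ContDiffAt.comp x (g := fun x : EuclideanSpace ℝ (Fin (2 * n + 1)) × ℝ × ℝ =>
      A ((extChartAt (𝓡 (2 * n + 1)) b₀).symm x.1, polarPt ζ x.2.1 x.2.2))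
      (f := fun x : EuclideanSpace ℝ (Fin (2 * n + 1)) × ℝ × ℝ => (x.1, x.2.1, (0 : ℝ)))
      (h.contDiffAt_A_polar ζ b₀ hx hr1) ?_
    exact (by fun_prop : ContDiff ℝ ∞ fun x : EuclideanSpace ℝ (Fin (2 * n + 1)) × ℝ × ℝ =>
      (x.1, x.2.1, (0 : ℝ))).contDiffAt
  have hFθ : fderiv ℝ F x (0, 0, 1) = 0 := by
    have h1 := HasFDerivAt.comp_hasDerivAt x.2.2 (f := fun s : ℝ => (x.1, x.2.1, s)) hF
      ((hasDerivAt_const _ x.1).prodMk ((hasDerivAt_const _ x.2.1).prodMk (hasDerivAt_id _)))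
    have h2 : HasDerivAt (F ∘ fun s : ℝ => (x.1, x.2.1, s)) 0 x.2.2 := hasDerivAt_const x.2.2
      (A ((extChartAt (𝓡 (2 * n + 1)) b₀).symm x.1, polarPt ζ x.2.1 0))
    exact h1.unique h2
  rw [formD_congr e4, formD_polarForm hF (hasFDerivAt_const 0 x)
    ((h.differentiableAt_bindingForm b₀ hx).differentiableAt (by simp)), hFθ]
  simp [formD]

lemma isMonodromyForm : O.IsMonodromyForm α ζ (interpForm O α A ζ δ ρ 1) where
  smooth := OneForm.smoothOn_of_smoothAt fun x hx => h.smoothAt_interpForm hc 1 hx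
  symplectic_pages := fun x hx => h.nondegenerateOn_interpForm hc ⟨zero_le_one, le_rfl⟩ hx
  eq_on_page := fun x hx v hv => h.interpForm_openPage hc 1 hx v hv
  eq_away := ⟨ρ, hc.ρ_pos, by linarith [hc.ρ_le], fun x hx => h.interpForm_eq hc 1 hx⟩
  collar_pages := by
    refine ⟨fun p => interpF A ζ δ ρ 1 p.1 p.2, fun b z h0 hz =>
      ⟨h.interpF_pos hc ⟨zero_le_one, le_rfl⟩ b hz, ?_, fun v s => ?_⟩⟩
    · obtain ⟨θ, -, hθ⟩ := exists_polarPt ζ z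
      have hr : 0 < ‖z‖ := norm_pos_iff.2 h0
      obtain ⟨F', hF', dF'⟩ := hc.decreasing 1 ⟨zero_le_one, le_rfl⟩ b θ ‖z‖ ⟨hr, hz⟩
      have h1 : HasDerivAt (fun s : ℝ => s * ‖z‖) ‖z‖ 1 := by
        simpa using (hasDerivAt_id (1 : ℝ)).mul_const ‖z‖
      have h2 : HasDerivAt (fun s : ℝ => interpF A ζ δ ρ 1 b (s * z)) (F' * ‖z‖) 1 := by
        rw [← one_mul ‖z‖] at dF'
        refine (HasDerivAt.comp (1 : ℝ) dF' h1).congr_of_eventuallyEq ?_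
        filter_upwards [Ioi_mem_nhds (one_pos : (0 : ℝ) < 1)] with s hs
        have hs0 : (0 : ℝ) < s := hs
        have e1 : ‖(s : ℂ) * z‖ = s * ‖z‖ := by
          rw [norm_mul, Complex.norm_real, Real.norm_of_nonneg hs0.le]
        have e2 : (s : ℂ) * z = polarPt ζ (s * ‖z‖) θ := by
          conv_lhs => rw [← hθ]
          simp only [polarPt]; push_cast; ring
        simp only [interpF, e1, Function.comp_apply]
        rw [← e2]
      exact lt_of_eq_of_lt h2.deriv (mul_neg_of_neg_of_pos hF' hr)
    · rw [h.interpForm_dcollar hc 1 b h0 hz]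
      have : (conj z * (s * z)).im = 0 := by
        have e : conj z * (s * z) = ((s * Complex.normSq z : ℝ) : ℂ) := by
          push_cast [Complex.normSq_eq_conj_mul_self]; ring
        rw [e, Complex.ofReal_im]
      rw [this, zero_div, mul_zero, add_zero]
  flat_near_binding := by
    refine ⟨ρ * Real.exp (-δ⁻¹), mul_pos hc.ρ_pos (Real.exp_pos _), ?_, fun b z h0 hz =>
      h.d_interpForm_one hc b h0 hz⟩
    have : Real.exp (-δ⁻¹) ≤ 1 := Real.exp_le_one_iff.2 (neg_nonpos.2 (inv_nonneg.2 hc.δ_pos.le))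
    nlinarith [hc.ρ_le, hc.ρ_pos, Real.exp_pos (-δ⁻¹)]

end ConcaveGirouxForm

/-- The horizontal lift of `∂/∂θ` for the connection given by the interpolated form. -/
def horizontalField (O : ConcreteOpenBook n Y B)
    (α : OneForm (EuclideanSpace ℝ (Fin (2 * n + 3))) Y) (A : B × ℂ → ℝ) (ζ : Circle) (δ ρ l : ℝ)
    (y : Y) : EuclideanSpace ℝ (Fin (2 * n + 3)) :=
  solveOnKer ((interpForm O α A ζ δ ρ l).dCLM y) (O.dthetaForm y) 1 0

/-- The horizontal lifts for all parameters, as a vector field on `Y × ℝ`. -/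
def suspendedField (O : ConcreteOpenBook n Y B)
    (α : OneForm (EuclideanSpace ℝ (Fin (2 * n + 3))) Y) (A : B × ℂ → ℝ) (ζ : Circle) (δ ρ : ℝ)
    (p : Y × ℝ) : TangentSpace ((𝓡 (2 * n + 3)).prod 𝓘(ℝ, ℝ)) p :=
  (horizontalField O α A ζ δ ρ (Real.smoothTransition p.2) p.1, (0 : ℝ))

lemma smoothTransition_mem (s : ℝ) : Real.smoothTransition s ∈ Icc (0 : ℝ) 1 :=
  ⟨Real.smoothTransition.nonneg _, Real.smoothTransition.le_one _⟩

/-- Differentiating `|proj|² = 1` shows that `conj p · P'` is purely imaginary; its imaginary part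
is `dθ(v)` by definition. -/
lemma hasDerivAt_proj (O : ConcreteOpenBook n Y B) {γ : ℝ → Y} {t : ℝ}
    {v : TangentSpace (𝓡 (2 * n + 3)) (γ t)}
    (hγ : HasMFDerivAt 𝓘(ℝ, ℝ) (𝓡 (2 * n + 3)) γ t ((1 : ℝ →L[ℝ] ℝ).smulRight v))
    (ht : γ t ∉ O.binding) :
    HasDerivAt (fun t => (O.proj (γ t) : ℂ)) (O.dthetaForm (γ t) v * Complex.I * O.proj (γ t)) t := by
  set P' : ℂ := mfderiv (𝓡 (2 * n + 3)) 𝓘(ℝ, ℂ) (fun y => (O.proj y : ℂ)) (γ t) v with hP'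
  have h1 : HasDerivAt (fun t => (O.proj (γ t) : ℂ)) P' t := by
    have h2 := HasMFDerivAt.comp t (g := fun y => (O.proj y : ℂ))
      ((O.contMDiffAt_proj ht).mdifferentiableAt (by simp)).hasMFDerivAt hγ
    have e := clm_comp_smulRight_one (E := EuclideanSpace ℝ (Fin (2 * n + 3))) (F := ℂ)
      (mfderiv (𝓡 (2 * n + 3)) 𝓘(ℝ, ℂ) (fun y => (O.proj y : ℂ)) (γ t)) v
    exact hasMFDerivAt_smulRight_iff.1 (Eq.mp (congrArg (fun T => HasMFDerivAt 𝓘(ℝ, ℝ) 𝓘(ℝ, ℂ)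
      ((fun y => (O.proj y : ℂ)) ∘ γ) t T) e) h2)
  convert h1 using 1
  set p : ℂ := (O.proj (γ t) : ℂ) with hp
  have e1 : O.dthetaForm (γ t) v = (conj p * P').im := rfl
  have hpp : conj p * p = 1 := by
    rw [← Complex.normSq_eq_conj_mul_self, hp, Circle.normSq_coe]; simp
  have hre : (conj p * P').re = 0 := by
    have d1 : HasDerivAt (fun t => conj (O.proj (γ t) : ℂ)) (conj P') t :=
      Complex.conjCLE.toContinuousLinearMap.hasFDerivAt.comp_hasDerivAt t h1
    have d2 := d1.mul h1
    have d3 : HasDerivAt (fun t => conj (O.proj (γ t) : ℂ) * (O.proj (γ t) : ℂ)) 0 t := by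
      refine (hasDerivAt_const t (1 : ℂ)).congr_of_eventuallyEq (Filter.Eventually.of_forall fun t => ?_)
      change conj (O.proj (γ t) : ℂ) * (O.proj (γ t) : ℂ) = 1
      rw [← Complex.normSq_eq_conj_mul_self, Circle.normSq_coe]; simp
    have d4 := congrArg Complex.re (d2.unique d3)
    simp only [Complex.add_re, Complex.mul_re, Complex.conj_re, Complex.conj_im, Complex.zero_re,
      ← hp] at d4 ⊢
    linarith
  have e2 : conj p * P' = O.dthetaForm (γ t) v * Complex.I := by
    apply Complex.ext <;> simp [hre, e1]
  rw [← e2, mul_comm (conj p), mul_assoc, hpp, mul_one]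

/-- `proj (γ t) · e^{-it}` has zero derivative. -/
lemma proj_eq_of_velocity (O : ConcreteOpenBook n Y B) {γ : ℝ → Y}
    {v : (t : ℝ) → TangentSpace (𝓡 (2 * n + 3)) (γ t)}
    (hγ : ∀ t, HasMFDerivAt 𝓘(ℝ, ℝ) (𝓡 (2 * n + 3)) γ t ((1 : ℝ →L[ℝ] ℝ).smulRight (v t)))
    (hb : ∀ t, γ t ∉ O.binding) (hv : ∀ t, O.dthetaForm (γ t) (v t) = 1) (t : ℝ) :
    O.proj (γ t) = O.proj (γ 0) * Circle.exp t := by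
  have h1 : ∀ t, HasDerivAt (fun t : ℝ => (O.proj (γ t) : ℂ) * Complex.exp (-(t * Complex.I))) 0 t := by
    intro t
    have d1 := hasDerivAt_proj O (hγ t) (hb t)
    rw [hv t] at d1
    have d2 : HasDerivAt (fun t : ℝ => -((t : ℂ) * Complex.I)) (-(1 * Complex.I)) t :=
      ((Complex.ofRealCLM.hasDerivAt (x := t)).mul_const Complex.I).neg
    refine (d1.mul d2.cexp).congr_deriv ?_
    push_cast
    ring
  have h2 := is_const_of_deriv_eq_zero (fun t => (h1 t).differentiableAt) (fun t => (h1 t).deriv) t 0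
  simp only [Complex.ofReal_zero, zero_mul, neg_zero, Complex.exp_zero, mul_one] at h2
  refine Circle.ext ?_
  rw [Circle.coe_mul, Circle.coe_exp, ← h2, mul_assoc, ← Complex.exp_add, neg_add_cancel,
    Complex.exp_zero, mul_one]

namespace ConcaveGirouxForm

variable {O : ConcreteOpenBook n Y B} {α : OneForm (EuclideanSpace ℝ (Fin (2 * n + 3))) Y}
  {A : B × ℂ → ℝ} (h : ConcaveGirouxForm O α A) {ζ : Circle} {δ ρ : ℝ}
  (hc : CutoffParameters A ζ δ ρ)
include h hc

lemma nondegenerateOnKer_interpForm {l : ℝ} (hl : l ∈ Icc (0 : ℝ) 1) {y : Y} (hy : y ∉ O.binding) :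
    NondegenerateOnKer (E := EuclideanSpace ℝ (Fin (2 * n + 3)))
      ((interpForm O α A ζ δ ρ l).dCLM y) (O.dthetaForm y) :=
  OneForm.nondegenerateOnKer (h.nondegenerateOn_interpForm hc hl hy) (h.dthetaForm_ne_zero hy)

lemma dthetaForm_horizontalField {l : ℝ} (hl : l ∈ Icc (0 : ℝ) 1) {y : Y} (hy : y ∉ O.binding) :
    O.dthetaForm y (horizontalField O α A ζ δ ρ l y) = 1 :=
  (h.nondegenerateOnKer_interpForm hc hl hy).solveOnKer_one_zero.1

lemma d_horizontalField {l : ℝ} (hl : l ∈ Icc (0 : ℝ) 1) {y : Y} (hy : y ∉ O.binding)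
    (w : EuclideanSpace ℝ (Fin (2 * n + 3))) :
    (interpForm O α A ζ δ ρ l).d y (horizontalField O α A ζ δ ρ l y) w = 0 :=
  (h.nondegenerateOnKer_interpForm hc hl hy).solveOnKer_one_zero.2 w

lemma eq_horizontalField {l : ℝ} (hl : l ∈ Icc (0 : ℝ) 1) {y : Y} (hy : y ∉ O.binding)
    {v : EuclideanSpace ℝ (Fin (2 * n + 3))} (h1 : O.dthetaForm y v = 1)
    (h2 : ∀ w, (interpForm O α A ζ δ ρ l).d y v w = 0) : v = horizontalField O α A ζ δ ρ l y :=
  (h.nondegenerateOnKer_interpForm hc hl hy).unique_kernel h1 h2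

lemma map_horizontalField {V : Type} [NormedAddCommGroup V] [NormedSpace ℝ V]
    [FiniteDimensional ℝ V] {l : ℝ} (hl : l ∈ Icc (0 : ℝ) 1) {φ : V → Y} {x : V}
    (hφ : ContMDiffAt 𝓘(ℝ, V) (𝓡 (2 * n + 3)) ∞ φ x)
    (hb : Function.Bijective (mfderiv 𝓘(ℝ, V) (𝓡 (2 * n + 3)) φ x)) (hx : φ x ∉ O.binding) :
    NondegenerateOnKer (formDCLM ((interpForm O α A ζ δ ρ l).pull φ) x) (O.dthetaForm.pull φ x) ∧
    (show V →L[ℝ] EuclideanSpace ℝ (Fin (2 * n + 3)) from mfderiv 𝓘(ℝ, V) (𝓡 (2 * n + 3)) φ x)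
      (solveOnKer (E := V) (formDCLM ((interpForm O α A ζ δ ρ l).pull φ) x) (O.dthetaForm.pull φ x) 1 0) =
      horizontalField O α A ζ δ ρ l (φ x) := by
  have hs := h.smoothAt_interpForm hc l hx
  have h1 := OneForm.nondegenerateOnKer_pull (τ := O.dthetaForm) hs hφ hb
    (h.nondegenerateOn_interpForm hc hl hx) (h.dthetaForm_ne_zero hx)
  exact ⟨h1, (h.nondegenerateOnKer_interpForm hc hl hx).map_solveOnKer h1 (μ := 0) (μ' := 0)
    (T := (mfderiv 𝓘(ℝ, V) (𝓡 (2 * n + 3)) φ x : V →L[ℝ] EuclideanSpace ℝ (Fin (2 * n + 3))))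
    hb.2 (fun v w => hs.formD_pull hφ v w) (fun _ => rfl) (fun _ => rfl)⟩

/-- The exterior derivative is affine in `l`; this gives the joint smoothness of the horizontal
fields in the point and the parameter. -/
lemma formDCLM_pull_interpForm {V : Type} [NormedAddCommGroup V] [NormedSpace ℝ V] {φ : V → Y}
    {x : V} (hφ : ContMDiffAt 𝓘(ℝ, V) (𝓡 (2 * n + 3)) ∞ φ x) (hx : φ x ∉ O.binding) (l : ℝ) :
    formDCLM ((interpForm O α A ζ δ ρ l).pull φ) x =
      formDCLM (α.pull φ) x + l • formDCLM ((correction O α A ζ δ ρ).pull φ) x := by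
  have e : (interpForm O α A ζ δ ρ l).pull φ =
      fun y => α.pull φ y + l • (correction O α A ζ δ ρ).pull φ y := by
    funext y
    ext u
    rfl
  have h1 := (((h.smoothAt _).contDiffAt_pull hφ).differentiableAt (by simp)).hasFDerivAt
  have h2 := (((h.smoothAt_correction hc hx).contDiffAt_pull hφ).differentiableAt
    (by simp)).hasFDerivAt
  have h3 : fderiv ℝ ((interpForm O α A ζ δ ρ l).pull φ) x = fderiv ℝ (α.pull φ) x +
      l • fderiv ℝ ((correction O α A ζ δ ρ).pull φ) x := by
    rw [e]; exact (h1.add (h2.const_smul l)).fderiv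
  ext u w
  simp only [formDCLM, h3]
  simp
  ring

lemma nonempty_vectorFieldChart {p : Y × ℝ} (hp : p ∈ O.bindingᶜ ×ˢ (univ : Set ℝ)) :
    Nonempty (VectorFieldChart (E := EuclideanSpace ℝ (Fin (2 * n + 3)) × ℝ)
      (suspendedField O α A ζ δ ρ) p) := by
  obtain ⟨y₀, s₀⟩ := p
  have hy₀ : y₀ ∉ O.binding := hp.1
  set e := extChartAt (𝓡 (2 * n + 3)) y₀ with he
  have hU : IsOpen (e.target ∩ e.symm ⁻¹' O.bindingᶜ) :=
    (continuousOn_extChartAt_symm y₀).isOpen_inter_preimage (isOpen_extChartAt_target y₀)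
      O.isClosed_binding.isOpen_compl
  refine ⟨{
    φ := fun x => (e.symm x.1, x.2)
    ψ := fun q => (e q.1, q.2)
    X := fun x => (solveOnKer (formDCLM ((interpForm O α A ζ δ ρ (Real.smoothTransition x.2)).pull
      e.symm) x.1) (O.dthetaForm.pull e.symm x.1) 1 0, 0)
    U := (e.target ∩ e.symm ⁻¹' O.bindingᶜ) ×ˢ univ
    V := (e.source ∩ O.bindingᶜ) ×ˢ univ
    isOpen_U := hU.prod isOpen_univ
    isOpen_V := ((isOpen_extChartAt_source y₀).inter O.isClosed_binding.isOpen_compl).prod isOpen_univ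
    mem_V := ⟨⟨mem_extChartAt_source y₀, hy₀⟩, mem_univ _⟩
    mapsTo_φ := fun x hx => ⟨⟨e.map_target hx.1.1, hx.1.2⟩, mem_univ _⟩
    mapsTo_ψ := fun q hq => ⟨⟨e.map_source hq.1.1, by
      rw [mem_preimage, e.left_inv hq.1.1]; exact hq.1.2⟩, mem_univ _⟩
    left_inv := fun q hq => by simp only [e.left_inv hq.1.1]
    right_inv := fun x hx => by simp only [e.right_inv hx.1.1]
    contMDiffOn_φ := ?_
    contMDiffOn_ψ := ?_
    contDiffOn_X := ?_
    eq_mfderiv := ?_ }⟩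
  · intro x hx
    refine ContMDiffAt.contMDiffWithinAt (ContMDiffAt.prodMk ?_ ?_)
    · exact ContMDiffAt.comp x (g := e.symm) (f := Prod.fst)
        (contMDiffAt_extChartAt_symm' y₀ hx.1.1) contDiffAt_fst.contMDiffAt
    · exact contDiffAt_snd.contMDiffAt
  · intro q hq
    refine ContMDiffAt.contMDiffWithinAt ?_
    have h1 : ContMDiffAt ((𝓡 (2 * n + 3)).prod 𝓘(ℝ, ℝ)) (𝓡 (2 * n + 3)) ∞ (fun q : Y × ℝ => e q.1) q :=
      ContMDiffAt.comp q (g := e) (f := Prod.fst)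
        (contMDiffAt_extChartAt' (by
          have := hq.1.1
          rwa [he, extChartAt_source] at this)) contMDiffAt_fst
    exact ContMDiffAt.prodMk_space h1 contMDiffAt_snd
  · intro x hx
    refine ContDiffAt.contDiffWithinAt ?_
    have hφ := contMDiffAt_extChartAt_symm' y₀ hx.1.1
    have hnd := (h.map_horizontalField hc (smoothTransition_mem x.2) hφ
      (bijective_mfderiv_extChartAt_symm y₀ hx.1.1) hx.1.2).1
    have hfst : ContDiffAt ℝ ∞ (Prod.fst : EuclideanSpace ℝ (Fin (2 * n + 3)) × ℝ → _) x :=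
      contDiffAt_fst
    have h1 : ContDiffAt ℝ ∞ (fun x : EuclideanSpace ℝ (Fin (2 * n + 3)) × ℝ =>
        formDCLM (α.pull e.symm) x.1) x :=
      (contDiffAt_formDCLM ((h.smoothAt _).contDiffAt_pull hφ)).comp x hfst
    have h2 : ContDiffAt ℝ ∞ (fun x : EuclideanSpace ℝ (Fin (2 * n + 3)) × ℝ =>
        formDCLM ((correction O α A ζ δ ρ).pull e.symm) x.1) x :=
      (contDiffAt_formDCLM ((h.smoothAt_correction hc hx.1.2).contDiffAt_pull hφ)).comp x hfst
    have h3 : ContDiffAt ℝ ∞ (fun x : EuclideanSpace ℝ (Fin (2 * n + 3)) × ℝ =>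
        Real.smoothTransition x.2) x :=
      (Real.smoothTransition.contDiff (n := (⊤ : ℕ∞))).contDiffAt.comp x contDiffAt_snd
    have h4 : ContDiffAt ℝ ∞ (fun x : EuclideanSpace ℝ (Fin (2 * n + 3)) × ℝ =>
        formDCLM ((interpForm O α A ζ δ ρ (Real.smoothTransition x.2)).pull e.symm) x.1) x := by
      have h6 : ContDiffAt ℝ ∞ (fun x : EuclideanSpace ℝ (Fin (2 * n + 3)) × ℝ =>
          Real.smoothTransition x.2 • formDCLM ((correction O α A ζ δ ρ).pull e.symm) x.1) x :=
        contDiffAt_real_smul h3 h2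
      refine (h1.add h6).congr_of_eventuallyEq ?_
      filter_upwards [(hU.prod isOpen_univ).mem_nhds hx] with x' hx'
      exact h.formDCLM_pull_interpForm hc (contMDiffAt_extChartAt_symm' y₀ hx'.1.1) hx'.1.2 _
    have h5 : ContDiffAt ℝ ∞ (fun x : EuclideanSpace ℝ (Fin (2 * n + 3)) × ℝ =>
        O.dthetaForm.pull e.symm x.1) x :=
      ((O.smoothAt_dthetaForm hx.1.2).contDiffAt_pull hφ).comp x hfst
    exact (contDiffAt_solveOnKer (p := x) (u := fun _ => 1) (μ := fun _ => 0)
      (σ := fun x : EuclideanSpace ℝ (Fin (2 * n + 3)) × ℝ =>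
        formDCLM ((interpForm O α A ζ δ ρ (Real.smoothTransition x.2)).pull e.symm) x.1)
      (τ := fun x : EuclideanSpace ℝ (Fin (2 * n + 3)) × ℝ => O.dthetaForm.pull e.symm x.1)
      hnd h4 h5 contDiffAt_const contDiffAt_const).prodMk contDiffAt_const
  · intro x hx
    have hφ := contMDiffAt_extChartAt_symm' y₀ hx.1.1
    have h1 := (h.map_horizontalField hc (smoothTransition_mem x.2) hφ
      (bijective_mfderiv_extChartAt_symm y₀ hx.1.1) hx.1.2).2
    have d1 : HasMFDerivAt 𝓘(ℝ, EuclideanSpace ℝ (Fin (2 * n + 3)) × ℝ) (𝓡 (2 * n + 3))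
        (fun x : EuclideanSpace ℝ (Fin (2 * n + 3)) × ℝ => e.symm x.1) x _ :=
      HasMFDerivAt.comp x (g := e.symm) (f := Prod.fst)
        (hφ.mdifferentiableAt (by simp)).hasMFDerivAt (hasFDerivAt_fst (𝕜 := ℝ) (p := x)).hasMFDerivAt
    have d2 : HasMFDerivAt 𝓘(ℝ, EuclideanSpace ℝ (Fin (2 * n + 3)) × ℝ) 𝓘(ℝ, ℝ)
        (fun x : EuclideanSpace ℝ (Fin (2 * n + 3)) × ℝ => x.2) x _ :=
      (hasFDerivAt_snd (𝕜 := ℝ) (p := x)).hasMFDerivAt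
    have d3 := (d1.prodMk d2).mfderiv
    refine Eq.symm ((congrArg (fun T : EuclideanSpace ℝ (Fin (2 * n + 3)) × ℝ →L[ℝ]
      EuclideanSpace ℝ (Fin (2 * n + 3)) × ℝ => T _) d3).trans ?_)
    exact Prod.ext h1 rfl

end ConcaveGirouxForm

end MonodromyForm

/-! ### The horizontal lift in polar coordinates, solved up to `r = 0`. -/

section PolarSolution

variable {E : Type*} [NormedAddCommGroup E] [NormedSpace ℝ E]

/-- The data at a point, in polar coordinates, of a form `(1 + r² q) α_B + r² g dθ`: the values of
`r`, `q`, `g`, of the derivatives of `q` and `g` with respect to `r` and `θ`, and of their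
differentials along the binding. -/
structure PolarData (E : Type*) [NormedAddCommGroup E] [NormedSpace ℝ E] where
  σ : E →L[ℝ] E →L[ℝ] ℝ
  τ : E →L[ℝ] ℝ
  r : ℝ
  q : ℝ
  g : ℝ
  qr : ℝ
  gr : ℝ
  qθ : ℝ
  dq : E →L[ℝ] ℝ
  dg : E →L[ℝ] ℝ

namespace PolarData

variable (D : PolarData E)

/-- The value of `r⁻¹ ∂F/∂r`. -/
def den : ℝ := 2 * D.q + D.r * D.qr

/-- The value of `α_B` on the horizontal lift of `∂/∂θ`. -/
def u : ℝ := -(2 * D.g + D.r * D.gr) / D.den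

/-- The component of the horizontal lift of `∂/∂θ` along the binding. -/
def W : E := solveOnKer D.σ D.τ D.u ((D.r ^ 2 / (1 + D.r ^ 2 * D.q)) • (D.dg + D.u • D.dq))

/-- The logarithmic derivative of the radius along the horizontal lift of `∂/∂θ`. -/
def k : ℝ := ((D.dg + D.u • D.dq) (solveOnKer D.σ D.τ 1 0) - D.qθ - D.dq D.W) / D.den

variable {D}

/-- The left-hand side is `dβ((W, r k, 1), (w, ρ, t))` for `β = (1 + r² q) α_B + r² g dθ`. The
coefficient of `ρ` fixes `u = α_B(W)`, the values on `ker α_B` fix `W`, and the Reeb direction of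
`α_B` fixes `k`. No division by `r` occurs, so the formulas make sense at `r = 0`. The derivative
`gθ` cancels, which is why it is not part of the data. -/
lemma horizontal [FiniteDimensional ℝ E] (hD : NondegenerateOnKer D.σ D.τ) (hden : D.den ≠ 0)
    (hF : 1 + D.r ^ 2 * D.q ≠ 0) (gθ : ℝ) (w : E) (ρ t : ℝ) :
    (D.r ^ 2 * (D.dq D.W + D.r * D.k * D.qr + D.qθ) + 2 * D.r * (D.r * D.k) * D.q) * D.τ w -
      (D.r ^ 2 * (D.dq w + ρ * D.qr + t * D.qθ) + 2 * D.r * ρ * D.q) * D.τ D.W +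
      (1 + D.r ^ 2 * D.q) * D.σ D.W w +
      ((D.r ^ 2 * (D.dg D.W + D.r * D.k * D.gr + gθ) + 2 * D.r * (D.r * D.k) * D.g) * t -
        (D.r ^ 2 * (D.dg w + ρ * D.gr + t * gθ) + 2 * D.r * ρ * D.g) * 1) = 0 := by
  obtain ⟨hR1, hR0⟩ := hD.solveOnKer_one_zero
  set R := solveOnKer D.σ D.τ 1 0 with hR
  have hW := hD.solveOnKer_spec D.u ((D.r ^ 2 / (1 + D.r ^ 2 * D.q)) • (D.dg + D.u • D.dq))
  change D.τ D.W = D.u ∧ ∀ w, D.τ w = 0 → D.σ D.W w = _ at hW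
  obtain ⟨hWu, hWσ⟩ := hW
  -- The condition on `W` is known only on `ker τ`. It extends to all `w` by subtracting `τ(w) R`,
  -- because `σ(W, R) = 0`.
  have hσ : ∀ w, (1 + D.r ^ 2 * D.q) * D.σ D.W w =
      D.r ^ 2 * (D.dg w + D.u * D.dq w - D.τ w * (D.dg R + D.u * D.dq R)) := by
    intro w
    have h1 := hWσ (w - D.τ w • R) (by simp [hR1])
    have h2 : D.σ D.W R = 0 := by rw [hD.skew, hR0, neg_zero]
    simp only [map_sub, map_smul, h2, smul_eq_mul, mul_zero, sub_zero, smul_apply, add_apply] at h1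
    rw [h1]
    field_simp
  have hk : D.k * D.den = D.dg R + D.u * D.dq R - D.qθ - D.dq D.W := by
    rw [k, div_mul_cancel₀ _ hden]
    simp [hR]
  have hu : D.u * D.den = -(2 * D.g + D.r * D.gr) := by rw [u, div_mul_cancel₀ _ hden]
  have hWW := hσ D.W
  rw [hD.self_eq_zero, hWu, mul_zero] at hWW
  rw [hWu, hσ]
  have hden' : D.den = 2 * D.q + D.r * D.qr := rfl
  rw [hden'] at hk hu
  -- The coefficients of `τ w`, `ρ` and `t` vanish separately. The one of `t` needs all three
  -- relations, in agreement with the form being alternating.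
  linear_combination (D.r ^ 2 * D.τ w - D.r ^ 2 * D.u * t) * hk + (-D.r * ρ + D.r ^ 2 * D.k * t) * hu - t * hWW

/-- The pullback of the data by a linear map. -/
def comap {V : Type*} [NormedAddCommGroup V] [NormedSpace ℝ V] (D : PolarData E) (T : V →L[ℝ] E) :
    PolarData V :=
  ⟨D.σ.bilinearComp T T, D.τ.comp T, D.r, D.q, D.g, D.qr, D.gr, D.qθ, D.dq.comp T, D.dg.comp T⟩

/-- The solution does not depend on the coordinates chosen on the binding, so the polar field is
well defined on `B × ℝ³` and its chart expressions are the solutions for the data read in the chart.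
-/
lemma map_comap {V : Type*} [NormedAddCommGroup V] [NormedSpace ℝ V] [FiniteDimensional ℝ E]
    [FiniteDimensional ℝ V] (hD : NondegenerateOnKer D.σ D.τ) {T : V →L[ℝ] E}
    (hT : Function.Bijective T) : T (D.comap T).W = D.W ∧ (D.comap T).k = D.k := by
  have h' : NondegenerateOnKer (D.σ.bilinearComp T T) (D.τ.comp T) := by
    refine ⟨fun v => hD.self_eq_zero _, fun h0 => hD.ne_zero ?_, fun v hv hw => ?_⟩
    · ext w
      obtain ⟨w, rfl⟩ := hT.2 w
      exact congrArg (fun S : V →L[ℝ] ℝ => S w) h0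
    · refine hT.1 ((hD.eq_zero (T v) hv fun w hw' => ?_).trans (map_zero _).symm)
      obtain ⟨w, rfl⟩ := hT.2 w
      exact hw w hw'
  have h1 : T (D.comap T).W = D.W :=
    hD.map_solveOnKer h' hT.2 (fun _ _ => rfl) (fun _ => rfl) (fun _ => rfl)
  have h2 : T (solveOnKer (D.σ.bilinearComp T T) (D.τ.comp T) 1 0) = solveOnKer D.σ D.τ 1 0 :=
    hD.map_solveOnKer h' hT.2 (fun _ _ => rfl) (fun _ => rfl) (fun _ => rfl)
  refine ⟨h1, ?_⟩
  have e1 : (D.comap T).k = ((D.dg + D.u • D.dq) (T (solveOnKer (D.σ.bilinearComp T T)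
    (D.τ.comp T) 1 0)) - D.qθ - D.dq (T (D.comap T).W)) / D.den := rfl
  rw [e1, h1, h2]
  rfl

/-- Smooth dependence of the data on parameters. -/
structure SmoothAt {P : Type*} [NormedAddCommGroup P] [NormedSpace ℝ P] (D : P → PolarData E)
    (p : P) : Prop where
  σ : ContDiffAt ℝ ∞ (fun p => (D p).σ) p
  τ : ContDiffAt ℝ ∞ (fun p => (D p).τ) p
  r : ContDiffAt ℝ ∞ (fun p => (D p).r) p
  q : ContDiffAt ℝ ∞ (fun p => (D p).q) p
  g : ContDiffAt ℝ ∞ (fun p => (D p).g) p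
  qr : ContDiffAt ℝ ∞ (fun p => (D p).qr) p
  gr : ContDiffAt ℝ ∞ (fun p => (D p).gr) p
  qθ : ContDiffAt ℝ ∞ (fun p => (D p).qθ) p
  dq : ContDiffAt ℝ ∞ (fun p => (D p).dq) p
  dg : ContDiffAt ℝ ∞ (fun p => (D p).dg) p

lemma SmoothAt.contDiffAt [FiniteDimensional ℝ E] {P : Type*} [NormedAddCommGroup P]
    [NormedSpace ℝ P] {D : P → PolarData E} {p : P} (h : SmoothAt D p)
    (hD : NondegenerateOnKer (D p).σ (D p).τ) (hden : (D p).den ≠ 0)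
    (hF : 1 + (D p).r ^ 2 * (D p).q ≠ 0) :
    ContDiffAt ℝ ∞ (fun p => (D p).W) p ∧ ContDiffAt ℝ ∞ (fun p => (D p).k) p := by
  have hd : ContDiffAt ℝ ∞ (fun p => (D p).den) p :=
    (contDiffAt_const.mul h.q).add (h.r.mul h.qr)
  have hu : ContDiffAt ℝ ∞ (fun p => (D p).u) p :=
    ((contDiffAt_const.mul h.g).add (h.r.mul h.gr)).neg.div hd hden
  have hμ : ContDiffAt ℝ ∞ (fun p => (D p).dg + (D p).u • (D p).dq) p := h.dg.add (hu.smul h.dq)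
  have hW : ContDiffAt ℝ ∞ (fun p => (D p).W) p :=
    contDiffAt_solveOnKer hD h.σ h.τ hu
      (((h.r.pow 2).div (contDiffAt_const.add ((h.r.pow 2).mul h.q)) hF).smul hμ)
  have hR : ContDiffAt ℝ ∞ (fun p => solveOnKer (D p).σ (D p).τ 1 0) p :=
    contDiffAt_solveOnKer hD h.σ h.τ contDiffAt_const contDiffAt_const
  exact ⟨hW, (((hμ.clm_apply hR).sub h.qθ).sub (h.dq.clm_apply hW)).div hd hden⟩

end PolarData

end PolarSolution

/-! ### Cutoffs in the variables `(s, r, θ)`. -/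

section PolarCutoff

/-- A smooth even function equal to `1` on `[-a, a]` and to `0` outside `[-3a/2, 3a/2]`. -/
def evenBump (a x : ℝ) : ℝ := Real.smoothTransition (2 - (x / a) ^ 2)

lemma contDiff_evenBump (a : ℝ) : ContDiff ℝ ∞ (evenBump a) :=
  (Real.smoothTransition.contDiff (n := (⊤ : ℕ∞))).comp
    (contDiff_const.sub ((contDiff_id.div_const a).pow 2))

lemma evenBump_eq_one {a x : ℝ} (ha : 0 < a) (hx : |x| ≤ a) : evenBump a x = 1 := by
  refine Real.smoothTransition.one_of_one_le ?_
  have h1 : |x / a| ≤ 1 := by rw [abs_div, abs_of_pos ha]; exact (div_le_one ha).2 hx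
  have h2 : (x / a) ^ 2 ≤ 1 := (sq_le_one_iff_abs_le_one _).2 h1
  linarith

lemma evenBump_eq_zero {a x : ℝ} (ha : 0 < a) (hx : 3 / 2 * a ≤ |x|) : evenBump a x = 0 := by
  refine Real.smoothTransition.zero_of_nonpos ?_
  have h1 : 3 / 2 ≤ |x / a| := by
    rw [abs_div, abs_of_pos ha]; exact (le_div_iff₀ ha).2 hx
  have h2 : (3 / 2) ^ 2 ≤ (x / a) ^ 2 := by
    rw [← sq_abs (x / a)]; exact pow_le_pow_left₀ (by norm_num) h1 2
  linarith

/-- The cutoff function in the variables `(s, r, θ)`. -/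
def polarCutoff (a : ℝ) (p : ℝ × ℝ × ℝ) : ℝ := evenBump 2 p.1 * evenBump a p.2.1 * evenBump 16 p.2.2

lemma contDiff_polarCutoff (a : ℝ) : ContDiff ℝ ∞ (polarCutoff a) :=
  (((contDiff_evenBump 2).comp contDiff_fst).mul
    ((contDiff_evenBump a).comp (contDiff_fst.comp contDiff_snd))).mul
      ((contDiff_evenBump 16).comp (contDiff_snd.comp contDiff_snd))

lemma polarCutoff_eq_one {a : ℝ} {p : ℝ × ℝ × ℝ} (ha : 0 < a) (hs : |p.1| ≤ 2) (hr : |p.2.1| ≤ a)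
    (hθ : |p.2.2| ≤ 16) : polarCutoff a p = 1 := by
  rw [polarCutoff, evenBump_eq_one (by norm_num) hs, evenBump_eq_one ha hr,
    evenBump_eq_one (by norm_num) hθ]
  norm_num

lemma polarCutoff_eq_zero {a : ℝ} {p : ℝ × ℝ × ℝ} (ha : 0 < a)
    (hp : 3 ≤ |p.1| ∨ 3 / 2 * a ≤ |p.2.1| ∨ 24 ≤ |p.2.2|) : polarCutoff a p = 0 := by
  rw [polarCutoff]
  rcases hp with h | h | h
  · rw [evenBump_eq_zero (by norm_num) (by linarith), zero_mul, zero_mul]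
  · rw [evenBump_eq_zero ha h, mul_zero, zero_mul]
  · rw [evenBump_eq_zero (a := 16) (by norm_num) (by linarith), mul_zero]

end PolarCutoff

/-! ### The horizontal field as a smooth field on `B × ℝ³`. -/

section PolarField

variable {n : ℕ}
  {Y : Type*} [TopologicalSpace Y] [ChartedSpace (EuclideanSpace ℝ (Fin (2 * n + 3))) Y]
  [IsManifold (𝓡 (2 * n + 3)) ∞ Y] [CompactSpace Y] [T2Space Y]
  {B : Type*} [TopologicalSpace B] [ChartedSpace (EuclideanSpace ℝ (Fin (2 * n + 1))) B]
  [IsManifold (𝓡 (2 * n + 1)) ∞ B] [CompactSpace B] [T2Space B]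

/-- The function `q` for the interpolated form. -/
def polarQ (A : B × ℂ → ℝ) (ζ : Circle) (b : B) (p : ℝ × ℝ × ℝ) : ℝ :=
  (1 - Real.smoothTransition p.1) * radialQuot A ζ b p.2.1 p.2.2 +
    Real.smoothTransition p.1 * radialQuot A ζ b p.2.1 0

/-- The function `g` for the interpolated form. -/
def polarG (A : B × ℂ → ℝ) (ζ : Circle) (b : B) (p : ℝ × ℝ × ℝ) : ℝ :=
  (1 - Real.smoothTransition p.1) * (1 + p.2.1 ^ 2 * radialQuot A ζ b p.2.1 p.2.2)

/-- The polar data of the interpolated form. -/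
def polarData (O : ConcreteOpenBook n Y B) (α : OneForm (EuclideanSpace ℝ (Fin (2 * n + 3))) Y)
    (A : B × ℂ → ℝ) (ζ : Circle) (b : B) (p : ℝ × ℝ × ℝ) :
    PolarData (EuclideanSpace ℝ (Fin (2 * n + 1))) where
  σ := (O.bindingForm α).dCLM b
  τ := O.bindingForm α b
  r := p.2.1
  q := polarQ A ζ b p
  g := polarG A ζ b p
  qr := deriv (fun r => polarQ A ζ b (p.1, r, p.2.2)) p.2.1
  gr := deriv (fun r => polarG A ζ b (p.1, r, p.2.2)) p.2.1
  qθ := deriv (fun θ => polarQ A ζ b (p.1, p.2.1, θ)) p.2.2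
  dq := mfderiv (𝓡 (2 * n + 1)) 𝓘(ℝ, ℝ) (fun b => polarQ A ζ b p) b
  dg := mfderiv (𝓡 (2 * n + 1)) 𝓘(ℝ, ℝ) (fun b => polarG A ζ b p) b

/-- The polar data of the interpolated form, in a chart of the binding. -/
def polarDataChart (O : ConcreteOpenBook n Y B)
    (α : OneForm (EuclideanSpace ℝ (Fin (2 * n + 3))) Y) (A : B × ℂ → ℝ) (ζ : Circle) (b₀ : B)
    (x : EuclideanSpace ℝ (Fin (2 * n + 1)) × ℝ × ℝ × ℝ) :
    PolarData (EuclideanSpace ℝ (Fin (2 * n + 1))) where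
  σ := formDCLM ((O.bindingForm α).inChart b₀) x.1
  τ := (O.bindingForm α).inChart b₀ x.1
  r := x.2.2.1
  q := polarQ A ζ ((extChartAt (𝓡 (2 * n + 1)) b₀).symm x.1) x.2
  g := polarG A ζ ((extChartAt (𝓡 (2 * n + 1)) b₀).symm x.1) x.2
  qr := deriv (fun r => polarQ A ζ ((extChartAt (𝓡 (2 * n + 1)) b₀).symm x.1)
    (x.2.1, r, x.2.2.2)) x.2.2.1
  gr := deriv (fun r => polarG A ζ ((extChartAt (𝓡 (2 * n + 1)) b₀).symm x.1)
    (x.2.1, r, x.2.2.2)) x.2.2.1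
  qθ := deriv (fun θ => polarQ A ζ ((extChartAt (𝓡 (2 * n + 1)) b₀).symm x.1)
    (x.2.1, x.2.2.1, θ)) x.2.2.2
  dq := fderiv ℝ (fun w => polarQ A ζ ((extChartAt (𝓡 (2 * n + 1)) b₀).symm w) x.2) x.1
  dg := fderiv ℝ (fun w => polarG A ζ ((extChartAt (𝓡 (2 * n + 1)) b₀).symm w) x.2) x.1

/-- The horizontal lift of `∂/∂θ` in polar coordinates, cut off away from the binding, with an
additional parameter. -/
def polarField (O : ConcreteOpenBook n Y B) (α : OneForm (EuclideanSpace ℝ (Fin (2 * n + 3))) Y)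
    (A : B × ℂ → ℝ) (ζ : Circle) (a : ℝ) (x : B × ℝ × ℝ × ℝ) :
    TangentSpace ((𝓡 (2 * n + 1)).prod 𝓘(ℝ, ℝ × ℝ × ℝ)) x :=
  (polarCutoff a x.2 • (polarData O α A ζ x.1 x.2).W,
    ((0 : ℝ), x.2.2.1 * (polarCutoff a x.2 * (polarData O α A ζ x.1 x.2).k), (1 : ℝ)))

/-- The expression of `polarField` in a chart of the binding. -/
def polarFieldChart (O : ConcreteOpenBook n Y B)
    (α : OneForm (EuclideanSpace ℝ (Fin (2 * n + 3))) Y)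
    (A : B × ℂ → ℝ) (ζ : Circle) (a : ℝ) (b₀ : B)
    (x : EuclideanSpace ℝ (Fin (2 * n + 1)) × ℝ × ℝ × ℝ) :
    EuclideanSpace ℝ (Fin (2 * n + 1)) × ℝ × ℝ × ℝ :=
  (polarCutoff a x.2 • (polarDataChart O α A ζ b₀ x).W,
    ((0 : ℝ), x.2.2.1 * (polarCutoff a x.2 * (polarDataChart O α A ζ b₀ x).k), (1 : ℝ)))

namespace ConcaveGirouxForm

variable {O : ConcreteOpenBook n Y B} {α : OneForm (EuclideanSpace ℝ (Fin (2 * n + 3))) Y}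
  {A : B × ℂ → ℝ} (h : ConcaveGirouxForm O α A)
include h

lemma contDiffAt_polarQ (ζ : Circle) (b₀ : B) {x : EuclideanSpace ℝ (Fin (2 * n + 1)) × ℝ × ℝ × ℝ}
    (hx : x.1 ∈ (extChartAt (𝓡 (2 * n + 1)) b₀).target) (hr : |x.2.2.1| < 1) :
    ContDiffAt ℝ ∞ (fun x : EuclideanSpace ℝ (Fin (2 * n + 1)) × ℝ × ℝ × ℝ =>
      polarQ A ζ ((extChartAt (𝓡 (2 * n + 1)) b₀).symm x.1) x.2) x ∧
    ContDiffAt ℝ ∞ (fun x : EuclideanSpace ℝ (Fin (2 * n + 1)) × ℝ × ℝ × ℝ =>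
      polarG A ζ ((extChartAt (𝓡 (2 * n + 1)) b₀).symm x.1) x.2) x := by
  have h1 : ContDiffAt ℝ ∞ (fun x : EuclideanSpace ℝ (Fin (2 * n + 1)) × ℝ × ℝ × ℝ =>
      radialQuot A ζ ((extChartAt (𝓡 (2 * n + 1)) b₀).symm x.1) x.2.2.1 x.2.2.2) x := by
    refine ContDiffAt.comp x (g := fun x : EuclideanSpace ℝ (Fin (2 * n + 1)) × ℝ × ℝ =>
      radialQuot A ζ ((extChartAt (𝓡 (2 * n + 1)) b₀).symm x.1) x.2.1 x.2.2)
      (f := fun x : EuclideanSpace ℝ (Fin (2 * n + 1)) × ℝ × ℝ × ℝ => (x.1, x.2.2.1, x.2.2.2))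
      (h.contDiffAt_radialQuot ζ b₀ hx hr) ?_
    exact (by fun_prop : ContDiff ℝ ∞ fun x : EuclideanSpace ℝ (Fin (2 * n + 1)) × ℝ × ℝ × ℝ =>
      (x.1, x.2.2.1, x.2.2.2)).contDiffAt
  have h2 : ContDiffAt ℝ ∞ (fun x : EuclideanSpace ℝ (Fin (2 * n + 1)) × ℝ × ℝ × ℝ =>
      radialQuot A ζ ((extChartAt (𝓡 (2 * n + 1)) b₀).symm x.1) x.2.2.1 0) x := by
    refine ContDiffAt.comp x (g := fun x : EuclideanSpace ℝ (Fin (2 * n + 1)) × ℝ × ℝ =>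
      radialQuot A ζ ((extChartAt (𝓡 (2 * n + 1)) b₀).symm x.1) x.2.1 x.2.2)
      (f := fun x : EuclideanSpace ℝ (Fin (2 * n + 1)) × ℝ × ℝ × ℝ => (x.1, x.2.2.1, (0 : ℝ)))
      (h.contDiffAt_radialQuot ζ b₀ hx hr) ?_
    exact (by fun_prop : ContDiff ℝ ∞ fun x : EuclideanSpace ℝ (Fin (2 * n + 1)) × ℝ × ℝ × ℝ =>
      (x.1, x.2.2.1, (0 : ℝ))).contDiffAt
  have h3 : ContDiffAt ℝ ∞ (fun x : EuclideanSpace ℝ (Fin (2 * n + 1)) × ℝ × ℝ × ℝ =>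
      Real.smoothTransition x.2.1) x :=
    (Real.smoothTransition.contDiff (n := (⊤ : ℕ∞))).contDiffAt.comp x
      (contDiffAt_fst.comp x contDiffAt_snd)
  have h4 : ContDiffAt ℝ ∞ (fun x : EuclideanSpace ℝ (Fin (2 * n + 1)) × ℝ × ℝ × ℝ => x.2.2.1) x := by
    fun_prop
  exact ⟨((contDiffAt_const.sub h3).mul h1).add (h3.mul h2),
    (contDiffAt_const.sub h3).mul (contDiffAt_const.add ((h4.pow 2).mul h1))⟩

lemma contMDiffAt_polarQ (ζ : Circle) (b : B) {p : ℝ × ℝ × ℝ} (hr : |p.2.1| < 1) :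
    ContMDiffAt (𝓡 (2 * n + 1)) 𝓘(ℝ, ℝ) ∞ (fun b => polarQ A ζ b p) b ∧
    ContMDiffAt (𝓡 (2 * n + 1)) 𝓘(ℝ, ℝ) ∞ (fun b => polarG A ζ b p) b := by
  have key : ∀ f : B → ℝ, ContDiffAt ℝ ∞ (fun w => f ((extChartAt (𝓡 (2 * n + 1)) b).symm w))
      (extChartAt (𝓡 (2 * n + 1)) b b) → ContMDiffAt (𝓡 (2 * n + 1)) 𝓘(ℝ, ℝ) ∞ f b := by
    intro f hf
    have h1 : ContMDiffAt (𝓡 (2 * n + 1)) 𝓘(ℝ, ℝ) ∞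
        (fun b' => f ((extChartAt (𝓡 (2 * n + 1)) b).symm (extChartAt (𝓡 (2 * n + 1)) b b'))) b :=
      ContMDiffAt.comp b (g := fun w => f ((extChartAt (𝓡 (2 * n + 1)) b).symm w))
        hf.contMDiffAt (contMDiffAt_extChartAt (x := b))
    refine h1.congr_of_eventuallyEq ?_
    filter_upwards [extChartAt_source_mem_nhds (I := 𝓡 (2 * n + 1)) b] with b' hb'
    rw [(extChartAt (𝓡 (2 * n + 1)) b).left_inv hb']
  have h1 := h.contDiffAt_polarQ ζ b (x := (extChartAt (𝓡 (2 * n + 1)) b b, p))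
    (mem_extChartAt_target b) hr
  have h2 : ContDiffAt ℝ ∞ (fun w : EuclideanSpace ℝ (Fin (2 * n + 1)) => (w, p))
      (extChartAt (𝓡 (2 * n + 1)) b b) := contDiffAt_id.prodMk contDiffAt_const
  exact ⟨key _ (ContDiffAt.comp (extChartAt (𝓡 (2 * n + 1)) b b)
      (g := fun x : EuclideanSpace ℝ (Fin (2 * n + 1)) × ℝ × ℝ × ℝ =>
        polarQ A ζ ((extChartAt (𝓡 (2 * n + 1)) b).symm x.1) x.2) (f := fun w => (w, p)) h1.1 h2),
    key _ (ContDiffAt.comp (extChartAt (𝓡 (2 * n + 1)) b b)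
      (g := fun x : EuclideanSpace ℝ (Fin (2 * n + 1)) × ℝ × ℝ × ℝ =>
        polarG A ζ ((extChartAt (𝓡 (2 * n + 1)) b).symm x.1) x.2) (f := fun w => (w, p)) h1.2 h2)⟩

lemma nondegenerateOnKer_bindingForm (b : B) :
    NondegenerateOnKer (E := EuclideanSpace ℝ (Fin (2 * n + 1))) ((O.bindingForm α).dCLM b)
      (O.bindingForm α b) :=
  OneForm.nondegenerateOnKer (h.giroux.contact_binding b).2 (h.giroux.contact_binding b).1

lemma nondegenerateOnKer_bindingForm_chart (b₀ : B) {w : EuclideanSpace ℝ (Fin (2 * n + 1))}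
    (hw : w ∈ (extChartAt (𝓡 (2 * n + 1)) b₀).target) :
    NondegenerateOnKer (formDCLM ((O.bindingForm α).inChart b₀) w) ((O.bindingForm α).inChart b₀ w) :=
  OneForm.nondegenerateOnKer_pull (τ := O.bindingForm α) (O.smoothAt_bindingForm h.smoothAt _)
    (contMDiffAt_extChartAt_symm' b₀ hw) (bijective_mfderiv_extChartAt_symm b₀ hw)
    (h.giroux.contact_binding _).2 (h.giroux.contact_binding _).1

/-- Chain rule for the differentials of `q` and `g`, and naturality of `d` for the binding form. -/
lemma polarDataChart_eq_comap (ζ : Circle) (b₀ : B)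
    {x : EuclideanSpace ℝ (Fin (2 * n + 1)) × ℝ × ℝ × ℝ}
    (hx : x.1 ∈ (extChartAt (𝓡 (2 * n + 1)) b₀).target) (hr : |x.2.2.1| < 1) :
    polarDataChart O α A ζ b₀ x =
      (polarData O α A ζ ((extChartAt (𝓡 (2 * n + 1)) b₀).symm x.1) x.2).comap
        (show EuclideanSpace ℝ (Fin (2 * n + 1)) →L[ℝ] EuclideanSpace ℝ (Fin (2 * n + 1)) from
          mfderiv (𝓡 (2 * n + 1)) (𝓡 (2 * n + 1)) (extChartAt (𝓡 (2 * n + 1)) b₀).symm x.1) := by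
  have hφ := contMDiffAt_extChartAt_symm' b₀ hx
  have hd : ∀ f : B → ℝ,
      MDifferentiableAt (𝓡 (2 * n + 1)) 𝓘(ℝ, ℝ) f ((extChartAt (𝓡 (2 * n + 1)) b₀).symm x.1) →
      fderiv ℝ (fun w => f ((extChartAt (𝓡 (2 * n + 1)) b₀).symm w)) x.1 =
      (show EuclideanSpace ℝ (Fin (2 * n + 1)) →L[ℝ] ℝ from
        mfderiv (𝓡 (2 * n + 1)) 𝓘(ℝ, ℝ) f ((extChartAt (𝓡 (2 * n + 1)) b₀).symm x.1)).comp
      (show EuclideanSpace ℝ (Fin (2 * n + 1)) →L[ℝ] EuclideanSpace ℝ (Fin (2 * n + 1)) from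
        mfderiv (𝓡 (2 * n + 1)) (𝓡 (2 * n + 1)) (extChartAt (𝓡 (2 * n + 1)) b₀).symm x.1) := by
    intro f hf
    have h1 := HasMFDerivAt.comp x.1 (g := f) hf.hasMFDerivAt
      (hφ.mdifferentiableAt (by simp)).hasMFDerivAt
    exact mfderiv_eq_fderiv.symm.trans h1.mfderiv
  obtain ⟨hq, hg⟩ := h.contMDiffAt_polarQ ζ ((extChartAt (𝓡 (2 * n + 1)) b₀).symm x.1) hr
  have e1 := hd _ (hq.mdifferentiableAt (by simp))
  have e2 := hd _ (hg.mdifferentiableAt (by simp))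
  have e3 : formDCLM ((O.bindingForm α).inChart b₀) x.1 =
      ((O.bindingForm α).dCLM ((extChartAt (𝓡 (2 * n + 1)) b₀).symm x.1)).bilinearComp
      (show EuclideanSpace ℝ (Fin (2 * n + 1)) →L[ℝ] EuclideanSpace ℝ (Fin (2 * n + 1)) from
        mfderiv (𝓡 (2 * n + 1)) (𝓡 (2 * n + 1)) (extChartAt (𝓡 (2 * n + 1)) b₀).symm x.1)
      (show EuclideanSpace ℝ (Fin (2 * n + 1)) →L[ℝ] EuclideanSpace ℝ (Fin (2 * n + 1)) from
        mfderiv (𝓡 (2 * n + 1)) (𝓡 (2 * n + 1)) (extChartAt (𝓡 (2 * n + 1)) b₀).symm x.1) := by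
    refine ContinuousLinearMap.ext fun v => ContinuousLinearMap.ext fun w => ?_
    exact (O.smoothAt_bindingForm h.smoothAt _).formD_pull hφ v w
  rw [polarDataChart, e1, e2, e3]
  rfl

/-- Both quantities are convex combinations of their values for `A` at the angles `θ` and `0`.
Strict negativity of `den` at `r = 0` is exactly where the Hessian hypothesis is needed. -/
lemma polarData_den_neg (ζ : Circle) (b : B) {p : ℝ × ℝ × ℝ} (hr : |p.2.1| < 1) :
    (polarData O α A ζ b p).den < 0 ∧ 0 < 1 + p.2.1 ^ 2 * polarQ A ζ b p := by
  obtain ⟨e1, d1, -, n1⟩ := h.radial ζ b p.2.2 hr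
  obtain ⟨e2, d2, -, n2⟩ := h.radial ζ b 0 hr
  have hl := smoothTransition_mem p.1
  set l := Real.smoothTransition p.1 with hldef
  have e3 : deriv (fun r => polarQ A ζ b (p.1, r, p.2.2)) p.2.1 =
      (1 - l) * deriv (fun r => radialQuot A ζ b r p.2.2) p.2.1 +
      l * deriv (fun r => radialQuot A ζ b r 0) p.2.1 :=
    ((d1.hasDerivAt.const_mul (1 - l)).add (d2.hasDerivAt.const_mul l)).deriv
  have e4 : (polarData O α A ζ b p).den = (1 - l) * radialDeriv A ζ b p.2.1 p.2.2 +
      l * radialDeriv A ζ b p.2.1 0 := by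
    change 2 * polarQ A ζ b p + p.2.1 * deriv (fun r => polarQ A ζ b (p.1, r, p.2.2)) p.2.1 = _
    rw [e3, polarQ, radialDeriv, radialDeriv]
    ring
  have e5 : 1 + p.2.1 ^ 2 * polarQ A ζ b p = (1 - l) * A (b, polarPt ζ p.2.1 p.2.2) +
      l * A (b, polarPt ζ p.2.1 0) := by
    rw [e1, e2, polarQ]; ring
  have p1 := h.A_pos b (z := polarPt ζ p.2.1 p.2.2) (by rwa [norm_polarPt])
  have p2 := h.A_pos b (z := polarPt ζ p.2.1 0) (by rwa [norm_polarPt])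
  rw [e4, e5]
  rcases eq_or_lt_of_le hl.1 with h0 | h0
  · rw [← h0]; constructor <;> simpa
  · constructor
    · have := mul_neg_of_pos_of_neg h0 n2
      have := mul_nonpos_of_nonneg_of_nonpos (sub_nonneg.2 hl.2) n1.le
      linarith
    · have := mul_pos h0 p2
      have := mul_nonneg (sub_nonneg.2 hl.2) p1.le
      linarith

/-- All partial derivatives in the data are values of the full derivative of one smooth function of
`(w, s, r, θ)` on fixed vectors. -/
lemma smoothAt_polarDataChart (ζ : Circle) (b₀ : B)
    {x : EuclideanSpace ℝ (Fin (2 * n + 1)) × ℝ × ℝ × ℝ}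
    (hx : x.1 ∈ (extChartAt (𝓡 (2 * n + 1)) b₀).target) (hr : |x.2.2.1| < 1) :
    PolarData.SmoothAt (polarDataChart O α A ζ b₀) x := by
  have hfst : ContDiffAt ℝ ∞
      (Prod.fst : EuclideanSpace ℝ (Fin (2 * n + 1)) × ℝ × ℝ × ℝ → _) x := contDiffAt_fst
  obtain ⟨hq, hg⟩ := h.contDiffAt_polarQ ζ b₀ hx hr
  have hev : ∀ᶠ y : EuclideanSpace ℝ (Fin (2 * n + 1)) × ℝ × ℝ × ℝ in 𝓝 x,
      y.1 ∈ (extChartAt (𝓡 (2 * n + 1)) b₀).target ∧ |y.2.2.1| < 1 := by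
    have hc : ContinuousAt (fun y : EuclideanSpace ℝ (Fin (2 * n + 1)) × ℝ × ℝ × ℝ => |y.2.2.1|) x := by
      fun_prop
    exact (continuousAt_fst.eventually_mem ((isOpen_extChartAt_target b₀).mem_nhds hx)).and
      (hc.eventually_mem (Iio_mem_nhds hr))
  have key : ∀ f : B → ℝ × ℝ × ℝ → ℝ, (∀ y : EuclideanSpace ℝ (Fin (2 * n + 1)) × ℝ × ℝ × ℝ,
      y.1 ∈ (extChartAt (𝓡 (2 * n + 1)) b₀).target → |y.2.2.1| < 1 →
      ContDiffAt ℝ ∞ (fun x : EuclideanSpace ℝ (Fin (2 * n + 1)) × ℝ × ℝ × ℝ =>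
        f ((extChartAt (𝓡 (2 * n + 1)) b₀).symm x.1) x.2) y) →
      ContDiffAt ℝ ∞ (fun x : EuclideanSpace ℝ (Fin (2 * n + 1)) × ℝ × ℝ × ℝ =>
        deriv (fun r => f ((extChartAt (𝓡 (2 * n + 1)) b₀).symm x.1) (x.2.1, r, x.2.2.2)) x.2.2.1) x ∧
      ContDiffAt ℝ ∞ (fun x : EuclideanSpace ℝ (Fin (2 * n + 1)) × ℝ × ℝ × ℝ =>
        deriv (fun θ => f ((extChartAt (𝓡 (2 * n + 1)) b₀).symm x.1) (x.2.1, x.2.2.1, θ)) x.2.2.2) x ∧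
      ContDiffAt ℝ ∞ (fun x : EuclideanSpace ℝ (Fin (2 * n + 1)) × ℝ × ℝ × ℝ =>
        fderiv ℝ (fun w => f ((extChartAt (𝓡 (2 * n + 1)) b₀).symm w) x.2) x.1) x := by
    intro f hf
    set fc := fun x : EuclideanSpace ℝ (Fin (2 * n + 1)) × ℝ × ℝ × ℝ =>
      f ((extChartAt (𝓡 (2 * n + 1)) b₀).symm x.1) x.2 with hfc
    have hd : ContDiffAt ℝ ∞ (fderiv ℝ fc) x := (hf x hx hr).fderiv_right (m := ∞) le_rfl
    refine ⟨?_, ?_, ?_⟩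
    · refine (hd.clm_apply (contDiffAt_const (c := ((0, 0, 1, 0) :
        EuclideanSpace ℝ (Fin (2 * n + 1)) × ℝ × ℝ × ℝ)))).congr_of_eventuallyEq ?_
      filter_upwards [hev] with y hy
      have h1 := ((hf y hy.1 hy.2).differentiableAt (by simp)).hasFDerivAt
      exact (HasFDerivAt.comp_hasDerivAt y.2.2.1 (f := fun s : ℝ => (y.1, y.2.1, s, y.2.2.2)) h1
        ((hasDerivAt_const _ y.1).prodMk ((hasDerivAt_const _ y.2.1).prodMk
          ((hasDerivAt_id _).prodMk (hasDerivAt_const _ y.2.2.2))))).deriv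
    · refine (hd.clm_apply (contDiffAt_const (c := ((0, 0, 0, 1) :
        EuclideanSpace ℝ (Fin (2 * n + 1)) × ℝ × ℝ × ℝ)))).congr_of_eventuallyEq ?_
      filter_upwards [hev] with y hy
      have h1 := ((hf y hy.1 hy.2).differentiableAt (by simp)).hasFDerivAt
      exact (HasFDerivAt.comp_hasDerivAt y.2.2.2 (f := fun s : ℝ => (y.1, y.2.1, y.2.2.1, s)) h1
        ((hasDerivAt_const _ y.1).prodMk ((hasDerivAt_const _ y.2.1).prodMk
          ((hasDerivAt_const _ y.2.2.1).prodMk (hasDerivAt_id _))))).deriv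
    · refine (hd.clm_comp (contDiffAt_const (c := ContinuousLinearMap.inl ℝ
        (EuclideanSpace ℝ (Fin (2 * n + 1))) (ℝ × ℝ × ℝ)))).congr_of_eventuallyEq ?_
      filter_upwards [hev] with y hy
      have h1 := ((hf y hy.1 hy.2).differentiableAt (by simp)).hasFDerivAt
      have h2 : HasFDerivAt (fun w : EuclideanSpace ℝ (Fin (2 * n + 1)) => (w, y.2))
          (ContinuousLinearMap.inl ℝ (EuclideanSpace ℝ (Fin (2 * n + 1))) (ℝ × ℝ × ℝ)) y.1 :=
        hasFDerivAt_prodMk_left y.1 y.2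
      exact (HasFDerivAt.comp y.1 (g := fc) h1 h2).fderiv
  obtain ⟨q1, q2, q3⟩ := key (polarQ A ζ) fun y hy hr => (h.contDiffAt_polarQ ζ b₀ hy hr).1
  obtain ⟨g1, -, g3⟩ := key (polarG A ζ) fun y hy hr => (h.contDiffAt_polarQ ζ b₀ hy hr).2
  have hβ := h.differentiableAt_bindingForm b₀ hx
  exact ⟨(contDiffAt_formDCLM hβ).comp x hfst, hβ.comp x hfst,
    (by fun_prop : ContDiff ℝ ∞ fun x : EuclideanSpace ℝ (Fin (2 * n + 1)) × ℝ × ℝ × ℝ =>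
      x.2.2.1).contDiffAt, hq, hg, q1, g1, q2, q3, g3⟩

omit h in
lemma mfderiv_chart_prod (b₀ : B) {x : EuclideanSpace ℝ (Fin (2 * n + 1)) × ℝ × ℝ × ℝ}
    (hx : x.1 ∈ (extChartAt (𝓡 (2 * n + 1)) b₀).target)
    (v : EuclideanSpace ℝ (Fin (2 * n + 1))) (w : ℝ × ℝ × ℝ) :
    mfderiv 𝓘(ℝ, EuclideanSpace ℝ (Fin (2 * n + 1)) × ℝ × ℝ × ℝ)
      ((𝓡 (2 * n + 1)).prod 𝓘(ℝ, ℝ × ℝ × ℝ))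
      (fun x : EuclideanSpace ℝ (Fin (2 * n + 1)) × ℝ × ℝ × ℝ =>
        ((extChartAt (𝓡 (2 * n + 1)) b₀).symm x.1, x.2)) x (v, w) =
      (mfderiv (𝓡 (2 * n + 1)) (𝓡 (2 * n + 1)) (extChartAt (𝓡 (2 * n + 1)) b₀).symm x.1 v, w) := by
  have d1 : HasMFDerivAt 𝓘(ℝ, EuclideanSpace ℝ (Fin (2 * n + 1)) × ℝ × ℝ × ℝ) (𝓡 (2 * n + 1))
      (fun x : EuclideanSpace ℝ (Fin (2 * n + 1)) × ℝ × ℝ × ℝ =>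
        (extChartAt (𝓡 (2 * n + 1)) b₀).symm x.1) x _ :=
    HasMFDerivAt.comp x (g := (extChartAt (𝓡 (2 * n + 1)) b₀).symm) (f := Prod.fst)
      ((contMDiffAt_extChartAt_symm' b₀ hx).mdifferentiableAt (by simp)).hasMFDerivAt
      (hasFDerivAt_fst (𝕜 := ℝ) (p := x)).hasMFDerivAt
  have d2 : HasMFDerivAt 𝓘(ℝ, EuclideanSpace ℝ (Fin (2 * n + 1)) × ℝ × ℝ × ℝ) 𝓘(ℝ, ℝ × ℝ × ℝ)
      (fun x : EuclideanSpace ℝ (Fin (2 * n + 1)) × ℝ × ℝ × ℝ => x.2) x _ :=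
    (hasFDerivAt_snd (𝕜 := ℝ) (p := x)).hasMFDerivAt
  exact congrArg (fun T : EuclideanSpace ℝ (Fin (2 * n + 1)) × ℝ × ℝ × ℝ →L[ℝ]
    EuclideanSpace ℝ (Fin (2 * n + 1)) × ℝ × ℝ × ℝ => T (v, w)) (d1.prodMk d2).mfderiv

lemma polarDataChart_W_k (ζ : Circle) (b₀ : B)
    {x : EuclideanSpace ℝ (Fin (2 * n + 1)) × ℝ × ℝ × ℝ}
    (hx : x.1 ∈ (extChartAt (𝓡 (2 * n + 1)) b₀).target) (hr : |x.2.2.1| < 1) :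
    mfderiv (𝓡 (2 * n + 1)) (𝓡 (2 * n + 1)) (extChartAt (𝓡 (2 * n + 1)) b₀).symm x.1
        (polarDataChart O α A ζ b₀ x).W =
      (polarData O α A ζ ((extChartAt (𝓡 (2 * n + 1)) b₀).symm x.1) x.2).W ∧
    (polarDataChart O α A ζ b₀ x).k =
      (polarData O α A ζ ((extChartAt (𝓡 (2 * n + 1)) b₀).symm x.1) x.2).k := by
  rw [h.polarDataChart_eq_comap ζ b₀ hx hr]
  exact PolarData.map_comap (V := EuclideanSpace ℝ (Fin (2 * n + 1)))
    (D := polarData O α A ζ ((extChartAt (𝓡 (2 * n + 1)) b₀).symm x.1) x.2)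
    (T := (show EuclideanSpace ℝ (Fin (2 * n + 1)) →L[ℝ] EuclideanSpace ℝ (Fin (2 * n + 1)) from
      mfderiv (𝓡 (2 * n + 1)) (𝓡 (2 * n + 1)) (extChartAt (𝓡 (2 * n + 1)) b₀).symm x.1))
    (h.nondegenerateOnKer_bindingForm _) (bijective_mfderiv_extChartAt_symm b₀ hx)

lemma map_polarFieldChart (ζ : Circle) {a : ℝ} (ha : 0 < a) (ha1 : a < 1 / 2) (b₀ : B)
    {x : EuclideanSpace ℝ (Fin (2 * n + 1)) × ℝ × ℝ × ℝ}
    (hx : x.1 ∈ (extChartAt (𝓡 (2 * n + 1)) b₀).target) :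
    polarField O α A ζ a ((extChartAt (𝓡 (2 * n + 1)) b₀).symm x.1, x.2) =
    mfderiv 𝓘(ℝ, EuclideanSpace ℝ (Fin (2 * n + 1)) × ℝ × ℝ × ℝ)
      ((𝓡 (2 * n + 1)).prod 𝓘(ℝ, ℝ × ℝ × ℝ))
      (fun x : EuclideanSpace ℝ (Fin (2 * n + 1)) × ℝ × ℝ × ℝ =>
        ((extChartAt (𝓡 (2 * n + 1)) b₀).symm x.1, x.2)) x (polarFieldChart O α A ζ a b₀ x) := by
  refine Eq.symm ((mfderiv_chart_prod b₀ hx _ _).trans ?_)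
  rw [polarField]
  rcases lt_or_ge |x.2.2.1| 1 with hr | hr
  · obtain ⟨h1, h2⟩ := h.polarDataChart_W_k ζ b₀ hx hr
    rw [h2]
    have hT : ∀ (T : EuclideanSpace ℝ (Fin (2 * n + 1)) →L[ℝ] EuclideanSpace ℝ (Fin (2 * n + 1)))
        (v w : EuclideanSpace ℝ (Fin (2 * n + 1))) (c : ℝ), T v = w → T (c • v) = c • w :=
      fun T v w c e => by rw [map_smul, e]
    exact congrArg (fun v : EuclideanSpace ℝ (Fin (2 * n + 1)) => (v, _)) (hT _ _ _ _ h1)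
  -- Here `3 a / 2 < 1 ≤ |r|`: the data are meaningless at this radius, but the cutoff vanishes.
  · have h0 := polarCutoff_eq_zero (p := x.2) ha (Or.inr (Or.inl (by linarith)))
    simp only [h0, zero_mul]
    refine congrArg (fun v : EuclideanSpace ℝ (Fin (2 * n + 1)) => (v, _)) ?_
    rw [zero_smul, zero_smul]
    exact map_zero _

/-- For `|r| < 1` the data are smooth and both denominators are nonzero; for `|r| ≥ 1` the field is
constant nearby because of the cutoff. -/
lemma contDiffAt_polarFieldChart (ζ : Circle) {a : ℝ} (ha : 0 < a) (ha1 : a < 1 / 2) (b₀ : B)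
    {x : EuclideanSpace ℝ (Fin (2 * n + 1)) × ℝ × ℝ × ℝ}
    (hx : x.1 ∈ (extChartAt (𝓡 (2 * n + 1)) b₀).target) :
    ContDiffAt ℝ ∞ (polarFieldChart O α A ζ a b₀) x := by
  rcases lt_or_ge |x.2.2.1| 1 with hr | hr
  · have hD : NondegenerateOnKer (polarDataChart O α A ζ b₀ x).σ (polarDataChart O α A ζ b₀ x).τ :=
      h.nondegenerateOnKer_bindingForm_chart b₀ hx
    have hden := h.polarData_den_neg ζ ((extChartAt (𝓡 (2 * n + 1)) b₀).symm x.1) (p := x.2) hr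
    have hd : (polarDataChart O α A ζ b₀ x).den =
        (polarData O α A ζ ((extChartAt (𝓡 (2 * n + 1)) b₀).symm x.1) x.2).den := by
      rw [PolarData.den, PolarData.den, polarDataChart, polarData]
    have hF : 1 + (polarDataChart O α A ζ b₀ x).r ^ 2 * (polarDataChart O α A ζ b₀ x).q ≠ 0 := by
      rw [polarDataChart]; exact hden.2.ne'
    obtain ⟨h1, h2⟩ := (h.smoothAt_polarDataChart ζ b₀ hx hr).contDiffAt hD
      (by rw [hd]; exact hden.1.ne) hF
    have h3 : ContDiffAt ℝ ∞ (fun x : EuclideanSpace ℝ (Fin (2 * n + 1)) × ℝ × ℝ × ℝ =>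
        polarCutoff a x.2) x := (contDiff_polarCutoff a).contDiffAt.comp x contDiffAt_snd
    have h4 : ContDiffAt ℝ ∞ (fun x : EuclideanSpace ℝ (Fin (2 * n + 1)) × ℝ × ℝ × ℝ =>
      x.2.2.1) x := by fun_prop
    exact (h3.smul h1).prodMk (contDiffAt_const.prodMk ((h4.mul (h3.mul h2)).prodMk contDiffAt_const))
  · have hc : ContinuousAt (fun y : EuclideanSpace ℝ (Fin (2 * n + 1)) × ℝ × ℝ × ℝ => |y.2.2.1|) x := by
      fun_prop
    refine (contDiffAt_const (c := ((0, 0, 0, 1) :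
      EuclideanSpace ℝ (Fin (2 * n + 1)) × ℝ × ℝ × ℝ))).congr_of_eventuallyEq ?_
    filter_upwards [hc.eventually_mem (Ioi_mem_nhds (show 3 / 2 * a < |x.2.2.1| by linarith))]
      with y hy
    rw [polarFieldChart, polarCutoff_eq_zero ha (Or.inr (Or.inl (le_of_lt hy)))]
    simp

/-- The chart of `polarField` over a chart of the binding. -/
def polarVectorFieldChart (ζ : Circle) {a : ℝ} (ha : 0 < a) (ha1 : a < 1 / 2) (b₀ : B)
    (p₀ : ℝ × ℝ × ℝ) :
    VectorFieldChart (E := EuclideanSpace ℝ (Fin (2 * n + 1)) × ℝ × ℝ × ℝ)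
      (polarField O α A ζ a) (b₀, p₀) where
  φ := fun x => ((extChartAt (𝓡 (2 * n + 1)) b₀).symm x.1, x.2)
  ψ := fun q => (extChartAt (𝓡 (2 * n + 1)) b₀ q.1, q.2)
  X := polarFieldChart O α A ζ a b₀
  U := (extChartAt (𝓡 (2 * n + 1)) b₀).target ×ˢ univ
  V := (extChartAt (𝓡 (2 * n + 1)) b₀).source ×ˢ univ
  isOpen_U := (isOpen_extChartAt_target b₀).prod isOpen_univ
  isOpen_V := (isOpen_extChartAt_source b₀).prod isOpen_univ
  mem_V := ⟨mem_extChartAt_source b₀, mem_univ _⟩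
  mapsTo_φ := fun _ hx => ⟨PartialEquiv.map_target _ hx.1, mem_univ _⟩
  mapsTo_ψ := fun _ hq => ⟨PartialEquiv.map_source _ hq.1, mem_univ _⟩
  left_inv := fun q hq => by simp only [PartialEquiv.left_inv _ hq.1]
  right_inv := fun x hx => by simp only [PartialEquiv.right_inv _ hx.1]
  contMDiffOn_φ := by
    intro x hx
    refine ContMDiffAt.contMDiffWithinAt (ContMDiffAt.prodMk ?_ ?_)
    · exact ContMDiffAt.comp x (g := (extChartAt (𝓡 (2 * n + 1)) b₀).symm) (f := Prod.fst)
        (contMDiffAt_extChartAt_symm' b₀ hx.1) contDiffAt_fst.contMDiffAt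
    · exact contDiffAt_snd.contMDiffAt
  contMDiffOn_ψ := by
    intro q hq
    refine ContMDiffAt.contMDiffWithinAt ?_
    have h1 : ContMDiffAt ((𝓡 (2 * n + 1)).prod 𝓘(ℝ, ℝ × ℝ × ℝ)) (𝓡 (2 * n + 1)) ∞
        (fun q : B × ℝ × ℝ × ℝ => extChartAt (𝓡 (2 * n + 1)) b₀ q.1) q :=
      ContMDiffAt.comp q (g := extChartAt (𝓡 (2 * n + 1)) b₀) (f := Prod.fst)
        (contMDiffAt_extChartAt' (by
          have := hq.1
          rwa [extChartAt_source] at this)) contMDiffAt_fst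
    exact ContMDiffAt.prodMk_space h1 contMDiffAt_snd
  contDiffOn_X := fun _ hx => (h.contDiffAt_polarFieldChart ζ ha ha1 b₀ hx.1).contDiffWithinAt
  eq_mfderiv := fun _ hx => h.map_polarFieldChart ζ ha ha1 b₀ hx.1

end ConcaveGirouxForm

end PolarField

/-! ### Derivatives of `c + r² q` in terms of partial derivatives. -/

section PartialDerivatives

variable {E : Type*} [NormedAddCommGroup E] [NormedSpace ℝ E]

lemma fderiv_eq_partials {f : E × ℝ × ℝ → ℝ} {x : E × ℝ × ℝ} (hf : DifferentiableAt ℝ f x) (v : E)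
    (ρ t : ℝ) :
    fderiv ℝ f x (v, ρ, t) = fderiv ℝ (fun w => f (w, x.2)) x.1 v +
      ρ * deriv (fun r => f (x.1, r, x.2.2)) x.2.1 +
      t * deriv (fun θ => f (x.1, x.2.1, θ)) x.2.2 := by
  have h1 : HasFDerivAt (fun w : E => (w, x.2)) (ContinuousLinearMap.inl ℝ E (ℝ × ℝ)) x.1 :=
    hasFDerivAt_prodMk_left x.1 x.2
  have e1 := (HasFDerivAt.comp x.1 (g := f) hf.hasFDerivAt h1).fderiv
  have e2 := (HasFDerivAt.comp_hasDerivAt x.2.1 (f := fun s : ℝ => (x.1, s, x.2.2)) hf.hasFDerivAt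
    ((hasDerivAt_const _ x.1).prodMk ((hasDerivAt_id _).prodMk (hasDerivAt_const _ x.2.2)))).deriv
  have e3 := (HasFDerivAt.comp_hasDerivAt x.2.2 (f := fun s : ℝ => (x.1, x.2.1, s)) hf.hasFDerivAt
    ((hasDerivAt_const _ x.1).prodMk ((hasDerivAt_const _ x.2.1).prodMk (hasDerivAt_id _)))).deriv
  have e1' := congrArg (fun T : E →L[ℝ] ℝ => T v) e1
  change fderiv ℝ (fun w => f (w, x.2)) x.1 v = fderiv ℝ f x (v, 0) at e1'
  change deriv (fun r => f (x.1, r, x.2.2)) x.2.1 = fderiv ℝ f x (0, 1, 0) at e2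
  change deriv (fun θ => f (x.1, x.2.1, θ)) x.2.2 = fderiv ℝ f x (0, 0, 1) at e3
  rw [e1', e2, e3, ← smul_eq_mul, ← smul_eq_mul, ← map_smul, ← map_smul, ← map_add, ← map_add]
  simp

lemma hasFDerivAt_add_sq_mul {q : E × ℝ × ℝ → ℝ} {x : E × ℝ × ℝ} (hq : DifferentiableAt ℝ q x)
    (c : ℝ) :
    ∃ F' : E × ℝ × ℝ →L[ℝ] ℝ, HasFDerivAt (fun x : E × ℝ × ℝ => c + x.2.1 ^ 2 * q x) F' x ∧
      ∀ v ρ t, F' (v, ρ, t) = x.2.1 ^ 2 * (fderiv ℝ (fun w => q (w, x.2)) x.1 v +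
        ρ * deriv (fun r => q (x.1, r, x.2.2)) x.2.1 +
        t * deriv (fun θ => q (x.1, x.2.1, θ)) x.2.2) + 2 * x.2.1 * ρ * q x := by
  have h1 : HasFDerivAt (fun x : E × ℝ × ℝ => x.2.1)
      ((ContinuousLinearMap.fst ℝ ℝ ℝ).comp (ContinuousLinearMap.snd ℝ E (ℝ × ℝ))) x :=
    ((ContinuousLinearMap.fst ℝ ℝ ℝ).comp (ContinuousLinearMap.snd ℝ E (ℝ × ℝ))).hasFDerivAt
  refine ⟨_, ((h1.pow 2).mul hq.hasFDerivAt).const_add c, fun v ρ t => ?_⟩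
  rw [← fderiv_eq_partials hq]
  simp
  ring

end PartialDerivatives

/-! ### The polar solution is the horizontal lift. -/

section PolarFlow

variable {n : ℕ}
  {Y : Type*} [TopologicalSpace Y] [ChartedSpace (EuclideanSpace ℝ (Fin (2 * n + 3))) Y]
  [IsManifold (𝓡 (2 * n + 3)) ∞ Y] [CompactSpace Y] [T2Space Y]
  {B : Type*} [TopologicalSpace B] [ChartedSpace (EuclideanSpace ℝ (Fin (2 * n + 1))) B]
  [IsManifold (𝓡 (2 * n + 1)) ∞ B] [CompactSpace B] [T2Space B]

namespace ConcaveGirouxForm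

variable {O : ConcreteOpenBook n Y B} {α : OneForm (EuclideanSpace ℝ (Fin (2 * n + 3))) Y}
  {A : B × ℂ → ℝ} (h : ConcaveGirouxForm O α A)
include h

/-- Below radius `ρ e^{-1/δ}` the cutoff is `1`, and the expansion `A = 1 + r² q` puts the form in
the shape handled by `PolarData`. -/
lemma pull_interpForm_eventuallyEq_polar {ζ : Circle} {δ ρ : ℝ} (hc : CutoffParameters A ζ δ ρ)
    (b₀ : B) {x : EuclideanSpace ℝ (Fin (2 * n + 1)) × ℝ × ℝ}
    (hx : x.1 ∈ (extChartAt (𝓡 (2 * n + 1)) b₀).target) (h0 : 0 < x.2.1)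
    (hr : x.2.1 < ρ * Real.exp (-δ⁻¹)) (hr1 : x.2.1 < 1) (s : ℝ) :
    (interpForm O α A ζ δ ρ (Real.smoothTransition s)).pull (O.polarChart ζ b₀) =ᶠ[𝓝 x] polarForm
      (fun x => 1 + x.2.1 ^ 2 * polarQ A ζ ((extChartAt (𝓡 (2 * n + 1)) b₀).symm x.1) (s, x.2))
      (fun x => 0 + x.2.1 ^ 2 * polarG A ζ ((extChartAt (𝓡 (2 * n + 1)) b₀).symm x.1) (s, x.2))
      ((O.bindingForm α).inChart b₀) := by
  have hcr : ContinuousAt (fun x : EuclideanSpace ℝ (Fin (2 * n + 1)) × ℝ × ℝ => x.2.1) x := by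
    fun_prop
  refine (h.pull_interpForm_eventuallyEq hc _ b₀ hx h0 hr1).trans ?_
  filter_upwards [hcr.eventually_mem (Ioo_mem_nhds h0 hr), hcr.eventually_mem (Ioo_mem_nhds h0 hr1)]
    with y hy hy1
  have ha : |y.2.1| < 1 := by rw [abs_of_pos hy1.1]; exact hy1.2
  refine ContinuousLinearMap.ext fun v => ?_
  obtain ⟨v, r', t⟩ := v
  have e1 := (h.radial ζ ((extChartAt (𝓡 (2 * n + 1)) b₀).symm y.1) y.2.2 ha).1
  have e2 := (h.radial ζ ((extChartAt (𝓡 (2 * n + 1)) b₀).symm y.1) 0 ha).1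
  simp only [polarForm_apply, logCutoff_eq_one hc.δ_pos hy.1 hy.2.le, mul_one]
  rw [e1, e2, polarQ, polarG]
  ring

/-- The image has `dθ = 1` and lies in the kernel by `PolarData.horizontal`; these properties
characterize the horizontal lift. -/
lemma mfderiv_polarChart_horizontal {ζ : Circle} {δ ρ : ℝ} (hc : CutoffParameters A ζ δ ρ)
    (b₀ : B) {x : EuclideanSpace ℝ (Fin (2 * n + 1)) × ℝ × ℝ × ℝ}
    (hx : x.1 ∈ (extChartAt (𝓡 (2 * n + 1)) b₀).target) (h0 : 0 < x.2.2.1)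
    (hr : x.2.2.1 < ρ * Real.exp (-δ⁻¹)) (hr1 : x.2.2.1 < 1) :
    mfderiv 𝓘(ℝ, EuclideanSpace ℝ (Fin (2 * n + 1)) × ℝ × ℝ) (𝓡 (2 * n + 3))
      (O.polarChart ζ b₀) (x.1, x.2.2)
      ((polarDataChart O α A ζ b₀ x).W, x.2.2.1 * (polarDataChart O α A ζ b₀ x).k, (1 : ℝ)) =
    horizontalField O α A ζ δ ρ (Real.smoothTransition x.2.1) (O.polarChart ζ b₀ (x.1, x.2.2)) := by
  have ha : |x.2.2.1| < 1 := by rw [abs_of_pos h0]; exact hr1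
  have hmem : O.polarChart ζ b₀ (x.1, x.2.2) ∉ O.binding := by
    intro hb
    have := (O.collar_mem_binding_iff _ (z := polarPt ζ x.2.2.1 x.2.2.2)
      (by rwa [norm_polarPt])).1 hb
    rw [← norm_eq_zero, norm_polarPt, abs_of_pos h0] at this
    exact h0.ne' this
  have hs := h.smoothAt_interpForm hc (Real.smoothTransition x.2.1) hmem
  have hφ := O.contMDiffAt_polarChart (ζ := ζ) (b₀ := b₀) (x := (x.1, x.2.2)) hx ha
  refine h.eq_horizontalField hc (smoothTransition_mem _) hmem
    (O.dthetaForm_polarChart ζ b₀ (x := (x.1, x.2.2)) hx h0 hr1 _ _ _) fun w => ?_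
  obtain ⟨⟨w, r', t⟩, rfl⟩ := (O.bijective_mfderiv_polarChart (ζ := ζ) (b₀ := b₀)
    (x := (x.1, x.2.2)) hx ha h0.ne').2 w
  refine (hs.formD_pull hφ _ _).symm.trans ?_
  rw [formD_congr (h.pull_interpForm_eventuallyEq_polar hc b₀ (x := (x.1, x.2.2)) hx h0 hr hr1 _)]
  obtain ⟨hq, hg⟩ := h.contDiffAt_polarQ ζ b₀ hx ha
  have hι : ContDiffAt ℝ ∞ (fun y : EuclideanSpace ℝ (Fin (2 * n + 1)) × ℝ × ℝ =>
      (y.1, x.2.1, y.2)) (x.1, x.2.2) :=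
    (by fun_prop : ContDiff ℝ ∞ fun y : EuclideanSpace ℝ (Fin (2 * n + 1)) × ℝ × ℝ =>
      (y.1, x.2.1, y.2)).contDiffAt
  obtain ⟨F', hF', eF⟩ := hasFDerivAt_add_sq_mul (q := fun y => polarQ A ζ
    ((extChartAt (𝓡 (2 * n + 1)) b₀).symm y.1) (x.2.1, y.2))
    ((ContDiffAt.comp (x.1, x.2.2) (g := fun x : EuclideanSpace ℝ (Fin (2 * n + 1)) × ℝ × ℝ × ℝ =>
      polarQ A ζ ((extChartAt (𝓡 (2 * n + 1)) b₀).symm x.1) x.2)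
      (f := fun y : EuclideanSpace ℝ (Fin (2 * n + 1)) × ℝ × ℝ => (y.1, x.2.1, y.2)) hq
      hι).differentiableAt (by simp)) 1
  obtain ⟨G', hG', eG⟩ := hasFDerivAt_add_sq_mul (q := fun y => polarG A ζ
    ((extChartAt (𝓡 (2 * n + 1)) b₀).symm y.1) (x.2.1, y.2))
    ((ContDiffAt.comp (x.1, x.2.2) (g := fun x : EuclideanSpace ℝ (Fin (2 * n + 1)) × ℝ × ℝ × ℝ =>
      polarG A ζ ((extChartAt (𝓡 (2 * n + 1)) b₀).symm x.1) x.2)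
      (f := fun y : EuclideanSpace ℝ (Fin (2 * n + 1)) × ℝ × ℝ => (y.1, x.2.1, y.2)) hg
      hι).differentiableAt (by simp)) 0
  rw [formD_polarForm hF' hG' ((h.differentiableAt_bindingForm b₀ hx).differentiableAt (by simp)),
    eF, eF, eG, eG]
  have hden := h.polarData_den_neg ζ ((extChartAt (𝓡 (2 * n + 1)) b₀).symm x.1) (p := x.2) ha
  have hd : (polarDataChart O α A ζ b₀ x).den =
      (polarData O α A ζ ((extChartAt (𝓡 (2 * n + 1)) b₀).symm x.1) x.2).den := by
    rw [PolarData.den, PolarData.den, polarDataChart, polarData]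
  have key := PolarData.horizontal (D := polarDataChart O α A ζ b₀ x)
    (h.nondegenerateOnKer_bindingForm_chart b₀ hx) (by rw [hd]; exact hden.1.ne)
    (by rw [polarDataChart]; exact hden.2.ne')
    (deriv (fun θ => polarG A ζ ((extChartAt (𝓡 (2 * n + 1)) b₀).symm x.1)
      (x.2.1, x.2.2.1, θ)) x.2.2.2) w r' t
  rw [← key]
  generalize (polarDataChart O α A ζ b₀ x).W = W
  generalize (polarDataChart O α A ζ b₀ x).k = k
  simp only [polarDataChart, formDCLM_apply, one_mul]

end ConcaveGirouxForm

end PolarFlow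

section Components

variable {E F : Type*} [NormedAddCommGroup E] [NormedSpace ℝ E] [NormedAddCommGroup F]
  [NormedSpace ℝ F] {f : ℝ → E × F} {v : E × F} {t : ℝ}

lemma hasDerivAt_fst_comp (hf : HasDerivAt f v t) : HasDerivAt (fun t => (f t).1) v.1 t :=
  (ContinuousLinearMap.fst ℝ E F).hasFDerivAt.comp_hasDerivAt t hf

lemma hasDerivAt_snd_comp (hf : HasDerivAt f v t) : HasDerivAt (fun t => (f t).2) v.2 t :=
  (ContinuousLinearMap.snd ℝ E F).hasFDerivAt.comp_hasDerivAt t hf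

end Components

/-! ### The flow on `B × ℝ³`. -/

section PolarFlow

variable {n : ℕ}
  {Y : Type*} [TopologicalSpace Y] [ChartedSpace (EuclideanSpace ℝ (Fin (2 * n + 3))) Y]
  [IsManifold (𝓡 (2 * n + 3)) ∞ Y] [CompactSpace Y] [T2Space Y]
  {B : Type*} [TopologicalSpace B] [ChartedSpace (EuclideanSpace ℝ (Fin (2 * n + 1))) B]
  [IsManifold (𝓡 (2 * n + 1)) ∞ B] [CompactSpace B] [T2Space B]

/-- The map of `B × ℝ³` to `Y × ℝ` given by the parameter and polar coordinates in the collar. -/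
def polarMap (O : ConcreteOpenBook n Y B) (ζ : Circle) (x : B × ℝ × ℝ × ℝ) : Y × ℝ :=
  (O.collar (x.1, polarPt ζ x.2.2.1 x.2.2.2), x.2.1)

namespace ConcaveGirouxForm

variable {O : ConcreteOpenBook n Y B} {α : OneForm (EuclideanSpace ℝ (Fin (2 * n + 3))) Y}
  {A : B × ℂ → ℝ} (h : ConcaveGirouxForm O α A)
include h

/-- Where the polar cutoff equals `1`, integral curves on `B × ℝ³` with `r > 0` project to integral
curves of the suspended field on `Y × ℝ`. -/
lemma hasVelocityAt_polarMap {ζ : Circle} {δ ρ a : ℝ} (hc : CutoffParameters A ζ δ ρ) (ha : 0 < a)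
    (ha1 : a < 1 / 2) (haρ : a ≤ ρ * Real.exp (-δ⁻¹)) {γ : ℝ → B × ℝ × ℝ × ℝ} {t : ℝ}
    (hγ : HasVelocityAt (polarField O α A ζ a) γ t) (hs : |(γ t).2.1| ≤ 2)
    (h0 : 0 < (γ t).2.2.1) (hr : (γ t).2.2.1 < a) (hθ : |(γ t).2.2.2| ≤ 16) :
    HasVelocityAt (suspendedField O α A ζ δ ρ) (fun t => polarMap O ζ (γ t)) t := by
  set b₀ := (γ t).1 with hb₀
  set C := h.polarVectorFieldChart ζ ha ha1 b₀ (γ t).2 with hC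
  have hV : γ t ∈ C.V := C.mem_V
  have hd := C.hasDerivAt_ψ_comp hγ hV
  set x := C.ψ (γ t) with hx
  have hxb : x.1 ∈ (extChartAt (𝓡 (2 * n + 1)) b₀).target := (C.mapsTo_ψ hV).1
  have hx2 : x.2 = (γ t).2 := rfl
  have hcut : polarCutoff a x.2 = 1 :=
    polarCutoff_eq_one ha hs (by rw [hx2, abs_of_pos h0]; exact hr.le) hθ
  have hX : C.X x = ((polarDataChart O α A ζ b₀ x).W,
      ((0 : ℝ), x.2.2.1 * (polarDataChart O α A ζ b₀ x).k, (1 : ℝ))) := by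
    change polarFieldChart O α A ζ a b₀ x = _
    rw [polarFieldChart, hcut, one_smul, one_mul]
  rw [hX] at hd
  have hd1 : HasDerivAt (fun t => ((C.ψ (γ t)).1, (C.ψ (γ t)).2.2))
      ((polarDataChart O α A ζ b₀ x).W, x.2.2.1 * (polarDataChart O α A ζ b₀ x).k, (1 : ℝ)) t :=
    (hasDerivAt_fst_comp hd).prodMk (hasDerivAt_snd_comp (hasDerivAt_snd_comp hd))
  have hd2 : HasDerivAt (fun t => (γ t).2.1) 0 t :=
    hasDerivAt_fst_comp (hasDerivAt_snd_comp hd)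
  have hab : |x.2.2.1| < 1 := by rw [hx2, abs_of_pos h0]; linarith
  have hφ := ((O.contMDiffAt_polarChart (ζ := ζ) (b₀ := b₀) (x := (x.1, x.2.2)) hxb
    hab).mdifferentiableAt (by simp)).hasMFDerivAt
  have key := h.mfderiv_polarChart_horizontal hc b₀ hxb (hx2 ▸ h0) (hx2 ▸ hr.trans_le haρ)
    (by rw [hx2]; linarith)
  have e1 : HasMFDerivAt 𝓘(ℝ, ℝ) (𝓡 (2 * n + 3))
      (fun t => O.polarChart ζ b₀ ((C.ψ (γ t)).1, (C.ψ (γ t)).2.2)) t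
      ((1 : ℝ →L[ℝ] ℝ).smulRight (horizontalField O α A ζ δ ρ (Real.smoothTransition x.2.1)
        (O.polarChart ζ b₀ (x.1, x.2.2)))) := by
    have h2 := HasMFDerivAt.comp t hφ (hasMFDerivAt_smulRight_iff.2 hd1)
    have e := clm_comp_smulRight_one (E := EuclideanSpace ℝ (Fin (2 * n + 1)) × ℝ × ℝ)
      (F := EuclideanSpace ℝ (Fin (2 * n + 3)))
      (mfderiv 𝓘(ℝ, EuclideanSpace ℝ (Fin (2 * n + 1)) × ℝ × ℝ) (𝓡 (2 * n + 3))
        (O.polarChart ζ b₀) (x.1, x.2.2))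
      ((polarDataChart O α A ζ b₀ x).W, x.2.2.1 * (polarDataChart O α A ζ b₀ x).k, (1 : ℝ))
    rw [← key]
    exact Eq.mp (congrArg (fun T => HasMFDerivAt 𝓘(ℝ, ℝ) (𝓡 (2 * n + 3))
      (fun t => O.polarChart ζ b₀ ((C.ψ (γ t)).1, (C.ψ (γ t)).2.2)) t T) e) h2
  have e2 : HasMFDerivAt 𝓘(ℝ, ℝ) 𝓘(ℝ, ℝ) (fun t => (γ t).2.1) t
      ((1 : ℝ →L[ℝ] ℝ).smulRight (0 : ℝ)) := hasMFDerivAt_smulRight_iff.2 hd2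
  have e3 := e1.prodMk e2
  have hev : (fun t => polarMap O ζ (γ t)) =ᶠ[𝓝 t]
      fun t => (O.polarChart ζ b₀ ((C.ψ (γ t)).1, (C.ψ (γ t)).2.2), (γ t).2.1) := by
    filter_upwards [hγ.continuousAt.eventually_mem (C.isOpen_V.mem_nhds hV)] with t' ht'
    have : (extChartAt (𝓡 (2 * n + 1)) b₀).symm (C.ψ (γ t')).1 = (γ t').1 :=
      PartialEquiv.left_inv _ ht'.1
    change (O.collar ((γ t').1, _), _) =
      (O.collar ((extChartAt (𝓡 (2 * n + 1)) b₀).symm (C.ψ (γ t')).1, _), _)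
    rw [this]
    rfl
  have e4 := e3.congr_of_eventuallyEq hev
  unfold HasVelocityAt
  have hpt : O.polarChart ζ b₀ (x.1, x.2.2) = (polarMap O ζ (γ t)).1 := by
    have := congrArg Prod.fst hev.self_of_nhds
    exact this.symm
  have hval : (((1 : ℝ →L[ℝ] ℝ).smulRight (horizontalField O α A ζ δ ρ (Real.smoothTransition x.2.1)
      (O.polarChart ζ b₀ (x.1, x.2.2)))).prod ((1 : ℝ →L[ℝ] ℝ).smulRight (0 : ℝ)) :
      ℝ →L[ℝ] EuclideanSpace ℝ (Fin (2 * n + 3)) × ℝ) =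
      (1 : ℝ →L[ℝ] ℝ).smulRight (horizontalField O α A ζ δ ρ
        (Real.smoothTransition (polarMap O ζ (γ t)).2) (polarMap O ζ (γ t)).1, (0 : ℝ)) := by
    rw [hpt]
    exact ContinuousLinearMap.ext fun _ => rfl
  exact Eq.mp (congrArg (fun T => HasMFDerivAt 𝓘(ℝ, ℝ) ((𝓡 (2 * n + 3)).prod 𝓘(ℝ, ℝ))
    (fun t => polarMap O ζ (γ t)) t T) hval) e4

lemma hasDerivAt_snd_of_hasVelocityAt {ζ : Circle} {a : ℝ} (ha : 0 < a) (ha1 : a < 1 / 2)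
    {γ : ℝ → B × ℝ × ℝ × ℝ} {t : ℝ} (hγ : HasVelocityAt (polarField O α A ζ a) γ t) :
    HasDerivAt (fun t => (γ t).2) (0, (γ t).2.2.1 *
      (polarCutoff a (γ t).2 * (polarData O α A ζ (γ t).1 (γ t).2).k), 1) t := by
  set b₀ := (γ t).1 with hb₀
  set C := h.polarVectorFieldChart ζ ha ha1 b₀ (γ t).2 with hC
  have hd := hasDerivAt_snd_comp (C.hasDerivAt_ψ_comp hγ C.mem_V)
  refine HasDerivAt.congr_deriv (f := fun t => (γ t).2) hd ?_
  change ((0 : ℝ), (γ t).2.2.1 * (polarCutoff a (γ t).2 *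
    (polarDataChart O α A ζ b₀ (C.ψ (γ t))).k), (1 : ℝ)) = _
  rcases lt_or_ge |(γ t).2.2.1| 1 with hr | hr
  · rw [(h.polarDataChart_W_k ζ b₀ (x := C.ψ (γ t)) (C.mapsTo_ψ C.mem_V).1 hr).2]
    have : (extChartAt (𝓡 (2 * n + 1)) b₀).symm (C.ψ (γ t)).1 = b₀ :=
      PartialEquiv.left_inv _ (mem_extChartAt_source _)
    rw [this]
    rfl
  · rw [polarCutoff_eq_zero ha (Or.inr (Or.inl (by linarith))), zero_mul, zero_mul]

/-- `k` is independent of the chart of the binding, so its continuity may be checked in each chart.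
-/
lemma continuous_polarCutoff_mul_k (ζ : Circle) {a : ℝ} (ha : 0 < a) (ha1 : a < 1 / 2) :
    Continuous fun x : B × ℝ × ℝ × ℝ => polarCutoff a x.2 * (polarData O α A ζ x.1 x.2).k := by
  rw [continuous_iff_continuousAt]
  intro x₀
  have hrc : ContinuousAt (fun x : B × ℝ × ℝ × ℝ => |x.2.2.1|) x₀ := by fun_prop
  rcases lt_or_ge |x₀.2.2.1| 1 with hr | hr
  · have hcut : ContinuousAt (fun x : B × ℝ × ℝ × ℝ => polarCutoff a x.2) x₀ :=
      ((contDiff_polarCutoff a).continuous.comp continuous_snd).continuousAt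
    refine hcut.mul ?_
    set e := extChartAt (𝓡 (2 * n + 1)) x₀.1 with he
    have hx₀ : e x₀.1 ∈ e.target := mem_extChartAt_target _
    have hk : ContinuousAt (fun y => (polarDataChart O α A ζ x₀.1 y).k) (e x₀.1, x₀.2) := by
      have hden := h.polarData_den_neg ζ (e.symm (e x₀.1)) (p := x₀.2) hr
      have hd : (polarDataChart O α A ζ x₀.1 (e x₀.1, x₀.2)).den =
          (polarData O α A ζ (e.symm (e x₀.1)) x₀.2).den := by
        rw [PolarData.den, PolarData.den, polarDataChart, polarData]
      exact ((h.smoothAt_polarDataChart ζ x₀.1 (x := (e x₀.1, x₀.2)) hx₀ hr).contDiffAt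
        (h.nondegenerateOnKer_bindingForm_chart x₀.1 hx₀) (by rw [hd]; exact hden.1.ne)
        (by rw [polarDataChart]; exact hden.2.ne')).2.continuousAt
    have hψ : ContinuousAt (fun x : B × ℝ × ℝ × ℝ => (e x.1, x.2)) x₀ :=
      ((continuousAt_extChartAt x₀.1).comp (f := Prod.fst) continuousAt_fst).prodMk continuousAt_snd
    refine (ContinuousAt.comp (x := x₀) (f := fun x : B × ℝ × ℝ × ℝ => (e x.1, x.2))
      (g := fun y => (polarDataChart O α A ζ x₀.1 y).k) hk hψ).congr ?_
    filter_upwards [hrc.eventually_mem (Iio_mem_nhds hr), continuousAt_fst.eventually_mem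
      (extChartAt_source_mem_nhds (I := 𝓡 (2 * n + 1)) x₀.1)] with x hx1 hx2
    have := (h.polarDataChart_W_k ζ x₀.1 (x := (e x.1, x.2)) (e.map_source hx2) hx1).2
    rw [e.left_inv hx2] at this
    exact this
  · refine (continuousAt_const (y := (0 : ℝ))).congr ?_
    filter_upwards [hrc.eventually_mem (Ioi_mem_nhds (show 3 / 2 * a < |x₀.2.2.1| by linarith))]
      with x hx
    rw [polarCutoff_eq_zero ha (Or.inr (Or.inl (le_of_lt hx))), zero_mul]

/-- The radius satisfies `r' = r κ` with `κ` continuous along the curve, hence `r(t) = r(0) exp ∫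
κ`. In particular orbits neither reach nor leave `r = 0`. -/
lemma coords_of_hasVelocityAt {ζ : Circle} {a : ℝ} (ha : 0 < a) (ha1 : a < 1 / 2)
    {γ : ℝ → B × ℝ × ℝ × ℝ} (hγ : ∀ t, HasVelocityAt (polarField O α A ζ a) γ t) (t : ℝ) :
    (γ t).2.1 = (γ 0).2.1 ∧ (γ t).2.2.2 = (γ 0).2.2.2 + t ∧
      ∃ c, (γ t).2.2.1 = (γ 0).2.2.1 * Real.exp c := by
  have hd := fun t => h.hasDerivAt_snd_of_hasVelocityAt ha ha1 (hγ t)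
  set κ : ℝ → ℝ := fun t => polarCutoff a (γ t).2 * (polarData O α A ζ (γ t).1 (γ t).2).k with hκ
  have hκc : Continuous κ := (h.continuous_polarCutoff_mul_k ζ ha ha1).comp
    (continuous_iff_continuousAt.2 fun t => (hγ t).continuousAt)
  have hs : ∀ t, HasDerivAt (fun t => (γ t).2.1) 0 t := fun t =>
    hasDerivAt_fst_comp (hd t)
  have hr : ∀ t, HasDerivAt (fun t => (γ t).2.2.1) ((γ t).2.2.1 * κ t) t := fun t =>
    hasDerivAt_fst_comp (hasDerivAt_snd_comp (hd t))
  have hθ : ∀ t, HasDerivAt (fun t => (γ t).2.2.2) 1 t := fun t =>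
    hasDerivAt_snd_comp (hasDerivAt_snd_comp (hd t))
  have hconst : ∀ f : ℝ → ℝ, (∀ t, HasDerivAt f 0 t) → f t = f 0 := fun f hf =>
    is_const_of_deriv_eq_zero (fun t => (hf t).differentiableAt) (fun t => (hf t).deriv) t 0
  refine ⟨hconst _ hs, ?_, ∫ u in (0 : ℝ)..t, κ u, ?_⟩
  · have := hconst (fun t => (γ t).2.2.2 - t) fun t =>
      ((hθ t).sub (hasDerivAt_id t)).congr_deriv (sub_self _)
    simp only [sub_zero] at this
    linarith
  · have hK : ∀ t, HasDerivAt (fun t => ∫ u in (0 : ℝ)..t, κ u) (κ t) t := fun t =>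
      intervalIntegral.integral_hasDerivAt_right (hκc.intervalIntegrable _ _)
        (hκc.stronglyMeasurableAtFilter _ _) hκc.continuousAt
    have := hconst (fun t => (γ t).2.2.1 * Real.exp (-∫ u in (0 : ℝ)..t, κ u)) fun t => by
      refine ((hr t).mul (hK t).neg.exp).congr_deriv ?_
      ring
    simp only [intervalIntegral.integral_same, neg_zero, Real.exp_zero, mul_one] at this
    rw [← this, mul_assoc, ← Real.exp_add]
    simp

/-- A uniform lifetime is needed on a noncompact manifold. The compact set `K` contains a unit
margin in the angle around the support of the cutoff, since the angle moves at unit speed. -/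
lemma exists_polarFlow (ζ : Circle) {a : ℝ} (ha : 0 < a) (ha1 : a < 1 / 2) :
    ∃ Φ : ℝ → B × ℝ × ℝ × ℝ → B × ℝ × ℝ × ℝ, IsCompleteFlow (polarField O α A ζ a) univ Φ := by
  have hv : ∀ x ∈ (univ : Set (B × ℝ × ℝ × ℝ)), Nonempty (VectorFieldChart
      (E := EuclideanSpace ℝ (Fin (2 * n + 1)) × ℝ × ℝ × ℝ) (polarField O α A ζ a) x) :=
    fun x _ => ⟨h.polarVectorFieldChart ζ ha ha1 x.1 x.2⟩
  set K : Set (B × ℝ × ℝ × ℝ) :=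
    univ ×ˢ (Icc (-3) 3 ×ˢ (Icc (-1) 1 ×ˢ Icc (-25) 25)) with hK
  have hKc : IsCompact K := isCompact_univ.prod (isCompact_Icc.prod (isCompact_Icc.prod isCompact_Icc))
  obtain ⟨ε, hε, hu⟩ := exists_uniform_time hv isOpen_univ hKc (subset_univ _)
  refine exists_isCompleteFlow hv (lt_min hε one_pos) fun x _ => ?_
  by_cases hx : x ∈ K
  · obtain ⟨γ, h0, hγ⟩ := hu x hx
    exact ⟨γ, h0, fun t ht => hγ t ⟨by linarith [ht.1, min_le_left ε 1], ht.2.trans_le (min_le_left _ _)⟩⟩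
  -- Starting outside `K`, this curve stays for `|t| < 1` where the cutoff vanishes and the field is
  -- `∂_θ`.
  · refine ⟨fun t => (x.1, x.2.1, x.2.2.1, x.2.2.2 + t), by simp, fun t ht => ⟨?_, mem_univ _⟩⟩
    have ht1 : |t| < 1 := abs_lt.2 ⟨by linarith [ht.1, min_le_right ε 1],
      ht.2.trans_le (min_le_right _ _)⟩
    have hcut : polarCutoff a (x.2.1, x.2.2.1, x.2.2.2 + t) = 0 := by
      refine polarCutoff_eq_zero ha ?_
      by_contra! hcon
      obtain ⟨h1, h2, h3⟩ := hcon
      refine hx ⟨mem_univ _, abs_le.1 h1.le, abs_le.1 (by linarith), abs_le.1 ?_⟩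
      have := abs_sub_abs_le_abs_sub x.2.2.2 (-t)
      rw [sub_neg_eq_add, abs_neg] at this
      linarith
    have hval : polarField O α A ζ a (x.1, x.2.1, x.2.2.1, x.2.2.2 + t) =
        ((0 : EuclideanSpace ℝ (Fin (2 * n + 1))), ((0 : ℝ), (0 : ℝ), (1 : ℝ))) := by
      rw [polarField]
      simp only [hcut, zero_mul, mul_zero]
      exact congrArg (fun v : EuclideanSpace ℝ (Fin (2 * n + 1)) =>
        (v, ((0 : ℝ), (0 : ℝ), (1 : ℝ)))) (zero_smul ℝ _)
    have d1 : HasDerivAt (fun t : ℝ => (x.2.1, x.2.2.1, x.2.2.2 + t)) ((0 : ℝ), (0 : ℝ), (1 : ℝ)) t :=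
      (hasDerivAt_const _ _).prodMk ((hasDerivAt_const _ _).prodMk ((hasDerivAt_id t).const_add _))
    have d2 := (hasMFDerivAt_const (I := 𝓘(ℝ, ℝ)) (I' := 𝓡 (2 * n + 1)) x.1 t).prodMk
      (hasMFDerivAt_smulRight_iff.2 d1)
    have e : ((0 : ℝ →L[ℝ] EuclideanSpace ℝ (Fin (2 * n + 1))).prod
        ((1 : ℝ →L[ℝ] ℝ).smulRight ((0 : ℝ), (0 : ℝ), (1 : ℝ)))) =
        (1 : ℝ →L[ℝ] ℝ).smulRight (show EuclideanSpace ℝ (Fin (2 * n + 1)) × ℝ × ℝ × ℝ from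
          polarField O α A ζ a (x.1, x.2.1, x.2.2.1, x.2.2.2 + t)) := by
      rw [hval]
      refine ContinuousLinearMap.ext fun c => ?_
      exact Prod.ext (smul_zero (M := ℝ) (A := EuclideanSpace ℝ (Fin (2 * n + 1))) c).symm rfl
    exact Eq.mp (congrArg (fun T => HasMFDerivAt 𝓘(ℝ, ℝ) ((𝓡 (2 * n + 1)).prod 𝓘(ℝ, ℝ × ℝ × ℝ))
      (fun t => (x.1, x.2.1, x.2.2.1, x.2.2.2 + t)) t T) e) d2

end ConcaveGirouxForm

end PolarFlow

/-! ### Completeness of the horizontal flows off the binding. -/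

section SuspendedFlow

variable {n : ℕ}
  {Y : Type*} [TopologicalSpace Y] [ChartedSpace (EuclideanSpace ℝ (Fin (2 * n + 3))) Y]
  [IsManifold (𝓡 (2 * n + 3)) ∞ Y] [CompactSpace Y] [T2Space Y]
  {B : Type*} [TopologicalSpace B] [ChartedSpace (EuclideanSpace ℝ (Fin (2 * n + 1))) B]
  [IsManifold (𝓡 (2 * n + 1)) ∞ B] [CompactSpace B] [T2Space B]

/-- `Φ` is a flow on `B × ℝ³` that lifts the flow of `suspendedField` in the part of the collar of
radius less than `r₀`. -/
structure IsPolarFlow (O : ConcreteOpenBook n Y B)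
    (α : OneForm (EuclideanSpace ℝ (Fin (2 * n + 3))) Y) (A : B × ℂ → ℝ) (ζ : Circle) (δ ρ : ℝ)
    (Φ : ℝ → B × ℝ × ℝ × ℝ → B × ℝ × ℝ × ℝ) (r₀ : ℝ) : Prop where
  pos : 0 < r₀
  lt_one : r₀ < 1
  contMDiff : ContMDiff (𝓘(ℝ, ℝ).prod ((𝓡 (2 * n + 1)).prod 𝓘(ℝ, ℝ × ℝ × ℝ)))
    ((𝓡 (2 * n + 1)).prod 𝓘(ℝ, ℝ × ℝ × ℝ)) ∞ (fun q : ℝ × B × ℝ × ℝ × ℝ => Φ q.1 q.2)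
  add : ∀ s t x, Φ (s + t) x = Φ s (Φ t x)
  zero : ∀ x, Φ 0 x = x
  param : ∀ t x, (Φ t x).2.1 = x.2.1
  angle : ∀ t x, (Φ t x).2.2.2 = x.2.2.2 + t
  radius : ∀ t x, ∃ c, (Φ t x).2.2.1 = x.2.2.1 * Real.exp c
  radius_lt : ∀ t x, |t| ≤ 7 → |x.2.1| ≤ 2 → |x.2.2.1| < r₀ → |x.2.2.2| ≤ 7 → |(Φ t x).2.2.1| < 1
  hasVelocityAt : ∀ t x, |t| < 7 → |x.2.1| ≤ 2 → 0 < x.2.2.1 → x.2.2.1 < r₀ → |x.2.2.2| ≤ 7 →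
    HasVelocityAt (suspendedField O α A ζ δ ρ) (fun t => polarMap O ζ (Φ t x)) t

lemma polarMap_mem (O : ConcreteOpenBook n Y B) (ζ : Circle) {x : B × ℝ × ℝ × ℝ}
    (h0 : 0 < x.2.2.1) (h1 : x.2.2.1 < 1) :
    polarMap O ζ x ∈ O.bindingᶜ ×ˢ (univ : Set ℝ) := by
  refine ⟨fun hb => ?_, mem_univ _⟩
  have := (O.collar_mem_binding_iff _ (z := polarPt ζ x.2.2.1 x.2.2.2)
    (by rwa [norm_polarPt, abs_of_pos h0])).1 hb
  rw [← norm_eq_zero, norm_polarPt, abs_of_pos h0] at this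
  exact h0.ne' this

lemma IsPolarFlow.radius_pos {O : ConcreteOpenBook n Y B}
    {α : OneForm (EuclideanSpace ℝ (Fin (2 * n + 3))) Y} {A : B × ℂ → ℝ} {ζ : Circle} {δ ρ : ℝ}
    {Φ : ℝ → B × ℝ × ℝ × ℝ → B × ℝ × ℝ × ℝ} {r₀ : ℝ} (hΦ : IsPolarFlow O α A ζ δ ρ Φ r₀)
    (t : ℝ) {x : B × ℝ × ℝ × ℝ} (h0 : 0 < x.2.2.1) : 0 < (Φ t x).2.2.1 := by
  obtain ⟨c, hc⟩ := hΦ.radius t x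
  rw [hc]
  positivity

lemma hasVelocityAt_suspendedField {O : ConcreteOpenBook n Y B}
    {α : OneForm (EuclideanSpace ℝ (Fin (2 * n + 3))) Y} {A : B × ℂ → ℝ} {ζ : Circle} {δ ρ : ℝ}
    {γ : ℝ → Y × ℝ} {t : ℝ} (hγ : HasVelocityAt (suspendedField O α A ζ δ ρ) γ t) :
    HasMFDerivAt 𝓘(ℝ, ℝ) (𝓡 (2 * n + 3)) (fun t => (γ t).1) t ((1 : ℝ →L[ℝ] ℝ).smulRight
      (horizontalField O α A ζ δ ρ (Real.smoothTransition (γ t).2) (γ t).1)) ∧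
    HasDerivAt (fun t => (γ t).2) 0 t := by
  have h1 := HasMFDerivAt.comp t (hasMFDerivAt_fst (I := 𝓡 (2 * n + 3)) (I' := 𝓘(ℝ, ℝ)) (γ t)) hγ
  have h2 := HasMFDerivAt.comp t (hasMFDerivAt_snd (I := 𝓡 (2 * n + 3)) (I' := 𝓘(ℝ, ℝ)) (γ t)) hγ
  have e1 : (ContinuousLinearMap.fst ℝ (EuclideanSpace ℝ (Fin (2 * n + 3))) ℝ).comp
      ((1 : ℝ →L[ℝ] ℝ).smulRight (show EuclideanSpace ℝ (Fin (2 * n + 3)) × ℝ from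
        suspendedField O α A ζ δ ρ (γ t))) =
      (1 : ℝ →L[ℝ] ℝ).smulRight
        (horizontalField O α A ζ δ ρ (Real.smoothTransition (γ t).2) (γ t).1) :=
    clm_comp_smulRight_one _ _
  have e2 : (ContinuousLinearMap.snd ℝ (EuclideanSpace ℝ (Fin (2 * n + 3))) ℝ).comp
      ((1 : ℝ →L[ℝ] ℝ).smulRight (show EuclideanSpace ℝ (Fin (2 * n + 3)) × ℝ from
        suspendedField O α A ζ δ ρ (γ t))) = (1 : ℝ →L[ℝ] ℝ).smulRight (0 : ℝ) :=
    clm_comp_smulRight_one _ _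
  exact ⟨Eq.mp (congrArg (fun T => HasMFDerivAt 𝓘(ℝ, ℝ) (𝓡 (2 * n + 3))
    (fun t => (γ t).1) t T) e1) h1, hasMFDerivAt_smulRight_iff.1
    (Eq.mp (congrArg (fun T => HasMFDerivAt 𝓘(ℝ, ℝ) 𝓘(ℝ, ℝ) (fun t => (γ t).2) t T) e2) h2)⟩

lemma hasVelocityAt_suspendedField_mk {O : ConcreteOpenBook n Y B}
    {α : OneForm (EuclideanSpace ℝ (Fin (2 * n + 3))) Y} {A : B × ℂ → ℝ} {ζ : Circle} {δ ρ : ℝ}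
    {γ : ℝ → Y} {s t : ℝ} (hγ : HasMFDerivAt 𝓘(ℝ, ℝ) (𝓡 (2 * n + 3)) γ t
      ((1 : ℝ →L[ℝ] ℝ).smulRight (horizontalField O α A ζ δ ρ (Real.smoothTransition s) (γ t)))) :
    HasVelocityAt (suspendedField O α A ζ δ ρ) (fun t => (γ t, s)) t := by
  have h1 := hγ.prodMk (hasMFDerivAt_smulRight_iff.2 (hasDerivAt_const t s))
  have e : ((1 : ℝ →L[ℝ] ℝ).smulRight (horizontalField O α A ζ δ ρ (Real.smoothTransition s)
      (γ t))).prod ((1 : ℝ →L[ℝ] ℝ).smulRight (0 : ℝ)) =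
      (1 : ℝ →L[ℝ] ℝ).smulRight (show EuclideanSpace ℝ (Fin (2 * n + 3)) × ℝ from
        suspendedField O α A ζ δ ρ (γ t, s)) := ContinuousLinearMap.ext fun _ => rfl
  exact Eq.mp (congrArg (fun T => HasMFDerivAt 𝓘(ℝ, ℝ) ((𝓡 (2 * n + 3)).prod 𝓘(ℝ, ℝ))
    (fun t => (γ t, s)) t T) e) h1

/-- The suspended field depends on `s` only through `smoothTransition s`, so the parameter can be
confined to the compact interval `[0, 1]`. -/
lemma exists_clamp (s : ℝ) :
    ∃ s' ∈ Icc (0 : ℝ) 1, Real.smoothTransition s' = Real.smoothTransition s := by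
  rcases le_total s 0 with h | h
  · exact ⟨0, by simp, by rw [Real.smoothTransition.zero_of_nonpos h,
      Real.smoothTransition.zero_of_nonpos le_rfl]⟩
  rcases le_total s 1 with h' | h'
  · exact ⟨s, ⟨h, h'⟩, rfl⟩
  · exact ⟨1, by simp, by rw [Real.smoothTransition.one_of_one_le h',
      Real.smoothTransition.one_of_one_le le_rfl]⟩

namespace ConcaveGirouxForm

variable {O : ConcreteOpenBook n Y B} {α : OneForm (EuclideanSpace ℝ (Fin (2 * n + 3))) Y}
  {A : B × ℂ → ℝ} (h : ConcaveGirouxForm O α A) {ζ : Circle} {δ ρ : ℝ}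
  (hc : CutoffParameters A ζ δ ρ)
include h hc

/-- The bound `7` on times and initial angles is any convenient number above `2π`; the inverse
holonomy starts at angle `2π` and runs backwards. -/
lemma exists_isPolarFlow : ∃ Φ r₀, IsPolarFlow O α A ζ δ ρ Φ r₀ := by
  have hρ := hc.ρ_pos
  obtain ⟨a, ha, ha1, haρ⟩ : ∃ a : ℝ, 0 < a ∧ a < 1 / 2 ∧ a ≤ ρ * Real.exp (-δ⁻¹) :=
    ⟨min (1 / 4) (ρ * Real.exp (-δ⁻¹)), by positivity,
      (min_le_left _ _).trans_lt (by norm_num), min_le_right _ _⟩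
  obtain ⟨Φ, hΦ⟩ := h.exists_polarFlow ζ ha ha1
  have hv : ∀ x ∈ (univ : Set (B × ℝ × ℝ × ℝ)), Nonempty (VectorFieldChart
      (E := EuclideanSpace ℝ (Fin (2 * n + 1)) × ℝ × ℝ × ℝ) (polarField O α A ζ a) x) :=
    fun x _ => ⟨h.polarVectorFieldChart ζ ha ha1 x.1 x.2⟩
  have hsm : ContMDiff (𝓘(ℝ, ℝ).prod ((𝓡 (2 * n + 1)).prod 𝓘(ℝ, ℝ × ℝ × ℝ)))
      ((𝓡 (2 * n + 1)).prod 𝓘(ℝ, ℝ × ℝ × ℝ)) ∞ (fun q : ℝ × B × ℝ × ℝ × ℝ => Φ q.1 q.2) :=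
    fun q => hΦ.contMDiffAt hv isOpen_univ (mem_univ q.2) q.1
  have hco : ∀ t x, (Φ t x).2.1 = x.2.1 ∧ (Φ t x).2.2.2 = x.2.2.2 + t ∧
      ∃ c, (Φ t x).2.2.1 = x.2.2.1 * Real.exp c := by
    intro t x
    have := h.coords_of_hasVelocityAt ha ha1 (fun t => hΦ.hasVelocityAt x (mem_univ x) t) t
    simpa only [hΦ.zero x (mem_univ x)] using this
  -- Orbits starting at `r = 0` stay there, so by the tube lemma orbits with small initial radius
  -- stay below `a` during the whole time interval.
  obtain ⟨r₀, hr₀, htube⟩ : ∃ r₀ > 0, ∀ t x, |t| ≤ 7 → |x.2.1| ≤ 2 → |x.2.2.1| < r₀ →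
      |x.2.2.2| ≤ 7 → |(Φ t x).2.2.1| < a := by
    set K : Set (ℝ × B × ℝ × ℝ) := Icc (-7) 7 ×ˢ (univ ×ˢ (Icc (-2) 2 ×ˢ Icc (-7) 7)) with hK
    have hKc : IsCompact K := isCompact_Icc.prod (isCompact_univ.prod (isCompact_Icc.prod isCompact_Icc))
    have hg : Continuous fun q : (ℝ × B × ℝ × ℝ) × ℝ =>
        |(Φ q.1.1 (q.1.2.1, q.1.2.2.1, q.2, q.1.2.2.2)).2.2.1| := by
      have h1 : Continuous fun q : (ℝ × B × ℝ × ℝ) × ℝ =>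
          (q.1.1, (q.1.2.1, q.1.2.2.1, q.2, q.1.2.2.2)) := by fun_prop
      exact ((continuous_fst.comp (continuous_snd.comp continuous_snd)).comp
        (hsm.continuous.comp h1)).abs
    obtain ⟨u, v, hu, hv', hKu, h0v, huv⟩ := generalized_tube_lemma hKc
      (isCompact_singleton (x := (0 : ℝ))) (isOpen_Iio.preimage hg (t := Iio a)) (by
        rintro ⟨p, r⟩ ⟨-, hr⟩
        have hr' : r = 0 := hr
        obtain ⟨c, hc'⟩ := (hco p.1 (p.2.1, p.2.2.1, r, p.2.2.2)).2.2
        change _ = r * _ at hc'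
        change |_| < a
        rw [hc', hr', zero_mul, abs_zero]
        exact ha)
    obtain ⟨r₀, hr₀, hb⟩ := Metric.isOpen_iff.1 hv' 0 (h0v rfl)
    refine ⟨r₀, hr₀, fun t x ht hs hr hθ => ?_⟩
    have hmem : ((t, x.1, x.2.1, x.2.2.2), x.2.2.1) ∈ u ×ˢ v :=
      ⟨hKu ⟨abs_le.1 ht, mem_univ _, abs_le.1 hs, abs_le.1 hθ⟩,
        hb (by rwa [Metric.mem_ball, dist_zero_right, Real.norm_eq_abs])⟩
    exact huv hmem
  refine ⟨Φ, min r₀ (1 / 2), lt_min hr₀ (by norm_num), (min_le_right _ _).trans_lt (by norm_num), hsm,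
    fun s t x => hΦ.add hv (mem_univ x) s t, fun x => hΦ.zero x (mem_univ x), fun t x => (hco t x).1,
    fun t x => (hco t x).2.1, fun t x => (hco t x).2.2, fun t x ht hs hr hθ => ?_,
    fun t x ht hs h0 hr hθ => ?_⟩
  · exact (htube t x ht hs (hr.trans_le (min_le_left _ _)) hθ).trans (by linarith)
  · obtain ⟨c, hc'⟩ := (hco t x).2.2
    have hpos : 0 < (Φ t x).2.2.1 := by rw [hc']; positivity
    refine h.hasVelocityAt_polarMap hc ha ha1 haρ (hΦ.hasVelocityAt x (mem_univ x) t) ?_ hpos ?_ ?_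
    · rw [(hco t x).1]; exact hs
    · exact lt_of_abs_lt (htube t x ht.le hs (by
        rw [abs_of_pos h0]; exact hr.trans_le (min_le_left _ _)) hθ)
    -- The angle stays below `7 + 7 ≤ 16`, within the region where the angular cutoff is `1`.
    · rw [(hco t x).2.1]
      have := abs_add_le x.2.2.2 t
      linarith

/-- The only danger for completeness is escape into the binding. Near it the polar flow supplies
curves of lifetime at least `1`; the rest of `Y`, with the parameter clamped, is compact and has a
uniform lifetime. -/
lemma exists_suspendedFlow :
    ∃ Θ : ℝ → Y × ℝ → Y × ℝ, IsCompleteFlow (suspendedField O α A ζ δ ρ) (O.bindingᶜ ×ˢ univ) Θ := by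
  obtain ⟨Φ, r₀, hΦ⟩ := h.exists_isPolarFlow hc
  set N := O.collar '' (univ ×ˢ Metric.ball 0 r₀) with hN
  have hNo : IsOpen N := O.isOpen_collar_image hΦ.lt_one.le
  have hBN : O.binding ⊆ N := O.binding_subset hΦ.pos
  obtain ⟨ε, hε, hu⟩ := exists_uniform_time
    (fun p hp => h.nonempty_vectorFieldChart hc (p := p) hp)
    (O.isClosed_binding.isOpen_compl.prod isOpen_univ)
    (hNo.isClosed_compl.isCompact.prod (isCompact_Icc (a := (0 : ℝ)) (b := 1)))
    (prod_mono (compl_subset_compl.2 hBN) (subset_univ _))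
  refine exists_isCompleteFlow (fun p hp => h.nonempty_vectorFieldChart hc (p := p) hp)
    (lt_min hε one_pos) fun p hp => ?_
  obtain ⟨y, s⟩ := p
  have hy : y ∉ O.binding := hp.1
  obtain ⟨s', hs', hss⟩ := exists_clamp s
  obtain ⟨γ, h0, hγ⟩ : ∃ γ : ℝ → Y × ℝ, γ 0 = (y, s') ∧ ∀ t ∈ Ioo (-(min ε 1)) (min ε 1),
      HasVelocityAt (suspendedField O α A ζ δ ρ) γ t ∧ γ t ∈ O.bindingᶜ ×ˢ (univ : Set ℝ) := by
    by_cases hyN : y ∈ N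
    · obtain ⟨⟨b, z⟩, ⟨-, hz⟩, rfl⟩ := hyN
      have hz' : ‖z‖ < r₀ := by simpa using hz
      have hz0 : z ≠ 0 := fun h0 => hy ((O.collar_mem_binding_iff b
        (hz'.trans hΦ.lt_one)).2 h0)
      obtain ⟨θ, hθ, hzθ⟩ := exists_polarPt ζ z
      have hθ' : |θ| ≤ 7 := by
        have := Real.pi_lt_four
        exact abs_le.2 ⟨by linarith [hθ.1], by linarith [hθ.2]⟩
      have hs2 : |s'| ≤ 2 := by rw [abs_of_nonneg hs'.1]; linarith [hs'.2]
      have hn := norm_pos_iff.2 hz0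
      refine ⟨fun t => polarMap O ζ (Φ t (b, s', ‖z‖, θ)), ?_, fun t ht => ?_⟩
      · simp only [hΦ.zero]
        rw [polarMap, hzθ]
      · have ht1 : |t| < 7 := abs_lt.2 ⟨by linarith [ht.1, min_le_right ε 1],
          by linarith [ht.2, min_le_right ε 1]⟩
        refine ⟨hΦ.hasVelocityAt t (b, s', ‖z‖, θ) ht1 hs2 hn hz' hθ', ?_⟩
        refine polarMap_mem O ζ (hΦ.radius_pos t (x := (b, s', ‖z‖, θ)) hn) ?_
        exact lt_of_abs_lt (hΦ.radius_lt t (b, s', ‖z‖, θ) ht1.le hs2 (by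
          rwa [abs_norm]) hθ')
    · obtain ⟨γ, h0, hγ⟩ := hu (y, s') ⟨hyN, hs'⟩
      exact ⟨γ, h0, fun t ht => hγ t ⟨by linarith [ht.1, min_le_left ε 1],
        ht.2.trans_le (min_le_left _ _)⟩⟩
  refine ⟨fun t => ((γ t).1, s), by simp only [h0], fun t ht => ⟨?_, (hγ t ht).2.1, mem_univ _⟩⟩
  obtain ⟨h1, -⟩ := hasVelocityAt_suspendedField (hγ t ht).1
  have hconst : (γ t).2 = s' := by
    have h0' : (0 : ℝ) ∈ Ioo (-(min ε 1)) (min ε 1) := by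
      have := lt_min hε one_pos
      exact ⟨by linarith, this⟩
    have := isOpen_Ioo.is_const_of_deriv_eq_zero isPreconnected_Ioo
      (fun t ht => (hasVelocityAt_suspendedField (hγ t ht).1).2.differentiableAt.differentiableWithinAt)
      (fun t ht => (hasVelocityAt_suspendedField (hγ t ht).1).2.deriv) ht h0'
    rw [this, h0]
  rw [hconst, hss] at h1
  exact hasVelocityAt_suspendedField_mk h1

end ConcaveGirouxForm

end SuspendedFlow

/-! ### The holonomy maps, extended over the binding. -/

section MonodromyMap

variable {n : ℕ}
  {Y : Type*} [TopologicalSpace Y] [ChartedSpace (EuclideanSpace ℝ (Fin (2 * n + 3))) Y]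
  [IsManifold (𝓡 (2 * n + 3)) ∞ Y] [CompactSpace Y] [T2Space Y]
  {B : Type*} [TopologicalSpace B] [ChartedSpace (EuclideanSpace ℝ (Fin (2 * n + 1))) B]
  [IsManifold (𝓡 (2 * n + 1)) ∞ B] [CompactSpace B] [T2Space B]

namespace ConcreteOpenBook

variable (O : ConcreteOpenBook n Y B)

lemma collar_zero_injective : Function.Injective fun b : B => O.collar (b, 0) := fun b b' hbb =>
  (O.collar_injective (z := 0) (z' := 0) (by simp) (by simp) hbb).1

/-- Away from the binding the fibre is closed by continuity of the projection, and every binding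
point is a limit along the ray at angle `ζ` in the collar. -/
lemma page_eq (ζ : Circle) : O.page ζ = O.openPage ζ ∪ O.binding := by
  refine Subset.antisymm (closure_minimal subset_union_left ?_) (union_subset subset_closure ?_)
  · rw [← isOpen_compl_iff, isOpen_iff_mem_nhds]
    intro y hy
    have hb : y ∉ O.binding := fun hb => hy (Or.inr hb)
    have hp : (O.proj y : ℂ) ≠ ζ := fun e => hy (Or.inl ⟨hb, Circle.ext e⟩)
    filter_upwards [(O.contMDiffAt_proj hb).continuousAt.eventually_ne hp,
      O.isClosed_binding.isOpen_compl.mem_nhds hb] with y' h1 h2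
    rintro (h3 | h3)
    · exact h1 (congrArg _ h3.2)
    · exact h2 h3
  · rintro _ ⟨b, rfl⟩
    have hc : ContinuousAt (fun r : ℝ => O.collar (b, polarPt ζ r 0)) 0 := by
      have h1 : ContinuousAt O.collar (b, polarPt ζ 0 0) :=
        (O.contMDiffAt_collar b (by rw [norm_polarPt]; simp)).continuousAt
      have h2 : Continuous fun r : ℝ => (b, polarPt ζ r 0) := by
        simp only [polarPt_angle_zero]
        fun_prop
      exact ContinuousAt.comp (f := fun r : ℝ => (b, polarPt ζ r 0)) (g := O.collar) h1
        h2.continuousAt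
    have h2 : Filter.Tendsto (fun r : ℝ => O.collar (b, polarPt ζ r 0)) (𝓝[>] 0)
        (𝓝 (O.collar (b, 0))) := by
      have := hc.tendsto
      rw [polarPt_zero] at this
      exact this.mono_left nhdsWithin_le_nhds
    refine mem_closure_of_tendsto h2 ?_
    filter_upwards [Ioo_mem_nhdsGT (zero_lt_one (α := ℝ))] with r hr
    have hn : ‖polarPt ζ r 0‖ = r := by rw [norm_polarPt, abs_of_pos hr.1]
    refine (O.collar_mem_openPage_iff ζ b (by rw [hn]; exact hr.2)).2 ⟨?_, ?_⟩
    · rw [← norm_ne_zero_iff, hn]; exact hr.1.ne'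
    · rw [hn, polarPt_angle_zero]

lemma collar_mem_page_iff (ζ : Circle) (b : B) {z : ℂ} (hz : ‖z‖ < 1) :
    O.collar (b, z) ∈ O.page ζ ↔ z = ‖z‖ * ζ := by
  rw [page_eq, mem_union, O.collar_mem_openPage_iff ζ b hz, O.collar_mem_binding_iff b hz]
  constructor
  · rintro (h | rfl)
    · exact h.2
    · simp
  · intro h
    by_cases h0 : z = 0
    · exact Or.inr h0
    · exact Or.inl ⟨h0, h⟩

end ConcreteOpenBook

/-- The map of `Y` given by the flow `Θ` at time `T`, with parameter `s`, away from the binding, and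
by the flow `Φ` starting at angle `θ₀` on the binding. -/
def monodromyMap (O : ConcreteOpenBook n Y B) (Θ : ℝ → Y × ℝ → Y × ℝ)
    (Φ : ℝ → B × ℝ × ℝ × ℝ → B × ℝ × ℝ × ℝ) (T θ₀ s : ℝ) : Y → Y :=
  Function.extend (fun b : B => O.collar (b, 0)) (fun b => O.collar ((Φ T (b, s, 0, θ₀)).1, 0))
    (fun y => (Θ T (y, s)).1)

lemma monodromyMap_binding (O : ConcreteOpenBook n Y B) (Θ : ℝ → Y × ℝ → Y × ℝ)
    (Φ : ℝ → B × ℝ × ℝ × ℝ → B × ℝ × ℝ × ℝ) (T θ₀ s : ℝ) (b : B) :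
    monodromyMap O Θ Φ T θ₀ s (O.collar (b, 0)) = O.collar ((Φ T (b, s, 0, θ₀)).1, 0) :=
  O.collar_zero_injective.extend_apply _ _ b

lemma monodromyMap_of_notMem (O : ConcreteOpenBook n Y B) (Θ : ℝ → Y × ℝ → Y × ℝ)
    (Φ : ℝ → B × ℝ × ℝ × ℝ → B × ℝ × ℝ × ℝ) (T θ₀ s : ℝ) {y : Y} (hy : y ∉ O.binding) :
    monodromyMap O Θ Φ T θ₀ s y = (Θ T (y, s)).1 :=
  Function.extend_apply' _ _ _ hy

namespace ConcaveGirouxForm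

variable {O : ConcreteOpenBook n Y B} {α : OneForm (EuclideanSpace ℝ (Fin (2 * n + 3))) Y}
  {A : B × ℂ → ℝ} (h : ConcaveGirouxForm O α A) {ζ : Circle} {δ ρ : ℝ}
  (hc : CutoffParameters A ζ δ ρ) {Θ : ℝ → Y × ℝ → Y × ℝ}
  (hΘ : IsCompleteFlow (suspendedField O α A ζ δ ρ) (O.bindingᶜ ×ˢ univ) Θ)
include h hc hΘ

lemma flow_param {p : Y × ℝ} (hp : p.1 ∉ O.binding) (t : ℝ) : (Θ t p).2 = p.2 := by
  have hd := fun t => (hasVelocityAt_suspendedField (hΘ.hasVelocityAt p ⟨hp, mem_univ _⟩ t)).2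
  have := is_const_of_deriv_eq_zero (fun t => (hd t).differentiableAt) (fun t => (hd t).deriv) t 0
  rw [this, hΘ.zero p ⟨hp, mem_univ _⟩]

lemma flow_notMem {y : Y} (hy : y ∉ O.binding) (s t : ℝ) : (Θ t (y, s)).1 ∉ O.binding :=
  (hΘ.mem (y, s) ⟨hy, mem_univ _⟩ t).1

lemma flow_eq {y : Y} (hy : y ∉ O.binding) (s t : ℝ) : Θ t (y, s) = ((Θ t (y, s)).1, s) :=
  Prod.ext rfl (h.flow_param hc hΘ (p := (y, s)) hy t)

lemma hasMFDerivAt_flow {y : Y} (hy : y ∉ O.binding) (s t : ℝ) :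
    HasMFDerivAt 𝓘(ℝ, ℝ) (𝓡 (2 * n + 3)) (fun t => (Θ t (y, s)).1) t ((1 : ℝ →L[ℝ] ℝ).smulRight
      (horizontalField O α A ζ δ ρ (Real.smoothTransition s) (Θ t (y, s)).1)) := by
  have := (hasVelocityAt_suspendedField (hΘ.hasVelocityAt (y, s) ⟨hy, mem_univ _⟩ t)).1
  rwa [h.flow_param hc hΘ (p := (y, s)) hy t] at this

lemma proj_flow {y : Y} (hy : y ∉ O.binding) (s t : ℝ) :
    O.proj (Θ t (y, s)).1 = O.proj y * Circle.exp t := by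
  have := proj_eq_of_velocity O (h.hasMFDerivAt_flow hc hΘ hy s)
    (h.flow_notMem hc hΘ hy s) (fun t => h.dthetaForm_horizontalField hc (smoothTransition_mem s)
      (h.flow_notMem hc hΘ hy s t)) t
  rwa [hΘ.zero (y, s) ⟨hy, mem_univ _⟩] at this

lemma flow_add {y : Y} (hy : y ∉ O.binding) (s t t' : ℝ) :
    (Θ (t + t') (y, s)).1 = (Θ t ((Θ t' (y, s)).1, s)).1 := by
  rw [hΘ.add (fun p hp => h.nonempty_vectorFieldChart hc (p := p) hp) (x := (y, s))
    ⟨hy, mem_univ _⟩, ← h.flow_eq hc hΘ hy s t']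

lemma flow_mem_openPage {T : ℝ} (hT1 : Circle.exp T = 1) (s : ℝ) {y : Y} (hy : y ∈ O.openPage ζ) :
    (Θ T (y, s)).1 ∈ O.openPage ζ := by
  refine ⟨h.flow_notMem hc hΘ hy.1 s T, ?_⟩
  have := h.proj_flow hc hΘ hy.1 s T
  rw [hT1, mul_one] at this
  exact this.trans hy.2

lemma contMDiffAt_flow {y : Y} (hy : y ∉ O.binding) (s t : ℝ) :
    ContMDiffAt (𝓘(ℝ, ℝ).prod ((𝓡 (2 * n + 3)).prod 𝓘(ℝ, ℝ))) (𝓡 (2 * n + 3)) ∞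
      (fun q : ℝ × Y × ℝ => (Θ q.1 q.2).1) (t, y, s) :=
  ContMDiffAt.comp (t, y, s) contMDiffAt_fst (hΘ.contMDiffAt
    (fun p hp => h.nonempty_vectorFieldChart hc (p := p) hp)
    (O.isClosed_binding.isOpen_compl.prod isOpen_univ) (x := (y, s)) ⟨hy, mem_univ _⟩ t)

variable {Φ : ℝ → B × ℝ × ℝ × ℝ → B × ℝ × ℝ × ℝ} {r₀ : ℝ} (hΦ : IsPolarFlow O α A ζ δ ρ Φ r₀)
include hΦ

/-- Both sides are integral curves of the suspended field with the same initial point. -/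
lemma flow_polarMap {t : ℝ} {x : B × ℝ × ℝ × ℝ} (ht : |t| < 7) (hs : |x.2.1| ≤ 2)
    (h0 : 0 < x.2.2.1) (hr : x.2.2.1 < r₀) (hθ : |x.2.2.2| ≤ 7) :
    Θ t (polarMap O ζ x) = polarMap O ζ (Φ t x) := by
  have := hΘ.eq_of_hasVelocityAt (fun p hp => h.nonempty_vectorFieldChart hc (p := p) hp)
    (γ := fun t => polarMap O ζ (Φ t x)) (J := Ioo (-7) 7) isOpen_Ioo isPreconnected_Ioo
    (by norm_num) (fun t ht => hΦ.hasVelocityAt t x (abs_lt.2 ht) hs h0 hr hθ)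
    (by simp only [hΦ.zero]; exact polarMap_mem O ζ h0 (hr.trans hΦ.lt_one)) (abs_lt.1 ht)
  simpa only [hΦ.zero] using this.symm

lemma monodromyMap_collar {T θ₀ s : ℝ} (hT : |T| < 7) (hθ : |θ₀| ≤ 7) (hθ1 : Circle.exp θ₀ = 1)
    (hs : |s| ≤ 2) {b : B} {z : ℂ} (hz : ‖z‖ < r₀) (hp : O.collar (b, z) ∈ O.page ζ) :
    monodromyMap O Θ Φ T θ₀ s (O.collar (b, z)) = (polarMap O ζ (Φ T (b, s, ‖z‖, θ₀))).1 := by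
  have hz1 := hz.trans hΦ.lt_one
  by_cases h0 : z = 0
  · subst h0
    obtain ⟨c, hc'⟩ := hΦ.radius T (b, s, 0, θ₀)
    rw [monodromyMap_binding, polarMap, norm_zero, hc']
    simp [polarPt_zero]
  · have hn := norm_pos_iff.2 h0
    have e : polarMap O ζ (b, s, ‖z‖, θ₀) = (O.collar (b, z), s) := by
      have : polarPt ζ ‖z‖ θ₀ = z := by
        rw [polarPt, hθ1, mul_one]
        exact ((O.collar_mem_page_iff ζ b hz1).1 hp).symm
      simp only [polarMap, this]
    rw [monodromyMap_of_notMem _ _ _ _ _ _ (fun hb => h0 ((O.collar_mem_binding_iff b hz1).1 hb)),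
      ← e, h.flow_polarMap hc hΘ hΦ hT hs hn hz hθ]

/-- Off the binding this is smoothness of `Θ`. At the binding the map agrees on the page with one
built from the polar flow, which is smooth up to and across `r = 0`. -/
lemma contMDiffWithinAt_monodromyMap {T θ₀ s : ℝ} (hT : |T| < 7) (hθ : |θ₀| ≤ 7)
    (hθ1 : Circle.exp θ₀ = 1) (hs : |s| < 2) {y : Y} (hy : y ∈ O.page ζ) :
    ContMDiffWithinAt (𝓘(ℝ, ℝ).prod (𝓡 (2 * n + 3))) (𝓡 (2 * n + 3)) ∞
      (fun q : ℝ × Y => monodromyMap O Θ Φ T θ₀ q.1 q.2) (univ ×ˢ O.page ζ) (s, y) := by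
  by_cases hb : y ∈ O.binding
  · obtain ⟨b, rfl⟩ := hb
    change ContMDiffWithinAt _ _ _ _ _ (s, O.collar (b, 0))
    obtain ⟨e, he, heq⟩ := O.isLocalDiffeomorphAt_collar b (z := 0) (by simp)
    have hy0 : O.collar (b, 0) = e (b, 0) := heq he
    have htarget : O.collar (b, 0) ∈ e.target := hy0 ▸ e.map_source he
    have hsymm : ContMDiffAt (𝓡 (2 * n + 3)) ((𝓡 (2 * n + 1)).prod 𝓘(ℝ, ℂ)) ∞ e.symm
        (O.collar (b, 0)) := e.contMDiffOn_invFun.contMDiffAt (e.open_target.mem_nhds htarget)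
    have hsymm0 : e.symm (O.collar (b, 0)) = (b, 0) := by rw [hy0]; exact e.left_inv he
    -- `‖z‖` is not smooth at `0`, but on the page, where `z = ‖z‖ ζ`, it equals `Re (conj ζ · z)`,
    -- which is smooth everywhere and may be negative off the page.
    set N : ℝ × B × ℂ → Y := fun q =>
      (polarMap O ζ (Φ T (q.2.1, q.1, (conj (ζ : ℂ) * q.2.2).re, θ₀))).1 with hN
    have hNs : ContMDiffAt (𝓘(ℝ, ℝ).prod ((𝓡 (2 * n + 1)).prod 𝓘(ℝ, ℂ))) (𝓡 (2 * n + 3)) ∞ N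
        (s, b, 0) := by
      have h1 : ContMDiffAt (𝓘(ℝ, ℝ).prod ((𝓡 (2 * n + 1)).prod 𝓘(ℝ, ℂ))) 𝓘(ℝ, ℝ) ∞
          (fun q : ℝ × B × ℂ => (conj (ζ : ℂ) * q.2.2).re) (s, b, 0) := by
        have hl : ContDiff ℝ ∞ fun z : ℂ => (conj (ζ : ℂ) * z).re :=
          Complex.reCLM.contDiff.comp (contDiff_const.mul contDiff_id)
        exact hl.contMDiff.contMDiffAt.comp (s, b, 0)
          (contMDiffAt_snd.comp (s, b, (0 : ℂ)) contMDiffAt_snd)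
      have h2 : ContMDiffAt (𝓘(ℝ, ℝ).prod ((𝓡 (2 * n + 1)).prod 𝓘(ℝ, ℂ)))
          ((𝓡 (2 * n + 1)).prod 𝓘(ℝ, ℝ × ℝ × ℝ)) ∞
          (fun q : ℝ × B × ℂ => (q.2.1, q.1, (conj (ζ : ℂ) * q.2.2).re, θ₀)) (s, b, 0) :=
        ContMDiffAt.prodMk (contMDiffAt_fst.comp (s, b, (0 : ℂ)) contMDiffAt_snd)
          (contMDiffAt_fst.prodMk_space (h1.prodMk_space contMDiffAt_const))
      have h3 : ContMDiffAt (𝓘(ℝ, ℝ).prod ((𝓡 (2 * n + 1)).prod 𝓘(ℝ, ℂ)))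
          ((𝓡 (2 * n + 1)).prod 𝓘(ℝ, ℝ × ℝ × ℝ)) ∞
          (fun q : ℝ × B × ℂ => Φ T (q.2.1, q.1, (conj (ζ : ℂ) * q.2.2).re, θ₀)) (s, b, 0) :=
        ContMDiffAt.comp (s, b, (0 : ℂ)) (g := fun q : ℝ × B × ℝ × ℝ × ℝ => Φ q.1 q.2)
          (f := fun q : ℝ × B × ℂ => (T, (q.2.1, q.1, (conj (ζ : ℂ) * q.2.2).re, θ₀)))
          hΦ.contMDiff.contMDiffAt (contMDiffAt_const.prodMk h2)
      have hlt : |(Φ T (b, s, (conj (ζ : ℂ) * (0 : ℂ)).re, θ₀)).2.2.1| < 1 := by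
        refine hΦ.radius_lt T _ hT.le hs.le ?_ hθ
        simpa using hΦ.pos
      have h4 : ContMDiffAt ((𝓡 (2 * n + 1)).prod 𝓘(ℝ, ℝ × ℝ × ℝ)) (𝓡 (2 * n + 3)) ∞
          (fun x : B × ℝ × ℝ × ℝ => (polarMap O ζ x).1)
          (Φ T (b, s, (conj (ζ : ℂ) * (0 : ℂ)).re, θ₀)) := by
        generalize hxdef : Φ T (b, s, (conj (ζ : ℂ) * (0 : ℂ)).re, θ₀) = x at hlt
        have hp : ContMDiffAt ((𝓡 (2 * n + 1)).prod 𝓘(ℝ, ℝ × ℝ × ℝ)) 𝓘(ℝ, ℂ) ∞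
            (fun x : B × ℝ × ℝ × ℝ => polarPt ζ x.2.2.1 x.2.2.2) x := by
          have hl : ContDiff ℝ ∞ fun p : ℝ × ℝ × ℝ => polarPt ζ p.2.1 p.2.2 :=
            (contDiff_polarPt ζ).comp contDiff_snd
          exact hl.contMDiff.contMDiffAt.comp x contMDiffAt_snd
        exact ContMDiffAt.comp x (g := O.collar)
          (f := fun x : B × ℝ × ℝ × ℝ => (x.1, polarPt ζ x.2.2.1 x.2.2.2))
          (O.contMDiffAt_collar x.1 (by rwa [norm_polarPt])) (contMDiffAt_fst.prodMk hp)
      exact ContMDiffAt.comp (s, b, (0 : ℂ)) (g := fun x : B × ℝ × ℝ × ℝ => (polarMap O ζ x).1)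
        (f := fun q : ℝ × B × ℂ => Φ T (q.2.1, q.1, (conj (ζ : ℂ) * q.2.2).re, θ₀)) h4 h3
    have hfin : ContMDiffAt (𝓘(ℝ, ℝ).prod (𝓡 (2 * n + 3))) (𝓡 (2 * n + 3)) ∞
        (fun q : ℝ × Y => N (q.1, e.symm q.2)) (s, O.collar (b, 0)) := by
      refine ContMDiffAt.comp (s, O.collar (b, 0)) (g := N) (f := fun q : ℝ × Y => (q.1, e.symm q.2))
        (by rw [hsymm0]; exact hNs) ?_
      exact contMDiffAt_fst.prodMk (ContMDiffAt.comp (s, O.collar (b, 0)) (g := e.symm)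
        (f := Prod.snd) hsymm contMDiffAt_snd)
    refine hfin.contMDiffWithinAt.congr_of_eventuallyEq_of_mem ?_ ⟨mem_univ _, hy⟩
    have hev : ∀ᶠ q : ℝ × Y in 𝓝 (s, O.collar (b, 0)), |q.1| < 2 ∧ q.2 ∈ e.target ∧
        ‖(e.symm q.2).2‖ < r₀ := by
      have c1 : ContinuousAt (fun q : ℝ × Y => |q.1|) (s, O.collar (b, 0)) := by fun_prop
      have c2 : ContinuousAt (fun q : ℝ × Y => ‖(e.symm q.2).2‖) (s, O.collar (b, 0)) :=
        (continuousAt_snd.comp (ContinuousAt.comp (x := (s, O.collar (b, 0))) (g := e.symm)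
          (f := Prod.snd) hsymm.continuousAt continuousAt_snd)).norm
      refine (c1.eventually_mem (Iio_mem_nhds hs)).and
        ((continuousAt_snd.eventually_mem (e.open_target.mem_nhds htarget)).and
          (c2.eventually_mem (Iio_mem_nhds ?_)))
      rw [hsymm0, norm_zero]
      exact hΦ.pos
    filter_upwards [nhdsWithin_le_nhds hev, self_mem_nhdsWithin] with q hq hqp
    have e1 : O.collar (e.symm q.2) = q.2 := (heq (e.map_target hq.2.1)).trans (e.right_inv hq.2.1)
    have hpage : O.collar ((e.symm q.2).1, (e.symm q.2).2) ∈ O.page ζ := by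
      rw [Prod.mk.eta, e1]; exact hqp.2
    have e2 := h.monodromyMap_collar hc hΘ hΦ hT hθ hθ1 hq.1.le hq.2.2 hpage
    have e3 := (O.collar_mem_page_iff ζ _ (hq.2.2.trans hΦ.lt_one)).1 hpage
    rw [Prod.mk.eta, e1] at e2
    have e4 : (conj (ζ : ℂ) * (e.symm q.2).2).re = ‖(e.symm q.2).2‖ := by
      conv_lhs => rw [e3]
      rw [mul_left_comm, Complex.conj_mul', Circle.norm_coe]
      simp
    change monodromyMap O Θ Φ T θ₀ q.1 q.2 =
      (polarMap O ζ (Φ T ((e.symm q.2).1, q.1, (conj (ζ : ℂ) * (e.symm q.2).2).re, θ₀))).1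
    rw [e2, e4]
  · refine ContMDiffAt.contMDiffWithinAt ?_
    have h1 : ContMDiffAt (𝓘(ℝ, ℝ).prod (𝓡 (2 * n + 3))) (𝓡 (2 * n + 3)) ∞
        (fun q : ℝ × Y => (Θ T (q.2, q.1)).1) (s, y) :=
      ContMDiffAt.comp (s, y) (g := fun q : ℝ × Y × ℝ => (Θ q.1 q.2).1)
        (f := fun q : ℝ × Y => (T, q.2, q.1)) (h.contMDiffAt_flow hc hΘ hb s T)
        (contMDiffAt_const.prodMk (contMDiffAt_snd.prodMk contMDiffAt_fst))
    refine h1.congr_of_eventuallyEq ?_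
    filter_upwards [continuousAt_snd.eventually_mem (O.isClosed_binding.isOpen_compl.mem_nhds hb)]
      with q hq
    exact monodromyMap_of_notMem O Θ Φ T θ₀ q.1 hq

end ConcaveGirouxForm

end MonodromyMap

/-! ### A retraction onto the page along the flow. -/

section PageRetraction

variable {n : ℕ}
  {Y : Type*} [TopologicalSpace Y] [ChartedSpace (EuclideanSpace ℝ (Fin (2 * n + 3))) Y]
  [IsManifold (𝓡 (2 * n + 3)) ∞ Y] [CompactSpace Y] [T2Space Y]
  {B : Type*} [TopologicalSpace B] [ChartedSpace (EuclideanSpace ℝ (Fin (2 * n + 1))) B]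
  [IsManifold (𝓡 (2 * n + 1)) ∞ B] [CompactSpace B] [T2Space B]

namespace ConcreteOpenBook

variable (O : ConcreteOpenBook n Y B)

lemma mfderiv_proj {x : Y} (hx : x ∉ O.binding) (v : EuclideanSpace ℝ (Fin (2 * n + 3))) :
    (show ℂ from mfderiv (𝓡 (2 * n + 3)) 𝓘(ℝ, ℂ) (fun y => (O.proj y : ℂ)) x v) =
      ((O.dthetaForm x v : ℝ) : ℂ) * Complex.I * O.proj x := by
  have hd := ((O.contMDiffAt_proj hx).mdifferentiableAt (by simp)).hasMFDerivAt
  set P : EuclideanSpace ℝ (Fin (2 * n + 3)) →L[ℝ] ℂ :=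
    mfderiv (𝓡 (2 * n + 3)) 𝓘(ℝ, ℂ) (fun y => (O.proj y : ℂ)) x with hP
  change P v = _
  set p : ℂ := (O.proj x : ℂ) with hp
  have e1 : O.dthetaForm x v = (conj p * P v).im := rfl
  have hpp : conj p * p = 1 := by
    rw [← Complex.normSq_eq_conj_mul_self, hp, Circle.normSq_coe]; simp
  have hre : (conj p * P v).re = 0 := by
    have d1 := HasMFDerivAt.comp x (g := fun z : ℂ => ‖z‖ ^ 2)
      (hasStrictFDerivAt_norm_sq p).hasFDerivAt.hasMFDerivAt hd
    have d2 : HasMFDerivAt (𝓡 (2 * n + 3)) 𝓘(ℝ, ℝ)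
        ((fun z : ℂ => ‖z‖ ^ 2) ∘ fun y => (O.proj y : ℂ)) x
        (0 : EuclideanSpace ℝ (Fin (2 * n + 3)) →L[ℝ] ℝ) := by
      refine (hasMFDerivAt_const (1 : ℝ) x).congr_of_eventuallyEq
        (Filter.Eventually.of_forall fun y => ?_)
      change ‖(O.proj y : ℂ)‖ ^ 2 = 1
      rw [Circle.norm_coe, one_pow]
    have d3 := congrArg (fun T : EuclideanSpace ℝ (Fin (2 * n + 3)) →L[ℝ] ℝ => T v)
      (hasMFDerivAt_unique d1 d2)
    change (2 • innerSL ℝ p : ℂ →L[ℝ] ℝ) (P v) = 0 at d3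
    have d4 : (2 : ℝ) * (inner ℝ p (P v)) = 0 := by
      rw [← d3]; simp [two_mul, two_nsmul]
    have d5 : inner ℝ p (P v) = (conj p * P v).re := by simp [Complex.inner, mul_comm]
    linarith
  have e2 : conj p * P v = O.dthetaForm x v * Complex.I := by
    apply Complex.ext <;> simp [hre, e1]
  rw [← e2, mul_comm (conj p), mul_assoc, hpp, mul_one]

/-- The angle relative to the page over `ζ`. -/
def relAngle (ζ : Circle) (y : Y) : ℝ := (Complex.log ((O.proj y / ζ : Circle) : ℂ)).im

lemma exp_relAngle (ζ : Circle) (y : Y) : Circle.exp (O.relAngle ζ y) = O.proj y / ζ := by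
  rw [relAngle, Complex.log_im, Circle.exp_arg]

lemma relAngle_openPage {ζ : Circle} {x : Y} (hx : x ∈ O.openPage ζ) : O.relAngle ζ x = 0 := by
  have : O.proj x = ζ := hx.2
  rw [relAngle, this, div_self']
  simp

lemma contMDiffAt_relAngle {ζ : Circle} {x : Y} (hx : x ∈ O.openPage ζ) :
    ContMDiffAt (𝓡 (2 * n + 3)) 𝓘(ℝ, ℝ) ∞ (O.relAngle ζ) x := by
  have h1 : ContDiffAt ℝ ∞ (fun z : ℂ => (Complex.log (z / ζ)).im) (O.proj x) := by
    have h0 : (O.proj x : ℂ) / ζ = 1 := by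
      rw [show O.proj x = ζ from hx.2]; exact div_self (Circle.coe_ne_zero ζ)
    have h2 : ContDiffAt ℝ ∞ Complex.log ((O.proj x : ℂ) / ζ) :=
      (Complex.contDiffAt_log (by rw [h0]; exact Complex.one_mem_slitPlane)).restrict_scalars ℝ
    exact Complex.imCLM.contDiff.contDiffAt.comp _ (h2.comp (O.proj x : ℂ) (f := fun z : ℂ => z / ζ)
      (contDiffAt_id.div_const _))
  have h3 := ContMDiffAt.comp x (g := fun z : ℂ => (Complex.log (z / ζ)).im)
    (f := fun y => (O.proj y : ℂ)) h1.contMDiffAt (O.contMDiffAt_proj hx.1)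
  refine h3.congr_of_eventuallyEq (Filter.Eventually.of_forall fun y => ?_)
  simp [relAngle]

lemma mfderiv_relAngle {ζ : Circle} {x : Y} (hx : x ∈ O.openPage ζ)
    {v : EuclideanSpace ℝ (Fin (2 * n + 3))} (hv : O.dthetaForm x v = 0) :
    (mfderiv (𝓡 (2 * n + 3)) 𝓘(ℝ, ℝ) (O.relAngle ζ) x v : ℝ) = 0 := by
  have h1 := ((O.contMDiffAt_relAngle hx).mdifferentiableAt (by simp)).hasMFDerivAt
  have h2 := HasMFDerivAt.comp x (g := fun t : ℝ => ((ζ * Circle.exp t : Circle) : ℂ))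
    (f := O.relAngle ζ) (f' := mfderiv (𝓡 (2 * n + 3)) 𝓘(ℝ, ℝ) (O.relAngle ζ) x)
    (by
      have : HasDerivAt (fun t : ℝ => ((ζ * Circle.exp t : Circle) : ℂ))
          (ζ * (Complex.exp (O.relAngle ζ x * Complex.I) * (1 * Complex.I))) (O.relAngle ζ x) := by
        have d2 : HasDerivAt (fun t : ℝ => (t : ℂ) * Complex.I) (1 * Complex.I) (O.relAngle ζ x) :=
          (Complex.ofRealCLM.hasDerivAt (x := O.relAngle ζ x)).mul_const Complex.I
        simpa only [Circle.coe_mul, Circle.coe_exp] using d2.cexp.const_mul (ζ : ℂ)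
      exact hasMFDerivAt_smulRight_iff.2 this) h1
  have h3 := (((O.contMDiffAt_proj hx.1).mdifferentiableAt (by simp)).hasMFDerivAt
    ).congr_of_eventuallyEq (f₁ := (fun t : ℝ => ((ζ * Circle.exp t : Circle) : ℂ)) ∘ O.relAngle ζ)
    (Filter.Eventually.of_forall fun y => by
      change ((ζ * Circle.exp (O.relAngle ζ y) : Circle) : ℂ) = O.proj y
      rw [O.exp_relAngle, mul_div_cancel])
  have h4 := congrArg (fun T : EuclideanSpace ℝ (Fin (2 * n + 3)) →L[ℝ] ℂ => T v)
    (hasMFDerivAt_unique h2 h3)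
  have h5 := (O.mfderiv_proj hx.1 v)
  rw [hv, Complex.ofReal_zero, zero_mul, zero_mul] at h5
  have h6 := h4.trans h5
  change ((show ℝ from mfderiv (𝓡 (2 * n + 3)) 𝓘(ℝ, ℝ) (O.relAngle ζ) x v) • ((ζ : ℂ) *
    (Complex.exp (O.relAngle ζ x * Complex.I) * (1 * Complex.I)))) = 0 at h6
  exact (smul_eq_zero.1 h6).resolve_right (by simp)

end ConcreteOpenBook

/-- The retraction onto the page over `ζ` along the flow `Θ`. -/
def pageRetraction (O : ConcreteOpenBook n Y B) (ζ : Circle) (Θ : ℝ → Y × ℝ → Y × ℝ) (y : Y) : Y :=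
  (Θ (-O.relAngle ζ y) (y, 0)).1

namespace ConcaveGirouxForm

variable {O : ConcreteOpenBook n Y B} {α : OneForm (EuclideanSpace ℝ (Fin (2 * n + 3))) Y}
  {A : B × ℂ → ℝ} (h : ConcaveGirouxForm O α A) {ζ : Circle} {δ ρ : ℝ}
  (hc : CutoffParameters A ζ δ ρ) {Θ : ℝ → Y × ℝ → Y × ℝ}
  (hΘ : IsCompleteFlow (suspendedField O α A ζ δ ρ) (O.bindingᶜ ×ˢ univ) Θ)
include h hc hΘ

lemma contMDiffAt_flow_time {y : Y} (hy : y ∉ O.binding) (s t : ℝ) :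
    ContMDiffAt (𝓡 (2 * n + 3)) (𝓡 (2 * n + 3)) ∞ (fun y => (Θ t (y, s)).1) y :=
  ContMDiffAt.comp y (g := fun q : ℝ × Y × ℝ => (Θ q.1 q.2).1) (f := fun y : Y => (t, y, s))
    (h.contMDiffAt_flow hc hΘ hy s t)
    (contMDiffAt_const.prodMk (contMDiffAt_id.prodMk contMDiffAt_const))

lemma pageRetraction_mem {y : Y} (hy : y ∉ O.binding) : pageRetraction O ζ Θ y ∈ O.openPage ζ := by
  refine ⟨h.flow_notMem hc hΘ hy 0 _, ?_⟩
  have := h.proj_flow hc hΘ hy 0 (-O.relAngle ζ y)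
  rw [Circle.exp_neg, O.exp_relAngle] at this
  refine this.trans ?_
  simp

lemma pageRetraction_eq {x : Y} (hx : x ∈ O.openPage ζ) : pageRetraction O ζ Θ x = x := by
  rw [pageRetraction, O.relAngle_openPage hx, neg_zero, hΘ.zero (x, 0) ⟨hx.1, mem_univ _⟩]

lemma contMDiffAt_pageRetraction {x : Y} (hx : x ∈ O.openPage ζ) :
    ContMDiffAt (𝓡 (2 * n + 3)) (𝓡 (2 * n + 3)) ∞ (pageRetraction O ζ Θ) x :=
  ContMDiffAt.comp x (g := fun q : ℝ × Y × ℝ => (Θ q.1 q.2).1)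
    (f := fun y : Y => (-O.relAngle ζ y, y, (0 : ℝ)))
    (h.contMDiffAt_flow hc hΘ hx.1 0 _)
    ((O.contMDiffAt_relAngle hx).neg.prodMk (contMDiffAt_id.prodMk contMDiffAt_const))

/-- On a vector with `dθ(v) = 0` the flow time is stationary, and at time `0` the flow is the
identity. -/
lemma mfderiv_pageRetraction {x : Y} (hx : x ∈ O.openPage ζ)
    {v : EuclideanSpace ℝ (Fin (2 * n + 3))} (hv : O.dthetaForm x v = 0) :
    (mfderiv (𝓡 (2 * n + 3)) (𝓡 (2 * n + 3)) (pageRetraction O ζ Θ) x v :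
      EuclideanSpace ℝ (Fin (2 * n + 3))) = v := by
  have hJ : ContMDiffAt (𝓘(ℝ, ℝ).prod (𝓡 (2 * n + 3))) (𝓡 (2 * n + 3)) ∞
      (fun q : ℝ × Y => (Θ q.1 (q.2, 0)).1) (0, x) :=
    ContMDiffAt.comp (0, x) (g := fun q : ℝ × Y × ℝ => (Θ q.1 q.2).1)
      (f := fun q : ℝ × Y => (q.1, q.2, (0 : ℝ))) (h.contMDiffAt_flow hc hΘ hx.1 0 0)
      (contMDiffAt_fst.prodMk (contMDiffAt_snd.prodMk contMDiffAt_const))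
  have hJd := (hJ.mdifferentiableAt (by simp)).hasMFDerivAt
  set D : ℝ × EuclideanSpace ℝ (Fin (2 * n + 3)) →L[ℝ] EuclideanSpace ℝ (Fin (2 * n + 3)) :=
    mfderiv (𝓘(ℝ, ℝ).prod (𝓡 (2 * n + 3))) (𝓡 (2 * n + 3))
      (fun q : ℝ × Y => (Θ q.1 (q.2, 0)).1) (0, x) with hD
  have h1 := HasMFDerivAt.comp x (f := fun y : Y => ((0 : ℝ), y)) hJd
    ((hasMFDerivAt_const (0 : ℝ) x).prodMk (hasMFDerivAt_id x))
  have h2 := (hasMFDerivAt_id (I := 𝓡 (2 * n + 3)) x).congr_of_eventuallyEq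
    (f₁ := (fun q : ℝ × Y => (Θ q.1 (q.2, 0)).1) ∘ fun y : Y => ((0 : ℝ), y)) (by
      filter_upwards [O.isClosed_binding.isOpen_compl.mem_nhds hx.1] with y hy
      change (Θ 0 (y, 0)).1 = y
      rw [hΘ.zero (y, 0) ⟨hy, mem_univ _⟩])
  have h3 : D (0, v) = v := congrArg (fun T : EuclideanSpace ℝ (Fin (2 * n + 3)) →L[ℝ]
    EuclideanSpace ℝ (Fin (2 * n + 3)) => T v) (hasMFDerivAt_unique h1 h2)
  have hθ := ((O.contMDiffAt_relAngle hx).neg.mdifferentiableAt (by simp)).hasMFDerivAt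
  have hθv : (mfderiv (𝓡 (2 * n + 3)) 𝓘(ℝ, ℝ) (fun y => -O.relAngle ζ y) x v : ℝ) = 0 := by
    have h4 := ((O.contMDiffAt_relAngle hx).mdifferentiableAt (by simp)).hasMFDerivAt.neg.mfderiv
    have h5 := congrArg (fun T : EuclideanSpace ℝ (Fin (2 * n + 3)) →L[ℝ] ℝ => T v) h4
    refine h5.trans ?_
    change -(mfderiv (𝓡 (2 * n + 3)) 𝓘(ℝ, ℝ) (O.relAngle ζ) x v : ℝ) = 0
    rw [O.mfderiv_relAngle hx hv, neg_zero]
  have hJd' : HasMFDerivAt (𝓘(ℝ, ℝ).prod (𝓡 (2 * n + 3))) (𝓡 (2 * n + 3))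
      (fun q : ℝ × Y => (Θ q.1 (q.2, 0)).1) (-O.relAngle ζ x, x) D := by
    rw [O.relAngle_openPage hx, neg_zero]; exact hJd
  have h6 := HasMFDerivAt.comp x (g := fun q : ℝ × Y => (Θ q.1 (q.2, 0)).1)
    (f := fun y : Y => (-O.relAngle ζ y, y)) hJd' (hθ.prodMk (hasMFDerivAt_id x))
  have h7 := congrArg (fun T : EuclideanSpace ℝ (Fin (2 * n + 3)) →L[ℝ]
    EuclideanSpace ℝ (Fin (2 * n + 3)) => T v) h6.mfderiv
  refine h7.trans ?_
  exact (congrArg (fun c : ℝ => D (c, v)) hθv).trans h3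

/-- The page has codimension one, so derivatives within it are not unique in general. Composing with
the retraction turns the derivative within the page into an ordinary one, and the retraction is the
identity on vectors tangent to the page. -/
lemma mfderivWithin_openPage {g F : Y → Y} {x : Y} (hx : x ∈ O.openPage ζ)
    (hF : ContMDiffAt (𝓡 (2 * n + 3)) (𝓡 (2 * n + 3)) ∞ F x) (he : EqOn g F (O.openPage ζ))
    {v : EuclideanSpace ℝ (Fin (2 * n + 3))} (hv : O.dthetaForm x v = 0) :
    (mfderivWithin (𝓡 (2 * n + 3)) (𝓡 (2 * n + 3)) g (O.openPage ζ) x v :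
      EuclideanSpace ℝ (Fin (2 * n + 3))) =
    mfderiv (𝓡 (2 * n + 3)) (𝓡 (2 * n + 3)) F x v := by
  have hr := ((h.contMDiffAt_pageRetraction hc hΘ hx).mdifferentiableAt (by simp)).hasMFDerivAt
  have hFd := (hF.mdifferentiableAt (by simp)).hasMFDerivAt
  have hg : MDifferentiableWithinAt (𝓡 (2 * n + 3)) (𝓡 (2 * n + 3)) g (O.openPage ζ) x :=
    (hF.mdifferentiableAt (by simp)).mdifferentiableWithinAt.congr (fun y hy => he hy) (he hx)
  have hx' := h.pageRetraction_eq hc hΘ hx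
  have hev : ∀ᶠ y in 𝓝 x, y ∉ O.binding := O.isClosed_binding.isOpen_compl.mem_nhds hx.1
  have h1 := HasMFDerivWithinAt.comp x (g := g) (f := pageRetraction O ζ Θ) (u := O.openPage ζ)
    (s := O.bindingᶜ) (by rw [hx']; exact hg.hasMFDerivWithinAt) hr.hasMFDerivWithinAt
    (fun y hy => h.pageRetraction_mem hc hΘ hy)
  have h2 := HasMFDerivAt.comp x (g := F) (f := pageRetraction O ζ Θ) (by rw [hx']; exact hFd) hr
  have h3 := (h1.hasMFDerivAt hev).congr_of_eventuallyEq (f₁ := F ∘ pageRetraction O ζ Θ)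
    (hev.mono fun y hy => (he (h.pageRetraction_mem hc hΘ hy)).symm)
  have h4 := congrArg (fun T : EuclideanSpace ℝ (Fin (2 * n + 3)) →L[ℝ]
    EuclideanSpace ℝ (Fin (2 * n + 3)) => T v) (hasMFDerivAt_unique h3 h2)
  have hrv := h.mfderiv_pageRetraction hc hΘ hx hv
  change (mfderivWithin (𝓡 (2 * n + 3)) (𝓡 (2 * n + 3)) g (O.openPage ζ) x
    (mfderiv (𝓡 (2 * n + 3)) (𝓡 (2 * n + 3)) (pageRetraction O ζ Θ) x v) :
      EuclideanSpace ℝ (Fin (2 * n + 3))) = mfderiv (𝓡 (2 * n + 3)) (𝓡 (2 * n + 3)) F x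
    (mfderiv (𝓡 (2 * n + 3)) (𝓡 (2 * n + 3)) (pageRetraction O ζ Θ) x v) at h4
  exact Eq.mp (congrArg (fun u : EuclideanSpace ℝ (Fin (2 * n + 3)) =>
    ((mfderivWithin (𝓡 (2 * n + 3)) (𝓡 (2 * n + 3)) g (O.openPage ζ) x u :
      EuclideanSpace ℝ (Fin (2 * n + 3))) = mfderiv (𝓡 (2 * n + 3)) (𝓡 (2 * n + 3)) F x u)) hrv) h4

end ConcaveGirouxForm

end PageRetraction

/-! ### The holonomies preserve `dα` on the page. -/

section Symplectic

variable {n : ℕ}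
  {Y : Type*} [TopologicalSpace Y] [ChartedSpace (EuclideanSpace ℝ (Fin (2 * n + 3))) Y]
  [IsManifold (𝓡 (2 * n + 3)) ∞ Y] [CompactSpace Y] [T2Space Y]
  {B : Type*} [TopologicalSpace B] [ChartedSpace (EuclideanSpace ℝ (Fin (2 * n + 1))) B]
  [IsManifold (𝓡 (2 * n + 1)) ∞ B] [CompactSpace B] [T2Space B]

namespace ConcaveGirouxForm

variable {O : ConcreteOpenBook n Y B} {α : OneForm (EuclideanSpace ℝ (Fin (2 * n + 3))) Y}
  {A : B × ℂ → ℝ} (h : ConcaveGirouxForm O α A) {ζ : Circle} {δ ρ : ℝ}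
  (hc : CutoffParameters A ζ δ ρ) {Θ : ℝ → Y × ℝ → Y × ℝ}
  (hΘ : IsCompleteFlow (suspendedField O α A ζ δ ρ) (O.bindingᶜ ×ˢ univ) Θ)
include h hc hΘ

/-- The two forms agree only on vectors tangent to the page, so both are pulled back by the
retraction composed with a chart. Its values lie in the page, the pullbacks have the same germ, and
`d` is natural. -/
lemma dCLM_interpForm_openPage (l : ℝ) {x : Y} (hx : x ∈ O.openPage ζ)
    {v w : EuclideanSpace ℝ (Fin (2 * n + 3))} (hv : O.dthetaForm x v = 0)
    (hw : O.dthetaForm x w = 0) :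
    (interpForm O α A ζ δ ρ l).dCLM x v w = α.dCLM x v w := by
  set e := extChartAt (𝓡 (2 * n + 3)) x with he
  have hu0 : e x ∈ e.target := mem_extChartAt_target x
  have hex : e.symm (e x) = x := extChartAt_to_inv x
  have hret := h.pageRetraction_eq hc hΘ hx
  set φ : EuclideanSpace ℝ (Fin (2 * n + 3)) → Y := fun u => pageRetraction O ζ Θ (e.symm u) with hφ
  have hφx : φ (e x) = x := by rw [hφ]; simp only [hex, hret]
  have hes := contMDiffAt_extChartAt_symm' x hu0
  have hrc := h.contMDiffAt_pageRetraction hc hΘ hx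
  have hφc : ContMDiffAt 𝓘(ℝ, EuclideanSpace ℝ (Fin (2 * n + 3))) (𝓡 (2 * n + 3)) ∞ φ (e x) :=
    ContMDiffAt.comp (e x) (g := pageRetraction O ζ Θ) (f := e.symm) (by rw [hex]; exact hrc) hes
  have hev : ∀ᶠ u in 𝓝 (e x), φ u ∈ O.openPage ζ := by
    have h1 : ContinuousAt e.symm (e x) := hes.continuousAt
    have h2 : O.bindingᶜ ∈ 𝓝 (e.symm (e x)) := by
      rw [hex]; exact O.isClosed_binding.isOpen_compl.mem_nhds hx.1
    exact (h1.eventually_mem h2).mono fun u hu => h.pageRetraction_mem hc hΘ hu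
  have hpull : (interpForm O α A ζ δ ρ l).pull φ =ᶠ[𝓝 (e x)] α.pull φ := by
    have h1 : ∀ᶠ u in 𝓝 (e x), ContMDiffAt 𝓘(ℝ, EuclideanSpace ℝ (Fin (2 * n + 3)))
        (𝓡 (2 * n + 3)) 1 φ u := by
      have := OneForm.isManifold_one (E := EuclideanSpace ℝ (Fin (2 * n + 3))) (M := Y)
      exact (contMDiffAt_iff_contMDiffAt_nhds (by simp)).1 (hφc.of_le (by simp))
    filter_upwards [hev.eventually_nhds, h1] with u hu hu1
    have hmem := hu.self_of_nhds
    refine ContinuousLinearMap.ext fun v => ?_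
    refine h.interpForm_openPage hc l hmem _ ?_
    have hp := O.dthetaForm_pull (hu1.mdifferentiableAt (by simp)) hmem.1
    have hconst : fderiv ℝ (fun v => (O.proj (φ v) : ℂ)) u = 0 := by
      have : (fun v => (O.proj (φ v) : ℂ)) =ᶠ[𝓝 u] fun _ => (ζ : ℂ) :=
        hu.mono fun v hv => congrArg _ hv.2
      rw [this.fderiv_eq]
      simp
    rw [hconst, ContinuousLinearMap.comp_zero] at hp
    exact congrArg (fun T : EuclideanSpace ℝ (Fin (2 * n + 3)) →L[ℝ] ℝ => T v) hp
  have hlift : ∀ v : EuclideanSpace ℝ (Fin (2 * n + 3)), O.dthetaForm x v = 0 →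
      ∃ v' : EuclideanSpace ℝ (Fin (2 * n + 3)),
        (show EuclideanSpace ℝ (Fin (2 * n + 3)) from mfderiv
          𝓘(ℝ, EuclideanSpace ℝ (Fin (2 * n + 3))) (𝓡 (2 * n + 3)) φ (e x) v') = v := by
    intro v hv
    obtain ⟨v', hv'⟩ := (bijective_mfderiv_extChartAt_symm x hu0).2 v
    refine ⟨v', ?_⟩
    have h1 := HasMFDerivAt.comp (e x) (g := pageRetraction O ζ Θ) (f := e.symm)
      (g' := mfderiv (𝓡 (2 * n + 3)) (𝓡 (2 * n + 3)) (pageRetraction O ζ Θ) x)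
      (by rw [hex]; exact (hrc.mdifferentiableAt (by simp)).hasMFDerivAt)
      (hes.mdifferentiableAt (by simp)).hasMFDerivAt
    have h2 := congrArg (fun T : EuclideanSpace ℝ (Fin (2 * n + 3)) →L[ℝ]
      EuclideanSpace ℝ (Fin (2 * n + 3)) => T v') h1.mfderiv
    refine h2.trans (Eq.trans ?_ (h.mfderiv_pageRetraction hc hΘ hx hv))
    exact congrArg (fun u : EuclideanSpace ℝ (Fin (2 * n + 3)) =>
      (show EuclideanSpace ℝ (Fin (2 * n + 3)) from
        mfderiv (𝓡 (2 * n + 3)) (𝓡 (2 * n + 3)) (pageRetraction O ζ Θ) x u)) hv'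
  obtain ⟨v', hv'⟩ := hlift v hv
  obtain ⟨w', hw'⟩ := hlift w hw
  have k1 := (h.smoothAt_interpForm hc l (y := φ (e x)) (by rw [hφx]; exact hx.1)).formD_pull hφc v' w'
  have k2 := (h.smoothAt (φ (e x))).formD_pull hφc v' w'
  have k3 := k1.symm.trans ((formD_congr hpull v' w').trans k2)
  have k4 : (interpForm O α A ζ δ ρ l).dCLM (φ (e x)) v w = α.dCLM (φ (e x)) v w := by
    rw [← hv', ← hw']; exact k3
  rwa [hφx] at k4

/-- Pull `β` back by `(t, u) ↦ Θ_t(u)`. The direction `∂_t` is then in the kernel of the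
differential, which by `formD_eq_of_kernel` does not change with `t`; at `t = 0` the flow is the
identity. -/
lemma dCLM_flow {x : Y} (hx : x ∉ O.binding) (s t : ℝ) (v w : EuclideanSpace ℝ (Fin (2 * n + 3))) :
    (interpForm O α A ζ δ ρ (Real.smoothTransition s)).dCLM (Θ t (x, s)).1
      (mfderiv (𝓡 (2 * n + 3)) (𝓡 (2 * n + 3)) (fun y => (Θ t (y, s)).1) x v)
      (mfderiv (𝓡 (2 * n + 3)) (𝓡 (2 * n + 3)) (fun y => (Θ t (y, s)).1) x w) =
    (interpForm O α A ζ δ ρ (Real.smoothTransition s)).dCLM x v w := by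
  set β := interpForm O α A ζ δ ρ (Real.smoothTransition s) with hβ
  set e := extChartAt (𝓡 (2 * n + 3)) x with he
  have hu0 : e x ∈ e.target := mem_extChartAt_target x
  have hex : e.symm (e x) = x := extChartAt_to_inv x
  set φ : ℝ × EuclideanSpace ℝ (Fin (2 * n + 3)) → Y := fun q => (Θ q.1 (e.symm q.2, s)).1 with hφ
  set U₀ : Set (EuclideanSpace ℝ (Fin (2 * n + 3))) := e.target ∩ e.symm ⁻¹' O.bindingᶜ with hU₀
  have hU₀o : IsOpen U₀ := (continuousOn_extChartAt_symm x).isOpen_inter_preimage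
    (isOpen_extChartAt_target x) O.isClosed_binding.isOpen_compl
  have hxU : e x ∈ U₀ := ⟨hu0, by rw [mem_preimage, hex]; exact hx⟩
  have hφc : ∀ q ∈ (univ : Set ℝ) ×ˢ U₀, ContMDiffAt 𝓘(ℝ, ℝ × EuclideanSpace ℝ (Fin (2 * n + 3)))
      (𝓡 (2 * n + 3)) ∞ φ q := by
    rintro q ⟨-, hq1, hq2⟩
    refine ContMDiffAt.comp q (g := fun q : ℝ × Y × ℝ => (Θ q.1 q.2).1)
      (f := fun q : ℝ × EuclideanSpace ℝ (Fin (2 * n + 3)) => (q.1, e.symm q.2, s))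
      (h.contMDiffAt_flow hc hΘ hq2 s q.1) ?_
    refine contDiffAt_fst.contMDiffAt.prodMk (ContMDiffAt.prodMk ?_ contMDiffAt_const)
    exact ContMDiffAt.comp q (g := e.symm) (f := Prod.snd)
      (contMDiffAt_extChartAt_symm' x hq1) contDiffAt_snd.contMDiffAt
  have hφb : ∀ q ∈ (univ : Set ℝ) ×ˢ U₀, φ q ∉ O.binding := fun q hq =>
    h.flow_notMem hc hΘ hq.2.2 s q.1
  have hsm : ∀ q ∈ (univ : Set ℝ) ×ˢ U₀, ContDiffAt ℝ ∞ (β.pull φ) q := fun q hq =>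
    (h.smoothAt_interpForm hc _ (hφb q hq)).contDiffAt_pull (hφc q hq)
  have hker : ∀ q ∈ (univ : Set ℝ) ×ˢ U₀, ∀ w,
      formD (β.pull φ) q ((1 : ℝ), (0 : EuclideanSpace ℝ (Fin (2 * n + 3)))) w = 0 := by
    intro q hq w
    refine ((h.smoothAt_interpForm hc _ (hφb q hq)).formD_pull (hφc q hq) _ w).trans ?_
    have h1 : HasDerivAt (fun t : ℝ => (t, q.2))
        ((1 : ℝ), (0 : EuclideanSpace ℝ (Fin (2 * n + 3)))) q.1 :=
      (hasDerivAt_id _).prodMk (hasDerivAt_const _ _)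
    have h2 := HasMFDerivAt.comp q.1 (g := φ)
      ((hφc q hq).mdifferentiableAt (by simp)).hasMFDerivAt (hasMFDerivAt_smulRight_iff.2 h1)
    have h3 := congrArg (fun T : ℝ →L[ℝ] EuclideanSpace ℝ (Fin (2 * n + 3)) => T 1)
      (hasMFDerivAt_unique h2 (h.hasMFDerivAt_flow hc hΘ hq.2.2 s q.1))
    let T : ℝ × EuclideanSpace ℝ (Fin (2 * n + 3)) →L[ℝ] EuclideanSpace ℝ (Fin (2 * n + 3)) :=
      mfderiv 𝓘(ℝ, ℝ × EuclideanSpace ℝ (Fin (2 * n + 3))) (𝓡 (2 * n + 3)) φ q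
    let H : EuclideanSpace ℝ (Fin (2 * n + 3)) :=
      horizontalField O α A ζ δ ρ (Real.smoothTransition s) (φ q)
    change T ((1 : ℝ) • ((1 : ℝ), (0 : EuclideanSpace ℝ (Fin (2 * n + 3))))) = (1 : ℝ) • H at h3
    rw [one_smul, one_smul] at h3
    change β.dCLM (φ q) (T ((1 : ℝ), (0 : EuclideanSpace ℝ (Fin (2 * n + 3))))) _ = 0
    rw [h3]
    exact h.d_horizontalField hc (smoothTransition_mem s) (hφb q hq) _
  have hline : ∀ t : ℝ, ((0 : ℝ), e x) + t • ((1 : ℝ), (0 : EuclideanSpace ℝ (Fin (2 * n + 3)))) =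
      (t, e x) := fun t => by simp
  have hφx : ∀ t, φ (t, e x) = (Θ t (x, s)).1 := fun t => by simp only [hφ, hex]
  have hder : ∀ (t : ℝ) (v' : EuclideanSpace ℝ (Fin (2 * n + 3))),
      (show EuclideanSpace ℝ (Fin (2 * n + 3)) from mfderiv
        𝓘(ℝ, ℝ × EuclideanSpace ℝ (Fin (2 * n + 3))) (𝓡 (2 * n + 3)) φ (t, e x) ((0 : ℝ), v')) =
      mfderiv (𝓡 (2 * n + 3)) (𝓡 (2 * n + 3)) (fun y => (Θ t (y, s)).1) x
        (mfderiv 𝓘(ℝ, EuclideanSpace ℝ (Fin (2 * n + 3))) (𝓡 (2 * n + 3)) e.symm (e x) v') := by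
    intro t v'
    have h1 : HasFDerivAt (fun u : EuclideanSpace ℝ (Fin (2 * n + 3)) => (t, u))
        (ContinuousLinearMap.inr ℝ ℝ (EuclideanSpace ℝ (Fin (2 * n + 3)))) (e x) :=
      hasFDerivAt_prodMk_right t (e x)
    have h2 := HasMFDerivAt.comp (e x) (g := φ)
      ((hφc (t, e x) ⟨mem_univ _, hxU⟩).mdifferentiableAt (by simp)).hasMFDerivAt h1.hasMFDerivAt
    have h3 := HasMFDerivAt.comp (e x) (g := fun y => (Θ t (y, s)).1) (f := e.symm)
      (g' := mfderiv (𝓡 (2 * n + 3)) (𝓡 (2 * n + 3)) (fun y => (Θ t (y, s)).1) x)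
      (by rw [hex]; exact ((h.contMDiffAt_flow_time hc hΘ hx s t).mdifferentiableAt
        (by simp)).hasMFDerivAt)
      ((contMDiffAt_extChartAt_symm' x hu0).mdifferentiableAt (by simp)).hasMFDerivAt
    exact congrArg (fun T : EuclideanSpace ℝ (Fin (2 * n + 3)) →L[ℝ]
      EuclideanSpace ℝ (Fin (2 * n + 3)) => T v') (hasMFDerivAt_unique h2 h3)
  obtain ⟨v', hv'⟩ := (bijective_mfderiv_extChartAt_symm x hu0).2 v
  obtain ⟨w', hw'⟩ := (bijective_mfderiv_extChartAt_symm x hu0).2 w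
  have hval : ∀ t : ℝ, formD (β.pull φ) (t, e x) ((0 : ℝ), v') ((0 : ℝ), w') =
      β.dCLM (Θ t (x, s)).1
      (mfderiv (𝓡 (2 * n + 3)) (𝓡 (2 * n + 3)) (fun y => (Θ t (y, s)).1) x v)
      (mfderiv (𝓡 (2 * n + 3)) (𝓡 (2 * n + 3)) (fun y => (Θ t (y, s)).1) x w) := by
    intro t
    have hq : ((t, e x) : ℝ × EuclideanSpace ℝ (Fin (2 * n + 3))) ∈ (univ : Set ℝ) ×ˢ U₀ :=
      ⟨mem_univ _, hxU⟩
    refine ((h.smoothAt_interpForm hc _ (hφb _ hq)).formD_pull (hφc _ hq) _ _).trans ?_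
    refine (congrArg₂ (fun a b : EuclideanSpace ℝ (Fin (2 * n + 3)) => β.dCLM (φ (t, e x)) a b)
      (hder t v') (hder t w')).trans ?_
    rw [hφx]
    exact congrArg₂ (fun a b : EuclideanSpace ℝ (Fin (2 * n + 3)) => β.dCLM (Θ t (x, s)).1
      (mfderiv (𝓡 (2 * n + 3)) (𝓡 (2 * n + 3)) (fun y => (Θ t (y, s)).1) x a)
      (mfderiv (𝓡 (2 * n + 3)) (𝓡 (2 * n + 3)) (fun y => (Θ t (y, s)).1) x b)) hv' hw'
  have h0 : ∀ v : EuclideanSpace ℝ (Fin (2 * n + 3)), (show EuclideanSpace ℝ (Fin (2 * n + 3)) from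
      mfderiv (𝓡 (2 * n + 3)) (𝓡 (2 * n + 3)) (fun y => (Θ 0 (y, s)).1) x v) = v := by
    intro v
    have h1 := (hasMFDerivAt_id (I := 𝓡 (2 * n + 3)) x).congr_of_eventuallyEq
      (f₁ := fun y => (Θ 0 (y, s)).1) (by
        filter_upwards [O.isClosed_binding.isOpen_compl.mem_nhds hx] with y hy
        rw [hΘ.zero (y, s) ⟨hy, mem_univ _⟩]
        rfl)
    exact congrArg (fun T : EuclideanSpace ℝ (Fin (2 * n + 3)) →L[ℝ]
      EuclideanSpace ℝ (Fin (2 * n + 3)) => T v) h1.mfderiv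
  have key := formD_eq_of_kernel (isOpen_univ.prod hU₀o) hsm hker (x := ((0 : ℝ), e x))
    (fun t => by rw [hline]; exact ⟨mem_univ _, hxU⟩) ((0 : ℝ), v') ((0 : ℝ), w') t
  rw [hline, hval, hval] at key
  refine key.trans ?_
  have e0 : (Θ 0 (x, s)).1 = x := by rw [hΘ.zero (x, s) ⟨hx, mem_univ _⟩]
  rw [e0]
  exact congrArg₂ (fun a b : EuclideanSpace ℝ (Fin (2 * n + 3)) => β.dCLM x a b) (h0 v) (h0 w)

/-- The flow over full turns commutes with the projection to the circle. -/
lemma dthetaForm_flow {x : Y} (hx : x ∉ O.binding) {T : ℝ} (hT1 : Circle.exp T = 1) (s : ℝ)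
    (v : EuclideanSpace ℝ (Fin (2 * n + 3))) :
    O.dthetaForm (Θ T (x, s)).1
      (mfderiv (𝓡 (2 * n + 3)) (𝓡 (2 * n + 3)) (fun y => (Θ T (y, s)).1) x v) =
      O.dthetaForm x v := by
  have hproj : ∀ y ∉ O.binding, O.proj (Θ T (y, s)).1 = O.proj y := fun y hy => by
    rw [h.proj_flow hc hΘ hy, hT1, mul_one]
  have h1 := HasMFDerivAt.comp x (g := fun y => (O.proj y : ℂ)) (f := fun y => (Θ T (y, s)).1)
    ((O.contMDiffAt_proj (h.flow_notMem hc hΘ hx s T)).mdifferentiableAt (by simp)).hasMFDerivAt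
    ((h.contMDiffAt_flow_time hc hΘ hx s T).mdifferentiableAt (by simp)).hasMFDerivAt
  have h2 := ((O.contMDiffAt_proj hx).mdifferentiableAt (by simp)).hasMFDerivAt.congr_of_eventuallyEq
    (f₁ := (fun y => (O.proj y : ℂ)) ∘ fun y => (Θ T (y, s)).1) (by
      filter_upwards [O.isClosed_binding.isOpen_compl.mem_nhds hx] with y hy
      exact congrArg _ (hproj y hy))
  have h3 := congrArg (fun T : EuclideanSpace ℝ (Fin (2 * n + 3)) →L[ℝ] ℂ => T v)
    (hasMFDerivAt_unique h1 h2)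
  change (conj (O.proj (Θ T (x, s)).1 : ℂ) * (show ℂ from mfderiv (𝓡 (2 * n + 3)) 𝓘(ℝ, ℂ)
    (fun y => (O.proj y : ℂ)) (Θ T (x, s)).1 (mfderiv (𝓡 (2 * n + 3)) (𝓡 (2 * n + 3))
      (fun y => (Θ T (y, s)).1) x v))).im = (conj (O.proj x : ℂ) * (show ℂ from
    mfderiv (𝓡 (2 * n + 3)) 𝓘(ℝ, ℂ) (fun y => (O.proj y : ℂ)) x v)).im
  rw [hproj x hx]
  exact congrArg (fun c : ℂ => (conj (O.proj x : ℂ) * c).im) h3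

/-- On the page `dα = dβ_l`, the flow preserves `dβ_l` and tangency to pages, and after a full turn
`dβ_l = dα` again. -/
lemma symplectic_flow {g : Y → Y} {T : ℝ} (hT1 : Circle.exp T = 1) {s : ℝ}
    (hg : EqOn g (fun y => (Θ T (y, s)).1) (O.openPage ζ)) {x : Y} (hx : x ∈ O.openPage ζ)
    {v w : EuclideanSpace ℝ (Fin (2 * n + 3))} (hv : O.dthetaForm x v = 0)
    (hw : O.dthetaForm x w = 0) :
    α.dCLM (g x) (mfderivWithin (𝓡 (2 * n + 3)) (𝓡 (2 * n + 3)) g (O.openPage ζ) x v)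
      (mfderivWithin (𝓡 (2 * n + 3)) (𝓡 (2 * n + 3)) g (O.openPage ζ) x w) = α.dCLM x v w := by
  have hF := h.contMDiffAt_flow_time hc hΘ hx.1 s T
  have hmem : (Θ T (x, s)).1 ∈ O.openPage ζ := h.flow_mem_openPage hc hΘ hT1 s hx
  have e1 := h.mfderivWithin_openPage hc hΘ hx hF hg hv
  have e2 := h.mfderivWithin_openPage hc hΘ hx hF hg hw
  have e3 := (h.dthetaForm_flow hc hΘ hx.1 hT1 s v).trans hv
  have e4 := (h.dthetaForm_flow hc hΘ hx.1 hT1 s w).trans hw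
  refine (congrArg₂ (fun a b : EuclideanSpace ℝ (Fin (2 * n + 3)) => α.dCLM (g x) a b) e1 e2).trans ?_
  rw [hg hx]
  refine (h.dCLM_interpForm_openPage hc hΘ (Real.smoothTransition s) hmem e3 e4).symm.trans ?_
  exact (h.dCLM_flow hc hΘ hx.1 s T v w).trans (h.dCLM_interpForm_openPage hc hΘ _ hx hv hw)

variable {Φ : ℝ → B × ℝ × ℝ × ℝ → B × ℝ × ℝ × ℝ} {r₀ : ℝ} (hΦ : IsPolarFlow O α A ζ δ ρ Φ r₀)
include hΦ

lemma mapsTo_monodromyMap {T θ₀ s : ℝ} (hT1 : Circle.exp T = 1) :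
    MapsTo (monodromyMap O Θ Φ T θ₀ s) (O.openPage ζ) (O.openPage ζ) ∧
    MapsTo (monodromyMap O Θ Φ T θ₀ s) O.binding O.binding := by
  refine ⟨fun y hy => ?_, ?_⟩
  · rw [monodromyMap_of_notMem _ _ _ _ _ _ hy.1]
    exact h.flow_mem_openPage hc hΘ hT1 s hy
  · rintro _ ⟨b, rfl⟩
    exact ⟨(Φ T (b, s, 0, θ₀)).1, (monodromyMap_binding O Θ Φ T θ₀ s b).symm⟩

/-- On the binding the polar flow depends on the angle, so the backward map has to start at the
angle `θ₀ + T` where the forward map ended. -/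
lemma monodromyMap_leftInverse (T θ₀ s : ℝ) :
    Function.LeftInverse (monodromyMap O Θ Φ (-T) (θ₀ + T) s) (monodromyMap O Θ Φ T θ₀ s) := by
  intro y
  by_cases hy : y ∈ O.binding
  · obtain ⟨b, rfl⟩ := hy
    change monodromyMap O Θ Φ (-T) (θ₀ + T) s (monodromyMap O Θ Φ T θ₀ s (O.collar (b, 0))) = _
    rw [monodromyMap_binding, monodromyMap_binding]
    have hx : Φ T (b, s, 0, θ₀) = ((Φ T (b, s, 0, θ₀)).1, s, 0, θ₀ + T) := by
      obtain ⟨c, hc'⟩ := hΦ.radius T (b, s, 0, θ₀)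
      refine Prod.ext rfl (Prod.ext (hΦ.param _ _) (Prod.ext ?_ (hΦ.angle _ _)))
      rw [hc']
      exact zero_mul _
    rw [← hx, ← hΦ.add, neg_add_cancel, hΦ.zero]
  · rw [monodromyMap_of_notMem _ _ _ _ _ _ hy,
      monodromyMap_of_notMem _ _ _ _ _ _ (h.flow_notMem hc hΘ hy s T), ← h.flow_add hc hΘ hy,
      neg_add_cancel, hΘ.zero (y, s) ⟨hy, mem_univ _⟩]

lemma bijOn_monodromyMap (s : ℝ) {S : Set Y} (hS : S = O.openPage ζ ∨ S = O.binding ∨ S = O.page ζ) :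
    BijOn (monodromyMap O Θ Φ (2 * Real.pi) 0 s) S S := by
  have key : ∀ T θ₀, Circle.exp T = 1 → MapsTo (monodromyMap O Θ Φ T θ₀ s) S S := by
    intro T θ₀ hT1
    obtain ⟨h1, h2⟩ := h.mapsTo_monodromyMap hc hΘ hΦ (θ₀ := θ₀) (s := s) hT1
    rcases hS with rfl | rfl | rfl
    · exact h1
    · exact h2
    · rw [O.page_eq]
      exact h1.union_union h2
  have hl := h.monodromyMap_leftInverse hc hΘ hΦ (2 * Real.pi) 0 s
  have hr := h.monodromyMap_leftInverse hc hΘ hΦ (-(2 * Real.pi)) (0 + 2 * Real.pi) s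
  rw [neg_neg, add_neg_cancel_right] at hr
  refine ⟨key _ _ Circle.exp_two_pi, hl.injective.injOn, fun y hy => ⟨_, key (-(2 * Real.pi))
    (0 + 2 * Real.pi) ?_ hy, hr y⟩⟩
  rw [Circle.exp_neg, Circle.exp_two_pi, inv_one]

/-- The inverse is a map of the same kind, with time `-2π` and initial angle `2π`, so the same
smoothness statement applies to it. -/
lemma isDiffeoOn_monodromyMap {s : ℝ} (hs : |s| < 2) {S : Set Y}
    (hS : S = O.openPage ζ ∨ S = O.page ζ) :
    IsDiffeoOn (E := EuclideanSpace ℝ (Fin (2 * n + 3)))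
      (monodromyMap O Θ Φ (2 * Real.pi) 0 s) S := by
  have hpi : 2 * Real.pi < 7 := by linarith [Real.pi_lt_d2]
  have hpi0 : |2 * Real.pi| < 7 := by rw [abs_of_pos (by positivity)]; exact hpi
  have hsub : S ⊆ O.page ζ := by
    rcases hS with rfl | rfl
    · exact subset_closure
    · exact Subset.rfl
  have key : ∀ T θ₀, |T| < 7 → |θ₀| ≤ 7 → Circle.exp θ₀ = 1 →
      ContMDiffOn (𝓡 (2 * n + 3)) (𝓡 (2 * n + 3)) ∞ (monodromyMap O Θ Φ T θ₀ s) S := by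
    intro T θ₀ hT hθ hθ1 y hy
    have h1 := h.contMDiffWithinAt_monodromyMap hc hΘ hΦ hT hθ hθ1 hs (hsub hy)
    exact h1.comp y (g := fun q : ℝ × Y => monodromyMap O Θ Φ T θ₀ q.1 q.2) (f := fun y => (s, y))
      (contMDiffAt_const.prodMk contMDiffAt_id).contMDiffWithinAt
      (fun y' hy' => ⟨mem_univ _, hsub hy'⟩)
  refine ⟨h.bijOn_monodromyMap hc hΘ hΦ s (by tauto), key _ _ hpi0 (by simp) Circle.exp_zero,
    monodromyMap O Θ Φ (-(2 * Real.pi)) (0 + 2 * Real.pi) s, key _ _ (by rwa [abs_neg])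
    (by rw [zero_add]; exact hpi0.le) (by rw [zero_add]; exact Circle.exp_two_pi),
    (h.monodromyMap_leftInverse hc hΘ hΦ _ _ _).leftInvOn _⟩

lemma isSymplectomorphism_monodromyMap {s : ℝ} (hs : |s| < 2) :
    O.IsSymplectomorphism α ζ (monodromyMap O Θ Φ (2 * Real.pi) 0 s) :=
  ⟨h.isDiffeoOn_monodromyMap hc hΘ hΦ hs (Or.inl rfl), fun _ hx _ _ hv hw =>
    h.symplectic_flow hc hΘ Circle.exp_two_pi
      (fun _ hy => monodromyMap_of_notMem _ _ _ _ _ _ hy.1) hx hv hw⟩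

end ConcaveGirouxForm

end Symplectic

/-! ### The end of the isotopy represents the symplectic monodromy. -/

section Monodromy

variable {n : ℕ}
  {Y : Type*} [TopologicalSpace Y] [ChartedSpace (EuclideanSpace ℝ (Fin (2 * n + 3))) Y]
  [IsManifold (𝓡 (2 * n + 3)) ∞ Y] [CompactSpace Y] [T2Space Y]
  {B : Type*} [TopologicalSpace B] [ChartedSpace (EuclideanSpace ℝ (Fin (2 * n + 1))) B]
  [IsManifold (𝓡 (2 * n + 1)) ∞ B] [CompactSpace B] [T2Space B]

lemma ConcreteOpenBook.hasMFDerivAt_rotation (O : ConcreteOpenBook n Y B) (b : B) {z : ℂ}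
    (hz : ‖z‖ < 1) (t : ℝ) :
    HasMFDerivAt 𝓘(ℝ, ℝ) (𝓡 (2 * n + 3)) (fun t : ℝ => O.collar (b, z * Circle.exp t)) t
      ((1 : ℝ →L[ℝ] ℝ).smulRight (O.dcollar b (z * Circle.exp t) 0
        (Complex.I * (z * Circle.exp t)))) := by
  have d1 : HasDerivAt (fun t : ℝ => z * (Circle.exp t : ℂ)) (Complex.I * (z * Circle.exp t)) t := by
    have d2 : HasDerivAt (fun t : ℝ => (t : ℂ) * Complex.I) (1 * Complex.I) t :=
      (Complex.ofRealCLM.hasDerivAt (x := t)).mul_const Complex.I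
    simp only [Circle.coe_exp]
    refine (d2.cexp.const_mul z).congr_deriv ?_
    ring
  have hz' : ‖z * (Circle.exp t : ℂ)‖ < 1 := by rwa [norm_mul, Circle.norm_coe, mul_one]
  have d3 := HasMFDerivAt.comp t (g := O.collar) (f := fun t : ℝ => (b, z * (Circle.exp t : ℂ)))
    ((O.contMDiffAt_collar b hz').mdifferentiableAt (by simp)).hasMFDerivAt
    ((hasMFDerivAt_const (I := 𝓘(ℝ, ℝ)) (I' := 𝓡 (2 * n + 1)) b t).prodMk
      (hasMFDerivAt_smulRight_iff.2 d1))
  have e1 : ((0 : ℝ →L[ℝ] EuclideanSpace ℝ (Fin (2 * n + 1))).prod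
      ((1 : ℝ →L[ℝ] ℝ).smulRight (Complex.I * (z * Circle.exp t)))) =
      (1 : ℝ →L[ℝ] ℝ).smulRight ((0 : EuclideanSpace ℝ (Fin (2 * n + 1))),
        (Complex.I * (z * Circle.exp t))) := by
    refine ContinuousLinearMap.ext fun c => ?_
    exact Prod.ext (smul_zero (M := ℝ) (A := EuclideanSpace ℝ (Fin (2 * n + 1))) c).symm rfl
  have e2 := clm_comp_smulRight_one (E := EuclideanSpace ℝ (Fin (2 * n + 1)) × ℂ)
    (F := EuclideanSpace ℝ (Fin (2 * n + 3)))
    (mfderiv ((𝓡 (2 * n + 1)).prod 𝓘(ℝ, ℂ)) (𝓡 (2 * n + 3)) O.collar (b, z * (Circle.exp t : ℂ)))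
    ((0 : EuclideanSpace ℝ (Fin (2 * n + 1))), (Complex.I * (z * Circle.exp t)))
  rw [← e1] at e2
  exact Eq.mp (congrArg (fun T => HasMFDerivAt 𝓘(ℝ, ℝ) (𝓡 (2 * n + 3))
    (fun t : ℝ => O.collar (b, z * Circle.exp t)) t T) e2) d3

namespace ConcaveGirouxForm

variable {O : ConcreteOpenBook n Y B} {α : OneForm (EuclideanSpace ℝ (Fin (2 * n + 3))) Y}
  {A : B × ℂ → ℝ} (h : ConcaveGirouxForm O α A) {ζ : Circle} {δ ρ : ℝ}
  (hc : CutoffParameters A ζ δ ρ) {Θ : ℝ → Y × ℝ → Y × ℝ}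
  (hΘ : IsCompleteFlow (suspendedField O α A ζ δ ρ) (O.bindingᶜ ×ˢ univ) Θ)
include h hc hΘ

/-- Near the binding `∂_θ` spans the kernel of `dβ_1`, so rotation of the collar is the horizontal
flow. -/
lemma flow_collar_one (b : B) {z : ℂ} (h0 : z ≠ 0) (hz : ‖z‖ < ρ * Real.exp (-δ⁻¹)) (t : ℝ) :
    (Θ t (O.collar (b, z), 1)).1 = O.collar (b, z * Circle.exp t) := by
  have hz1 : ‖z‖ < 1 := by
    have h1 : Real.exp (-δ⁻¹) ≤ 1 := Real.exp_le_one_iff.2 (neg_nonpos.2 (inv_nonneg.2 hc.δ_pos.le))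
    have := mul_le_mul_of_nonneg_left h1 hc.ρ_pos.le
    linarith [hc.ρ_le]
  have hn : ∀ t : ℝ, ‖z * (Circle.exp t : ℂ)‖ = ‖z‖ := fun t => by
    rw [norm_mul, Circle.norm_coe, mul_one]
  have hn0 : ∀ t : ℝ, z * (Circle.exp t : ℂ) ≠ 0 := fun t => by simp [h0]
  have hb : ∀ t : ℝ, O.collar (b, z * (Circle.exp t : ℂ)) ∉ O.binding := fun t hb =>
    hn0 t ((O.collar_mem_binding_iff b (by rwa [hn])).1 hb)
  have hvel : ∀ t, HasVelocityAt (suspendedField O α A ζ δ ρ)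
      (fun t => (O.collar (b, z * (Circle.exp t : ℂ)), (1 : ℝ))) t := by
    intro t
    refine hasVelocityAt_suspendedField_mk ?_
    have e : (show EuclideanSpace ℝ (Fin (2 * n + 3)) from O.dcollar b (z * Circle.exp t) 0
        (Complex.I * (z * Circle.exp t))) = horizontalField O α A ζ δ ρ (Real.smoothTransition 1)
          (O.collar (b, z * Circle.exp t)) := by
      refine h.eq_horizontalField hc (smoothTransition_mem 1) (hb t) ?_ ?_
      · refine (O.dthetaForm_dcollar b (hn0 t) (by rwa [hn]) _ _).trans ?_
        rw [mul_left_comm, Complex.conj_mul', ← Complex.ofReal_pow, Complex.im_mul_ofReal,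
          Complex.I_im, one_mul]
        exact div_self (pow_ne_zero 2 (norm_ne_zero_iff.2 (hn0 t)))
      · rw [Real.smoothTransition.one_of_one_le le_rfl]
        exact h.d_interpForm_one hc b (hn0 t) (by rwa [hn])
    exact Eq.mp (congrArg (fun v : EuclideanSpace ℝ (Fin (2 * n + 3)) =>
      HasMFDerivAt 𝓘(ℝ, ℝ) (𝓡 (2 * n + 3)) (fun t : ℝ => O.collar (b, z * Circle.exp t)) t
        ((1 : ℝ →L[ℝ] ℝ).smulRight v)) e) (O.hasMFDerivAt_rotation b hz1 t)
  have key := hΘ.eq_of_hasVelocityAt (fun p hp => h.nonempty_vectorFieldChart hc (p := p) hp)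
    isOpen_univ isPreconnected_univ (mem_univ _) (fun t _ => hvel t) ⟨hb 0, mem_univ _⟩ (mem_univ t)
  simp only [Circle.exp_zero, Circle.coe_one, mul_one] at key
  rw [← key]

variable {Φ : ℝ → B × ℝ × ℝ × ℝ → B × ℝ × ℝ × ℝ} {r₀ : ℝ} (hΦ : IsPolarFlow O α A ζ δ ρ Φ r₀)
include hΦ

lemma isHolonomy_monodromyMap :
    O.IsHolonomy (interpForm O α A ζ δ ρ 1) ζ (monodromyMap O Θ Φ (2 * Real.pi) 0 1) := by
  intro p hp
  have h1 : Real.smoothTransition 1 = 1 := Real.smoothTransition.one_of_one_le le_rfl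
  refine ⟨fun t => (Θ t (p, 1)).1, by simp only [hΘ.zero (p, 1) ⟨hp.1, mem_univ _⟩],
    (monodromyMap_of_notMem _ _ _ _ _ _ hp.1).symm, fun t _ => ?_⟩
  have hb := h.flow_notMem hc hΘ hp.1 1 t
  have hproj := h.proj_flow hc hΘ hp.1 1 t
  rw [show O.proj p = ζ from hp.2] at hproj
  refine ⟨hb, hproj, horizontalField O α A ζ δ ρ (Real.smoothTransition 1) (Θ t (p, 1)).1,
    (h.hasMFDerivAt_flow hc hΘ hp.1 1 t).hasMFDerivWithinAt, fun u => ?_⟩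
  rw [h1]
  exact h.d_horizontalField hc (by simp) hb u

/-- The map is itself the holonomy of a monodromy form, so the constant isotopy suffices. Near the
binding the flow is a rotation, and a full turn is the identity. -/
lemma representsSymplecticMonodromy_monodromyMap :
    O.RepresentsSymplecticMonodromy α ζ (monodromyMap O Θ Φ (2 * Real.pi) 0 1) := by
  have hρ := hc.ρ_pos
  have hr : 0 < ρ * Real.exp (-δ⁻¹) := by positivity
  have hr1 : ρ * Real.exp (-δ⁻¹) ≤ 1 := by
    have h1 : Real.exp (-δ⁻¹) ≤ 1 := Real.exp_le_one_iff.2 (neg_nonpos.2 (inv_nonneg.2 hc.δ_pos.le))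
    have := mul_le_mul_of_nonneg_left h1 hc.ρ_pos.le
    linarith [hc.ρ_le]
  refine ⟨interpForm O α A ζ δ ρ 1, monodromyMap O Θ Φ (2 * Real.pi) 0 1,
    fun _ => monodromyMap O Θ Φ (2 * Real.pi) 0 1,
    O.collar '' (univ ×ˢ Metric.ball 0 (ρ * Real.exp (-δ⁻¹))), h.isMonodromyForm hc,
    h.isHolonomy_monodromyMap hc hΘ hΦ, O.isOpen_collar_image hr1, O.binding_subset hr,
    ⟨?_, fun _ _ => h.isSymplectomorphism_monodromyMap hc hΘ hΦ (by norm_num)⟩,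
    fun _ _ => rfl, fun _ _ => rfl, ?_⟩
  · have h1 := (h.isDiffeoOn_monodromyMap hc hΘ hΦ (s := 1) (by norm_num) (S := O.openPage ζ)
      (Or.inl rfl)).2.1
    exact h1.comp contMDiffOn_snd (fun q hq => hq.2)
  · rintro - - _ ⟨hx, ⟨b, z⟩, ⟨-, hz⟩, rfl⟩
    have hz' : ‖z‖ < ρ * Real.exp (-δ⁻¹) := by simpa using hz
    have h0 : z ≠ 0 := ((O.collar_mem_openPage_iff ζ b (hz'.trans_le hr1)).1 hx).1
    change monodromyMap O Θ Φ (2 * Real.pi) 0 1 (O.collar (b, z)) = _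
    rw [monodromyMap_of_notMem _ _ _ _ _ _ hx.1, h.flow_collar_one hc hΘ b h0 hz',
      Circle.exp_two_pi, Circle.coe_one, mul_one]

end ConcaveGirouxForm

end Monodromy

/-! ### Reparametrization of time. -/

section TimeChange

/-- Reparametrization of time by a primitive of a positive continuous function. -/
lemma exists_time_change {g : ℝ → ℝ} (hg : Continuous g) (hpos : ∀ s, 0 < g s) :
    ∃ t σ : ℝ → ℝ, t 0 = 0 ∧ StrictMono t ∧ Continuous t ∧ IsOpen (range t) ∧
      IsPreconnected (range t) ∧ (∀ s, σ (t s) = s) ∧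
      ∀ s, HasDerivAt σ (g s)⁻¹ (t s) := by
  set t : ℝ → ℝ := fun s => ∫ x in (0 : ℝ)..s, g x with ht
  have hd : ∀ s, HasStrictDerivAt t (g s) s := fun s => hg.integral_hasStrictDerivAt 0 s
  have hc : Continuous t := continuous_iff_continuousAt.2 fun s => (hd s).hasDerivAt.continuousAt
  have hmono : StrictMono t := strictMono_of_deriv_pos fun s => by
    rw [(hd s).hasDerivAt.deriv]; exact hpos s
  have hopen : IsOpenMap t := isOpenMap_of_hasStrictDerivAt hd fun s => (hpos s).ne'
  have hemb : Topology.IsOpenEmbedding t := .of_continuous_injective_isOpenMap hc hmono.injective hopen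
  set T := hemb.toOpenPartialHomeomorph t with hT
  have hT1 : ∀ s, T.symm (t s) = s := fun s => T.left_inv (by simp [hT])
  refine ⟨t, T.symm, by simp [ht], hmono, hc, hopen.isOpen_range, isPreconnected_range hc, hT1,
    fun s => ?_⟩
  have h1 := T.hasDerivAt_symm (a := t s) (f' := g s) (by simp [hT]) (hpos s).ne' (by
    rw [hT1]; exact (hd s).hasDerivAt)
  exact h1

end TimeChange

/-! ### Continuity of a form evaluated on a vector field. -/

section FieldContinuity

variable {E : Type} [NormedAddCommGroup E] [NormedSpace ℝ E]
  {M : Type*} [TopologicalSpace M] [ChartedSpace E M] [IsManifold 𝓘(ℝ, E) ∞ M]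

lemma VectorFieldChart.continuousAt_apply {v : (x : M) → TangentSpace 𝓘(ℝ, E) x} {x₀ : M}
    (C : VectorFieldChart v x₀) {τ : OneForm E M} (hτ : τ.SmoothAt x₀) :
    ContinuousAt (fun x => τ x (v x)) x₀ := by
  have hu := C.mapsTo_ψ C.mem_V
  have hφ := C.contMDiffOn_φ.contMDiffAt (C.isOpen_U.mem_nhds hu)
  have h1 : ContinuousAt (fun u => τ.pull C.φ u (C.X u)) (C.ψ x₀) :=
    ((show τ.SmoothAt (C.φ (C.ψ x₀)) by rwa [C.left_inv _ C.mem_V]).contDiffAt_pull hφ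
      ).continuousAt.clm_apply
      (C.contDiffOn_X.contDiffAt (C.isOpen_U.mem_nhds hu)).continuousAt
  have h2 : ContinuousAt C.ψ x₀ :=
    (C.contMDiffOn_ψ.contMDiffAt (C.isOpen_V.mem_nhds C.mem_V)).continuousAt
  refine (ContinuousAt.comp (g := fun u => τ.pull C.φ u (C.X u)) (f := C.ψ) h1 h2).congr ?_
  filter_upwards [C.isOpen_V.mem_nhds C.mem_V] with x hx
  have h3 : τ.pull C.φ (C.ψ x) (C.X (C.ψ x)) = τ (C.φ (C.ψ x)) (v (C.φ (C.ψ x))) :=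
    (congrArg (fun w => τ (C.φ (C.ψ x)) w) (C.eq_mfderiv _ (C.mapsTo_ψ hx))).symm
  rw [C.left_inv x hx] at h3
  exact h3

end FieldContinuity

/-! ### The return map as the holonomy of `ker dα`. -/

section ReturnMap

variable {n : ℕ}
  {Y : Type*} [TopologicalSpace Y] [ChartedSpace (EuclideanSpace ℝ (Fin (2 * n + 3))) Y]
  [IsManifold (𝓡 (2 * n + 3)) ∞ Y] [CompactSpace Y] [T2Space Y]
  {B : Type*} [TopologicalSpace B] [ChartedSpace (EuclideanSpace ℝ (Fin (2 * n + 1))) B]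
  [IsManifold (𝓡 (2 * n + 1)) ∞ B] [CompactSpace B] [T2Space B]

namespace ConcaveGirouxForm

variable {O : ConcreteOpenBook n Y B} {α : OneForm (EuclideanSpace ℝ (Fin (2 * n + 3))) Y}
  {A : B × ℂ → ℝ} (h : ConcaveGirouxForm O α A)
  {R : (x : Y) → TangentSpace (𝓡 (2 * n + 3)) x} (hR : ∀ x, α.IsReebVector x (R x))
include h hR

lemma reeb_eq_solveOnKer (x : Y) :
    (show EuclideanSpace ℝ (Fin (2 * n + 3)) from R x) = solveOnKer (α.dCLM x) (α x) 1 0 :=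
  (h.nondegenerateOnKer x).unique_kernel (hR x).1 fun w => (hR x).2 w

lemma map_reeb {V : Type} [NormedAddCommGroup V] [NormedSpace ℝ V]
    [FiniteDimensional ℝ V] {φ : V → Y} {x : V}
    (hφ : ContMDiffAt 𝓘(ℝ, V) (𝓡 (2 * n + 3)) ∞ φ x)
    (hb : Function.Bijective (mfderiv 𝓘(ℝ, V) (𝓡 (2 * n + 3)) φ x)) :
    NondegenerateOnKer (formDCLM (α.pull φ) x) (α.pull φ x) ∧
    (show V →L[ℝ] EuclideanSpace ℝ (Fin (2 * n + 3)) from mfderiv 𝓘(ℝ, V) (𝓡 (2 * n + 3)) φ x)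
      (solveOnKer (E := V) (formDCLM (α.pull φ) x) (α.pull φ x) 1 0) = R (φ x) := by
  have hs := h.smoothAt (φ x)
  have h1 := OneForm.nondegenerateOnKer_pull (τ := α) hs hφ hb
    (h.giroux.contact (φ x)).2 (h.giroux.contact (φ x)).1
  exact ⟨h1, ((h.nondegenerateOnKer (φ x)).map_solveOnKer h1 (μ := 0) (μ' := 0)
    (T := (mfderiv 𝓘(ℝ, V) (𝓡 (2 * n + 3)) φ x : V →L[ℝ] EuclideanSpace ℝ (Fin (2 * n + 3))))
    hb.2 (fun v w => hs.formD_pull hφ v w) (fun _ => rfl) (fun _ => rfl)).trans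
      (h.reeb_eq_solveOnKer hR (φ x)).symm⟩

lemma nonempty_vectorFieldChart_reeb (y₀ : Y) :
    Nonempty (VectorFieldChart (E := EuclideanSpace ℝ (Fin (2 * n + 3))) R y₀) := by
  set e := extChartAt (𝓡 (2 * n + 3)) y₀ with he
  refine ⟨{
    φ := e.symm
    ψ := e
    X := fun x => solveOnKer (formDCLM (α.pull e.symm) x) (α.pull e.symm x) 1 0
    U := e.target
    V := e.source
    isOpen_U := isOpen_extChartAt_target y₀
    isOpen_V := isOpen_extChartAt_source y₀
    mem_V := mem_extChartAt_source y₀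
    mapsTo_φ := fun x hx => e.map_target hx
    mapsTo_ψ := fun q hq => e.map_source hq
    left_inv := fun q hq => e.left_inv hq
    right_inv := fun x hx => e.right_inv hx
    contMDiffOn_φ := fun x hx => (contMDiffAt_extChartAt_symm' y₀ hx).contMDiffWithinAt
    contMDiffOn_ψ := fun q hq => (contMDiffAt_extChartAt' (by
      rwa [he, extChartAt_source] at hq)).contMDiffWithinAt
    contDiffOn_X := fun x hx => ?_
    eq_mfderiv := fun x hx => (h.map_reeb hR (contMDiffAt_extChartAt_symm' y₀ hx)
      (bijective_mfderiv_extChartAt_symm y₀ hx)).2.symm }⟩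
  have hφ := contMDiffAt_extChartAt_symm' y₀ hx
  have hα := (h.smoothAt _).contDiffAt_pull hφ
  exact (contDiffAt_solveOnKer (p := x) (u := fun _ => 1) (μ := fun _ => 0)
    (σ := fun x => formDCLM (α.pull e.symm) x) (τ := fun x => α.pull e.symm x)
    (h.map_reeb hR hφ (bijective_mfderiv_extChartAt_symm y₀ hx)).1 (contDiffAt_formDCLM hα) hα
    contDiffAt_const contDiffAt_const).contDiffWithinAt

lemma dthetaForm_reeb_pos {y : Y} (hy : y ∉ O.binding) : 0 < O.dthetaForm y (R y) :=
  h.giroux.positive y hy _ (hR y)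

variable {ζ : Circle} {δ ρ : ℝ} (hc : CutoffParameters A ζ δ ρ)
include hc

omit [T2Space Y] hR h hc [CompactSpace B] [T2Space B] [IsManifold (𝓡 (2 * n + 1)) ∞ B] [CompactSpace Y]
  [IsManifold (𝓡 (2 * n + 3)) ∞ Y] in
lemma interpForm_zero : interpForm O α A ζ δ ρ 0 = α := by
  funext y
  ext v
  have : interpForm O α A ζ δ ρ 0 y v = α y v + 0 * (correction O α A ζ δ ρ y v) := rfl
  rw [this, zero_mul, add_zero]

/-- The kernel of `dα` is spanned by the Reeb vector; it is normalized to have `dθ = 1`. -/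
lemma horizontalField_zero {y : Y} (hy : y ∉ O.binding) :
    horizontalField O α A ζ δ ρ 0 y =
      (O.dthetaForm y (R y))⁻¹ • (show EuclideanSpace ℝ (Fin (2 * n + 3)) from R y) := by
  have hp := h.dthetaForm_reeb_pos hR hy
  refine (h.eq_horizontalField hc ⟨le_rfl, zero_le_one⟩ hy ?_ fun w => ?_).symm
  · exact ((O.dthetaForm y).map_smul _ _).trans (inv_mul_cancel₀ hp.ne')
  · rw [interpForm_zero]
    have h1 : α.dCLM y ((O.dthetaForm y (R y))⁻¹ • (show EuclideanSpace ℝ (Fin (2 * n + 3)) from R y)) w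
        = (O.dthetaForm y (R y))⁻¹ * α.d y (R y) w := by
      rw [map_smul]; rfl
    exact h1.trans (by rw [(hR y).2 w, mul_zero])

/-- The return map of the Reeb flow is the holonomy of `ker dα`. -/
lemma returnMap_eq_flow {Θ : ℝ → Y × ℝ → Y × ℝ}
    (hΘ : IsCompleteFlow (suspendedField O α A ζ δ ρ) (O.bindingᶜ ×ˢ univ) Θ)
    {f : Y → Y} (hf : O.IsReturnMap R ζ f) {p : Y} (hp : p ∈ O.openPage ζ) :
    f p = (Θ (2 * Real.pi) (p, 0)).1 := by
  obtain ⟨hfp, γ, τ, hγ, hγ0, hτ, hγτ, hfirst⟩ := hf p hp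
  set c : ℝ → Y := fun s => (Θ s (p, 0)).1 with hcdef
  have hcb : ∀ s, c s ∉ O.binding := h.flow_notMem hc hΘ hp.1 0
  have hc0 : c 0 = p := by simp only [hcdef, hΘ.zero (p, 0) ⟨hp.1, mem_univ _⟩]
  have hdc : ∀ s, HasMFDerivAt 𝓘(ℝ, ℝ) (𝓡 (2 * n + 3)) c s ((1 : ℝ →L[ℝ] ℝ).smulRight
      (horizontalField O α A ζ δ ρ 0 (c s))) := fun s => by
    have := h.hasMFDerivAt_flow hc hΘ hp.1 0 s
    rwa [Real.smoothTransition.zero_of_nonpos le_rfl] at this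
  have hcproj : ∀ s, O.proj (c s) = ζ * Circle.exp s := fun s =>
    (h.proj_flow hc hΘ hp.1 0 s).trans (by rw [show O.proj p = ζ from hp.2])
  -- `g` is the Reeb time elapsed per unit of angle along the horizontal curve `c`. Its primitive
  -- converts angle into Reeb time, and `c` then becomes the Reeb orbit `γ`.
  set g : ℝ → ℝ := fun s => (O.dthetaForm (c s) (R (c s)))⁻¹ with hgdef
  have hgpos : ∀ s, 0 < g s := fun s => inv_pos.2 (h.dthetaForm_reeb_pos hR (hcb s))
  have hg : Continuous g := continuous_iff_continuousAt.2 fun s => by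
    obtain ⟨C⟩ := h.nonempty_vectorFieldChart_reeb hR (c s)
    have h1 := C.continuousAt_apply (O.smoothAt_dthetaForm (hcb s))
    exact (ContinuousAt.comp (g := fun x => O.dthetaForm x (R x)) (f := c) h1
      (hdc s).continuousAt).inv₀ (h.dthetaForm_reeb_pos hR (hcb s)).ne'
  obtain ⟨t, σ, ht0, htmono, htc, hto, htp, hσ, hσd⟩ := exists_time_change hg hgpos
  have heq : ∀ s, γ (t s) = c s := by
    have hv : ∀ r ∈ range t, HasVelocityAt R (fun r => c (σ r)) r := by
      rintro _ ⟨s, rfl⟩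
      have h1 : HasMFDerivAt 𝓘(ℝ, ℝ) 𝓘(ℝ, ℝ) σ (t s) ((1 : ℝ →L[ℝ] ℝ).smulRight ((g s)⁻¹ : ℝ)) :=
        hasMFDerivAt_smulRight_iff.2 (hσd s)
      have h0 := hdc (σ (t s))
      have h2 := HasMFDerivAt.comp (t s) (g := c) (f := σ) h0 h1
      have e : ((1 : ℝ →L[ℝ] ℝ).smulRight (horizontalField O α A ζ δ ρ 0 (c (σ (t s))))).comp
          ((1 : ℝ →L[ℝ] ℝ).smulRight ((g s)⁻¹ : ℝ)) = (1 : ℝ →L[ℝ] ℝ).smulRight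
            (show EuclideanSpace ℝ (Fin (2 * n + 3)) from R (c (σ (t s)))) := by
        rw [h.horizontalField_zero hR hc (hcb _)]
        have : (O.dthetaForm (c (σ (t s))) (R (c (σ (t s)))))⁻¹ = g s := by rw [hσ]
        rw [this]
        refine ContinuousLinearMap.ext_ring ?_
        have hne := (hgpos s).ne'
        have e1 : (1 * (g s)⁻¹) • (g s • (show EuclideanSpace ℝ (Fin (2 * n + 3)) from
            R (c (σ (t s))))) = (1 : ℝ) • (show EuclideanSpace ℝ (Fin (2 * n + 3)) from
            R (c (σ (t s)))) := by
          rw [smul_smul, one_mul, inv_mul_cancel₀ hne]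
        exact e1
      exact Eq.mp (congrArg (fun T => HasMFDerivAt 𝓘(ℝ, ℝ) (𝓡 (2 * n + 3)) (c ∘ σ) (t s) T) e) h2
    have key := eqOn_of_hasVelocityAt (W := univ)
      (fun x _ => h.nonempty_vectorFieldChart_reeb hR x) hto htp (γ := γ)
      (γ' := fun r => c (σ r)) (fun r _ => hγ r) hv (fun _ _ => mem_univ _) (t₀ := 0)
      ⟨0, ht0⟩ (by
        have : σ 0 = 0 := by simpa only [ht0] using hσ 0
        simp only [this, hγ0, hc0])
    intro s
    have := key ⟨s, rfl⟩
    simpa only [hσ] using this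
  have hpage : ∀ s, c s ∈ O.openPage ζ ↔ Circle.exp s = 1 := fun s => by
    refine ⟨fun hs => ?_, fun hs => ⟨hcb s, (hcproj s).trans (by rw [hs, mul_one])⟩⟩
    have : ζ * Circle.exp s = ζ := (hcproj s).symm.trans hs.2
    simpa using this
  have hpi : 0 < 2 * Real.pi := Real.two_pi_pos
  -- At angle `2π` the orbit is back on the page, so the first return cannot be later.
  have hle : τ ≤ t (2 * Real.pi) := by
    by_contra! hlt
    refine hfirst _ ⟨?_, hlt⟩ ?_
    · rw [← ht0]; exact htmono hpi
    · rw [heq]; exact (hpage _).2 Circle.exp_two_pi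
  obtain ⟨s, hs, hst⟩ := intermediate_value_Icc hpi.le htc.continuousOn
    (show τ ∈ Icc (t 0) (t (2 * Real.pi)) from ⟨by rw [ht0]; exact hτ.le, hle⟩)
  have hs0 : 0 < s := by
    rcases hs.1.eq_or_lt with h1 | h1
    · rw [← h1, ht0] at hst; exact absurd hst hτ.ne
    · exact h1
  have h1 : Circle.exp s = 1 := (hpage s).1 (by rw [← heq, hst, hγτ]; exact hfp)
  obtain ⟨m, hm⟩ := Circle.exp_eq_one.1 h1
  -- The angle at the return is a positive multiple of `2π` not exceeding `2π`.
  have hs2 : s = 2 * Real.pi := by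
    have hm1 : (1 : ℤ) ≤ m := by
      by_contra! hlt
      have : (m : ℝ) ≤ 0 := by exact_mod_cast (by omega : m ≤ 0)
      nlinarith
    have : (1 : ℝ) ≤ m := by exact_mod_cast hm1
    nlinarith [hs.2]
  rw [← hγτ, ← hst, heq, hs2]

end ConcaveGirouxForm

end ReturnMap

/-! ### Confining the isotopy to a given neighbourhood of the binding. -/

section Support

variable {n : ℕ}
  {Y : Type*} [TopologicalSpace Y] [ChartedSpace (EuclideanSpace ℝ (Fin (2 * n + 3))) Y]
  [IsManifold (𝓡 (2 * n + 3)) ∞ Y] [CompactSpace Y] [T2Space Y]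
  {B : Type*} [TopologicalSpace B] [ChartedSpace (EuclideanSpace ℝ (Fin (2 * n + 1))) B]
  [IsManifold (𝓡 (2 * n + 1)) ∞ B] [CompactSpace B] [T2Space B]

/-- Sufficiently thin closed collars avoid a given compact set in the complement of the binding. -/
lemma ConcreteOpenBook.exists_disjoint_collar (O : ConcreteOpenBook n Y B) {K : Set Y}
    (hK : IsCompact K) (hKb : K ⊆ O.bindingᶜ) :
    ∃ ρ ∈ Ioc (0 : ℝ) (1 / 2), ∀ y ∈ K, y ∉ O.collar '' (univ ×ˢ Metric.closedBall 0 ρ) := by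
  have hcont : ContinuousOn O.collar (univ ×ˢ Metric.ball 0 1) := fun p hp =>
    (O.contMDiffAt_collar p.1 (mem_ball_zero_iff.1 hp.2)).continuousAt.continuousWithinAt
  have hopen := hcont.isOpen_inter_preimage (isOpen_univ.prod Metric.isOpen_ball) hK.isClosed.isOpen_compl
  obtain ⟨u, v, -, hv, hu, h0, huv⟩ := generalized_tube_lemma (isCompact_univ (X := B))
    (isCompact_singleton (x := (0 : ℂ))) hopen (by
      rintro ⟨b, z⟩ ⟨-, hz⟩
      obtain rfl : z = 0 := hz
      exact ⟨⟨mem_univ _, by simp⟩, fun hb => hKb hb ⟨b, rfl⟩⟩)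
  obtain ⟨ε, hε, hεv⟩ := Metric.isOpen_iff.1 hv 0 (h0 rfl)
  refine ⟨min (1 / 2) (ε / 2), ⟨by positivity, min_le_left _ _⟩, ?_⟩
  rintro y hy ⟨⟨b, z⟩, ⟨-, hz⟩, rfl⟩
  refine (huv ⟨hu (mem_univ b), hεv ?_⟩).2 hy
  exact Metric.closedBall_subset_ball (lt_of_le_of_lt (min_le_right _ _) (half_lt_self hε)) hz

namespace ConcaveGirouxForm

variable {O : ConcreteOpenBook n Y B} {α : OneForm (EuclideanSpace ℝ (Fin (2 * n + 3))) Y}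
  {A : B × ℂ → ℝ} (h : ConcaveGirouxForm O α A) {ζ : Circle}
include h

/-- Near such a point every interpolated form equals `α`, so all the horizontal lifts coincide with
that of `ker dα`. -/
lemma horizontalField_eq_of_notMem {δ ρ δ' ρ' : ℝ} (hc : CutoffParameters A ζ δ ρ)
    (hc' : CutoffParameters A ζ δ' ρ') {l : ℝ} (hl : l ∈ Icc (0 : ℝ) 1) {y : Y}
    (hy : y ∉ O.binding) (hyK : y ∉ O.collar '' (univ ×ˢ Metric.closedBall 0 ρ)) :
    horizontalField O α A ζ δ' ρ' 0 y = horizontalField O α A ζ δ ρ l y := by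
  have h0 : (0 : ℝ) ∈ Icc (0 : ℝ) 1 := ⟨le_rfl, zero_le_one⟩
  refine h.eq_horizontalField hc hl hy (h.dthetaForm_horizontalField hc' h0 hy) fun w => ?_
  rw [OneForm.d_congr (h.interpForm_eventuallyEq hc l hyK)]
  have := h.d_horizontalField hc' h0 hy w
  rwa [interpForm_zero] at this

/-- Along an orbit of the horizontal field of `dα` that avoids the support of the correction, the
horizontal fields of all the interpolated forms have the same flow. -/
lemma flow_eq_of_notMem {δ ρ δ' ρ' : ℝ} (hc : CutoffParameters A ζ δ ρ)
    (hc' : CutoffParameters A ζ δ' ρ') {Θ Θ' : ℝ → Y × ℝ → Y × ℝ}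
    (hΘ : IsCompleteFlow (suspendedField O α A ζ δ ρ) (O.bindingᶜ ×ˢ univ) Θ)
    (hΘ' : IsCompleteFlow (suspendedField O α A ζ δ' ρ') (O.bindingᶜ ×ˢ univ) Θ')
    {p : Y} (hp : p ∉ O.binding) {J : Set ℝ} (hJ : IsOpen J) (hJc : IsPreconnected J)
    (h0 : (0 : ℝ) ∈ J)
    (hK : ∀ t ∈ J, (Θ' t (p, 0)).1 ∉ O.collar '' (univ ×ˢ Metric.closedBall 0 ρ))
    (s : ℝ) {t : ℝ} (ht : t ∈ J) : (Θ t (p, s)).1 = (Θ' t (p, 0)).1 := by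
  have e0 : (Θ' 0 (p, 0)).1 = p := by rw [hΘ'.zero (p, 0) ⟨hp, mem_univ _⟩]
  have := hΘ.eq_of_hasVelocityAt (fun q hq => h.nonempty_vectorFieldChart hc (p := q) hq)
    (γ := fun t => ((Θ' t (p, 0)).1, s)) hJ hJc h0 (fun t ht => hasVelocityAt_suspendedField_mk (by
      have d := h.hasMFDerivAt_flow hc' hΘ' hp 0 t
      rwa [Real.smoothTransition.zero_of_nonpos le_rfl,
        h.horizontalField_eq_of_notMem hc hc' (smoothTransition_mem s)
          (h.flow_notMem hc' hΘ' hp 0 t) (hK t ht)] at d))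
    ⟨h.flow_notMem hc' hΘ' hp 0 0, mem_univ _⟩ ht
  simp only [e0] at this
  rw [← this]

/-- There are cutoff parameters for which the flow over `[0, 2π]` of the horizontal field, starting at
points of a given compact set in the complement of the binding, is unaffected by the correction. -/
lemma exists_cutoffParameters_flow_eq (ζ : Circle) {K : Set Y} (hK : IsCompact K)
    (hKb : K ⊆ O.bindingᶜ) :
    ∃ δ ρ Θ, CutoffParameters A ζ δ ρ ∧
      IsCompleteFlow (suspendedField O α A ζ δ ρ) (O.bindingᶜ ×ˢ univ) Θ ∧
      ∀ p ∈ K, ∀ s, (Θ (2 * Real.pi) (p, s)).1 = (Θ (2 * Real.pi) (p, 0)).1 := by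
  obtain ⟨δ, hδ, hdec⟩ := h.exists_cutoff_parameter ζ
  -- A provisional radius. It serves only to have the complete flow at parameter `0`, where the form
  -- is `α` whatever the radius; it tells how close orbits from `K` come to the binding before `ρ`
  -- is chosen.
  have hc' : CutoffParameters A ζ δ (1 / 2) :=
    ⟨hδ, by norm_num, le_rfl, hdec _ ⟨by norm_num, le_rfl⟩⟩
  obtain ⟨Θ', hΘ'⟩ := h.exists_suspendedFlow hc'
  -- The interval `[-1, 7]` contains `[0, 2π]` in its interior, as uniqueness of integral curves is
  -- used on open intervals.
  have hcont : ContinuousOn (fun q : ℝ × Y => (Θ' q.1 (q.2, 0)).1) (Icc (-1) 7 ×ˢ K) := by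
    rintro ⟨t, p⟩ hq
    refine ContinuousAt.continuousWithinAt ?_
    exact ContinuousAt.comp (x := (t, p)) (g := fun q : ℝ × Y × ℝ => (Θ' q.1 q.2).1)
      (f := fun q : ℝ × Y => (q.1, q.2, (0 : ℝ)))
      (h.contMDiffAt_flow hc' hΘ' (hKb hq.2) 0 t).continuousAt (by fun_prop)
  obtain ⟨ρ, hρ, hdisj⟩ := O.exists_disjoint_collar ((isCompact_Icc.prod hK).image_of_continuousOn hcont)
    (by
      rintro _ ⟨⟨t, p⟩, hq, rfl⟩
      exact h.flow_notMem hc' hΘ' (hKb hq.2) 0 t)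
  have hc : CutoffParameters A ζ δ ρ := ⟨hδ, hρ.1, hρ.2, hdec _ hρ⟩
  obtain ⟨Θ, hΘ⟩ := h.exists_suspendedFlow hc
  have key : ∀ p ∈ K, ∀ s, (Θ (2 * Real.pi) (p, s)).1 = (Θ' (2 * Real.pi) (p, 0)).1 :=
    fun p hp s => h.flow_eq_of_notMem hc hc' hΘ hΘ' (hKb hp) (J := Ioo (-1) 7) isOpen_Ioo
      isPreconnected_Ioo (by norm_num)
      (fun t ht => hdisj _ ⟨(t, p), ⟨Ioo_subset_Icc_self ht, hp⟩, rfl⟩) s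
      ⟨by linarith [Real.pi_pos], by linarith [Real.pi_lt_d2]⟩
  exact ⟨δ, ρ, Θ, hc, hΘ, fun p hp s => (key p hp s).trans (key p hp 0).symm⟩

end ConcaveGirouxForm

end Support

/-! ### Assembly of the isotopy. -/

theorem mainTheorem7 (n : ℕ)
    {Y : Type*} [TopologicalSpace Y] [ChartedSpace (EuclideanSpace ℝ (Fin (2 * n + 3))) Y]
    [IsManifold (𝓡 (2 * n + 3)) ∞ Y] [CompactSpace Y] [T2Space Y]
    {B : Type*} [TopologicalSpace B] [ChartedSpace (EuclideanSpace ℝ (Fin (2 * n + 1))) B]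
    [IsManifold (𝓡 (2 * n + 1)) ∞ B] [CompactSpace B] [T2Space B]
    (O : ConcreteOpenBook n Y B)
    (α : OneForm (EuclideanSpace ℝ (Fin (2 * n + 3))) Y) (hα : O.IsGirouxForm α)
    (A : B × ℂ → ℝ) (hA : O.HasNormalForm α A)
    (hHess : ∀ (b : B) (w : ℂ), w ≠ 0 →
      fderiv ℝ (fderiv ℝ (fun z : ℂ => A (b, z))) 0 w w < 0)
    (R : (x : Y) → TangentSpace (𝓡 (2 * n + 3)) x) (hR : ∀ x, α.IsReebVector x (R x))
    (ζ : Circle) (f : Y → Y) (hf : O.IsReturnMap R ζ f)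
    (hfsmooth : ContMDiffOn (𝓡 (2 * n + 3)) (𝓡 (2 * n + 3)) ∞ f (O.page ζ)) :
    ∀ U : Set Y, IsOpen U → O.binding ⊆ U →
      ∃ (φ : Y → Y) (Ψ : ℝ → Y → Y),
        O.RepresentsSymplecticMonodromy α ζ φ ∧
        O.IsSymplecticIsotopy α ζ Ψ ∧
        EqOn (Ψ 0) f (O.page ζ) ∧ EqOn (Ψ 1) φ (O.openPage ζ) ∧
        (∀ t ∈ Icc (0 : ℝ) 1, ∀ x ∈ O.page ζ \ U, Ψ t x = f x) ∧
        ContMDiffOn (𝓘(ℝ, ℝ).prod (𝓡 (2 * n + 3))) (𝓡 (2 * n + 3)) ∞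
          (fun q : ℝ × Y => Ψ q.1 q.2) (Icc 0 1 ×ˢ O.page ζ) ∧
        (∀ t ∈ Icc (0 : ℝ) 1,
          IsDiffeoOn (E := EuclideanSpace ℝ (Fin (2 * n + 3))) (Ψ t) (O.page ζ) ∧
          BijOn (Ψ t) O.binding O.binding) := by

  intro U hU hBU
  have h : ConcaveGirouxForm O α A := ⟨hα, hA, hHess⟩
  have hK : IsCompact (O.page ζ \ U) := (isClosed_closure.sdiff hU).isCompact
  -- The part of the page outside `U` is compact and misses the binding; the cutoff radius is
  -- adapted to it.
  obtain ⟨δ, ρ, Θ, hc, hΘ, hsupp⟩ := h.exists_cutoffParameters_flow_eq ζ hK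
    fun y hy hb => hy.2 (hBU hb)
  obtain ⟨Φ, r₀, hΦ⟩ := h.exists_isPolarFlow hc
  have hpi : |2 * Real.pi| < 7 := by
    rw [abs_of_pos Real.two_pi_pos]; linarith [Real.pi_lt_d2]
  have hlt : ∀ t ∈ Icc (0 : ℝ) 1, |t| < 2 := fun t ht => by
    rw [abs_of_nonneg ht.1]; linarith [ht.2]
  have hsmooth : ContMDiffOn (𝓘(ℝ, ℝ).prod (𝓡 (2 * n + 3))) (𝓡 (2 * n + 3)) ∞
      (fun q : ℝ × Y => monodromyMap O Θ Φ (2 * Real.pi) 0 q.1 q.2) (Icc 0 1 ×ˢ O.page ζ) := by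
    rintro ⟨t, y⟩ hq
    exact (h.contMDiffWithinAt_monodromyMap hc hΘ hΦ hpi (by norm_num) Circle.exp_zero
      (hlt t hq.1) hq.2).mono (prod_mono (subset_univ _) Subset.rfl)
  have hpage : O.openPage ζ ⊆ O.page ζ := subset_closure
  have h0 : ∀ y ∈ O.openPage ζ, monodromyMap O Θ Φ (2 * Real.pi) 0 0 y = f y := fun y hy =>
    (monodromyMap_of_notMem _ _ _ _ _ _ hy.1).trans (h.returnMap_eq_flow hR hc hΘ hf hy).symm
  refine ⟨monodromyMap O Θ Φ (2 * Real.pi) 0 1, monodromyMap O Θ Φ (2 * Real.pi) 0,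
    h.representsSymplecticMonodromy_monodromyMap hc hΘ hΦ,
    ⟨hsmooth.mono (prod_mono Subset.rfl hpage), fun t ht =>
      h.isSymplectomorphism_monodromyMap hc hΘ hΦ (hlt t ht)⟩, ?_, fun _ _ => rfl, ?_, hsmooth,
    fun t ht => ⟨h.isDiffeoOn_monodromyMap hc hΘ hΦ (hlt t ht) (Or.inr rfl),
      h.bijOn_monodromyMap hc hΘ hΦ t (Or.inr (Or.inl rfl))⟩⟩
  -- Equality with `f` is known on the open page and passes to its closure, both maps being
  -- continuous on the page.
  · refine EqOn.of_subset_closure h0 ?_ hfsmooth.continuousOn hpage Subset.rfl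
    exact (h.isDiffeoOn_monodromyMap hc hΘ hΦ (by norm_num) (Or.inr rfl)).2.1.continuousOn
  · intro t _ y hy
    have hb : y ∉ O.binding := fun hb => hy.2 (hBU hb)
    have hyp : y ∈ O.openPage ζ := by
      have := hy.1
      rw [O.page_eq] at this
      exact this.resolve_right hb
    rw [monodromyMap_of_notMem _ _ _ _ _ _ hb, hsupp y hy t]
    exact (h.returnMap_eq_flow hR hc hΘ hf hyp).symm
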